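/- Setting. Let $b$ be prime, $m,s\ge 1$, $N=b^m$, and let $\boldsymbol\beta=(\beta_j)_{j\ge1}$ be positive numbers with $\sum_{j\ge1}\beta_j^p<\infty$ for some $0<p\le 1$. Put $\alpha=\lfloor 1/p\rfloor+1$. For $F:[0,1]^s\to\mathbb R$ let $I_s(F)=\int_{[0,1]^s}F(\boldsymbol y)\,d\boldsymbol y$ and $Q_{N,s}(F)=\frac1N\sum_{n=0}^{N-1}F(\boldsymbol y_n)$. Rules. Let $P\in\mathbb Z_b[x]$ be irreducible of degree $m$ and let $G_{b,m}$ be the set of nonzero polynomials over $\mathbb Z_b$ of degree less than $m$. For $0\le n<N$ with base-$b$ digits $\eta_r$ put $n(x)=\sum_{r<m}\eta_r x^r$, and let $v_m\big(\sum_{\ell}t_\ell x^{-\ell}\big)=\sum_{\ell=1}^m t_\ell b^{-\ell}$ on formal Laurent series in $x^{-1}$. The interlaced polynomial lattice rule of order $\alpha$ with modulus $P$ and generating vector $\boldsymbol q=(q_1,\dots,q_{\alpha s})\in G_{b,m}^{\alpha s}$ has the nodes $\boldsymbol y_n\in[0,1)^s$ whose $i$-th coordinate is obtained by interlacing the base-$b$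 digits of the $\alpha$ numbers $v_m\big(n(x)q_j(x)/P(x)\big)$, $\alpha(i-1)<j\le\alpha i$. Component-by-component (CBC) construction with product weights. Let $\delta(\nu,\alpha)=1$ if $\nu=\alpha$ and $0$ otherwise, $$\gamma_j=\sum_{\nu=1}^{\alpha}\nu!\,2^{\delta(\nu,\alpha)}\beta_j^{\nu},$$ $$C_{\alpha,b}=\max\Big(\tfrac{2}{(2\sin\frac{\pi}{b})^{\alpha}},\max_{1\le z\le\alpha-1}\tfrac1{(2\sin\frac{\pi}{b})^{z}}\Big)\Big(1+\tfrac1b+\tfrac1{b(b+1)}\Big)^{\alpha-2}\Big(3+\tfrac2b+\tfrac{2b+1}{b-1}\Big),$$ and $\widetilde\gamma_{\mathfrak v}=\prod_{j\in\mathfrak u(\mathfrak v)}C_{\alpha,b}\,b^{\alpha(\alpha-1)/2}\gamma_j$ with $\mathfrak u(\mathfrak v)=\{\lceil j/\alpha\rceil:j\in\mathfrak v\}$. For $1\le d\le\alpha s$ let $$E_d(\boldsymbol q)=\sum_{\emptyset\ne\mathfrak v\subseteq\{1,\dots,d\}}\widetilde\gamma_{\mathfrak v}\sum_{\boldsymbol\ell}b^{-\alpha\sum_{j\in\mathfrak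 v}\mu_1(\ell_j)},$$ where $\boldsymbol\ell=(\ell_j)_{j\in\mathfrak v}$ runs over the vectors of positive integers with $P\mid\sum_{j\in\mathfrak v}\mathrm{tr}_m(\ell_j)\,q_j$, $\mathrm{tr}_m(\ell)$ is the polynomial whose coefficients are the first $m$ base-$b$ digits of $\ell$, and $\mu_1(\ell)$ is the number of base-$b$ digits of $\ell$. The CBC construction sets $q_1=1$ and then, for $d=2,3,\dots,\alpha s$, chooses $q_d\in G_{b,m}$ minimizing $E_d(q_1,\dots,q_{d-1},q_d)$. Theorem. There are an algorithm (one fixed program for a machine with exact real arithmetic, all of whose operations, including those on addresses and other integers of $O(\log(\alpha sN))$ bits, are counted) and an absolute constant $K$ such that, for all $b,m,s,p,\boldsymbol\beta,P$ as above, the algorithm, given $b,m,s,\alpha,\beta_1,\dots,\beta_s$ and $P$, performs the CBC construction with at most $K\,\alpha\,s\,N\log N$ operations. The resulting interlaced polynomial lattice rule of order $\alpha$ satisfies the following. If $F:[0,1]^s\to\mathbb R$ has mixed partial derivatives $\partial^{\boldsymbol\nu}F$ on $[0,1]^s$ for all $\boldsymbol\nu\in\{0,1,\dots,\alpha\}^s$,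 and, for some $c>0$, $$\sup_{\boldsymbol y\in[0,1]^s}\big|(\partial^{\boldsymbol\nu}F)(\boldsymbol y)\big|\le c\,\boldsymbol\nu!\prod_{j=1}^s\beta_j^{\nu_j}\qquad\text{for all }\boldsymbol\nu\in\{0,1,\dots,\alpha\}^s,$$ where $\boldsymbol\nu!=\prod_j\nu_j!$, then $$|I_s(F)-Q_{N,s}(F)|\le c\,C\,N^{-1/p},$$ where $C<\infty$ depends only on $\alpha,\boldsymbol\beta,b,p$ (not on $s$, $N$, $P$, $F$ or $c$). No smallness condition on $\sum_j\beta_j$ is needed, also when $p=1$. -/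

import Mathlib

noncomputable section

namespace QMC

open Polynomial

/-! ### Integrands on the unit cube -/

/-- `D ν` is the mixed partial derivative `∂^ν F` on the closed unit cube `[0,1]^s`, for every
multi-index `ν ∈ {0,…,α}^s` (one-sided derivatives on the boundary of the cube). -/
structure IsMixedPartials {s : ℕ} (α : ℕ) (F : (Fin s → ℝ) → ℝ)
    (D : (Fin s → ℕ) → (Fin s → ℝ) → ℝ) : Prop where
  zero : ∀ y ∈ Set.Icc (0 : Fin s → ℝ) 1, D 0 y = F y
  succ : ∀ (ν : Fin s → ℕ) (j : Fin s), (∀ i, ν i ≤ α) → ν j < α →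
    ∀ y ∈ Set.Icc (0 : Fin s → ℝ) 1,
      HasDerivWithinAt (fun t => D ν (Function.update y j t)) (D (ν + Pi.single j 1) y)
        (Set.Icc 0 1) (y j)

/-- `sup_y |∂^ν F(y)| ≤ c ν! β^ν` for all `ν ∈ {0,…,α}^s`, where `ν! = ∏ ν_j!`. The sequence `β`
is indexed from `0`. -/
def ProductBound {s : ℕ} (α : ℕ) (β : ℕ → ℝ) (c : ℝ)
    (D : (Fin s → ℕ) → (Fin s → ℝ) → ℝ) : Prop :=
  ∀ ν : Fin s → ℕ, (∀ j, ν j ≤ α) → ∀ y ∈ Set.Icc (0 : Fin s → ℝ) 1,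
    |D ν y| ≤ c * (∏ j, ((ν j).factorial : ℝ)) * ∏ j : Fin s, β j ^ ν j

/-- The integral over the unit cube. -/
def cubeIntegral {s : ℕ} (F : (Fin s → ℝ) → ℝ) : ℝ :=
  ∫ y in Set.Icc (0 : Fin s → ℝ) 1, F y

/-- The equal-weight quadrature rule with nodes `x 0, …, x (N-1)`. -/
def quadrature {s : ℕ} (N : ℕ) (x : ℕ → Fin s → ℝ) (F : (Fin s → ℝ) → ℝ) : ℝ :=
  (1 / (N : ℝ)) * ∑ n ∈ Finset.range N, F (x n)

/-! ### Interlaced polynomial lattice rules -/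

/-- The polynomial `κ₀ + κ₁ x + ⋯ + κ_{m-1} x^{m-1}` over `ℤ_b`, where `κ₀, κ₁, …` are the base-`b`
digits of `k`. -/
def truncPoly (b m k : ℕ) : (ZMod b)[X] :=
  ∑ r ∈ Finset.range m, C ((k / b ^ r : ℕ) : ZMod b) * X ^ r

/-- The nonzero polynomials over `ℤ_b` of degree less than `m`. -/
def genSet (b m : ℕ) : Set (ZMod b)[X] := {q | q ≠ 0 ∧ q.natDegree < m}

/-- A polynomial in `x`, seen as a formal Laurent series in `x⁻¹`: the variable of
`LaurentSeries` plays the role of `x⁻¹`. -/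
def laurentAtInfty (b : ℕ) (f : (ZMod b)[X]) : LaurentSeries (ZMod b) :=
  aeval (HahnSeries.single (-1 : ℤ) (1 : ZMod b)) f

/-- The map `v_m (∑ t_ℓ x^{-ℓ}) = ∑_{ℓ=1}^m t_ℓ b^{-ℓ}`. -/
def vMap (b m : ℕ) (L : LaurentSeries (ZMod b)) : ℝ :=
  ∑ l ∈ Finset.Icc 1 m, ((L.coeff (l : ℤ)).val : ℝ) / (b : ℝ) ^ l

/-- Coordinate of the `n`-th point of the polynomial lattice rule with modulus `P` that belongs to
the component `q` of the generating vector: `v_m (n(x) q(x) / P(x))`. -/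
def latticeCoord (b : ℕ) [Fact b.Prime] (m : ℕ) (P q : (ZMod b)[X]) (n : ℕ) : ℝ :=
  vMap b m (laurentAtInfty b (truncPoly b m n) * laurentAtInfty b q / laurentAtInfty b P)

/-- Digit interlacing of `x 0, …, x (α-1)`: the digit of `x j` in position `a` (both counted from
`0`) becomes the digit of the result in position `j + a α`. -/
def interlace (b : ℕ) [Fact b.Prime] (α : ℕ) (x : ℕ → ℝ) : ℝ :=
  Real.ofDigits fun i : ℕ => Real.digits (x (i % α)) b (i / α)

/-- The `n`-th point of the `s`-dimensional interlaced polynomial lattice rule of order `α` with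
generating vector `(q 0, …, q (α s - 1))`. -/
def interlacedPoint (b : ℕ) [Fact b.Prime] (m α s : ℕ) (P : (ZMod b)[X]) (q : ℕ → (ZMod b)[X])
    (n : ℕ) : Fin s → ℝ :=
  fun i => interlace b α fun j => latticeCoord b m P (q (α * i + j)) n

/-! ### Component-by-component construction with product weights -/

/-- The constant `C_{α,b}` (for `α ≥ 2`). -/
def walshConst (α b : ℕ) : ℝ :=
  (Finset.Icc 1 (α - 1)).fold max (2 / (2 * Real.sin (Real.pi / b)) ^ α)
      (fun z => 1 / (2 * Real.sin (Real.pi / b)) ^ z) *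
    (1 + 1 / (b : ℝ) + 1 / ((b : ℝ) * (b + 1))) ^ (α - 2) *
    (3 + 2 / (b : ℝ) + (2 * b + 1) / ((b : ℝ) - 1))

/-- The product weight of a single coordinate, `∑_{ν=1}^α ν! 2^{δ(ν,α)} β_j^ν`; the argument is
the number `β_j`. -/
def coordWeight (α : ℕ) (x : ℝ) : ℝ :=
  ∑ ν ∈ Finset.Icc 1 α, (ν.factorial : ℝ) * (if ν = α then 2 else 1) * x ^ ν

/-- The weight of a set `v` of components of the generating vector:
`∏_{j ∈ u(v)} C_{α,b} b^{α(α-1)/2} γ_j`, where `u(v)` is the set of blocks of length `α` that `v`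
meets. -/
def setWeight (b α : ℕ) (β : ℕ → ℝ) (v : Finset ℕ) : ℝ :=
  ∏ j ∈ v.image (· / α),
    walshConst α b * (b : ℝ) ^ (α * (α - 1) / 2) * coordWeight α (β j)

/-- The dual net without zero components, projected to the components in `v`. -/
def dualNet (b m : ℕ) (P : (ZMod b)[X]) (q : ℕ → (ZMod b)[X]) (v : Finset ℕ) : Set (v → ℕ) :=
  {l | (∀ j, 0 < l j) ∧ P ∣ ∑ j : v, truncPoly b m (l j) * q j}

/-- The function `μ₁`: the position of the leading base-`b` digit (with `μ₁ 0 = 0`). -/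
def mu1 (b k : ℕ) : ℕ := (Nat.digits b k).length

/-- The search criterion
`E_d(q) = ∑_{∅ ≠ v ⊆ {0,…,d-1}} γ̃_v ∑_{l ∈ dual net} b^{-α μ₁(l)}`. -/
def criterion (b m α : ℕ) (β : ℕ → ℝ) (P : (ZMod b)[X]) (d : ℕ) (q : ℕ → (ZMod b)[X]) : ℝ :=
  ∑ v ∈ (Finset.range d).powerset.filter Finset.Nonempty,
    setWeight b α β v *
      ∑' l : dualNet b m P q v, ((b : ℝ) ^ (α * ∑ j : v, mu1 b (l.1 j)))⁻¹

/-- `q 0, …, q (d-1)` is an output of the component-by-component algorithm: it starts with the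
polynomial `1`, and each component minimizes the criterion, the earlier ones being fixed. -/
structure IsCBC (b m α : ℕ) (β : ℕ → ℝ) (P : (ZMod b)[X]) (d : ℕ) (q : ℕ → (ZMod b)[X]) :
    Prop where
  first : q 0 = 1
  mem : ∀ i < d, q i ∈ genSet b m
  minimal : ∀ i < d, ∀ r ∈ genSet b m,
    criterion b m α β P (i + 1) q ≤ criterion b m α β P (i + 1) (Function.update q i r)

/-! ### A real-number machine with step count

Programs work on arrays of natural numbers (machine words, used for control and addressing) and
arrays of real numbers (exact real arithmetic). Every elementary operation, memory access,
comparison and loop iteration costs one step. There is no conversion from reals to words. -/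

/-- Memory: arrays of words and arrays of reals. -/
structure Mem where
  word : ℕ → ℕ → ℕ
  real : ℕ → ℕ → ℝ

def Mem.setWord (σ : Mem) (a i x : ℕ) : Mem :=
  ⟨Function.update σ.word a (Function.update (σ.word a) i x), σ.real⟩

def Mem.setReal (σ : Mem) (a i : ℕ) (x : ℝ) : Mem :=
  ⟨σ.word, Function.update σ.real a (Function.update (σ.real a) i x)⟩

/-- Word expressions; `load a i` reads cell `i` of the array number `a`. -/
inductive WExp where
  | const (n : ℕ)
  | load (a : ℕ) (i : WExp)
  | add (e f : WExp)
  | sub (e f : WExp)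
  | mul (e f : WExp)
  | div (e f : WExp)
  | mod (e f : WExp)

def WExp.eval (σ : Mem) : WExp → ℕ
  | .const n => n
  | .load a i => σ.word a (i.eval σ)
  | .add e f => e.eval σ + f.eval σ
  | .sub e f => e.eval σ - f.eval σ
  | .mul e f => e.eval σ * f.eval σ
  | .div e f => e.eval σ / f.eval σ
  | .mod e f => e.eval σ % f.eval σ

/-- Number of elementary operations in a word expression. -/
def WExp.cost : WExp → ℕ
  | .const _ => 1
  | .load _ i => i.cost + 1
  | .add e f => e.cost + f.cost + 1
  | .sub e f => e.cost + f.cost + 1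
  | .mul e f => e.cost + f.cost + 1
  | .div e f => e.cost + f.cost + 1
  | .mod e f => e.cost + f.cost + 1

/-- Largest word that occurs in the evaluation of a word expression. -/
def WExp.peak (σ : Mem) : WExp → ℕ
  | .const n => n
  | .load a i => max (i.peak σ) (σ.word a (i.eval σ))
  | .add e f => max (max (e.peak σ) (f.peak σ)) (e.eval σ + f.eval σ)
  | .sub e f => max (e.peak σ) (f.peak σ)
  | .mul e f => max (max (e.peak σ) (f.peak σ)) (e.eval σ * f.eval σ)
  | .div e f => max (e.peak σ) (f.peak σ)
  | .mod e f => max (e.peak σ) (f.peak σ)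

/-- Real expressions. The operations `cosTurn k n` and `sinTurn k n` give `cos (2πk/n)` and
`sin (2πk/n)` (the roots of unity needed for the Fourier transform) for words `k` and `n`. -/
inductive RExp where
  | ofWord (e : WExp)
  | load (a : ℕ) (i : WExp)
  | add (e f : RExp)
  | sub (e f : RExp)
  | mul (e f : RExp)
  | div (e f : RExp)
  | cosTurn (k n : WExp)
  | sinTurn (k n : WExp)

def RExp.eval (σ : Mem) : RExp → ℝ
  | .ofWord e => (e.eval σ : ℝ)
  | .load a i => σ.real a (i.eval σ)
  | .add e f => e.eval σ + f.eval σ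
  | .sub e f => e.eval σ - f.eval σ
  | .mul e f => e.eval σ * f.eval σ
  | .div e f => e.eval σ / f.eval σ
  | .cosTurn k n => Real.cos (2 * Real.pi * (k.eval σ : ℝ) / (n.eval σ : ℝ))
  | .sinTurn k n => Real.sin (2 * Real.pi * (k.eval σ : ℝ) / (n.eval σ : ℝ))

def RExp.cost : RExp → ℕ
  | .ofWord e => e.cost + 1
  | .load _ i => i.cost + 1
  | .add e f => e.cost + f.cost + 1
  | .sub e f => e.cost + f.cost + 1
  | .mul e f => e.cost + f.cost + 1
  | .div e f => e.cost + f.cost + 1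
  | .cosTurn k n => k.cost + n.cost + 1
  | .sinTurn k n => k.cost + n.cost + 1

def RExp.peak (σ : Mem) : RExp → ℕ
  | .ofWord e => e.peak σ
  | .load _ i => i.peak σ
  | .add e f => max (e.peak σ) (f.peak σ)
  | .sub e f => max (e.peak σ) (f.peak σ)
  | .mul e f => max (e.peak σ) (f.peak σ)
  | .div e f => max (e.peak σ) (f.peak σ)
  | .cosTurn k n => max (k.peak σ) (n.peak σ)
  | .sinTurn k n => max (k.peak σ) (n.peak σ)

/-- Programs. `setWord a i e` stores `e` in cell `i` of the word array `a`; `ifWordLt e f c d` runs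
`c` if `e < f` and `d` otherwise; `loop a e c` evaluates `e` once and runs `c` that many times, with
the iteration number `0, 1, 2, …` stored in cell `0` of the word array `a`. -/
inductive Prog where
  | skip
  | setWord (a : ℕ) (i e : WExp)
  | setReal (a : ℕ) (i : WExp) (e : RExp)
  | seq (c d : Prog)
  | ifWordLt (e f : WExp) (c d : Prog)
  | ifRealLt (e f : RExp) (c d : Prog)
  | loop (a : ℕ) (e : WExp) (c : Prog)

/-- `iter f n σ` applies `f 0`, `f 1`, …, `f (n-1)` one after the other. -/
def iter (f : ℕ → Mem → Mem) : ℕ → Mem → Mem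
  | 0, σ => σ
  | n + 1, σ => f n (iter f n σ)

open Classical in
/-- The memory after the run of a program. -/
def Prog.run : Prog → Mem → Mem
  | .skip, σ => σ
  | .setWord a i e, σ => σ.setWord a (i.eval σ) (e.eval σ)
  | .setReal a i e, σ => σ.setReal a (i.eval σ) (e.eval σ)
  | .seq c d, σ => d.run (c.run σ)
  | .ifWordLt e f c d, σ => if e.eval σ < f.eval σ then c.run σ else d.run σ
  | .ifRealLt e f c d, σ => if e.eval σ < f.eval σ then c.run σ else d.run σ
  | .loop a e c, σ => iter (fun i τ => c.run (τ.setWord a 0 i)) (e.eval σ) σ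

open Classical in
/-- The number of steps of the run of a program. -/
def Prog.steps : Prog → Mem → ℕ
  | .skip, _ => 1
  | .setWord _ i e, _ => i.cost + e.cost + 1
  | .setReal _ i e, _ => i.cost + e.cost + 1
  | .seq c d, σ => c.steps σ + d.steps (c.run σ)
  | .ifWordLt e f c d, σ =>
      e.cost + f.cost + 1 + if e.eval σ < f.eval σ then c.steps σ else d.steps σ
  | .ifRealLt e f c d, σ =>
      e.cost + f.cost + 1 + if e.eval σ < f.eval σ then c.steps σ else d.steps σ
  | .loop a e c, σ =>
      e.cost + 1 + ∑ i ∈ Finset.range (e.eval σ),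
        (c.steps ((iter (fun i τ => c.run (τ.setWord a 0 i)) i σ).setWord a 0 i) + 1)

open Classical in
/-- The largest word that occurs in the run of a program. -/
def Prog.peak : Prog → Mem → ℕ
  | .skip, _ => 0
  | .setWord _ i e, σ => max (i.peak σ) (e.peak σ)
  | .setReal _ i e, σ => max (i.peak σ) (e.peak σ)
  | .seq c d, σ => max (c.peak σ) (d.peak (c.run σ))
  | .ifWordLt e f c d, σ =>
      max (max (e.peak σ) (f.peak σ)) (if e.eval σ < f.eval σ then c.peak σ else d.peak σ)
  | .ifRealLt e f c d, σ =>
      max (max (e.peak σ) (f.peak σ)) (if e.eval σ < f.eval σ then c.peak σ else d.peak σ)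
  | .loop a e c, σ =>
      max (e.peak σ) ((Finset.range (e.eval σ)).sup fun i =>
        c.peak ((iter (fun i τ => c.run (τ.setWord a 0 i)) i σ).setWord a 0 i))

/-- The input of the construction: the words `b, m, s, α` in the word array `0`, the coefficients of
the modulus `P` in the word array `1`, and `β_1, …, β_s` in the real array `0`. All other cells
hold zero. -/
def input (b m s α : ℕ) (P : (ZMod b)[X]) (β : ℕ → ℝ) : Mem where
  word a i :=
    if a = 0 then
      (if i = 0 then b else if i = 1 then m else if i = 2 then s else if i = 3 then α else 0)
    else if a = 1 then (P.coeff i).val else 0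
  real a i := if a = 0 ∧ i < s then β i else 0

/-- The output of the construction: the word in cell `i` of the word array `2` encodes the `i`-th
component of the generating vector, its base-`b` digits being the coefficients. -/
def output (b m : ℕ) (σ : Mem) (i : ℕ) : (ZMod b)[X] := truncPoly b m (σ.word 2 i)

end QMC

end

noncomputable section
namespace QMC
open Polynomial

/-! ### Laurent expansions at infinity -/

/-! The proof consists of an error analysis and a verified algorithm, which meet in the search
criterion.

Error. The integrand is expanded in discrete Walsh functions on a `b`-adic grid that contains the
nodes. The digits of the nodes are residues of rational functions with denominator `P`, so
orthogonality of the additive characters of the field `ℤ_b[x]/P` shows that the quadrature rule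
keeps exactly the Walsh coefficients with frequency in the dual net (`sum_nodes_eq`). The
coefficient at zero is a Riemann sum and tends to the integral as the grid is refined
(`tendsto_walshCoeffMulti_zero`). For the others, each nonzero digit of the frequency allows a
summation by parts that trades it for a derivative and powers of `b`, up to `α` times
(`norm_walshCoeff_le`). Undoing the interlacing turns the decay exponent into `α ∑ μ₁`, up to a loss
of `α (α - 1) / 2` per coordinate (`sum_mu1_le_walshExp`), and the remaining constants are dominated
by `C_{α,b}` (`walsh_factor_le`). Hence the error is at most `c` times the criterion, uniformly in
the grid.

Size of the criterion (`criterion_rpow_le`). The map `t ↦ t ^ p` is subadditive, and a minimum is at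
most the mean over all candidates. A frequency whose word at the new component is nonzero modulo `P`
is dual for at most one candidate, because `P` is prime, and `α p > 1` makes the `p`-th powers of
the weights summable. The weights depend only on the blocks that are met, so the sum over subsets is
a product over blocks (`sum_blockWeight`). This product is at most the exponential of a multiple of
the sum of the `p`-th powers of the weights, which is why no smallness of `∑ β_j` is needed.

Algorithm. Written as a character sum, the criterion is an average over the nodes of products of one
real kernel (`dualSum_eq_nodes`), whose value at a nonzero word depends only on its number of digits
(`nodeFactor_eq_nodeWeight`). Two vectors indexed by the nodes carry all information on earlier
choices (`stepSum_eq_nodes`). If nodes and candidates are written as powers of a primitive element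
`g`, the values for all candidates form one cyclic correlation of length `N - 1` (`powerSum_pow`),
computed by fast Fourier transforms in `O(N log N)` steps. The element `g` is found
deterministically: by a pigeonhole argument the words below about `2 √N`, together with `-1`,
contain for each prime factor of `N - 1` an element that is not a power of that order
(`exists_small_word_pow_ne_one`). This search is cheap compared with the transforms. The program is
verified in a small program logic (`Ok`) that tracks the postcondition, the number of steps and the
size of the stored words together. -/

theorem laurentAtInfty_eq_sum (b : ℕ) (f : (ZMod b)[X]) :
    laurentAtInfty b f = f.sum fun n c => HahnSeries.single (-(n : ℤ)) c := by
  unfold laurentAtInfty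
  rw [aeval_eq_sum_range, sum_over_range]
  · refine Finset.sum_congr rfl fun i _ => ?_
    rw [HahnSeries.single_pow]
    -- Ring homomorphisms out of `ZMod b` are unique, so scalars act as constant series.
    rw [Algebra.smul_def, show algebraMap (ZMod b) (LaurentSeries (ZMod b)) (f.coeff i) =
      HahnSeries.single 0 (f.coeff i) from
      RingHom.congr_fun (Subsingleton.elim (algebraMap (ZMod b) (LaurentSeries (ZMod b)))
        HahnSeries.C) _]
    simp
  · simp

theorem laurentAtInfty_coeff (b : ℕ) (f : (ZMod b)[X]) (z : ℤ) :
    (laurentAtInfty b f).coeff z = if z ≤ 0 then f.coeff z.natAbs else 0 := by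
  rw [laurentAtInfty_eq_sum, Polynomial.sum, HahnSeries.coeff_sum]
  simp only [HahnSeries.coeff_single]
  split_ifs with h
  · obtain ⟨n, rfl⟩ : ∃ n : ℕ, z = -(n : ℤ) := ⟨z.natAbs, by omega⟩
    simp only [neg_inj, Nat.cast_inj, Int.natAbs_neg, Int.natAbs_natCast]
    rw [Finset.sum_ite_eq]
    simp only [mem_support_iff, ne_eq, ite_not]
    split_ifs with h' <;> simp [h']
  · refine Finset.sum_eq_zero fun i _ => ?_
    rw [if_neg (by omega)]

theorem laurentAtInfty_mul (b : ℕ) (f g : (ZMod b)[X]) :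
    laurentAtInfty b (f * g) = laurentAtInfty b f * laurentAtInfty b g := by
  simp [laurentAtInfty]

theorem laurentAtInfty_add (b : ℕ) (f g : (ZMod b)[X]) :
    laurentAtInfty b (f + g) = laurentAtInfty b f + laurentAtInfty b g := by
  simp [laurentAtInfty]

theorem laurentAtInfty_zero (b : ℕ) : laurentAtInfty b 0 = 0 := by simp [laurentAtInfty]

theorem laurentAtInfty_X_pow (b n : ℕ) :
    laurentAtInfty b (X ^ n) = HahnSeries.single (-(n : ℤ)) 1 := by
  simp [laurentAtInfty, HahnSeries.single_pow]

theorem laurentAtInfty_ne_zero {b : ℕ} {f : (ZMod b)[X]} (hf : f ≠ 0) :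
    laurentAtInfty b f ≠ 0 := by
  intro h
  have := congrArg (fun L => HahnSeries.coeff L (-(f.natDegree : ℤ))) h
  simp [laurentAtInfty_coeff, hf] at this

theorem laurentAtInfty_order {b : ℕ} {f : (ZMod b)[X]} (hf : f ≠ 0) :
    (laurentAtInfty b f).order = -(f.natDegree : ℤ) := by
  refine le_antisymm (HahnSeries.order_le_of_coeff_ne_zero (by simp [laurentAtInfty_coeff, hf])) ?_
  by_contra! h
  have h1 := HahnSeries.coeff_order_eq_zero (x := laurentAtInfty b f)
  have h2 : (laurentAtInfty b f).coeff (laurentAtInfty b f).order = 0 := by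
    rw [laurentAtInfty_coeff, if_pos (by omega)]
    exact coeff_eq_zero_of_natDegree_lt (by omega)
  exact laurentAtInfty_ne_zero hf (h1.1 h2)

section Residue

variable {b : ℕ} [Fact b.Prime]

/-- The coefficient of `x⁻¹` in the Laurent expansion of `f / P`. -/
def residue (P f : (ZMod b)[X]) : ZMod b :=
  (laurentAtInfty b f / laurentAtInfty b P).coeff 1

theorem residue_add (P f g : (ZMod b)[X]) : residue P (f + g) = residue P f + residue P g := by
  simp [residue, laurentAtInfty_add, add_div]

/-- The quotient is a polynomial, whose expansion has no term in `x⁻¹`. Hence the residue depends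
only on the class modulo `P`. -/
theorem residue_mul_left {P : (ZMod b)[X]} (hP : P ≠ 0) (g : (ZMod b)[X]) :
    residue P (P * g) = 0 := by
  unfold residue
  rw [laurentAtInfty_mul, mul_div_cancel_left₀ _ (laurentAtInfty_ne_zero hP), laurentAtInfty_coeff]
  simp

theorem order_div {P f : (ZMod b)[X]} (hP : P ≠ 0) (hf : f ≠ 0) :
    (laurentAtInfty b f / laurentAtInfty b P).order = (P.natDegree : ℤ) - f.natDegree := by
  have h0 := laurentAtInfty_ne_zero hP
  have h1 : laurentAtInfty b f / laurentAtInfty b P ≠ 0 := div_ne_zero (laurentAtInfty_ne_zero hf) h0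
  have := HahnSeries.order_mul h1 h0
  rw [div_mul_cancel₀ _ h0, laurentAtInfty_order hf, laurentAtInfty_order hP] at this
  omega

/-- The expansion of `f / P` starts at the power `deg P - deg f` of `x⁻¹`. If this exceeds one the
residue vanishes; in the borderline case, `residue_ne_zero`, the residue is the leading coefficient.
-/
theorem residue_eq_zero_of_natDegree_lt {P f : (ZMod b)[X]} (h : f.natDegree + 1 < P.natDegree) :
    residue P f = 0 := by
  rcases eq_or_ne f 0 with rfl | hf
  · simp [residue, laurentAtInfty_zero]
  have hP : P ≠ 0 := by rintro rfl; simp at h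
  apply HahnSeries.coeff_eq_zero_of_lt_order
  rw [order_div hP hf]
  omega

theorem residue_ne_zero {P f : (ZMod b)[X]} (hf : f ≠ 0) (h : f.natDegree + 1 = P.natDegree) :
    residue P f ≠ 0 := by
  have hP : P ≠ 0 := by rintro rfl; simp at h
  have h1 : laurentAtInfty b f / laurentAtInfty b P ≠ 0 :=
    div_ne_zero (laurentAtInfty_ne_zero hf) (laurentAtInfty_ne_zero hP)
  unfold residue
  rw [show (1 : ℤ) = (laurentAtInfty b f / laurentAtInfty b P).order by
    rw [order_div hP hf]; omega]
  exact fun h => h1 (HahnSeries.coeff_order_eq_zero.1 h)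

/-- Multiplication by a power of `X` shifts the expansion. Every digit of a lattice coordinate is
therefore itself a residue, and so is linear in the numerator. -/
theorem residue_X_pow_mul (P f : (ZMod b)[X]) (n : ℕ) :
    residue P (X ^ n * f) = (laurentAtInfty b f / laurentAtInfty b P).coeff (n + 1) := by
  unfold residue
  rw [laurentAtInfty_mul, mul_div_assoc, laurentAtInfty_X_pow]
  have := HahnSeries.coeff_single_mul_add (r := (1 : ZMod b)) (b := -(n : ℤ)) (a := (n + 1 : ℤ))
    (x := laurentAtInfty b f / laurentAtInfty b P)
  rw [show (n + 1 : ℤ) + -(n : ℤ) = 1 by ring, one_mul] at this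
  exact this

end Residue

/-! ### Base-`b` words and the residue field -/

section Words

variable {b : ℕ}

theorem truncPoly_coeff (b m k i : ℕ) :
    (truncPoly b m k).coeff i = if i < m then ((k / b ^ i : ℕ) : ZMod b) else 0 := by
  unfold truncPoly
  simp only [finsetSum_coeff, coeff_C_mul_X_pow]
  rw [Finset.sum_ite_eq]
  simp

theorem truncPoly_zero (b m : ℕ) : truncPoly b m 0 = 0 := by simp [truncPoly]

theorem truncPoly_natDegree_lt {m : ℕ} (hm : 1 ≤ m) (b k : ℕ) : (truncPoly b m k).natDegree < m := by
  rw [← Nat.le_sub_one_iff_lt (by omega), natDegree_le_iff_coeff_eq_zero]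
  intro N hN
  rw [truncPoly_coeff, if_neg (by omega)]

theorem digit_sum (b m k : ℕ) :
    ∑ r ∈ Finset.range m, (k / b ^ r % b) * b ^ r = k % b ^ m := by
  induction m with
  | zero => simp [Nat.mod_one]
  | succ m ih => rw [Finset.sum_range_succ, ih, Nat.mod_pow_succ]; ring

theorem digit_sum_lt (_hb : 0 < b) (f : ℕ → ℕ) (hf : ∀ r, f r < b) (m : ℕ) :
    ∑ r ∈ Finset.range m, f r * b ^ r < b ^ m := by
  induction m with
  | zero => simp
  | succ m ih =>
    rw [Finset.sum_range_succ, pow_succ]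
    have := hf m
    calc _ < b ^ m + f m * b ^ m := by omega
      _ = (f m + 1) * b ^ m := by ring
      _ ≤ b * b ^ m := Nat.mul_le_mul_right _ this
      _ = _ := by ring

/-- The sum is split at position `i`: the lower part is less than `b ^ i` and disappears in the
division, and beyond digit `i` only multiples of `b` are left. -/
theorem digit_of_digit_sum (hb : 0 < b) (f : ℕ → ℕ) (hf : ∀ r, f r < b) (m i : ℕ) (hi : i < m) :
    (∑ r ∈ Finset.range m, f r * b ^ r) / b ^ i % b = f i := by
  have h1 : ∑ r ∈ Finset.range m, f r * b ^ r = ∑ r ∈ Finset.range i, f r * b ^ r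
      + b ^ i * (f i + b * ∑ r ∈ Finset.range (m - i - 1), f (i + 1 + r) * b ^ r) := by
    conv_lhs => rw [show m = (i + 1) + (m - i - 1) by omega, Finset.sum_range_add,
      Finset.sum_range_succ]
    rw [mul_add, add_assoc, ← mul_assoc, Finset.mul_sum]
    congr 1
    rw [mul_comm (b ^ i)]
    congr 1
    refine Finset.sum_congr rfl fun r _ => ?_
    rw [pow_add, pow_succ]; ring
  rw [h1, Nat.add_mul_div_left _ _ (by positivity),
    Nat.div_eq_of_lt (digit_sum_lt hb f hf i), zero_add, Nat.add_mul_mod_self_left,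
    Nat.mod_eq_of_lt (hf i)]

theorem truncPoly_injOn (m : ℕ) {k l : ℕ} (hk : k < b ^ m) (hl : l < b ^ m)
    (h : truncPoly b m k = truncPoly b m l) : k = l := by
  rw [← Nat.mod_eq_of_lt hk, ← Nat.mod_eq_of_lt hl, ← digit_sum, ← digit_sum]
  refine Finset.sum_congr rfl fun r hr => ?_
  have := congrArg (fun f => coeff f r) h
  simp only [truncPoly_coeff, if_pos (Finset.mem_range.1 hr)] at this
  rw [(ZMod.natCast_eq_natCast_iff' _ _ _).1 this]

theorem exists_truncPoly (hb : 0 < b) {m : ℕ} {f : (ZMod b)[X]} (hf : ∀ i, m ≤ i → f.coeff i = 0) :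
    ∃ k < b ^ m, truncPoly b m k = f := by
  have : NeZero b := ⟨hb.ne'⟩
  refine ⟨∑ r ∈ Finset.range m, (f.coeff r).val * b ^ r,
    digit_sum_lt hb _ (fun r => ZMod.val_lt _) m, ?_⟩
  ext i
  rw [truncPoly_coeff]
  split_ifs with hi
  · rw [← ZMod.natCast_mod, digit_of_digit_sum hb _ (fun r => ZMod.val_lt _) m i hi]
    simp
  · exact (hf i (by omega)).symm

theorem truncPoly_mod (m k : ℕ) : truncPoly b m (k % b ^ m) = truncPoly b m k := by
  ext i
  rw [truncPoly_coeff, truncPoly_coeff]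
  split_ifs with hi
  · rw [ZMod.natCast_eq_natCast_iff]
    have h : b ^ m = b ^ i * (b * b ^ (m - i - 1)) := by
      rw [← pow_succ', ← pow_add]; congr 1; omega
    have : k / b ^ i = k % b ^ m / b ^ i + b * (b ^ (m - i - 1) * (k / b ^ m)) := by
      rcases Nat.eq_zero_or_pos b with rfl | hb
      · rcases i with _ | i
        · rcases m with _ | m
          · omega
          · simp
        · simp
      conv_lhs => rw [← Nat.mod_add_div k (b ^ m)]
      nth_rw 2 [h]
      rw [mul_assoc, Nat.add_mul_div_left _ _ (by positivity), mul_assoc]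
    rw [this]
    simp [Nat.ModEq]
  · rfl

end Words

section Field

variable {b : ℕ} [Fact b.Prime] (m : ℕ) (P : (ZMod b)[X])

/-- The residue class modulo `P` of the polynomial encoded by a word. -/
def wordClass (k : ℕ) : AdjoinRoot P := AdjoinRoot.mk P (truncPoly b m k)

variable {m} {P}

theorem wordClass_zero : wordClass m P 0 = 0 := by simp [wordClass, truncPoly_zero]

/-- A difference of polynomials of degree below `m` is divisible by `P` only if it vanishes. -/
theorem wordClass_injOn (hm : 1 ≤ m) (hP : P.natDegree = m) {k l : ℕ} (hk : k < b ^ m)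
    (hl : l < b ^ m) (h : wordClass m P k = wordClass m P l) : k = l := by
  apply truncPoly_injOn m hk hl
  rw [wordClass, wordClass, AdjoinRoot.mk_eq_mk] at h
  have := eq_zero_of_dvd_of_natDegree_lt h (lt_of_le_of_lt (natDegree_sub_le _ _) (by
    rw [hP]; exact max_lt (truncPoly_natDegree_lt hm _ _) (truncPoly_natDegree_lt hm _ _)))
  exact sub_eq_zero.1 this

theorem wordClass_surjOn (hm : 1 ≤ m) (hP : P.natDegree = m) (z : AdjoinRoot P) :
    ∃ k < b ^ m, wordClass m P k = z := by
  obtain ⟨f, rfl⟩ := AdjoinRoot.mk_surjective z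
  have hP0 : P ≠ 0 := by rintro rfl; simp at hP; omega
  obtain ⟨k, hk, hf⟩ := exists_truncPoly (b := b) (m := m) (f := f % P)
    (Fact.out : b.Prime).pos (fun i hi => by
      by_cases h0 : f % P = 0
      · simp [h0]
      apply coeff_eq_zero_of_natDegree_lt
      have h1 : (f % P).degree < P.degree := EuclideanDomain.mod_lt f hP0
      have h2 := natDegree_lt_natDegree h0 h1
      omega)
  refine ⟨k, hk, ?_⟩
  rw [wordClass, hf, AdjoinRoot.mk_eq_mk]
  exact ⟨-(f / P), by linear_combination EuclideanDomain.div_add_mod f P⟩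

theorem wordClass_eq_zero_iff (hm : 1 ≤ m) (hP : P.natDegree = m) {k : ℕ} (hk : k < b ^ m) :
    wordClass m P k = 0 ↔ k = 0 := by
  have hb : 0 < b := (Fact.out : b.Prime).pos
  refine ⟨fun h => wordClass_injOn hm hP hk (by positivity) (h.trans wordClass_zero.symm), ?_⟩
  rintro rfl
  exact wordClass_zero

/-- Words of length `m` are the elements of the residue field. -/
def wordEquiv (hm : 1 ≤ m) (hP : P.natDegree = m) : Fin (b ^ m) ≃ AdjoinRoot P :=
  Equiv.ofBijective (fun k => wordClass m P k)
    ⟨fun k l h => Fin.ext (wordClass_injOn hm hP k.2 l.2 h), fun z => by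
      obtain ⟨k, hk, h⟩ := wordClass_surjOn hm hP z
      exact ⟨⟨k, hk⟩, h⟩⟩

theorem wordEquiv_apply (hm : 1 ≤ m) (hP : P.natDegree = m) (k : Fin (b ^ m)) :
    wordEquiv hm hP k = wordClass m P k := rfl

/-- The residue as a function on the residue field. -/
def fieldResidue (P : (ZMod b)[X]) (z : AdjoinRoot P) : ZMod b :=
  residue P (Function.surjInv AdjoinRoot.mk_surjective z)

/-- `fieldResidue` uses an arbitrary representative; two of them differ by a multiple of `P`, which
has residue zero. -/
theorem fieldResidue_mk (hP : P ≠ 0) (f : (ZMod b)[X]) :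
    fieldResidue P (AdjoinRoot.mk P f) = residue P f := by
  have h := Function.surjInv_eq (AdjoinRoot.mk_surjective (g := P)) (AdjoinRoot.mk P f)
  rw [AdjoinRoot.mk_eq_mk] at h
  obtain ⟨g, hg⟩ := h
  unfold fieldResidue
  rw [sub_eq_iff_eq_add.1 hg, residue_add, residue_mul_left hP, zero_add]

/-- The additive character of the residue field induced by the residue. -/
def fieldChar (hP : P ≠ 0) : AddChar (AdjoinRoot P) ℂ where
  toFun z := ZMod.stdAddChar (fieldResidue P z)
  map_zero_eq_one' := by
    have := fieldResidue_mk hP 0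
    rw [map_zero] at this
    rw [this]
    simp [residue, laurentAtInfty_zero]
  map_add_eq_mul' := by
    intro z w
    obtain ⟨f, rfl⟩ := AdjoinRoot.mk_surjective z
    obtain ⟨g, rfl⟩ := AdjoinRoot.mk_surjective w
    rw [← map_add, fieldResidue_mk hP, fieldResidue_mk hP, fieldResidue_mk hP, residue_add,
      AddChar.map_add_eq_mul]

theorem fieldChar_mk (hP : P ≠ 0) (f : (ZMod b)[X]) :
    fieldChar hP (AdjoinRoot.mk P f) = ZMod.stdAddChar (residue P f) := by
  show ZMod.stdAddChar (fieldResidue P _) = _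
  rw [fieldResidue_mk hP]

theorem fieldChar_ne_one_of_natDegree (hP : P ≠ 0) {f : (ZMod b)[X]} (hf : f ≠ 0)
    (h : f.natDegree + 1 = P.natDegree) : fieldChar hP (AdjoinRoot.mk P f) ≠ 1 := by
  rw [fieldChar_mk]
  intro h1
  refine residue_ne_zero hf h (ZMod.injective_stdAddChar ?_)
  rw [h1, AddChar.map_zero_eq_one]

theorem fieldChar_ne_one (hm : 1 ≤ m) (hP : P ≠ 0) (hd : P.natDegree = m) : fieldChar hP ≠ 1 := by
  intro h
  apply fieldChar_ne_one_of_natDegree hP (f := X ^ (m - 1)) (by simp) (by rw [natDegree_X_pow]; omega)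
  rw [h]; rfl

/-- In a field every nontrivial additive character is primitive, and `X ^ (m - 1)` witnesses
nontriviality. This relation is what detects the dual net. -/
theorem fieldChar_sum [Fact (Irreducible P)] [Fintype (AdjoinRoot P)] [DecidableEq (AdjoinRoot P)]
    (hm : 1 ≤ m) (hP : P ≠ 0) (hd : P.natDegree = m) (y : AdjoinRoot P) :
    ∑ z, fieldChar hP (z * y) = if y = 0 then (b ^ m : ℂ) else 0 := by
  rw [AddChar.sum_mulShift y (AddChar.IsPrimitive.of_ne_one (fieldChar_ne_one hm hP hd))]
  rw [← Fintype.card_congr (wordEquiv hm hd)]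
  simp

end Field

end QMC
end

/-! ### The search criterion as a character sum over the nodes -/

noncomputable section
namespace QMC
open Polynomial

/-! ### Products of sums over finitely many coordinates -/

/-- Induction on the number of coordinates, after transport to `Fin n`; nonnegativity supplies the
summability of the product family. -/
theorem hasSum_pi_prod {ι : Type*} [Fintype ι] {κ : Type*} (f : ι → κ → ℝ) (a : ι → ℝ)
    (hf : ∀ i k, 0 ≤ f i k) (h : ∀ i, HasSum (f i) (a i)) :
    HasSum (fun l : ι → κ => ∏ i, f i (l i)) (∏ i, a i) := by
  classical
  suffices H : ∀ (n : ℕ) (f : Fin n → κ → ℝ) (a : Fin n → ℝ), (∀ i k, 0 ≤ f i k) →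
      (∀ i, HasSum (f i) (a i)) → HasSum (fun l : Fin n → κ => ∏ i, f i (l i)) (∏ i, a i) by
    let e := Fintype.equivFin ι
    have := H _ (fun i => f (e.symm i)) (fun i => a (e.symm i)) (fun i => hf _) (fun i => h _)
    rw [← (Equiv.arrowCongr e (Equiv.refl κ)).hasSum_iff] at this
    convert this using 1
    · ext l
      simp only [Function.comp, Equiv.arrowCongr, Equiv.coe_fn_mk, Equiv.coe_refl, id]
      exact (e.symm.prod_comp (fun i => f i (l i))).symm
    · exact (e.symm.prod_comp a).symm
  clear h hf a f
  intro n
  induction n with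
  | zero =>
    intro f a _ _
    simpa only [Finset.univ_eq_empty, Finset.prod_empty] using
      hasSum_unique (fun _ : Fin 0 → κ => (1 : ℝ))
  | succ n ih =>
    intro f a hf h
    have h1 := ih (fun i => f i.succ) (fun i => a i.succ) (fun i => hf _) (fun i => h _)
    set F : κ → ℝ := f 0
    set G : (Fin n → κ) → ℝ := fun l => ∏ i : Fin n, f i.succ (l i) with hG
    have hF0 : 0 ≤ F := fun k => hf 0 k
    have hG0 : 0 ≤ G := fun l => Finset.prod_nonneg fun (i : Fin n) _ => hf i.succ (l i)
    have hFs : Summable F := (h 0).summable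
    have hGs : Summable G := h1.summable
    have hs : Summable fun x : κ × (Fin n → κ) => F x.1 * G x.2 :=
      Summable.mul_of_nonneg hFs hGs hF0 hG0
    have := HasSum.mul (h 0) h1 hs
    rw [← (Fin.consEquiv fun _ => κ).hasSum_iff, Fin.prod_univ_succ]
    have he : (fun l : Fin (n + 1) → κ => ∏ i, f i (l i)) ∘ (Fin.consEquiv fun _ => κ) =
        fun x : κ × (Fin n → κ) => f 0 x.1 * G x.2 := by
      funext x
      simp [Fin.prod_univ_succ, Fin.consEquiv, hG]
    rw [he]
    exact this

/-! ### The leading digit -/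

theorem mu1_zero (b : ℕ) : mu1 b 0 = 0 := by simp [mu1]

theorem mu1_le_iff {b : ℕ} (hb : 1 < b) {k e : ℕ} : mu1 b k ≤ e ↔ k < b ^ e :=
  ⟨fun h => Nat.lt_of_lt_of_le (Nat.lt_base_pow_length_digits hb)
    (Nat.pow_le_pow_right (by omega) h), fun h => by
    by_contra! h1
    exact absurd (Nat.base_pow_length_digits_le' (b - 2) k (by rintro rfl; simp [mu1] at h1)) (by
      rw [show b - 2 + 2 = b by omega, not_le]
      calc b * k < b * b ^ e := by gcongr
        _ = b ^ (e + 1) := by ring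
        _ ≤ _ := Nat.pow_le_pow_right (by omega) h1)⟩

theorem mu1_pos {b : ℕ} (hb : 1 < b) {k : ℕ} (hk : k ≠ 0) : 1 ≤ mu1 b k := by
  by_contra! h
  have := (mu1_le_iff hb (k := k) (e := 0)).1 (by omega)
  simp at this; omega

theorem mu1_mod_add {b : ℕ} (hb : 1 < b) (m : ℕ) {l : ℕ} (hl : b ^ m ≤ l) :
    mu1 b l = m + mu1 b (l / b ^ m) := by
  have hp : 0 < b ^ m := by positivity
  have h1 : ∀ e, mu1 b l ≤ m + e ↔ mu1 b (l / b ^ m) ≤ e := by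
    intro e
    rw [mu1_le_iff hb, mu1_le_iff hb, Nat.div_lt_iff_lt_mul hp, pow_add, mul_comm]
  have h2 : m < mu1 b l := by
    by_contra! h
    exact absurd ((mu1_le_iff hb).1 h) (by omega)
  refine le_antisymm ((h1 _).2 le_rfl) ?_
  have := (h1 (mu1 b l - m)).1 (by omega)
  omega

/-- The summand `b^{-α μ₁(l)}` of the search criterion, set to zero at `l = 0`. -/
def decay (b α l : ℕ) : ℝ := if l = 0 then 0 else ((b : ℝ) ^ (α * mu1 b l))⁻¹

theorem decay_nonneg (b α l : ℕ) : 0 ≤ decay b α l := by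
  unfold decay; split_ifs <;> positivity

/-- Since `l < b ^ mu1 b l`, the summand is at most `l⁻²` as soon as `2 ≤ α`. -/
theorem summable_decay {b α : ℕ} (hb : 1 < b) (hα : 2 ≤ α) : Summable (decay b α) := by
  refine Summable.of_nonneg_of_le (decay_nonneg b α) (fun l => ?_)
    (Real.summable_nat_pow_inv.2 (by norm_num : 1 < 2))
  unfold decay
  split_ifs with h
  · positivity
  · have h1 : (l : ℝ) < (b : ℝ) ^ mu1 b l := by exact_mod_cast (mu1_le_iff hb).1 le_rfl
    have h2 : (0 : ℝ) < l := by exact_mod_cast Nat.pos_of_ne_zero h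
    have h3 : (1 : ℝ) < b := by exact_mod_cast hb
    gcongr
    calc (l : ℝ) ^ 2 ≤ ((b : ℝ) ^ mu1 b l) ^ 2 := by gcongr
      _ = (b : ℝ) ^ (2 * mu1 b l) := by rw [← pow_mul, mul_comm]
      _ ≤ _ := pow_le_pow_right₀ h3.le (by gcongr)

/-- The sum of `b^{-α μ₁(l)}` over the positive `l` with given residue `r` modulo `b^m`. -/
def residueWeight (b m α r : ℕ) : ℝ :=
  decay b α r + ((b : ℝ) ^ (α * m))⁻¹ * ∑' t, decay b α t

theorem residueWeight_nonneg (b m α r : ℕ) : 0 ≤ residueWeight b m α r := by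
  unfold residueWeight
  have : 0 ≤ ∑' t, decay b α t := tsum_nonneg (decay_nonneg b α)
  have := decay_nonneg b α r
  positivity

/-- The leading digit of `r + b ^ m * t` is that of `t`, moved up by `m` positions, so `r` plays no
role. -/
theorem decay_add_mul {b m α r t : ℕ} (hb : 1 < b) (hr : r < b ^ m) (ht : t ≠ 0) :
    decay b α (r + b ^ m * t) = ((b : ℝ) ^ (α * m))⁻¹ * decay b α t := by
  have hp : 0 < b ^ m := by positivity
  have h1 : b ^ m ≤ r + b ^ m * t := by nlinarith [Nat.pos_of_ne_zero ht]
  unfold decay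
  rw [if_neg (by omega), if_neg ht, mu1_mod_add hb m h1, Nat.add_mul_div_left _ _ hp,
    Nat.div_eq_of_lt hr, zero_add, mul_add, pow_add, mul_inv]

theorem hasSum_decay_residue {b m α r : ℕ} (hb : 1 < b) (hα : 2 ≤ α) (hr : r < b ^ m) :
    HasSum (fun l => if l % b ^ m = r then decay b α l else 0) (residueWeight b m α r) := by
  have hp : 0 < b ^ m := by positivity
  have : Set.range (fun t => r + b ^ m * t) = {l | l % b ^ m = r} := by
    ext l
    constructor
    · rintro ⟨t, rfl⟩
      simp [Nat.mod_eq_of_lt hr]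
    · intro h
      exact ⟨l / b ^ m, by rw [← h.out]; exact Nat.mod_add_div _ _⟩
  have h1 : HasSum (fun t => decay b α (r + b ^ m * t)) (residueWeight b m α r) := by
    -- The term `t = 0` contributes `decay b α r`; as `decay b α 0 = 0`, the full series over `t`
    -- does not count it again.
    have h2 := (hasSum_ite_eq 0 (decay b α r)).add
      ((summable_decay hb hα).hasSum.mul_left (((b : ℝ) ^ (α * m))⁻¹))
    unfold residueWeight
    convert h2 using 1
    ext t
    split_ifs with ht
    · subst ht; simp [decay]
    · rw [decay_add_mul hb hr ht, zero_add]
  have h2 := (Function.Injective.hasSum_iff (g := fun t => r + b ^ m * t)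
    (f := fun l => if l % b ^ m = r then decay b α l else 0) (a := residueWeight b m α r)
    (fun x y h => Nat.eq_of_mul_eq_mul_left hp (Nat.add_left_cancel h)) (fun l hl => by
      rw [this] at hl
      exact if_neg hl)).1
  apply h2
  convert h1 using 1
  ext t
  simp [Nat.mod_eq_of_lt hr]

/-! ### The search criterion as a finite sum -/

/-- The contribution of the dual net projected to `v`. -/
def dualSum (b m α : ℕ) (P : (ZMod b)[X]) (q : ℕ → (ZMod b)[X]) (v : Finset ℕ) : ℝ :=
  ∑' l : dualNet b m P q v, ((b : ℝ) ^ (α * ∑ j : v, mu1 b (l.1 j)))⁻¹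

section Dual

variable {b : ℕ} [Fact b.Prime] {m : ℕ} {P : (ZMod b)[X]}

-- Membership in the dual net involves the components only modulo `b ^ m`, so the series is grouped
-- by residue vectors, each of which gives a product of one-dimensional sums. Positivity of the
-- components is carried by `decay b α 0 = 0`.
open Classical in
theorem dualSum_eq_sum {α : ℕ} (hα : 2 ≤ α) (q : ℕ → (ZMod b)[X]) (v : Finset ℕ) :
    dualSum b m α P q v = ∑ r : v → Fin (b ^ m),
      if P ∣ ∑ j : v, truncPoly b m (r j) * q j then ∏ j : v, residueWeight b m α (r j) else 0 := by
  have hb : 1 < b := (Fact.out : b.Prime).one_lt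
  have hp : 0 < b ^ m := by positivity
  have h1 : dualSum b m α P q v = ∑' l : v → ℕ,
      if P ∣ ∑ j : v, truncPoly b m (l j) * q j then ∏ j : v, decay b α (l j) else 0 := by
    unfold dualSum
    rw [tsum_subtype (dualNet b m P q v) (fun l => ((b : ℝ) ^ (α * ∑ j : v, mu1 b (l j)))⁻¹)]
    refine tsum_congr fun l => ?_
    unfold dualNet
    rw [Set.indicator_apply]
    by_cases h2 : ∀ j, 0 < l j
    · simp only [Set.mem_ofPred_eq, h2, implies_true, true_and]
      congr 1
      rw [Finset.mul_sum, ← Finset.prod_pow_eq_pow_sum, ← Finset.prod_inv_distrib]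
      exact Finset.prod_congr rfl fun j _ => (if_neg (h2 j).ne').symm
    · rw [if_neg (fun h => h2 h.1)]
      split_ifs
      · push Not at h2
        obtain ⟨j, hj⟩ := h2
        refine (Finset.prod_eq_zero (f := fun j => decay b α (l j)) (Finset.mem_univ j) ?_).symm
        exact if_pos (by omega)
      · rfl
  rw [h1]
  apply HasSum.tsum_eq
  have h2 : ∀ r ∈ (Finset.univ : Finset (v → Fin (b ^ m))), HasSum (fun l : v → ℕ =>
      if P ∣ ∑ j : v, truncPoly b m (r j) * q j then
        ∏ j : v, (if l j % b ^ m = r j then decay b α (l j) else 0) else 0)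
      (if P ∣ ∑ j : v, truncPoly b m (r j) * q j then ∏ j : v, residueWeight b m α (r j) else 0) := by
    intro r _
    split_ifs
    · exact hasSum_pi_prod (fun j l => if l % b ^ m = r j then decay b α l else 0) _
        (fun j l => by split_ifs; exacts [decay_nonneg _ _ _, le_rfl])
        (fun j => hasSum_decay_residue hb hα (r j).2)
    · exact hasSum_zero
  convert hasSum_sum h2 using 1
  ext l
  let r0 : v → Fin (b ^ m) := fun j => ⟨l j % b ^ m, Nat.mod_lt _ hp⟩
  rw [Finset.sum_eq_single r0]
  · have : ∀ j, truncPoly b m (r0 j) = truncPoly b m (l j) := fun j => truncPoly_mod m (l j)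
    simp only [this]
    simp only [r0, if_true]
  · intro r _ hr
    split_ifs
    · obtain ⟨j, hj⟩ := Function.ne_iff.1 hr
      refine Finset.prod_eq_zero (Finset.mem_univ j) (if_neg fun h => hj (Fin.ext h.symm))
    · rfl
  · simp

theorem addChar_map_sum {A ι : Type*} [AddCommMonoid A] (ψ : AddChar A ℂ) (s : Finset ι)
    (f : ι → A) : ψ (∑ i ∈ s, f i) = ∏ i ∈ s, ψ (f i) := by
  classical
  induction s using Finset.induction_on with
  | empty => simp [AddChar.map_zero_eq_one]
  | insert a s ha ih => rw [Finset.sum_insert ha, Finset.prod_insert ha, AddChar.map_add_eq_mul, ih]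

/-- The Fourier transform of the residue weights. -/
def nodeFactor (α : ℕ) (hP : P ≠ 0) (y : AdjoinRoot P) : ℂ :=
  ∑ r : Fin (b ^ m), (residueWeight b m α r : ℂ) * fieldChar hP (y * wordClass m P r)

variable [Fact (Irreducible P)]

theorem wordClass_char_sum (hm : 1 ≤ m) (hP : P ≠ 0) (hd : P.natDegree = m) (y : AdjoinRoot P) :
    ∑ n : Fin (b ^ m), fieldChar hP (wordClass m P n * y) =
      if y = 0 then (b ^ m : ℂ) else 0 := by
  classical
  let _ : Fintype (AdjoinRoot P) := Fintype.ofEquiv _ (wordEquiv hm hd)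
  rw [← fieldChar_sum hm hP hd y, ← (wordEquiv hm hd).sum_comp]
  congr 1

/-- Divisibility by `P` is detected by averaging `fieldChar` over all words `n`. The character of a
sum is a product, so the sum over residue vectors splits into one factor per component. -/
theorem dualSum_eq_char {α : ℕ} (hα : 2 ≤ α) (hm : 1 ≤ m) (hP : P ≠ 0) (hd : P.natDegree = m)
    (q : ℕ → (ZMod b)[X]) (v : Finset ℕ) :
    (dualSum b m α P q v : ℂ) = (1 / (b : ℂ) ^ m) * ∑ n : Fin (b ^ m),
      ∏ j ∈ v, nodeFactor (m := m) α hP (wordClass m P n * AdjoinRoot.mk P (q j)) := by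
  classical
  have hb : (b : ℂ) ≠ 0 := by exact_mod_cast (Fact.out : b.Prime).ne_zero
  have h1 : ∀ n : Fin (b ^ m),
      ∏ j ∈ v, nodeFactor (m := m) α hP (wordClass m P n * AdjoinRoot.mk P (q j)) =
      ∑ r : v → Fin (b ^ m), ((∏ j : v, residueWeight b m α (r j) : ℝ) : ℂ) *
        fieldChar hP (wordClass m P n * ∑ j : v, wordClass m P (r j) * AdjoinRoot.mk P (q j)) := by
    intro n
    rw [← Finset.prod_coe_sort]
    unfold nodeFactor
    rw [Finset.prod_univ_sum, Fintype.piFinset_univ]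
    refine Finset.sum_congr rfl fun r _ => ?_
    rw [Finset.prod_mul_distrib, Complex.ofReal_prod, Finset.mul_sum, addChar_map_sum]
    congr 1
    refine Finset.prod_congr rfl fun j _ => ?_
    congr 1; ring
  simp_rw [h1]
  rw [Finset.sum_comm]
  simp_rw [← Finset.mul_sum]
  simp_rw [wordClass_char_sum hm hP hd]
  rw [dualSum_eq_sum hα, Finset.mul_sum, Complex.ofReal_sum]
  refine Finset.sum_congr rfl fun r _ => ?_
  have : (P ∣ ∑ j : v, truncPoly b m (r j) * q j) ↔
      ∑ j : v, wordClass m P (r j) * AdjoinRoot.mk P (q j) = 0 := by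
    rw [← AdjoinRoot.mk_eq_zero, map_sum]
    simp [wordClass]
  simp only [this]
  split_ifs
  · field_simp
  · simp

/-- The value of the Fourier transform of the residue weights at the words with `e` digits. -/
def nodeWeight (b m α e : ℕ) : ℝ :=
  ∑ k ∈ Finset.range (m - e), ((b : ℝ) ^ (α * (k + 1)))⁻¹ * ((b : ℝ) ^ (k + 1) - (b : ℝ) ^ k) -
    ((b : ℝ) ^ (α * (m - e + 1)))⁻¹ * (b : ℝ) ^ (m - e)

theorem truncPoly_natDegree_of_lt {k e : ℕ} (he : 1 ≤ e) (hk : k < b ^ e) (m : ℕ) :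
    (truncPoly b m k).natDegree < e := by
  rw [← Nat.le_sub_one_iff_lt (by omega), natDegree_le_iff_coeff_eq_zero]
  intro i hi
  rw [truncPoly_coeff]
  split_ifs
  · rw [Nat.div_eq_of_lt (lt_of_lt_of_le hk (Nat.pow_le_pow_right (Fact.out : b.Prime).pos
      (by omega)))]
    simp
  · rfl

/-- The top digit is positive and less than `b`, hence nonzero modulo `b`. -/
theorem truncPoly_natDegree_add_one {m n : ℕ} (hn : n ≠ 0) (hnm : n < b ^ m) :
    (truncPoly b m n).natDegree + 1 = mu1 b n := by
  have hb : 1 < b := (Fact.out : b.Prime).one_lt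
  have h1 := mu1_pos hb hn
  have h2 : n < b ^ mu1 b n := (mu1_le_iff hb).1 le_rfl
  have h3 : b ^ (mu1 b n - 1) ≤ n := by
    by_contra! h
    have := (mu1_le_iff hb).2 h
    omega
  have h4 : mu1 b n ≤ m := (mu1_le_iff hb).2 hnm
  refine le_antisymm (truncPoly_natDegree_of_lt h1 h2 m) ?_
  have : mu1 b n - 1 ≤ (truncPoly b m n).natDegree := by
    apply le_natDegree_of_ne_zero
    rw [truncPoly_coeff, if_pos (by omega), Ne, ZMod.natCast_eq_zero_iff]
    intro h5
    have h6 : 0 < n / b ^ (mu1 b n - 1) := Nat.div_pos h3 (by positivity)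
    have h7 : n / b ^ (mu1 b n - 1) < b := by
      rw [Nat.div_lt_iff_lt_mul (by positivity), ← pow_succ']
      rwa [Nat.sub_add_cancel h1]
    exact absurd (Nat.le_of_dvd h6 h5) (by omega)
  omega

theorem truncPoly_ne_zero {m n : ℕ} (hn : n ≠ 0) (hnm : n < b ^ m) : truncPoly b m n ≠ 0 := by
  intro h
  apply hn
  apply truncPoly_injOn m hnm (by have := (Fact.out : b.Prime).pos; positivity)
  rw [h, truncPoly_zero]

/-- The classes of the words below `b ^ k` are invariant under translation by `X ^ (m - mu1 b n)`.
The product of this monomial with the word `n` has degree exactly `m - 1`, where the character is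
not one, so the translation multiplies the sum by a number different from one. -/
theorem wordClass_add_char_sum_zero (hP : P ≠ 0) (hd : P.natDegree = m) {n k : ℕ} (hn : n ≠ 0)
    (hnm : n < b ^ m) (hk : m < mu1 b n + k) (hkm : k ≤ m) :
    ∑ r ∈ Finset.range (b ^ k), fieldChar hP (wordClass m P n * wordClass m P r) = 0 := by
  have hb : 1 < b := (Fact.out : b.Prime).one_lt
  have h4 : mu1 b n ≤ m := (mu1_le_iff hb).2 hnm
  classical
  have hinj : ∀ r ∈ Finset.range (b ^ k), ∀ r' ∈ Finset.range (b ^ k),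
      wordClass m P r = wordClass m P r' → r = r' := by
    have hle : b ^ k ≤ b ^ m := Nat.pow_le_pow_right (by omega) hkm
    intro r hr r' hr' h
    exact wordClass_injOn (by have := mu1_pos hb hn; omega) hd
      ((Finset.mem_range.1 hr).trans_le hle) ((Finset.mem_range.1 hr').trans_le hle) h
  let V := (Finset.range (b ^ k)).image (wordClass m P)
  have hV : ∀ z, z ∈ V ↔ ∃ f : (ZMod b)[X], (∀ i, k ≤ i → f.coeff i = 0) ∧
      AdjoinRoot.mk P f = z := by
    intro z
    simp only [V, Finset.mem_image, Finset.mem_range]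
    constructor
    · rintro ⟨r, hr, rfl⟩
      refine ⟨truncPoly b m r, fun i hi => ?_, rfl⟩
      rw [truncPoly_coeff]
      split_ifs
      · rw [Nat.div_eq_of_lt (lt_of_lt_of_le hr (Nat.pow_le_pow_right (by omega) hi))]
        simp
      · rfl
    · rintro ⟨f, hf, rfl⟩
      obtain ⟨r, hr, h⟩ := exists_truncPoly (b := b) (by omega) hf
      refine ⟨r, hr, ?_⟩
      rw [wordClass, ← h]
      congr 1
      ext i
      rw [truncPoly_coeff, truncPoly_coeff]
      split_ifs with h1 h2 h2
      · rfl
      · rw [Nat.div_eq_of_lt (lt_of_lt_of_le hr (Nat.pow_le_pow_right (by omega) (by omega)))]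
        simp
      · omega
      · rfl
  have hsum : ∑ r ∈ Finset.range (b ^ k), fieldChar hP (wordClass m P n * wordClass m P r) =
      ∑ z ∈ V, fieldChar hP (wordClass m P n * z) := by
    rw [Finset.sum_image (fun r hr r' hr' => hinj r hr r' hr')]
  rw [hsum]
  set z₀ := AdjoinRoot.mk P (X ^ (m - mu1 b n)) with hz₀
  have hne : fieldChar hP (wordClass m P n * z₀) ≠ 1 := by
    have h0 := truncPoly_ne_zero hn hnm
    have h1 : truncPoly b m n * X ^ (m - mu1 b n) ≠ 0 := mul_ne_zero h0 (by simp)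
    have h2 : (truncPoly b m n * X ^ (m - mu1 b n)).natDegree + 1 = P.natDegree := by
      rw [natDegree_mul h0 (by simp), natDegree_X_pow, hd]
      have := truncPoly_natDegree_add_one hn hnm
      omega
    rw [wordClass, ← map_mul, fieldChar_mk]
    intro h
    exact residue_ne_zero h1 h2 (ZMod.injective_stdAddChar (h.trans (AddChar.map_zero_eq_one _).symm))
  have hshift : ∀ z, z ∈ V ↔ z + z₀ ∈ V := by
    intro z
    rw [hV, hV]
    constructor
    · rintro ⟨f, hf, rfl⟩
      exact ⟨f + X ^ (m - mu1 b n), fun i hi => by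
        rw [coeff_add, hf i hi, coeff_X_pow, if_neg (by omega), add_zero], by rw [map_add]⟩
    · rintro ⟨f, hf, h⟩
      exact ⟨f - X ^ (m - mu1 b n), fun i hi => by
        rw [coeff_sub, hf i hi, coeff_X_pow, if_neg (by omega), sub_zero], by rw [map_sub, h]; ring⟩
  have h1 : ∑ z ∈ V, fieldChar hP (wordClass m P n * z) =
      fieldChar hP (wordClass m P n * z₀) * ∑ z ∈ V, fieldChar hP (wordClass m P n * z) := by
    conv_lhs => rw [← Finset.sum_equiv (s := V) (Equiv.addRight z₀)
      (f := fun z => fieldChar hP (wordClass m P n * (z + z₀))) hshift (fun _ _ => rfl)]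
    rw [Finset.mul_sum]
    refine Finset.sum_congr rfl fun z _ => ?_
    rw [mul_add, AddChar.map_add_eq_mul, mul_comm]
  by_contra h0
  exact hne (mul_right_cancel₀ h0 (h1.symm.trans (one_mul _).symm))

/-- All products have degree below `m - 1`, so their residues vanish and every summand is one. -/
theorem wordClass_add_char_sum_eq (hP : P ≠ 0) (hd : P.natDegree = m) {n k : ℕ} (hn : n ≠ 0)
    (hnm : n < b ^ m) (hk : mu1 b n + k ≤ m) :
    ∑ r ∈ Finset.range (b ^ k), fieldChar hP (wordClass m P n * wordClass m P r) = (b : ℂ) ^ k := by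
  have hb : 1 < b := (Fact.out : b.Prime).one_lt
  have h1 : ∀ r ∈ Finset.range (b ^ k), fieldChar hP (wordClass m P n * wordClass m P r) = 1 := by
    intro r hr
    rw [Finset.mem_range] at hr
    rcases Nat.eq_zero_or_pos r with rfl | hr0
    · rw [wordClass_zero, mul_zero, AddChar.map_zero_eq_one]
    have h2 : (truncPoly b m n * truncPoly b m r).natDegree + 1 < P.natDegree := by
      have h3 := natDegree_mul_le (p := truncPoly b m n) (q := truncPoly b m r)
      have h4 := truncPoly_natDegree_add_one hn hnm
      have hk0 : 1 ≤ k := by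
        by_contra! h
        obtain rfl : k = 0 := by omega
        simp at hr; omega
      have h5 := truncPoly_natDegree_of_lt hk0 hr m
      omega
    rw [wordClass, wordClass, ← map_mul, fieldChar_mk, residue_eq_zero_of_natDegree_lt h2,
      AddChar.map_zero_eq_one]
  rw [Finset.sum_congr rfl h1]
  simp

/-- The decay is constant on the words with a given number of digits, so the sum is arranged by the
blocks between consecutive powers of `b`. The character sums over initial segments are `b ^ k` up to
`k = m - e` and zero afterwards. As a result the kernel at a nonzero word depends only on the number
of digits, and a table of at most `m` values describes it. -/
theorem nodeFactor_eq_nodeWeight {α : ℕ} (hP : P ≠ 0) (hd : P.natDegree = m) {n : ℕ}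
    (hn : n ≠ 0) (hnm : n < b ^ m) :
    nodeFactor (m := m) α hP (wordClass m P n) = (nodeWeight b m α (mu1 b n) : ℂ) := by
  have hb : 1 < b := (Fact.out : b.Prime).one_lt
  have he1 := mu1_pos hb hn
  have hem : mu1 b n ≤ m := (mu1_le_iff hb).2 hnm
  set e := mu1 b n with he
  set ψ := fun r : ℕ => fieldChar hP (wordClass m P n * wordClass m P r) with hψ
  set S : ℕ → ℂ := fun k => ∑ r ∈ Finset.range (b ^ k), ψ r with hS
  have hS0 : S 0 = 1 := by simp [hS, hψ, wordClass_zero, AddChar.map_zero_eq_one]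
  have hSle : ∀ k, e + k ≤ m → S k = (b : ℂ) ^ k := fun k hk =>
    wordClass_add_char_sum_eq hP hd hn hnm hk
  have hSgt : ∀ k, m < e + k → k ≤ m → S k = 0 := fun k hk hkm =>
    wordClass_add_char_sum_zero hP hd hn hnm hk hkm
  have h1 : ∀ k ≤ m, ∑ r ∈ Finset.range (b ^ k), (decay b α r : ℂ) * ψ r =
      ∑ i ∈ Finset.range k, ((b : ℂ) ^ (α * (i + 1)))⁻¹ * (S (i + 1) - S i) := by
    intro k
    induction k with
    | zero => simp [decay]
    | succ k ih =>
      intro hk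
      have hle : b ^ k ≤ b ^ (k + 1) := Nat.pow_le_pow_right (by omega) (by omega)
      rw [Finset.sum_range_succ, ← ih (by omega), ← Finset.sum_range_add_sum_Ico _ hle, hS]
      simp only
      rw [← Finset.sum_range_add_sum_Ico ψ hle, add_sub_cancel_left, Finset.mul_sum]
      congr 1
      refine Finset.sum_congr rfl fun r hr => ?_
      rw [Finset.mem_Ico] at hr
      have hmu : mu1 b r = k + 1 := by
        refine le_antisymm ((mu1_le_iff hb).2 hr.2) ?_
        by_contra! h
        exact absurd ((mu1_le_iff hb).1 (show mu1 b r ≤ k by omega)) (by omega)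
      have hr0 : r ≠ 0 := by
        have : 0 < b ^ k := by positivity
        omega
      rw [decay, if_neg hr0, hmu]
      push_cast
      rfl
  have h2 : nodeFactor (m := m) α hP (wordClass m P n) =
      ∑ r ∈ Finset.range (b ^ m), (residueWeight b m α r : ℂ) * ψ r := by
    rw [nodeFactor, ← Fin.sum_univ_eq_sum_range (fun r => (residueWeight b m α r : ℂ) * ψ r)]
  rw [h2]
  simp only [residueWeight, Complex.ofReal_add, add_mul, Finset.sum_add_distrib, ← Finset.mul_sum]
  -- The part of the weight that does not depend on `r` is killed by the full character sum.
  rw [show (∑ r ∈ Finset.range (b ^ m), ψ r : ℂ) = 0 from hSgt m (by omega) le_rfl, mul_zero, add_zero,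
    h1 m le_rfl]
  have hsplit : m = (m - e) + 1 + (e - 1) := by omega
  -- Beyond the first `m - e` blocks only the one where the character sums drop to zero contributes;
  -- it gives the negative term of `nodeWeight`.
  have h3 : ∑ i ∈ Finset.range m, ((b : ℂ) ^ (α * (i + 1)))⁻¹ * (S (i + 1) - S i) =
      ∑ i ∈ Finset.range (m - e + 1), ((b : ℂ) ^ (α * (i + 1)))⁻¹ * (S (i + 1) - S i) := by
    conv_lhs => rw [hsplit, Finset.sum_range_add]
    rw [add_eq_left]
    refine Finset.sum_eq_zero fun i hi => ?_
    rw [Finset.mem_range] at hi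
    rw [hSgt _ (by omega) (by omega), hSgt _ (by omega) (by omega)]
    simp
  rw [h3, Finset.sum_range_succ, hSgt (m - e + 1) (by omega) (by omega), hSle (m - e) (by omega),
    nodeWeight]
  push_cast
  rw [zero_sub, mul_neg, ← sub_eq_add_neg]
  congr 1
  refine Finset.sum_congr rfl fun i hi => ?_
  rw [Finset.mem_range] at hi
  rw [hSle _ (by omega), hSle _ (by omega)]

end Dual
end QMC
end

/-! ### Factorization over blocks, and the dependence on a single component -/

noncomputable section
namespace QMC
open Polynomial

/-! ### Block weights -/

/-- The product of the weights of the blocks of length `α` that `v` meets. -/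
def blockWeight (α : ℕ) (w : ℕ → ℝ) (v : Finset ℕ) : ℝ := ∏ i ∈ v.image (· / α), w i

/-- The generating product over the first `I` blocks. -/
def fullProd (α : ℕ) (w x : ℕ → ℝ) (I : ℕ) : ℝ :=
  ∏ i ∈ Finset.range I, (1 + w i * (∏ j ∈ Finset.range α, (1 + x (α * i + j)) - 1))

/-- The product over the first `j` components of the block `I`. -/
def partProd (α : ℕ) (x : ℕ → ℝ) (I j : ℕ) : ℝ :=
  ∏ j' ∈ Finset.range j, (1 + x (α * I + j'))

theorem fullProd_succ (α : ℕ) (w x : ℕ → ℝ) (I : ℕ) :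
    fullProd α w x (I + 1) = fullProd α w x I * (1 + w I * (partProd α x I α - 1)) := by
  rw [fullProd, Finset.prod_range_succ]; rfl

theorem partProd_succ (α : ℕ) (x : ℕ → ℝ) (I j : ℕ) :
    partProd α x I (j + 1) = partProd α x I j * (1 + x (α * I + j)) := by
  rw [partProd, Finset.prod_range_succ]; rfl

theorem blockWeight_insert {α : ℕ} (w : ℕ → ℝ) (u : Finset ℕ) {I j : ℕ} (hj : j < α) :
    blockWeight α w (insert (α * I + j) u) = ∏ i ∈ insert I (u.image (· / α)), w i := by
  rw [blockWeight, Finset.image_insert, Nat.mul_add_div (by omega), Nat.div_eq_of_lt hj, add_zero]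

theorem sum_powerset_range_succ (g : Finset ℕ → ℝ) (d : ℕ) :
    ∑ u ∈ (Finset.range (d + 1)).powerset, g u =
      ∑ u ∈ (Finset.range d).powerset, g u + ∑ u ∈ (Finset.range d).powerset, g (insert d u) := by
  rw [Finset.range_add_one, Finset.sum_powerset_insert (by simp)]

theorem notMem_of_mem_powerset_range {d : ℕ} {u : Finset ℕ} (hu : u ∈ (Finset.range d).powerset) :
    d ∉ u := fun h => by simpa using Finset.mem_powerset.1 hu h

/-- Once block `I` is counted, a further component of that block changes no weight, so each of its
components contributes a free factor `1 + x`. -/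
theorem sum_blockWeight_forced (α : ℕ) (w x : ℕ → ℝ) (I : ℕ) (j : ℕ) (hj : j ≤ α) :
    ∑ u ∈ (Finset.range (α * I + j)).powerset,
        (∏ i ∈ insert I (u.image (· / α)), w i) * ∏ k ∈ u, x k =
      (∑ u ∈ (Finset.range (α * I)).powerset, blockWeight α w u * ∏ k ∈ u, x k) *
        (w I * partProd α x I j) := by
  induction j with
  | zero =>
    rw [partProd, Finset.prod_range_zero, mul_one, Finset.sum_mul]
    refine Finset.sum_congr (by simp) fun u hu => ?_
    rw [Finset.prod_insert, blockWeight]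
    · ring
    · intro h
      obtain ⟨k, hk, hkI⟩ := Finset.mem_image.1 h
      have h1 := Finset.mem_range.1 (Finset.mem_powerset.1 hu hk)
      have h2 := Nat.div_lt_of_lt_mul h1
      omega
  | succ j ih =>
    rw [← add_assoc, sum_powerset_range_succ, partProd_succ, ih (by omega)]
    have h : ∑ u ∈ (Finset.range (α * I + j)).powerset,
        (∏ i ∈ insert I ((insert (α * I + j) u).image (· / α)), w i) *
          ∏ k ∈ insert (α * I + j) u, x k =
        (∑ u ∈ (Finset.range (α * I + j)).powerset,
        (∏ i ∈ insert I (u.image (· / α)), w i) * ∏ k ∈ u, x k) * x (α * I + j) := by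
      rw [Finset.sum_mul]
      refine Finset.sum_congr rfl fun u hu => ?_
      rw [Finset.prod_insert (notMem_of_mem_powerset_range hu), Finset.image_insert,
        Nat.mul_add_div (by omega), Nat.div_eq_of_lt (by omega : j < α), add_zero,
        Finset.insert_idem]
      ring
    rw [h, ih (by omega)]
    ring

/-- Subsets are split by whether they contain the newest component; if they do, block `I` is met and
the forced sum applies. -/
theorem sum_blockWeight_partial (α : ℕ) (w x : ℕ → ℝ) (I : ℕ) (j : ℕ) (hj : j ≤ α) :
    ∑ u ∈ (Finset.range (α * I + j)).powerset, blockWeight α w u * ∏ k ∈ u, x k =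
      (∑ u ∈ (Finset.range (α * I)).powerset, blockWeight α w u * ∏ k ∈ u, x k) *
        (1 + w I * (partProd α x I j - 1)) := by
  induction j with
  | zero => simp [partProd]
  | succ j ih =>
    rw [← add_assoc, sum_powerset_range_succ, ih (by omega), partProd_succ]
    have h : ∑ u ∈ (Finset.range (α * I + j)).powerset,
        blockWeight α w (insert (α * I + j) u) * ∏ k ∈ insert (α * I + j) u, x k =
        (∑ u ∈ (Finset.range (α * I + j)).powerset,
        (∏ i ∈ insert I (u.image (· / α)), w i) * ∏ k ∈ u, x k) * x (α * I + j) := by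
      rw [Finset.sum_mul]
      refine Finset.sum_congr rfl fun u hu => ?_
      rw [Finset.prod_insert (notMem_of_mem_powerset_range hu), blockWeight_insert w u (by omega)]
      ring
    rw [h, sum_blockWeight_forced α w x I j (by omega)]
    ring

/-- The weight sees only which blocks are met: a block contributes `1` if it is avoided, and `w i`
times the sum over its nonempty subsets otherwise. -/
theorem sum_blockWeight (α : ℕ) (w x : ℕ → ℝ) (I : ℕ) :
    ∑ u ∈ (Finset.range (α * I)).powerset, blockWeight α w u * ∏ k ∈ u, x k = fullProd α w x I := by
  induction I with
  | zero => simp [fullProd, blockWeight]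
  | succ I ih =>
    rw [mul_add, mul_one, sum_blockWeight_partial α w x I α le_rfl, ih, fullProd_succ]

/-! ### The weights of the construction -/

/-- The weight of a coordinate in the search criterion. -/
def cbcWeight (b α : ℕ) (β : ℕ → ℝ) (j : ℕ) : ℝ :=
  walshConst α b * (b : ℝ) ^ (α * (α - 1) / 2) * coordWeight α (β j)

theorem setWeight_eq (b α : ℕ) (β : ℕ → ℝ) (v : Finset ℕ) :
    setWeight b α β v = blockWeight α (cbcWeight b α β) v := rfl

theorem sin_pi_div_pos {b : ℕ} (hb : 1 < b) : 0 < Real.sin (Real.pi / b) := by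
  have h : (1 : ℝ) < b := by exact_mod_cast hb
  apply Real.sin_pos_of_pos_of_lt_pi
  · have := Real.pi_pos; positivity
  · exact div_lt_self Real.pi_pos h

theorem walshConst_pos {α b : ℕ} (hb : 1 < b) : 0 < walshConst α b := by
  have h : (1 : ℝ) < b := by exact_mod_cast hb
  have hs := sin_pi_div_pos hb
  unfold walshConst
  have h1 : 0 < (Finset.Icc 1 (α - 1)).fold max (2 / (2 * Real.sin (Real.pi / b)) ^ α)
      (fun z => 1 / (2 * Real.sin (Real.pi / b)) ^ z) :=
    (Finset.lt_fold_max _).2 (Or.inl (by positivity))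
  have h2 : 0 < (b : ℝ) - 1 := by linarith
  positivity

theorem coordWeight_nonneg (α : ℕ) {x : ℝ} (hx : 0 ≤ x) : 0 ≤ coordWeight α x := by
  unfold coordWeight
  refine Finset.sum_nonneg fun ν _ => ?_
  split_ifs <;> positivity

theorem cbcWeight_nonneg {b : ℕ} (hb : 1 < b) (α : ℕ) {β : ℕ → ℝ} (hβ : ∀ j, 0 < β j) (j : ℕ) :
    0 ≤ cbcWeight b α β j := by
  have := (walshConst_pos (α := α) hb).le
  have := coordWeight_nonneg α (hβ j).le
  unfold cbcWeight
  positivity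

/-! ### One step of the component-by-component construction -/

/-- The part of the search criterion that involves the component `d`. -/
def stepSum (b m α : ℕ) (β : ℕ → ℝ) (P : (ZMod b)[X]) (d : ℕ) (q : ℕ → (ZMod b)[X]) : ℝ :=
  ∑ u ∈ (Finset.range d).powerset,
    setWeight b α β (insert d u) * dualSum b m α P q (insert d u)

theorem dualSum_congr {b m α : ℕ} {P : (ZMod b)[X]} {q q' : ℕ → (ZMod b)[X]} {v : Finset ℕ}
    (h : ∀ j ∈ v, q j = q' j) : dualSum b m α P q v = dualSum b m α P q' v := by
  have : dualNet b m P q v = dualNet b m P q' v := by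
    unfold dualNet
    ext l
    simp only [Set.mem_ofPred_eq]
    rw [Finset.sum_congr rfl fun j _ => by rw [h j.1 j.2]]
  unfold dualSum
  rw [this]

theorem criterion_succ (b m α : ℕ) (β : ℕ → ℝ) (P : (ZMod b)[X]) (d : ℕ) (q : ℕ → (ZMod b)[X]) :
    criterion b m α β P (d + 1) q = criterion b m α β P d q + stepSum b m α β P d q := by
  unfold criterion stepSum
  rw [Finset.sum_filter, sum_powerset_range_succ, Finset.sum_filter]
  congr 1
  refine Finset.sum_congr rfl fun u _ => ?_
  rw [if_pos (Finset.insert_nonempty _ _)]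
  rfl

theorem criterion_zero (b m α : ℕ) (β : ℕ → ℝ) (P : (ZMod b)[X]) (q : ℕ → (ZMod b)[X]) :
    criterion b m α β P 0 q = 0 := by
  unfold criterion
  apply Finset.sum_eq_zero
  intro v hv
  simp only [Finset.range_zero, Finset.powerset_empty, Finset.mem_filter,
    Finset.mem_singleton] at hv
  obtain ⟨rfl, h⟩ := hv
  simp at h

theorem criterion_congr {b m α : ℕ} {β : ℕ → ℝ} {P : (ZMod b)[X]} {d : ℕ}
    {q q' : ℕ → (ZMod b)[X]} (h : ∀ j < d, q j = q' j) :
    criterion b m α β P d q = criterion b m α β P d q' := by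
  unfold criterion
  refine Finset.sum_congr rfl fun v hv => ?_
  rw [Finset.mem_filter, Finset.mem_powerset] at hv
  congr 1
  exact dualSum_congr fun j hj => h j (Finset.mem_range.1 (hv.1 hj))

theorem criterion_update_le_iff {b m α : ℕ} {β : ℕ → ℝ} {P : (ZMod b)[X]} {d : ℕ}
    {q : ℕ → (ZMod b)[X]} {r : (ZMod b)[X]} :
    criterion b m α β P (d + 1) q ≤ criterion b m α β P (d + 1) (Function.update q d r) ↔
      stepSum b m α β P d q ≤ stepSum b m α β P d (Function.update q d r) := by
  rw [criterion_succ, criterion_succ, criterion_congr (q := Function.update q d r) (q' := q)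
    (fun j hj => Function.update_of_ne (by omega) _ _)]
  simp

section Nodes

variable {b : ℕ} [Fact b.Prime] {m : ℕ} {P : (ZMod b)[X]} [Fact (Irreducible P)]

/-- The real number `nodeFactor`. -/
def nodeReal (m α : ℕ) (hP : P ≠ 0) (y : AdjoinRoot P) : ℝ := (nodeFactor (m := m) α hP y).re

theorem nodeReal_wordClass {α : ℕ} (hP : P ≠ 0) (hd : P.natDegree = m) {n : ℕ}
    (hn : n ≠ 0) (hnm : n < b ^ m) :
    nodeReal m α hP (wordClass m P n) = nodeWeight b m α (mu1 b n) := by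
  rw [nodeReal, nodeFactor_eq_nodeWeight hP hd hn hnm, Complex.ofReal_re]

/-- At nonzero classes the value is the real `nodeWeight`; at zero all characters are one. -/
theorem ofReal_nodeReal {α : ℕ} (hm : 1 ≤ m) (hP : P ≠ 0) (hd : P.natDegree = m)
    (y : AdjoinRoot P) : (nodeReal m α hP y : ℂ) = nodeFactor (m := m) α hP y := by
  obtain ⟨n, hn, rfl⟩ := wordClass_surjOn hm hd y
  rcases Nat.eq_zero_or_pos n with rfl | h0
  · rw [nodeReal, wordClass_zero, nodeFactor]
    simp only [zero_mul, AddChar.map_zero_eq_one, mul_one, ← Complex.ofReal_sum, Complex.ofReal_re]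
  · rw [nodeReal_wordClass hP hd h0.ne' hn, nodeFactor_eq_nodeWeight hP hd h0.ne' hn]

theorem dualSum_eq_nodes {α : ℕ} (hα : 2 ≤ α) (hm : 1 ≤ m) (hP : P ≠ 0) (hd : P.natDegree = m)
    (q : ℕ → (ZMod b)[X]) (v : Finset ℕ) :
    dualSum b m α P q v = (1 / (b : ℝ) ^ m) * ∑ n : Fin (b ^ m),
      ∏ j ∈ v, nodeReal m α hP (wordClass m P n * AdjoinRoot.mk P (q j)) := by
  have := dualSum_eq_char hα hm hP hd q v
  simp_rw [← ofReal_nodeReal hm hP hd] at this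
  apply Complex.ofReal_injective
  push_cast
  exact this

/-- For a fixed node, `sum_blockWeight_forced` evaluates the sum over all sets that contain the new
component. Completed blocks enter through `fullProd` and the current one through `partProd`; these
are the two vectors that the algorithm maintains. -/
theorem stepSum_eq_nodes {α : ℕ} (hα : 2 ≤ α) (hm : 1 ≤ m) (hP : P ≠ 0) (hd : P.natDegree = m)
    (β : ℕ → ℝ) (q : ℕ → (ZMod b)[X]) {I j : ℕ} (hj : j < α) :
    stepSum b m α β P (α * I + j) q = (cbcWeight b α β I / (b : ℝ) ^ m) * ∑ n : Fin (b ^ m),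
      fullProd α (cbcWeight b α β)
        (fun k => nodeReal m α hP (wordClass m P n * AdjoinRoot.mk P (q k))) I *
      partProd α (fun k => nodeReal m α hP (wordClass m P n * AdjoinRoot.mk P (q k))) I j *
      nodeReal m α hP (wordClass m P n * AdjoinRoot.mk P (q (α * I + j))) := by
  unfold stepSum
  simp_rw [dualSum_eq_nodes hα hm hP hd, Finset.mul_sum]
  rw [Finset.sum_comm]
  refine Finset.sum_congr rfl fun n _ => ?_
  set x : ℕ → ℝ := fun k => nodeReal m α hP (wordClass m P n * AdjoinRoot.mk P (q k)) with hx
  have h := sum_blockWeight_forced α (cbcWeight b α β) x I j hj.le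
  rw [sum_blockWeight] at h
  have h2 : ∑ u ∈ (Finset.range (α * I + j)).powerset,
      setWeight b α β (insert (α * I + j) u) * ((1 / (b : ℝ) ^ m) * ∏ k ∈ insert (α * I + j) u, x k)
      = (1 / (b : ℝ) ^ m * x (α * I + j)) * ∑ u ∈ (Finset.range (α * I + j)).powerset,
        (∏ i ∈ insert I (u.image (· / α)), cbcWeight b α β i) * ∏ k ∈ u, x k := by
    rw [Finset.mul_sum]
    refine Finset.sum_congr rfl fun u hu => ?_
    rw [Finset.prod_insert (notMem_of_mem_powerset_range hu), setWeight_eq, blockWeight_insert _ _ hj]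
    ring
  rw [h2, h]
  ring

/-- The quantity minimized by the algorithm, as a function of the candidate component. -/
def searchSum (m α : ℕ) (hP : P ≠ 0) (w : ℕ → ℝ) (q : ℕ → (ZMod b)[X]) (I j : ℕ)
    (r : AdjoinRoot P) : ℝ :=
  ∑ n ∈ Finset.univ.filter (fun n : Fin (b ^ m) => (n : ℕ) ≠ 0),
    fullProd α w (fun k => nodeReal m α hP (wordClass m P n * AdjoinRoot.mk P (q k))) I *
    partProd α (fun k => nodeReal m α hP (wordClass m P n * AdjoinRoot.mk P (q k))) I j *
    nodeReal m α hP (wordClass m P n * r)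

/-- At the node `n = 0` the kernel is evaluated at zero whatever the candidate, so this node
contributes only a constant. Without it the nodes form a cyclic group. -/
theorem stepSum_eq_searchSum {α : ℕ} (hα : 2 ≤ α) (hm : 1 ≤ m) (hP : P ≠ 0)
    (hd : P.natDegree = m) (β : ℕ → ℝ) (q : ℕ → (ZMod b)[X]) {I j : ℕ} (hj : j < α) :
    ∃ c : ℝ, ∀ r, stepSum b m α β P (α * I + j) (Function.update q (α * I + j) r) =
      cbcWeight b α β I / (b : ℝ) ^ m *
        (c + searchSum m α hP (cbcWeight b α β) q I j (AdjoinRoot.mk P r)) := by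
  have hb : 1 < b := (Fact.out : b.Prime).one_lt
  refine ⟨∑ n ∈ Finset.univ.filter (fun n : Fin (b ^ m) => ¬ (n : ℕ) ≠ 0),
    fullProd α (cbcWeight b α β)
      (fun k => nodeReal m α hP (wordClass m P n * AdjoinRoot.mk P (q k))) I *
    partProd α (fun k => nodeReal m α hP (wordClass m P n * AdjoinRoot.mk P (q k))) I j *
    nodeReal m α hP 0, fun r => ?_⟩
  rw [stepSum_eq_nodes hα hm hP hd _ _ hj, searchSum,
    ← Finset.sum_filter_add_sum_filter_not _ (fun n : Fin (b ^ m) => (n : ℕ) ≠ 0), add_comm]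
  have hfull : ∀ n : Fin (b ^ m), fullProd α (cbcWeight b α β) (fun k => nodeReal m α hP
      (wordClass m P n * AdjoinRoot.mk P (Function.update q (α * I + j) r k))) I =
      fullProd α (cbcWeight b α β) (fun k => nodeReal m α hP
      (wordClass m P n * AdjoinRoot.mk P (q k))) I := by
    intro n
    refine Finset.prod_congr rfl fun i hi => ?_
    rw [Finset.mem_range] at hi
    have : ∀ k ∈ Finset.range α, 1 + nodeReal m α hP
      (wordClass m P n * AdjoinRoot.mk P (Function.update q (α * I + j) r (α * i + k))) =
      1 + nodeReal m α hP (wordClass m P n * AdjoinRoot.mk P (q (α * i + k))) := by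
      intro k hk
      rw [Finset.mem_range] at hk
      rw [Function.update_of_ne]
      have : α * (i + 1) ≤ α * I := Nat.mul_le_mul_left _ hi
      rw [mul_add] at this
      omega
    rw [Finset.prod_congr rfl this]
  have hpart : ∀ n : Fin (b ^ m), partProd α (fun k => nodeReal m α hP
      (wordClass m P n * AdjoinRoot.mk P (Function.update q (α * I + j) r k))) I j =
      partProd α (fun k => nodeReal m α hP
      (wordClass m P n * AdjoinRoot.mk P (q k))) I j := by
    intro n
    refine Finset.prod_congr rfl fun k hk => ?_
    rw [Finset.mem_range] at hk
    simp only
    rw [Function.update_of_ne (by omega)]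
  simp_rw [hfull, hpart, Function.update_self]
  congr 2
  refine Finset.sum_congr rfl fun n hn => ?_
  have : (n : ℕ) = 0 := by simpa using hn
  rw [this, wordClass_zero, zero_mul]

/-- A nonnegative factor and an additive constant preserve minimizers. -/
theorem isCBC_of_minimal {α s : ℕ} (hα : 2 ≤ α) (hm : 1 ≤ m) (hP : P ≠ 0)
    (hd : P.natDegree = m) {β : ℕ → ℝ} (hβ : ∀ j, 0 < β j) (q : ℕ → (ZMod b)[X])
    (h0 : q 0 = 1) (hq : ∀ i < α * s, q i ∈ genSet b m)
    (hmin : ∀ I < s, ∀ j < α, ∀ r ∈ genSet b m,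
      searchSum m α hP (cbcWeight b α β) q I j (AdjoinRoot.mk P (q (α * I + j))) ≤
        searchSum m α hP (cbcWeight b α β) q I j (AdjoinRoot.mk P r)) :
    IsCBC b m α β P (α * s) q := by
  refine ⟨h0, hq, fun i hi r hr => ?_⟩
  have hb : 1 < b := (Fact.out : b.Prime).one_lt
  have hα0 : 0 < α := by omega
  have hI : i / α < s := Nat.div_lt_of_lt_mul hi
  have hj : i % α < α := Nat.mod_lt _ hα0
  have hdec : α * (i / α) + i % α = i := Nat.div_add_mod i α
  rw [criterion_update_le_iff]
  obtain ⟨c, hc⟩ := stepSum_eq_searchSum (m := m) hα hm hP hd β q (I := i / α) hj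
  have h1 := hc (q i)
  have h2 := hc r
  rw [hdec] at h1 h2
  rw [Function.update_eq_self] at h1
  rw [h1, h2]
  have := hmin _ hI _ hj r hr
  rw [hdec] at this
  have := cbcWeight_nonneg hb α hβ (i / α)
  gcongr

end Nodes
end QMC
end

noncomputable section
namespace QMC
open Polynomial

/-! ### The error bound of the component-by-component construction -/

theorem rpow_sum_le_sum_rpow {ι : Type*} (s : Finset ι) (f : ι → ℝ) {p : ℝ} (hp : 0 < p)
    (hp1 : p ≤ 1) (hf : ∀ i ∈ s, 0 ≤ f i) : (∑ i ∈ s, f i) ^ p ≤ ∑ i ∈ s, f i ^ p := by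
  classical
  induction s using Finset.induction_on with
  | empty => simp [Real.zero_rpow hp.ne']
  | insert a s ha ih =>
    rw [Finset.sum_insert ha, Finset.sum_insert ha]
    have h1 := ih fun i hi => hf i (Finset.mem_insert_of_mem hi)
    have h2 := Real.rpow_add_le_add_rpow (hf a (Finset.mem_insert_self _ _))
      (Finset.sum_nonneg fun i hi => hf i (Finset.mem_insert_of_mem hi)) hp.le hp1
    linarith

theorem decay_rpow_le {b α : ℕ} (hb : 1 < b) {p : ℝ} (hp : 0 < p) (l : ℕ) :
    decay b α l ^ p ≤ ((l : ℝ) ^ (α * p))⁻¹ := by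
  unfold decay
  split_ifs with h
  · rw [Real.zero_rpow hp.ne']; positivity
  · have h1 : (l : ℝ) < (b : ℝ) ^ mu1 b l := by exact_mod_cast (mu1_le_iff hb).1 le_rfl
    have h2 : (0 : ℝ) < l := by exact_mod_cast Nat.pos_of_ne_zero h
    rw [Real.inv_rpow (by positivity)]
    gcongr
    rw [mul_comm α, pow_mul, ← Real.rpow_natCast _ α, ← Real.rpow_mul (by positivity)]
    gcongr

theorem summable_decay_rpow {b α : ℕ} (hb : 1 < b) {p : ℝ} (hp : 0 < p) (hαp : 1 < α * p) :
    Summable fun l => decay b α l ^ p :=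
  Summable.of_nonneg_of_le (fun _ => Real.rpow_nonneg (decay_nonneg _ _ _) _)
    (decay_rpow_le hb hp) (Real.summable_nat_rpow_inv.2 hαp)

/-- Because `α p > 1`, the `p`-th power of `b ^ (α m)` is at least `b ^ m`, the number of residues
over which the tail is going to be summed. -/
theorem tail_rpow_le {b m α : ℕ} (hb : 1 < b) {p : ℝ} (hαp : 1 < α * p) {t : ℝ}
    (ht : 0 ≤ t) : (((b : ℝ) ^ (α * m))⁻¹ * t) ^ p ≤ ((b : ℝ) ^ m)⁻¹ * t ^ p := by
  have hb' : (1 : ℝ) < b := by exact_mod_cast hb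
  rw [Real.mul_rpow (by positivity) ht, Real.inv_rpow (by positivity)]
  gcongr
  rw [mul_comm α, pow_mul, ← Real.rpow_natCast _ α, ← Real.rpow_mul (by positivity)]
  exact Real.self_le_rpow_of_one_le (one_le_pow₀ hb'.le) hαp.le

/-- A bound, uniform in `m`, for the sum of the `p`-th powers of the residue weights. -/
def residueBound (b α : ℕ) (p : ℝ) : ℝ :=
  ∑' l, decay b α l ^ p + 2 * (∑' l, decay b α l) ^ p

theorem residueBound_nonneg (b α : ℕ) (p : ℝ) : 0 ≤ residueBound b α p := by
  have h1 : 0 ≤ ∑' l, decay b α l ^ p :=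
    tsum_nonneg fun l => Real.rpow_nonneg (decay_nonneg _ _ _) _
  have h2 : 0 ≤ ∑' l, decay b α l := tsum_nonneg fun l => decay_nonneg _ _ _
  unfold residueBound
  positivity

/-- Each of the `b ^ m` tails is at most `b ^ (-m)` times a constant, so together they cost that
constant once. The extra term at residue zero, with factor `b ^ m`, is reserved for frequencies that
may be dual for every candidate, and costs the constant a second time. -/
theorem sum_residueWeight_rpow_le {b m α : ℕ} (hb : 1 < b) {p : ℝ} (hp : 0 < p) (hp1 : p ≤ 1)
    (hαp : 1 < α * p) :
    ∑ r : Fin (b ^ m), residueWeight b m α r ^ p + b ^ m * residueWeight b m α 0 ^ p ≤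
      residueBound b α p := by
  have ht : 0 ≤ ∑' l, decay b α l := tsum_nonneg fun l => decay_nonneg _ _ _
  have hb' : (1 : ℝ) < b := by exact_mod_cast hb
  have hN : (0 : ℝ) < (b : ℝ) ^ m := by positivity
  have h1 : ∀ r : Fin (b ^ m), residueWeight b m α r ^ p ≤
      decay b α r ^ p + ((b : ℝ) ^ m)⁻¹ * (∑' l, decay b α l) ^ p := by
    intro r
    refine (Real.rpow_add_le_add_rpow (decay_nonneg _ _ _) (by positivity) hp.le hp1).trans ?_
    gcongr
    exact tail_rpow_le hb hαp ht
  have h2 : residueWeight b m α 0 ^ p ≤ ((b : ℝ) ^ m)⁻¹ * (∑' l, decay b α l) ^ p := by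
    rw [residueWeight, decay, if_pos rfl, zero_add]
    exact tail_rpow_le hb hαp ht
  have h3 : ∑ r : Fin (b ^ m), decay b α r ^ p ≤ ∑' l, decay b α l ^ p := by
    rw [Fin.sum_univ_eq_sum_range (fun r => decay b α r ^ p)]
    exact (summable_decay_rpow hb hp hαp).sum_le_tsum _
      fun l _ => Real.rpow_nonneg (decay_nonneg _ _ _) _
  calc _ ≤ ∑ r : Fin (b ^ m), (decay b α r ^ p + ((b : ℝ) ^ m)⁻¹ * (∑' l, decay b α l) ^ p) +
        b ^ m * (((b : ℝ) ^ m)⁻¹ * (∑' l, decay b α l) ^ p) := by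
        gcongr with r _
        exact h1 r
    _ = ∑ r : Fin (b ^ m), decay b α r ^ p + 2 * (∑' l, decay b α l) ^ p := by
        rw [Finset.sum_add_distrib, Finset.sum_const, Finset.card_univ, Fintype.card_fin,
          nsmul_eq_mul]
        push_cast
        field_simp
        ring
    _ ≤ _ := by unfold residueBound; gcongr

section Step

variable {b : ℕ} [Fact b.Prime] {m : ℕ} {P : (ZMod b)[X]} [Fact (Irreducible P)]

theorem truncPoly_mem_genSet (hm : 1 ≤ m) {k : ℕ} (hk : k < b ^ m) (h0 : k ≠ 0) :
    truncPoly b m k ∈ genSet b m :=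
  ⟨truncPoly_ne_zero h0 hk, truncPoly_natDegree_lt hm _ _⟩

open Classical in
/-- For a fixed vector `r` few components put `r` into the dual net. -/
theorem card_dual_le (hm : 1 ≤ m) (hd : P.natDegree = m) (v : Finset ℕ) (d : v)
    (q : ℕ → (ZMod b)[X]) (r : v → Fin (b ^ m)) :
    (((Finset.range (b ^ m)).filter fun k => k ≠ 0 ∧
      P ∣ ∑ j : v, truncPoly b m (r j) * Function.update q d (truncPoly b m k) j).card : ℝ) ≤
      if (r d : ℕ) = 0 then (b : ℝ) ^ m - 1 else 1 := by
  have hb : 0 < b := (Fact.out : b.Prime).pos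
  split_ifs with h
  · have h1 : ((Finset.range (b ^ m)).filter fun k => k ≠ 0 ∧
      P ∣ ∑ j : v, truncPoly b m (r j) * Function.update q d (truncPoly b m k) j).card ≤
        b ^ m - 1 := by
      have h2 : ((Finset.range (b ^ m)).erase 0).card = b ^ m - 1 := by
        rw [Finset.card_erase_of_mem (Finset.mem_range.2 (show 0 < b ^ m by positivity)),
          Finset.card_range]
      rw [← h2]
      apply Finset.card_le_card
      intro k hk
      rw [Finset.mem_filter] at hk
      exact Finset.mem_erase.2 ⟨hk.2.1, hk.1⟩
    calc _ ≤ ((b ^ m - 1 : ℕ) : ℝ) := by exact_mod_cast h1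
      _ = _ := by rw [Nat.cast_sub (Nat.one_le_pow _ _ hb)]; simp
  · have h1 : ((Finset.range (b ^ m)).filter fun k => k ≠ 0 ∧
      P ∣ ∑ j : v, truncPoly b m (r j) * Function.update q d (truncPoly b m k) j).card ≤ 1 := by
      rw [Finset.card_le_one]
      intro k hk k' hk'
      rw [Finset.mem_filter, Finset.mem_range] at hk hk'
      have h2 := dvd_sub hk.2.2 hk'.2.2
      rw [← Finset.sum_sub_distrib, Finset.sum_eq_single d] at h2
      -- `P` divides the word `r d` times the difference of two admissible candidates; being prime,
      -- it divides one of the two factors.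
      · rw [Function.update_self, Function.update_self, ← mul_sub] at h2
        have hPp : Prime P := (Fact.out : Irreducible P).prime
        rcases hPp.dvd_or_dvd h2 with h3 | h3
        · have h4 : wordClass m P (r d) = 0 := AdjoinRoot.mk_eq_zero.2 h3
          exact absurd ((wordClass_eq_zero_iff hm hd (r d).2).1 h4) h
        · exact wordClass_injOn hm hd hk.1 hk'.1 (AdjoinRoot.mk_eq_mk.2 h3)
      · intro j _ hj
        rw [Function.update_of_ne (fun h => hj (Subtype.ext h)),
          Function.update_of_ne (fun h => hj (Subtype.ext h)), sub_self]
      · simp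
    exact_mod_cast h1

omit [Fact (Irreducible P)] in
theorem dualSum_nonneg (α : ℕ) (q : ℕ → (ZMod b)[X]) (v : Finset ℕ) :
    0 ≤ dualSum b m α P q v := tsum_nonneg fun _ => by positivity

/-- The average of the `p`-th power of a dual sum over the last component. -/
theorem sum_dualSum_rpow_le (hm : 1 ≤ m) (hd : P.natDegree = m) {α : ℕ} (hα : 2 ≤ α) {p : ℝ}
    (hp : 0 < p) (hp1 : p ≤ 1) (hαp : 1 < α * p) (q : ℕ → (ZMod b)[X]) (u : Finset ℕ) (d : ℕ) :
    ∑ k ∈ (Finset.range (b ^ m)).filter (· ≠ 0),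
      dualSum b m α P (Function.update q d (truncPoly b m k)) (insert d u) ^ p ≤
      residueBound b α p ^ (insert d u).card := by
  classical
  have hb : 1 < b := (Fact.out : b.Prime).one_lt
  set v := insert d u with hv
  let d' : v := ⟨d, Finset.mem_insert_self _ _⟩
  have hw : ∀ (r : Fin (b ^ m)), 0 ≤ residueWeight b m α r ^ p :=
    fun r => Real.rpow_nonneg (residueWeight_nonneg _ _ _ _) _
  -- The count in `card_dual_le` depends only on the coordinate `d'`, so it is absorbed into the
  -- weight there and the sum over residue vectors remains a product.
  let g : v → Fin (b ^ m) → ℝ := fun j r => residueWeight b m α r ^ p *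
    if j = d' then (if (r : ℕ) = 0 then (b : ℝ) ^ m - 1 else 1) else 1
  have h1 : ∀ k, dualSum b m α P (Function.update q d (truncPoly b m k)) v ^ p ≤
      ∑ r : v → Fin (b ^ m),
      if P ∣ ∑ j : v, truncPoly b m (r j) * Function.update q d (truncPoly b m k) j then
        ∏ j : v, residueWeight b m α (r j) ^ p else 0 := by
    intro k
    rw [dualSum_eq_sum hα]
    refine (rpow_sum_le_sum_rpow _ _ hp hp1 fun r _ => ?_).trans (le_of_eq ?_)
    · split_ifs
      · exact Finset.prod_nonneg fun j _ => residueWeight_nonneg _ _ _ _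
      · exact le_rfl
    · refine Finset.sum_congr rfl fun r _ => ?_
      split_ifs
      · rw [Real.finsetProd_rpow _ _ fun j _ => residueWeight_nonneg _ _ _ _]
      · exact Real.zero_rpow hp.ne'
  have hB1 : ∀ j : v, ∑ r : Fin (b ^ m), g j r ≤ residueBound b α p := by
    intro j
    refine le_trans ?_ (sum_residueWeight_rpow_le (m := m) hb hp hp1 hαp)
    have h0 : 0 ≤ residueWeight b m α 0 ^ p := Real.rpow_nonneg (residueWeight_nonneg _ _ _ _) _
    have hN : (0 : ℝ) < (b : ℝ) ^ m := by have : (0 : ℝ) < b := by positivity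
                                          positivity
    simp only [g]
    split_ifs with hj
    · have hN0 : 0 < b ^ m := by positivity
      have : ∀ r : Fin (b ^ m), residueWeight b m α r ^ p *
          (if (r : ℕ) = 0 then (b : ℝ) ^ m - 1 else 1) ≤ residueWeight b m α r ^ p +
          if r = ⟨0, hN0⟩ then (b : ℝ) ^ m * residueWeight b m α 0 ^ p else 0 := by
        intro r
        by_cases hr : (r : ℕ) = 0
        · rw [if_pos hr, if_pos (Fin.ext hr), hr]
          nlinarith
        · rw [if_neg hr, if_neg (fun h => hr (congrArg Fin.val h))]
          simp
      refine (Finset.sum_le_sum fun r _ => this r).trans ?_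
      rw [Finset.sum_add_distrib, Finset.sum_ite_eq' Finset.univ, if_pos (Finset.mem_univ _)]
    · simp only [mul_one]
      have : 0 ≤ (b : ℝ) ^ m * residueWeight b m α 0 ^ p := by positivity
      linarith
  have hg : ∀ j r, 0 ≤ g j r := by
    intro j r
    have : (1 : ℝ) ≤ (b : ℝ) ^ m := one_le_pow₀ (by exact_mod_cast hb.le)
    refine mul_nonneg (hw r) ?_
    split_ifs <;> linarith
  calc _ ≤ ∑ k ∈ (Finset.range (b ^ m)).filter (· ≠ 0), ∑ r : v → Fin (b ^ m),
      if P ∣ ∑ j : v, truncPoly b m (r j) * Function.update q d (truncPoly b m k) j then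
        ∏ j : v, residueWeight b m α (r j) ^ p else 0 := Finset.sum_le_sum fun k _ => h1 k
    _ = ∑ r : v → Fin (b ^ m), (∏ j : v, residueWeight b m α (r j) ^ p) *
        (((Finset.range (b ^ m)).filter fun k => k ≠ 0 ∧
      P ∣ ∑ j : v, truncPoly b m (r j) * Function.update q d' (truncPoly b m k) j).card : ℝ) := by
        rw [Finset.sum_comm]
        refine Finset.sum_congr rfl fun r _ => ?_
        rw [← Finset.sum_filter, Finset.filter_filter, Finset.sum_const, nsmul_eq_mul, mul_comm]
    _ ≤ ∑ r : v → Fin (b ^ m), ∏ j : v, g j (r j) := by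
        refine Finset.sum_le_sum fun r _ => ?_
        simp only [g]
        rw [Finset.prod_mul_distrib, Finset.prod_ite_eq' Finset.univ d'
          (fun j => if (r j : ℕ) = 0 then (b : ℝ) ^ m - 1 else 1), if_pos (Finset.mem_univ _)]
        exact mul_le_mul_of_nonneg_left (card_dual_le hm hd v d' q r)
          (Finset.prod_nonneg fun j _ => hw _)
    _ = ∏ j : v, ∑ r : Fin (b ^ m), g j r := by
        rw [Finset.prod_univ_sum, Fintype.piFinset_univ]
    _ ≤ ∏ _j : v, residueBound b α p := Finset.prod_le_prod
        (fun j _ => Finset.sum_nonneg fun r _ => hg j r) fun j _ => hB1 j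
    _ = _ := by rw [Finset.prod_const, Finset.card_univ, Fintype.card_coe]

omit [Fact (Irreducible P)] in
theorem stepSum_nonneg {α : ℕ} {β : ℕ → ℝ} (hβ : ∀ j, 0 < β j) (d : ℕ) (q : ℕ → (ZMod b)[X]) :
    0 ≤ stepSum b m α β P d q :=
  Finset.sum_nonneg fun _ _ => mul_nonneg (Finset.prod_nonneg fun j _ =>
    cbcWeight_nonneg (Fact.out : b.Prime).one_lt α hβ j) (dualSum_nonneg _ _ _)

/-- The minimum is at most the value at each of the `b ^ m - 1` candidates. Summing over them, with
the `p`-th power moved inside the sum over sets, reduces the claim to `sum_dualSum_rpow_le`. -/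
theorem stepSum_rpow_le (hm : 1 ≤ m) (hd : P.natDegree = m) {α : ℕ} (hα : 2 ≤ α) {p : ℝ}
    (hp : 0 < p) (hp1 : p ≤ 1) (hαp : 1 < α * p) {β : ℕ → ℝ} (hβ : ∀ j, 0 < β j)
    (q : ℕ → (ZMod b)[X]) (d : ℕ)
    (hmin : ∀ r ∈ genSet b m, stepSum b m α β P d q ≤
      stepSum b m α β P d (Function.update q d r)) :
    ((b : ℝ) ^ m - 1) * stepSum b m α β P d q ^ p ≤
      ∑ u ∈ (Finset.range d).powerset, blockWeight α (fun i => cbcWeight b α β i ^ p) (insert d u) *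
        residueBound b α p ^ (insert d u).card := by
  classical
  have hb : 1 < b := (Fact.out : b.Prime).one_lt
  have hcard : (((Finset.range (b ^ m)).filter (· ≠ 0)).card : ℝ) = (b : ℝ) ^ m - 1 := by
    have : (Finset.range (b ^ m)).filter (· ≠ 0) = (Finset.range (b ^ m)).erase 0 := by
      ext; simp [and_comm]
    rw [this, Finset.card_erase_of_mem (Finset.mem_range.2 (show 0 < b ^ m by positivity)),
      Finset.card_range, Nat.cast_sub (Nat.one_le_pow _ _ (by omega))]
    simp
  have hw := cbcWeight_nonneg hb α hβ
  calc _ = ∑ k ∈ (Finset.range (b ^ m)).filter (· ≠ 0), stepSum b m α β P d q ^ p := by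
        rw [Finset.sum_const, nsmul_eq_mul, hcard]
    _ ≤ ∑ k ∈ (Finset.range (b ^ m)).filter (· ≠ 0), ∑ u ∈ (Finset.range d).powerset,
        blockWeight α (fun i => cbcWeight b α β i ^ p) (insert d u) *
        dualSum b m α P (Function.update q d (truncPoly b m k)) (insert d u) ^ p := by
        refine Finset.sum_le_sum fun k hk => ?_
        rw [Finset.mem_filter, Finset.mem_range] at hk
        refine (Real.rpow_le_rpow (stepSum_nonneg hβ d q)
          (hmin _ (truncPoly_mem_genSet hm hk.1 hk.2)) hp.le).trans ?_
        unfold stepSum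
        refine (rpow_sum_le_sum_rpow _ _ hp hp1 fun u _ => ?_).trans (le_of_eq ?_)
        · exact mul_nonneg (Finset.prod_nonneg fun j _ => hw j) (dualSum_nonneg _ _ _)
        · refine Finset.sum_congr rfl fun u _ => ?_
          have h1 : 0 ≤ blockWeight α (cbcWeight b α β) (insert d u) :=
            Finset.prod_nonneg fun j _ => hw j
          rw [setWeight_eq, Real.mul_rpow h1 (dualSum_nonneg _ _ _)]
          congr 1
          exact (Real.finsetProd_rpow _ _ (fun j _ => hw j) _).symm
    _ = ∑ u ∈ (Finset.range d).powerset,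
        blockWeight α (fun i => cbcWeight b α β i ^ p) (insert d u) *
        ∑ k ∈ (Finset.range (b ^ m)).filter (· ≠ 0),
        dualSum b m α P (Function.update q d (truncPoly b m k)) (insert d u) ^ p := by
        rw [Finset.sum_comm]
        simp_rw [Finset.mul_sum]
    _ ≤ _ := by
        refine Finset.sum_le_sum fun u _ => mul_le_mul_of_nonneg_left ?_
          (Finset.prod_nonneg fun j _ => Real.rpow_nonneg (hw j) _)
        exact sum_dualSum_rpow_le hm hd hα hp hp1 hαp q u d

omit [Fact (Irreducible P)] in
theorem criterion_nonneg {α : ℕ} {β : ℕ → ℝ} (hβ : ∀ j, 0 < β j) (d : ℕ) (q : ℕ → (ZMod b)[X]) :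
    0 ≤ criterion b m α β P d q :=
  Finset.sum_nonneg fun _ _ => mul_nonneg (Finset.prod_nonneg fun j _ =>
    cbcWeight_nonneg (Fact.out : b.Prime).one_lt α hβ j) (tsum_nonneg fun _ => by positivity)

/-- Components are added one at a time. The bound for step `d` runs over the sets with largest
element `d`, and subadditivity of the `p`-th power lets these bounds add up to the sum over all
subsets. -/
theorem criterion_rpow_le (hm : 1 ≤ m) (hd : P.natDegree = m) {α : ℕ} (hα : 2 ≤ α) {p : ℝ}
    (hp : 0 < p) (hp1 : p ≤ 1) (hαp : 1 < α * p) {β : ℕ → ℝ} (hβ : ∀ j, 0 < β j)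
    (q : ℕ → (ZMod b)[X]) (D : ℕ) (hq : IsCBC b m α β P D q) (d : ℕ) (hdD : d ≤ D) :
    ((b : ℝ) ^ m - 1) * criterion b m α β P d q ^ p ≤
      ∑ v ∈ (Finset.range d).powerset, blockWeight α (fun i => cbcWeight b α β i ^ p) v *
        ∏ _k ∈ v, residueBound b α p := by
  have hb : 1 < b := (Fact.out : b.Prime).one_lt
  have hN : (0 : ℝ) ≤ (b : ℝ) ^ m - 1 := by
    have : (1 : ℝ) ≤ (b : ℝ) ^ m := one_le_pow₀ (by exact_mod_cast hb.le)
    linarith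
  induction d with
  | zero =>
    rw [criterion_zero, Real.zero_rpow hp.ne', mul_zero]
    simp [blockWeight]
  | succ d ih =>
    rw [sum_powerset_range_succ, criterion_succ]
    have h1 := Real.rpow_add_le_add_rpow (criterion_nonneg (m := m) (P := P) (α := α) hβ d q)
      (stepSum_nonneg (m := m) (P := P) (α := α) hβ d q) hp.le hp1
    have h2 := stepSum_rpow_le hm hd hα hp hp1 hαp hβ q d
      (fun r hr => criterion_update_le_iff.1 (hq.minimal d (by omega) r hr))
    have h3 := ih (by omega)
    have h4 := mul_le_mul_of_nonneg_left h1 hN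
    simp_rw [← Finset.prod_const] at h2
    linarith

end Step

theorem coordWeight_le {α : ℕ} {x M : ℝ} (hx : 0 ≤ x) (hxM : x ≤ M) :
    coordWeight α x ≤ x * ∑ ν ∈ Finset.Icc 1 α, (ν.factorial : ℝ) * 2 * M ^ (ν - 1) := by
  unfold coordWeight
  rw [Finset.mul_sum]
  refine Finset.sum_le_sum fun ν hν => ?_
  rw [Finset.mem_Icc] at hν
  have h : x ^ ν ≤ x * M ^ (ν - 1) := by
    conv_lhs => rw [show ν = (ν - 1) + 1 by omega, pow_succ']
    gcongr
  calc (ν.factorial : ℝ) * (if ν = α then 2 else 1) * x ^ ν ≤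
      (ν.factorial : ℝ) * 2 * (x * M ^ (ν - 1)) := by
        gcongr
        split_ifs <;> norm_num
    _ = _ := by ring

/-- Summability of the `p`-th powers makes `β` bounded, and on a bounded range `coordWeight` is at
most a multiple of its argument. -/
theorem summable_cbcWeight_rpow {b : ℕ} (hb : 1 < b) (α : ℕ) {p : ℝ} (hp : 0 < p) {β : ℕ → ℝ}
    (hβ : ∀ j, 0 < β j) (hs : Summable fun j => β j ^ p) :
    Summable fun j => cbcWeight b α β j ^ p := by
  obtain ⟨M, hM⟩ : ∃ M, ∀ j, β j ≤ M := by
    refine ⟨(∑' j, β j ^ p) ^ (1 / p), fun j => ?_⟩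
    have h1 := hs.le_tsum j fun i _ => Real.rpow_nonneg (hβ i).le _
    have h2 := Real.rpow_le_rpow (Real.rpow_nonneg (hβ j).le _) h1 (by positivity : 0 ≤ 1 / p)
    rwa [← Real.rpow_mul (hβ j).le, mul_one_div_cancel hp.ne', Real.rpow_one] at h2
  have hM0 : 0 ≤ M := (hβ 0).le.trans (hM 0)
  have hw := (walshConst_pos (α := α) hb).le
  set c := walshConst α b * (b : ℝ) ^ (α * (α - 1) / 2) *
    ∑ ν ∈ Finset.Icc 1 α, (ν.factorial : ℝ) * 2 * M ^ (ν - 1) with hc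
  have hc0 : 0 ≤ c := by positivity
  refine Summable.of_nonneg_of_le (fun j => Real.rpow_nonneg (cbcWeight_nonneg hb α hβ j) _)
    (fun j => ?_) (hs.mul_left (c ^ p))
  rw [← Real.mul_rpow hc0 (hβ j).le]
  refine Real.rpow_le_rpow (cbcWeight_nonneg hb α hβ j) ?_ hp.le
  unfold cbcWeight
  calc _ ≤ walshConst α b * (b : ℝ) ^ (α * (α - 1) / 2) * (β j *
      ∑ ν ∈ Finset.Icc 1 α, (ν.factorial : ℝ) * 2 * M ^ (ν - 1)) := by
        gcongr
        exact coordWeight_le (hβ j).le (hM j)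
    _ = _ := by rw [hc]; ring

/-- Each factor is at most the exponential of `(1 + B) ^ α * w i`. The bound is uniform in the
number of blocks and asks only for convergence of `∑ w`. -/
theorem fullProd_const_le {α : ℕ} {w : ℕ → ℝ} {B : ℝ} (hw : ∀ j, 0 ≤ w j) (hB : 0 ≤ B)
    (hs : Summable w) (s : ℕ) :
    fullProd α w (fun _ => B) s ≤ Real.exp ((1 + B) ^ α * ∑' j, w j) := by
  unfold fullProd
  simp only [Finset.prod_const, Finset.card_range]
  have h1 : (1 : ℝ) ≤ (1 + B) ^ α := one_le_pow₀ (by linarith)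
  calc _ ≤ ∏ i ∈ Finset.range s, Real.exp ((1 + B) ^ α * w i) := by
        refine Finset.prod_le_prod (fun i _ => ?_) fun i _ => ?_
        · have := mul_nonneg (hw i) (sub_nonneg.2 h1); linarith
        · have := Real.add_one_le_exp ((1 + B) ^ α * w i)
          have := hw i
          nlinarith
    _ = Real.exp ((1 + B) ^ α * ∑ i ∈ Finset.range s, w i) := by
        rw [← Real.exp_sum, Finset.mul_sum]
    _ ≤ _ := by
        gcongr
        exact hs.sum_le_tsum _ fun i _ => hw i

theorem exists_criterion_bound (b : ℕ) [Fact b.Prime] (p : ℝ) (β : ℕ → ℝ) (hp : 0 < p)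
    (hp1 : p ≤ 1) (hβ : ∀ j, 0 < β j) (hs : Summable fun j => β j ^ p) {α : ℕ} (hα : 2 ≤ α)
    (hαp : 1 < α * p) :
    ∃ C : ℝ, 0 < C ∧ ∀ (s m : ℕ) (P : (ZMod b)[X]) (q : ℕ → (ZMod b)[X]), 1 ≤ m →
      Irreducible P → P.natDegree = m → IsCBC b m α β P (α * s) q →
      criterion b m α β P (α * s) q ≤ C * ((b : ℝ) ^ m) ^ (-(1 / p)) := by
  have hb : 1 < b := (Fact.out : b.Prime).one_lt
  set B := residueBound b α p with hBdef
  have hB : 0 ≤ B := residueBound_nonneg b α p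
  -- The factor `2` pays for replacing `b ^ m - 1` by `b ^ m`, which is at least `2`.
  set A := 2 * Real.exp ((1 + B) ^ α * ∑' j, cbcWeight b α β j ^ p) with hA
  have hA0 : 0 < A := by positivity
  refine ⟨A ^ (1 / p), by positivity, fun s m P q hm hirr hd hq => ?_⟩
  have : Fact (Irreducible P) := ⟨hirr⟩
  have h1 := criterion_rpow_le hm hd hα hp hp1 hαp hβ q (α * s) hq (α * s) le_rfl
  rw [sum_blockWeight] at h1
  have h2 := fullProd_const_le (α := α) (fun j => Real.rpow_nonneg (cbcWeight_nonneg hb α hβ j) p)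
    hB (summable_cbcWeight_rpow hb α hp hβ hs) s
  have hE := criterion_nonneg (m := m) (P := P) (α := α) hβ (α * s) q
  have hEp := Real.rpow_nonneg hE p
  have hN2 : (2 : ℝ) ≤ (b : ℝ) ^ m := by
    calc (2 : ℝ) ≤ b := by exact_mod_cast hb
      _ = (b : ℝ) ^ 1 := (pow_one _).symm
      _ ≤ (b : ℝ) ^ m := pow_le_pow_right₀ (by exact_mod_cast hb.le) hm
  have h3 : criterion b m α β P (α * s) q ^ p ≤ A * ((b : ℝ) ^ m)⁻¹ := by
    rw [← div_eq_mul_inv, le_div_iff₀ (by linarith)]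
    have h4 := h1.trans h2
    rw [hA]
    nlinarith
  have h5 := Real.rpow_le_rpow hEp h3 (by positivity : 0 ≤ 1 / p)
  rw [← Real.rpow_mul hE, mul_one_div_cancel hp.ne', Real.rpow_one,
    Real.mul_rpow hA0.le (by positivity), Real.inv_rpow (by positivity)] at h5
  rwa [Real.rpow_neg (by positivity)]

end QMC
end

noncomputable section
namespace QMC

/-! ### Decay of discrete Walsh coefficients in one variable -/

/-- The mean value inequality for `f t - c * t`. Keeping the linear part separate allows it to
cancel in the digit averages. -/
theorem norm_sub_sub_le_of_hasDerivWithinAt {f f' : ℝ → ℂ} {c : ℂ} {R : ℝ}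
    (hf : ∀ t ∈ Set.Icc (0 : ℝ) 1, HasDerivWithinAt f (f' t) (Set.Icc 0 1) t)
    (hR : ∀ t ∈ Set.Icc (0 : ℝ) 1, ‖f' t - c‖ ≤ R) {x y : ℝ} (hx : x ∈ Set.Icc (0 : ℝ) 1)
    (hy : y ∈ Set.Icc (0 : ℝ) 1) : ‖f x - f y - c * ((x : ℂ) - y)‖ ≤ R * |x - y| := by
  have h1 : ∀ t ∈ Set.Icc (0 : ℝ) 1,
      HasDerivWithinAt (fun t : ℝ => f t - c * (t : ℂ)) (f' t - c) (Set.Icc 0 1) t := by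
    intro t ht
    have := (Complex.ofRealCLM.hasDerivAt (x := t)).hasDerivWithinAt (s := Set.Icc 0 1)
    have h2 := (hf t ht).fun_sub (this.const_mul c)
    exact h2.congr_deriv (by simp)
  have := (convex_Icc (0 : ℝ) 1).norm_image_sub_le_of_norm_hasDerivWithin_le h1 hR hy hx
  rw [Real.norm_eq_abs] at this
  rwa [show f x - f y - c * ((x : ℂ) - y) = f x - c * x - (f y - c * y) by ring]

section Walsh

variable {b : ℕ} [Fact b.Prime]

theorem stdAddChar_pow (a : ZMod b) (n : ℕ) :
    ZMod.stdAddChar (a * (n : ZMod b)) = (ZMod.stdAddChar a : ℂ) ^ n := by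
  rw [← AddChar.map_nsmul_eq_pow, nsmul_eq_mul, mul_comm]

theorem stdAddChar_pow_card (a : ZMod b) : (ZMod.stdAddChar a : ℂ) ^ b = 1 := by
  rw [← stdAddChar_pow]
  simp

theorem stdAddChar_ne_one {a : ZMod b} (ha : a ≠ 0) : (ZMod.stdAddChar a : ℂ) ≠ 1 := fun h =>
  ha (ZMod.injective_stdAddChar (h.trans (AddChar.map_zero_eq_one _).symm))

theorem stdAddChar_norm (a : ZMod b) : ‖(ZMod.stdAddChar a : ℂ)‖ = 1 := AddChar.norm_apply _ _

/-- The norm is `2 sin (π k / b)` with `1 ≤ k ≤ b - 1`, and the sine is smallest at both ends of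
this range. -/
theorem sin_le_norm_one_sub_stdAddChar {a : ZMod b} (ha : a ≠ 0) :
    2 * Real.sin (Real.pi / b) ≤ ‖1 - (ZMod.stdAddChar a : ℂ)‖ := by
  have hb : 1 < b := (Fact.out : b.Prime).one_lt
  have hb0 : (0 : ℝ) < b := by positivity
  have h1 : (ZMod.stdAddChar a : ℂ) = Complex.exp (Complex.I * ((2 * Real.pi * a.val / b : ℝ) : ℂ)) := by
    conv_lhs => rw [← ZMod.natCast_zmod_val a]
    have := ZMod.stdAddChar_coe (N := b) (a.val : ℤ)
    push_cast at this
    rw [this]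
    congr 1
    push_cast
    ring
  have hv : 0 < a.val := Nat.pos_of_ne_zero fun h => ha ((ZMod.val_eq_zero a).1 h)
  have hv' : a.val < b := ZMod.val_lt a
  rw [norm_sub_rev, h1, Complex.norm_exp_I_mul_ofReal_sub_one, Real.norm_eq_abs]
  refine le_trans ?_ (le_abs_self _)
  have h2 : 2 * Real.pi * a.val / b / 2 = Real.pi * (a.val / b) := by ring
  rw [h2]
  have h3 : (1 : ℝ) / b ≤ a.val / b := by gcongr; exact_mod_cast hv
  have h4 : (a.val : ℝ) / b ≤ 1 - 1 / b := by
    rw [le_sub_iff_add_le, ← add_div, div_le_one hb0]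
    exact_mod_cast hv'
  have hpi := Real.pi_pos
  have h5 : (0 : ℝ) < 1 / b := by positivity
  gcongr 2 * ?_
  rcases le_total ((a.val : ℝ) / b) (1 / 2) with h | h
  · apply Real.sin_le_sin_of_le_of_le_pi_div_two
    · have : 0 < Real.pi / b := by positivity
      linarith
    · nlinarith
    · calc Real.pi / b = Real.pi * (1 / b) := by ring
        _ ≤ _ := by gcongr
  · rw [← Real.sin_pi_sub (Real.pi * _)]
    apply Real.sin_le_sin_of_le_of_le_pi_div_two
    · have : 0 < Real.pi / b := by positivity
      linarith
    · nlinarith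
    · calc Real.pi / b = Real.pi * (1 / b) := by ring
        _ ≤ Real.pi * (1 - a.val / b) := by gcongr; linarith
        _ = _ := by ring

/-- The average of `h` over the digit in first position, weighted with a character. -/
def digitAverage (a : ZMod b) (h : ℝ → ℂ) (u : ℝ) : ℂ :=
  (1 / (b : ℂ)) * ∑ n ∈ Finset.range b, ZMod.stdAddChar (a * (n : ZMod b)) * h ((n + u) / b)

/-- The discrete Walsh coefficient at resolution `b^{-M}` with digits `κ`. -/
def walshCoeff : (M : ℕ) → (Fin M → ZMod b) → (ℝ → ℂ) → ℂ
  | 0, _, h => h 0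
  | M + 1, κ, h => walshCoeff M (Fin.tail κ) (digitAverage (κ 0) h)

/-- The number of derivatives used for the digits `κ`. -/
def walshOrder (α : ℕ) : (M : ℕ) → (Fin M → ZMod b) → ℕ
  | 0, _ => 0
  | M + 1, κ => min α (walshOrder α M (Fin.tail κ) + if κ 0 ≠ 0 then 1 else 0)

/-- The sum of the positions of the `α` leading nonzero digits of `κ`. -/
def walshExp (α : ℕ) : (M : ℕ) → (Fin M → ZMod b) → ℕ
  | 0, _ => 0
  | M + 1, κ => walshExp α M (Fin.tail κ) + walshOrder α (M + 1) κ

theorem walshOrder_le (α M : ℕ) (κ : Fin M → ZMod b) : walshOrder α M κ ≤ α := by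
  cases M with
  | zero => exact Nat.zero_le _
  | succ M => exact min_le_left _ _

theorem mem_cell {n : ℕ} (hn : n < b) {u : ℝ} (hu : u ∈ Set.Icc (0 : ℝ) 1) :
    (n + u) / (b : ℝ) ∈ Set.Icc (0 : ℝ) 1 := by
  have hb0 : (0 : ℝ) < b := by have := (Fact.out : b.Prime).pos; positivity
  have h1 : (n : ℝ) + 1 ≤ b := by exact_mod_cast hn
  have hn0 : (0 : ℝ) ≤ n := by positivity
  exact ⟨div_nonneg (add_nonneg hn0 hu.1) hb0.le, (div_le_one hb0).2 (by linarith [hu.2])⟩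

theorem sum_stdAddChar_range (a : ZMod b) :
    ∑ n ∈ Finset.range b, (ZMod.stdAddChar (a * (n : ZMod b)) : ℂ) = if a = 0 then (b : ℂ) else 0 := by
  simp_rw [stdAddChar_pow]
  split_ifs with h
  · subst h; simp
  · have := geom_sum_mul (ZMod.stdAddChar a : ℂ) b
    rw [stdAddChar_pow_card, sub_self] at this
    exact (mul_eq_zero.1 this).resolve_right (sub_ne_zero.2 (stdAddChar_ne_one h))

theorem digitAverage_sub_const (a : ZMod b) (h : ℝ → ℂ) (c : ℂ) (u : ℝ) :
    digitAverage a (fun t => h t - c) u = digitAverage a h u - if a = 0 then c else 0 := by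
  have hb0 : (b : ℂ) ≠ 0 := by exact_mod_cast (Fact.out : b.Prime).ne_zero
  unfold digitAverage
  simp_rw [mul_sub, Finset.sum_sub_distrib, ← Finset.sum_mul, sum_stdAddChar_range]
  split_ifs
  · field_simp
  · simp

theorem norm_digitAverage_le (a : ZMod b) {h : ℝ → ℂ} {R : ℝ}
    (hR : ∀ t ∈ Set.Icc (0 : ℝ) 1, ‖h t‖ ≤ R) {u : ℝ} (hu : u ∈ Set.Icc (0 : ℝ) 1) :
    ‖digitAverage a h u‖ ≤ R := by
  have hb0 : (0 : ℝ) < b := by have := (Fact.out : b.Prime).pos; positivity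
  unfold digitAverage
  rw [norm_mul, norm_div, norm_one, Complex.norm_natCast, one_div, inv_mul_le_iff₀ hb0]
  refine (norm_sum_le _ _).trans ?_
  calc _ ≤ ∑ _n ∈ Finset.range b, R := by
        refine Finset.sum_le_sum fun n hn => ?_
        rw [norm_mul, stdAddChar_norm, one_mul]
        exact hR _ (mem_cell (Finset.mem_range.1 hn) hu)
    _ = _ := by simp

/-- `h 0, …, h α` are successive derivatives on the unit interval. -/
def IsDerivFamily (α : ℕ) (h : ℕ → ℝ → ℂ) : Prop :=
  ∀ i < α, ∀ t ∈ Set.Icc (0 : ℝ) 1, HasDerivWithinAt (h i) (h (i + 1) t) (Set.Icc 0 1) t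

/-- The derivatives of a digit average. -/
def averageFamily (a : ZMod b) (h : ℕ → ℝ → ℂ) (i : ℕ) (u : ℝ) : ℂ :=
  ((b : ℂ) ^ i)⁻¹ * digitAverage a (h i) u

theorem averageFamily_zero (a : ZMod b) (h : ℕ → ℝ → ℂ) :
    averageFamily a h 0 = digitAverage a (h 0) := by
  ext u; simp [averageFamily]

/-- The substitution `u ↦ (n + u) / b` yields a factor `1 / b` per derivative; this is the source of
the powers of `b` in the decay. -/
theorem IsDerivFamily.average {α : ℕ} {h : ℕ → ℝ → ℂ} (hh : IsDerivFamily α h) (a : ZMod b) :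
    IsDerivFamily α (averageFamily a h) := by
  intro i hi t ht
  have hb0 : (b : ℂ) ≠ 0 := by exact_mod_cast (Fact.out : b.Prime).ne_zero
  have hbr : (b : ℝ) ≠ 0 := by exact_mod_cast (Fact.out : b.Prime).ne_zero
  have h1 : HasDerivWithinAt (digitAverage a (h i)) ((b : ℂ)⁻¹ * digitAverage a (h (i + 1)) t)
      (Set.Icc 0 1) t := by
    unfold digitAverage
    rw [mul_left_comm, Finset.mul_sum]
    refine HasDerivWithinAt.const_mul _ (HasDerivWithinAt.fun_sum fun n hn => ?_)
    rw [mul_left_comm]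
    refine HasDerivWithinAt.const_mul _ ?_
    have h2 : HasDerivWithinAt (fun u : ℝ => (n + u) / (b : ℝ)) (1 / (b : ℝ)) (Set.Icc 0 1) t :=
      (((hasDerivAt_id t).const_add (n : ℝ)).div_const (b : ℝ)).hasDerivWithinAt
    have h3 := (hh i hi _ (mem_cell (Finset.mem_range.1 hn) ht)).scomp t h2
      (fun u hu => mem_cell (Finset.mem_range.1 hn) hu)
    refine h3.congr_deriv ?_
    rw [Complex.real_smul]
    push_cast
    ring
  have := h1.const_mul (((b : ℂ) ^ i)⁻¹)
  refine this.congr_deriv ?_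
  rw [averageFamily, pow_succ, mul_inv]
  ring

/-- Summation by parts. -/
theorem one_sub_mul_sum_pow (ω : ℂ) (g : ℕ → ℂ) (N : ℕ) :
    (1 - ω) * ∑ n ∈ Finset.range (N + 1), ω ^ n * g n =
      g 0 - ω ^ (N + 1) * g N + ∑ n ∈ Finset.range N, ω ^ (n + 1) * (g (n + 1) - g n) := by
  induction N with
  | zero => simp; ring
  | succ N ih => rw [Finset.sum_range_succ, mul_add, ih, Finset.sum_range_succ]; ring

/-- Summation by parts produces increments of `f`, which the two boundary pieces complete to the
whole interval. Each increment is `c` times its length up to an error of `R` times its length. The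
linear parts cancel because the powers `ω, …, ω ^ (b - 1)` add up to `-1`, and the lengths add up to
one. -/
theorem norm_digitAverage_add_le {a : ZMod b} (ha : a ≠ 0) {f f' : ℝ → ℂ} {c : ℂ} {R : ℝ}
    (hf : ∀ t ∈ Set.Icc (0 : ℝ) 1, HasDerivWithinAt f (f' t) (Set.Icc 0 1) t)
    (hR : ∀ t ∈ Set.Icc (0 : ℝ) 1, ‖f' t - c‖ ≤ R) {u : ℝ} (hu : u ∈ Set.Icc (0 : ℝ) 1) :
    ‖digitAverage a f u - (-(1 / (b : ℂ)) * (f 1 - f 0) / (1 - ZMod.stdAddChar a))‖ ≤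
      R / (b * ‖1 - (ZMod.stdAddChar a : ℂ)‖) := by
  have hb : 1 < b := (Fact.out : b.Prime).one_lt
  have hb0 : (0 : ℝ) < b := by positivity
  have hbc : (b : ℂ) ≠ 0 := by exact_mod_cast hb0.ne'
  set ω : ℂ := ZMod.stdAddChar a with hω
  have hω1 : (1 - ω) ≠ 0 := sub_ne_zero.2 (stdAddChar_ne_one ha).symm
  have hωn : ‖ω‖ = 1 := stdAddChar_norm a
  obtain ⟨N, hN⟩ : ∃ N, b = N + 1 := ⟨b - 1, by omega⟩
  have hωb : ω ^ (N + 1) = 1 := by rw [← hN]; exact stdAddChar_pow_card a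
  set g : ℕ → ℂ := fun n => f ((n + u) / b) with hg
  have hgeom : ∑ n ∈ Finset.range N, ω ^ (n + 1) = -1 := by
    have := sum_stdAddChar_range a
    simp_rw [stdAddChar_pow, if_neg ha] at this
    rw [congrArg Finset.range hN, Finset.sum_range_succ', pow_zero] at this
    linear_combination this
  have hkey : (b : ℂ) * (1 - ω) *
      (digitAverage a f u - (-(1 / (b : ℂ)) * (f 1 - f 0) / (1 - ω))) =
      (g 0 - f 0 - c * (((((0 : ℕ) : ℝ) + u) / b : ℝ) - (0 : ℝ))) +
      (f 1 - g N - c * ((1 : ℝ) - ((N + u) / b : ℝ))) +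
      ∑ n ∈ Finset.range N, ω ^ (n + 1) * (g (n + 1) - g n -
        c * (((((n + 1 : ℕ) : ℝ) + u) / b : ℝ) - ((n + u) / b : ℝ))) := by
    have h1 := one_sub_mul_sum_pow ω g N
    rw [hωb] at h1
    have h2 : digitAverage a f u = (1 / (b : ℂ)) * ∑ n ∈ Finset.range (N + 1), ω ^ n * g n := by
      unfold digitAverage
      simp_rw [stdAddChar_pow]
      rw [← congrArg Finset.range hN]
    have h3 : ∀ n : ℕ, c * (((((n + 1 : ℕ) : ℝ) + u) / b : ℝ) - (((n + u) / b : ℝ) : ℂ)) = c / b := by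
      intro n
      push_cast
      field_simp
      ring
    simp_rw [h3, mul_sub (ω ^ _) (_ - _), Finset.sum_sub_distrib, ← Finset.sum_mul, hgeom]
    have h4 : (N : ℂ) = b - 1 := by rw [hN]; push_cast; ring
    have h5 : (b : ℂ) * (1 - ω) *
      (digitAverage a f u - (-(1 / (b : ℂ)) * (f 1 - f 0) / (1 - ω))) =
      (1 - ω) * ∑ n ∈ Finset.range (N + 1), ω ^ n * g n + (f 1 - f 0) := by
      rw [h2]; field_simp; ring
    rw [h5, h1]
    push_cast
    rw [h4]
    field_simp
    ring
  have h0 : ‖(b : ℂ) * (1 - ω) *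
      (digitAverage a f u - (-(1 / (b : ℂ)) * (f 1 - f 0) / (1 - ω)))‖ ≤ R := by
    have hz : (0 : ℝ) ∈ Set.Icc (0 : ℝ) 1 := by simp
    have ho : (1 : ℝ) ∈ Set.Icc (0 : ℝ) 1 := by simp
    have e1 := norm_sub_sub_le_of_hasDerivWithinAt hf hR (mem_cell (b := b) (n := 0) (by omega) hu) hz
    have e2 := norm_sub_sub_le_of_hasDerivWithinAt hf hR ho (mem_cell (b := b) (n := N) (by omega) hu)
    have e3 : ∀ n ∈ Finset.range N, ‖ω ^ (n + 1) * (g (n + 1) - g n -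
        c * (((((n + 1 : ℕ) : ℝ) + u) / b : ℝ) - ((n + u) / b : ℝ)))‖ ≤ R * (1 / b) := by
      intro n hn
      rw [Finset.mem_range] at hn
      have := norm_sub_sub_le_of_hasDerivWithinAt hf hR (mem_cell (b := b) (n := n + 1) (by omega) hu)
        (mem_cell (b := b) (n := n) (by omega) hu)
      rw [norm_mul, norm_pow, hωn, one_pow, one_mul]
      refine this.trans (le_of_eq ?_)
      congr 1
      rw [← sub_div]
      push_cast
      rw [show (n : ℝ) + 1 + u - (n + u) = 1 by ring, abs_of_nonneg (by positivity)]
    rw [hkey]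
    refine (norm_add₃_le).trans ?_
    have e4 := (norm_sum_le _ _).trans (Finset.sum_le_sum e3)
    have hu0 := hu.1
    have hu1 := hu.2
    have hNr : (N : ℝ) = b - 1 := by rw [hN]; push_cast; ring
    rw [abs_of_nonneg (by simpa using div_nonneg hu0 hb0.le)] at e1
    rw [abs_of_nonneg (by
      rw [sub_nonneg, div_le_one hb0, hNr]; linarith)] at e2
    refine (add_le_add (add_le_add e1 e2) e4).trans (le_of_eq ?_)
    rw [Finset.sum_const, Finset.card_range, nsmul_eq_mul, hNr, Nat.cast_zero]
    field_simp
    ring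
  rw [norm_mul, norm_mul, Complex.norm_natCast] at h0
  rw [le_div_iff₀ (mul_pos hb0 (norm_pos_iff.2 hω1)), mul_comm]
  exact h0

/-- The growth of the oscillation of the iterated kernels. -/
def oscBound (b : ℕ) : ℕ → ℝ
  | 0 => 0
  | ν + 1 => 1 + Real.sin (Real.pi / b) * oscBound b ν

/-- Without nonzero digits the coefficient is an iterated plain average. -/
theorem walshCoeff_of_walshOrder_eq_zero {α : ℕ} (hα : 1 ≤ α) (M : ℕ) (κ : Fin M → ZMod b)
    (h0 : walshOrder α M κ = 0) {h : ℝ → ℂ} {c : ℂ} {R : ℝ}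
    (hR : ∀ t ∈ Set.Icc (0 : ℝ) 1, ‖h t - c‖ ≤ R) : ‖walshCoeff M κ h - c‖ ≤ R := by
  induction M generalizing h with
  | zero => exact hR 0 (by simp)
  | succ M ih =>
    have h1 : κ 0 = 0 := by
      by_contra h
      simp [walshOrder, h] at h0
      omega
    have h2 : walshOrder α M (Fin.tail κ) = 0 := by
      simp [walshOrder, h1] at h0
      omega
    refine ih (Fin.tail κ) h2 fun t ht => ?_
    have := norm_digitAverage_le (κ 0) hR ht
    rwa [digitAverage_sub_const, if_pos h1] at this

theorem walshExp_of_walshOrder_eq_zero {α : ℕ} (hα : 1 ≤ α) (M : ℕ) (κ : Fin M → ZMod b)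
    (h0 : walshOrder α M κ = 0) : walshExp α M κ = 0 := by
  induction M with
  | zero => rfl
  | succ M ih =>
    rw [walshExp, h0, ih]
    simp [walshOrder] at h0
    omega

/-- The number of nonzero digits. -/
def digitCount : (M : ℕ) → (Fin M → ZMod b) → ℕ
  | 0, _ => 0
  | M + 1, κ => digitCount M (Fin.tail κ) + if κ 0 ≠ 0 then 1 else 0

theorem walshOrder_eq_min (α M : ℕ) (κ : Fin M → ZMod b) :
    walshOrder α M κ = min α (digitCount M κ) := by
  induction M with
  | zero => simp [walshOrder, digitCount]
  | succ M ih => rw [walshOrder, digitCount, ih]; omega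

/-- Induction on the digits, for a statement finer than a bound: the coefficient is a multiple of a
boundary difference plus a remainder controlled by the oscillation of the next derivative about any
constant `c`. The freedom in `c` gains a factor `1 / 2` at each further nonzero digit, which leads
to the recursion of `oscBound`. -/
theorem walshCoeff_main {α : ℕ} (hα : 1 ≤ α) (M : ℕ) (κ : Fin M → ZMod b) (ν : ℕ)
    (hν : digitCount M κ = ν + 1) (hνα : ν + 1 ≤ α) :
    ∃ c₀ : ℂ, ‖c₀‖ ≤ ((2 * Real.sin (Real.pi / b)) ^ (ν + 1) * (b : ℝ) ^ walshExp α M κ)⁻¹ ∧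
      ∀ (h : ℕ → ℝ → ℂ) (c : ℂ) (R : ℝ), IsDerivFamily α h →
        (∀ t ∈ Set.Icc (0 : ℝ) 1, ‖h (ν + 1) t - c‖ ≤ R) →
        ‖walshCoeff M κ (h 0) - c₀ * (h ν 1 - h ν 0)‖ ≤
          oscBound b (ν + 1) *
            ((2 * Real.sin (Real.pi / b)) ^ (ν + 1) * (b : ℝ) ^ walshExp α M κ)⁻¹ * R := by
  have hb : 1 < b := (Fact.out : b.Prime).one_lt
  have hb0 : (0 : ℝ) < b := by positivity
  have hbc : (b : ℂ) ≠ 0 := by exact_mod_cast hb0.ne'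
  have hs := sin_pi_div_pos hb
  have hz : (0 : ℝ) ∈ Set.Icc (0 : ℝ) 1 := by simp
  have ho : (1 : ℝ) ∈ Set.Icc (0 : ℝ) 1 := by simp
  induction M generalizing ν with
  | zero => simp [digitCount] at hν
  | succ M ih =>
    by_cases ha : κ 0 = 0
    · have hν' : digitCount M (Fin.tail κ) = ν + 1 := by simpa [digitCount, ha] using hν
      obtain ⟨c₀, hc₀, H⟩ := ih (Fin.tail κ) ν hν' hνα
      have he : walshExp α (M + 1) κ = walshExp α M (Fin.tail κ) + (ν + 1) := by
        rw [walshExp, walshOrder_eq_min, hν, min_eq_right hνα]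
      refine ⟨c₀ * ((b : ℂ) ^ (ν + 1))⁻¹, ?_, fun h c R hh hR => ?_⟩
      · rw [norm_mul, norm_inv, norm_pow, Complex.norm_natCast, he,
          pow_add (b : ℝ) (walshExp α M (Fin.tail κ)), ← mul_assoc, mul_inv _ ((b : ℝ) ^ (ν + 1))]
        gcongr
      · have h1 := H (averageFamily (κ 0) h) (((b : ℂ) ^ (ν + 1))⁻¹ * c)
          (((b : ℝ) ^ (ν + 1))⁻¹ * R) (hh.average _) (fun t ht => by
            have := norm_digitAverage_le (κ 0) hR ht
            rw [digitAverage_sub_const, if_pos ha] at this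
            rw [averageFamily, ← mul_sub, norm_mul, norm_inv, norm_pow, Complex.norm_natCast]
            gcongr)
        -- For a zero digit the differences over the cells telescope, so the main term is reproduced
        -- exactly.
        have h2 : averageFamily (κ 0) h ν 1 - averageFamily (κ 0) h ν 0 =
            ((b : ℂ) ^ (ν + 1))⁻¹ * (h ν 1 - h ν 0) := by
          unfold averageFamily digitAverage
          rw [← mul_sub, ← mul_sub, ← Finset.sum_sub_distrib, ha]
          have : ∀ n ∈ Finset.range b, (ZMod.stdAddChar ((0 : ZMod b) * (n : ZMod b)) : ℂ) *
              h ν ((n + 1) / b) - ZMod.stdAddChar ((0 : ZMod b) * (n : ZMod b)) * h ν ((n + 0) / b) =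
              h ν (((n + 1 : ℕ) : ℝ) / b) - h ν ((n : ℝ) / b) := by
            intro n _
            simp
          rw [Finset.sum_congr rfl this, Finset.sum_range_sub (fun n : ℕ => h ν ((n : ℝ) / b)),
            pow_succ, mul_inv, div_self hb0.ne']
          simp
          ring
        rw [h2, averageFamily_zero] at h1
        rw [walshCoeff]
        refine (le_of_eq ?_).trans (h1.trans (le_of_eq ?_))
        · congr 2; ring
        · rw [he, pow_add (b : ℝ) (walshExp α M (Fin.tail κ))]
          simp only [mul_inv]
          ring
    · set ω : ℂ := ZMod.stdAddChar (κ 0) with hω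
      have hω1 : (1 - ω) ≠ 0 := sub_ne_zero.2 (stdAddChar_ne_one ha).symm
      have hωm := sin_le_norm_one_sub_stdAddChar ha
      rw [← hω] at hωm
      have hωp : 0 < ‖1 - ω‖ := norm_pos_iff.2 hω1
      have hν' : digitCount M (Fin.tail κ) = ν := by simpa [digitCount, ha] using hν
      have he : walshExp α (M + 1) κ = walshExp α M (Fin.tail κ) + (ν + 1) := by
        rw [walshExp, walshOrder_eq_min, hν, min_eq_right hνα]
      rcases Nat.eq_zero_or_pos ν with rfl | hνpos
      · have ho' : walshOrder α M (Fin.tail κ) = 0 := by rw [walshOrder_eq_min, hν']; omega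
        have he' : walshExp α (M + 1) κ = 1 := by
          rw [he, walshExp_of_walshOrder_eq_zero hα _ _ ho']
        refine ⟨-(1 / (b : ℂ)) / (1 - ω), ?_, fun h c R hh hR => ?_⟩
        · rw [norm_div, norm_neg, norm_div, norm_one, Complex.norm_natCast, he', zero_add, pow_one,
            pow_one, mul_inv, div_eq_mul_inv, mul_comm, one_div]
          gcongr
        · have h1 := walshCoeff_of_walshOrder_eq_zero hα M (Fin.tail κ) ho'
            (fun t ht => norm_digitAverage_add_le ha (hh 0 (by omega)) hR ht)
          have hR0 : 0 ≤ R := (norm_nonneg _).trans (hR 0 hz)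
          rw [walshCoeff]
          refine (le_of_eq ?_).trans (h1.trans ?_)
          · congr 2; ring
          · rw [he']
            simp only [oscBound, mul_zero, add_zero, one_mul, zero_add, pow_one]
            rw [div_eq_inv_mul, mul_comm (b : ℝ)]
            gcongr
      · obtain ⟨μ, rfl⟩ : ∃ μ, ν = μ + 1 := ⟨ν - 1, by omega⟩
        obtain ⟨c₀, hc₀, H⟩ := ih (Fin.tail κ) μ hν' (by omega)
        refine ⟨-c₀ * ((b : ℂ) ^ (μ + 1 + 1))⁻¹ / (1 - ω), ?_, fun h c R hh hR => ?_⟩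
        · rw [norm_div, norm_mul, norm_neg, norm_inv, norm_pow, Complex.norm_natCast, he,
            pow_add (b : ℝ) (walshExp α M (Fin.tail κ)), pow_succ (2 * Real.sin _) (μ + 1), div_eq_mul_inv]
          calc _ ≤ ((2 * Real.sin (Real.pi / b)) ^ (μ + 1) *
                (b : ℝ) ^ walshExp α M (Fin.tail κ))⁻¹ * ((b : ℝ) ^ (μ + 1 + 1))⁻¹ *
                (2 * Real.sin (Real.pi / b))⁻¹ := by gcongr
            _ = _ := by rw [mul_inv, mul_inv, mul_inv, mul_inv]; ring
        · have hR0 : 0 ≤ R := (norm_nonneg _).trans (hR 0 hz)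
          have hfam := hh.average (κ 0)
          set f := averageFamily (κ 0) h with hf
          have hd2 : ∀ t ∈ Set.Icc (0 : ℝ) 1, ‖f (μ + 1 + 1) t - 0‖ ≤
              ((b : ℝ) ^ (μ + 1 + 1))⁻¹ * R := by
            intro t ht
            have := norm_digitAverage_le (κ 0) hR ht
            rw [digitAverage_sub_const, if_neg ha, sub_zero] at this
            rw [sub_zero, hf, averageFamily, norm_mul, norm_inv, norm_pow, Complex.norm_natCast]
            gcongr
          -- Recentring at the midpoint, from which no point is farther than `1 / 2`. Compared with
          -- the factor `(2 sin (π / b))⁻¹` of a nonzero digit, this `1 / 2` is the factor `sin (π /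
          -- b)` in `oscBound`.
          have hhalf : (1 / 2 : ℝ) ∈ Set.Icc (0 : ℝ) 1 := by norm_num
          have h1 := H f (f (μ + 1) (1 / 2)) (((b : ℝ) ^ (μ + 1 + 1))⁻¹ * R * (1 / 2)) hfam
            (fun t ht => by
              have h2 := norm_sub_sub_le_of_hasDerivWithinAt (hfam (μ + 1) (by omega)) hd2 ht hhalf
              rw [zero_mul, sub_zero] at h2
              refine h2.trans ?_
              gcongr
              rw [abs_le]
              constructor <;> linarith [ht.1, ht.2])
          -- The approximate value of the digit average of `h (μ + 1)`; integrated over the interval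
          -- it turns the main term of the tail into the new main term.
          set c' : ℂ := -(1 / (b : ℂ)) * (h (μ + 1) 1 - h (μ + 1) 0) / (1 - ω) with hc'
          have h3 : ‖f μ 1 - f μ 0 - ((b : ℂ) ^ (μ + 1))⁻¹ * c'‖ ≤
              ((b : ℝ) ^ (μ + 1))⁻¹ * (R / (b * ‖1 - ω‖)) := by
            have := norm_sub_sub_le_of_hasDerivWithinAt (c := ((b : ℂ) ^ (μ + 1))⁻¹ * c')
              (R := ((b : ℝ) ^ (μ + 1))⁻¹ * (R / (b * ‖1 - ω‖))) (hfam μ (by omega))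
              (fun t ht => by
                rw [hf, averageFamily, ← mul_sub, norm_mul, norm_inv, norm_pow,
                  Complex.norm_natCast]
                gcongr
                exact norm_digitAverage_add_le ha (hh (μ + 1) (by omega)) hR ht) ho hz
            simpa using this
          rw [walshCoeff, ← averageFamily_zero]
          have h4 : walshCoeff M (Fin.tail κ) (f 0) -
              -c₀ * ((b : ℂ) ^ (μ + 1 + 1))⁻¹ / (1 - ω) * (h (μ + 1) 1 - h (μ + 1) 0) =
              (walshCoeff M (Fin.tail κ) (f 0) - c₀ * (f μ 1 - f μ 0)) +
              c₀ * (f μ 1 - f μ 0 - ((b : ℂ) ^ (μ + 1))⁻¹ * c') := by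
            rw [hc', pow_succ (b : ℂ) (μ + 1), mul_inv]
            field_simp
            ring
          rw [h4]
          refine (norm_add_le _ _).trans ?_
          rw [norm_mul]
          refine (add_le_add h1 (mul_le_mul hc₀ h3 (norm_nonneg _) (by positivity))).trans ?_
          rw [he, show oscBound b (μ + 1 + 1) =
            1 + Real.sin (Real.pi / b) * oscBound b (μ + 1) from rfl]
          set A := ((2 * Real.sin (Real.pi / b)) ^ (μ + 1) *
                (b : ℝ) ^ walshExp α M (Fin.tail κ))⁻¹ with hA
          have hA0 : 0 < A := by positivity
          have h5 : ((2 * Real.sin (Real.pi / b)) ^ (μ + 1 + 1) *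
              (b : ℝ) ^ (walshExp α M (Fin.tail κ) + (μ + 1 + 1)))⁻¹ =
              A * ((b : ℝ) ^ (μ + 1 + 1))⁻¹ * (2 * Real.sin (Real.pi / b))⁻¹ := by
            rw [hA, pow_succ (2 * Real.sin _) (μ + 1), pow_add (b : ℝ) (walshExp α M (Fin.tail κ))]
            simp only [mul_inv]
            ring
          rw [h5]
          have h6 : ((b : ℝ) ^ (μ + 1))⁻¹ * (R / (b * ‖1 - ω‖)) =
              ((b : ℝ) ^ (μ + 1 + 1))⁻¹ * R * ‖1 - ω‖⁻¹ := by
            rw [pow_succ (b : ℝ) (μ + 1)]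
            field_simp
          have h7 : ‖1 - ω‖⁻¹ ≤ (2 * Real.sin (Real.pi / b))⁻¹ := by gcongr
          rw [h6]
          calc _ ≤ oscBound b (μ + 1) * A * (((b : ℝ) ^ (μ + 1 + 1))⁻¹ * R * (1 / 2)) +
              A * (((b : ℝ) ^ (μ + 1 + 1))⁻¹ * R * (2 * Real.sin (Real.pi / b))⁻¹) := by gcongr
            _ = _ := by field_simp; ring

omit [Fact b.Prime] in
theorem oscBound_nonneg (hb : 1 < b) (ν : ℕ) : 0 ≤ oscBound b ν := by
  induction ν with
  | zero => exact le_rfl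
  | succ ν ih => have := sin_pi_div_pos hb; rw [oscBound]; positivity

/-- With at most `α` nonzero digits `walshCoeff_main` applies with `c = 0`, and the summand `1`
beside `oscBound` pays for the main term. While more than `α` nonzero digits are left, the first
digit is merely averaged over, which scales the `α`-th derivative by `b ^ (-α)`. -/
theorem norm_walshCoeff_le {α : ℕ} (hα : 1 ≤ α) (M : ℕ) (κ : Fin M → ZMod b)
    {h : ℕ → ℝ → ℂ} {R : ℝ} (hh : IsDerivFamily α h)
    (hR : ∀ t ∈ Set.Icc (0 : ℝ) 1, ‖h (walshOrder α M κ) t‖ ≤ R) :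
    ‖walshCoeff M κ (h 0)‖ ≤ (oscBound b (walshOrder α M κ) + 1) *
      ((2 * Real.sin (Real.pi / b)) ^ walshOrder α M κ * (b : ℝ) ^ walshExp α M κ)⁻¹ * R := by
  have hb : 1 < b := (Fact.out : b.Prime).one_lt
  have hb0 : (0 : ℝ) < b := by positivity
  have hs := sin_pi_div_pos hb
  have hz : (0 : ℝ) ∈ Set.Icc (0 : ℝ) 1 := by simp
  have ho : (1 : ℝ) ∈ Set.Icc (0 : ℝ) 1 := by simp
  induction M generalizing h R with
  | zero => simpa [walshOrder, walshExp, oscBound, walshCoeff] using hR 0 hz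
  | succ M ih =>
    by_cases hle : digitCount (M + 1) κ ≤ α
    · have hord : walshOrder α (M + 1) κ = digitCount (M + 1) κ := by
        rw [walshOrder_eq_min, min_eq_right hle]
      rcases Nat.eq_zero_or_pos (digitCount (M + 1) κ) with h0 | hpos
      · have hord0 : walshOrder α (M + 1) κ = 0 := hord.trans h0
        rw [hord0] at hR
        rw [walshExp_of_walshOrder_eq_zero hα _ _ hord0, hord0]
        have := walshCoeff_of_walshOrder_eq_zero hα (M + 1) κ hord0 (h := h 0) (c := 0) (R := R)
          (by simpa using hR)
        simpa [oscBound] using this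
      · obtain ⟨ν, hν⟩ : ∃ ν, digitCount (M + 1) κ = ν + 1 := ⟨_, (Nat.sub_add_cancel hpos).symm⟩
        obtain ⟨c₀, hc₀, H⟩ := walshCoeff_main hα (M + 1) κ ν hν (by omega)
        rw [hord, hν] at hR ⊢
        have h1 := H h 0 R hh (by simpa using hR)
        have h2 := norm_sub_sub_le_of_hasDerivWithinAt (c := 0) (R := R) (hh ν (by omega))
          (by simpa using hR) ho hz
        have h2 : ‖h ν 1 - h ν 0‖ ≤ R := by simpa using h2
        have h3 : walshCoeff (M + 1) κ (h 0) =
          (walshCoeff (M + 1) κ (h 0) - c₀ * (h ν 1 - h ν 0)) + c₀ * (h ν 1 - h ν 0) := by ring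
        rw [h3]
        refine (norm_add_le _ _).trans ?_
        rw [norm_mul]
        refine (add_le_add h1 (mul_le_mul hc₀ h2 (norm_nonneg _) (by positivity))).trans
          (le_of_eq ?_)
        ring
    · have hord : walshOrder α (M + 1) κ = α := by
        rw [walshOrder_eq_min]; omega
      have hord' : walshOrder α M (Fin.tail κ) = α := by
        rw [walshOrder_eq_min]
        simp only [digitCount] at hle
        split_ifs at hle <;> omega
      have h1 := ih (Fin.tail κ) (hh.average (κ 0)) (R := ((b : ℝ) ^ α)⁻¹ * R) (fun t ht => by
        rw [hord'] at *
        rw [hord] at hR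
        rw [averageFamily, norm_mul, norm_inv, norm_pow, Complex.norm_natCast]
        gcongr
        exact norm_digitAverage_le _ hR ht)
      rw [averageFamily_zero] at h1
      rw [walshCoeff, walshExp, hord]
      rw [hord'] at h1
      refine h1.trans (le_of_eq ?_)
      rw [pow_add]
      field_simp

theorem sum_fin_succ_mem {M : ℕ} (Z : Finset (Fin (M + 1))) (f : Fin (M + 1) → ℕ) :
    ∑ i ∈ Z, f i = (if (0 : Fin (M + 1)) ∈ Z then f 0 else 0) +
      ∑ i ∈ Finset.univ.filter (fun i : Fin M => i.succ ∈ Z), f i.succ := by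
  rw [← Finset.univ_inter Z, ← Finset.sum_ite_mem, Fin.sum_univ_succ, Finset.sum_filter]
  simp

theorem card_le_digitCount (M : ℕ) (κ : Fin M → ZMod b) (Z : Finset (Fin M))
    (hZ : ∀ i ∈ Z, κ i ≠ 0) : Z.card ≤ digitCount M κ := by
  induction M with
  | zero => rw [Finset.eq_empty_of_isEmpty Z]; simp
  | succ M ih =>
    have h1 := ih (Fin.tail κ) (Finset.univ.filter fun i => i.succ ∈ Z)
      (fun i hi => hZ _ (Finset.mem_filter.1 hi).2)
    have h2 := sum_fin_succ_mem Z fun _ => 1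
    rw [← Finset.card_eq_sum_ones, ← Finset.card_eq_sum_ones] at h2
    rw [digitCount]
    split_ifs at h2 with h3
    · rw [if_pos (hZ 0 h3)]; omega
    · omega

/-- The exponent `walshExp` dominates the sum of any `α` positions of nonzero digits. -/
theorem sum_le_walshExp (α M : ℕ) (κ : Fin M → ZMod b) (Z : Finset (Fin M))
    (hZ : ∀ i ∈ Z, κ i ≠ 0) (hcard : Z.card ≤ α) :
    ∑ i ∈ Z, ((i : ℕ) + 1) ≤ walshExp α M κ := by
  induction M with
  | zero => rw [Finset.eq_empty_of_isEmpty Z]; simp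
  | succ M ih =>
    set Z' := Finset.univ.filter fun i : Fin M => i.succ ∈ Z with hZ'
    have h2 := sum_fin_succ_mem Z fun _ => 1
    rw [← Finset.card_eq_sum_ones, ← Finset.card_eq_sum_ones, ← hZ'] at h2
    have h1 := ih (Fin.tail κ) Z' (fun i hi => hZ _ (Finset.mem_filter.1 hi).2)
      (by split_ifs at h2 <;> omega)
    -- Passing to the tail lowers every position in `Z` by one, a total loss of `Z.card`, and the
    -- recursion of `walshExp` gives back at least that much.
    have h3 : Z.card ≤ walshOrder α (M + 1) κ := by
      rw [walshOrder_eq_min]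
      exact le_min hcard (card_le_digitCount _ _ _ hZ)
    rw [sum_fin_succ_mem, ← hZ', walshExp]
    have h4 : ∑ i ∈ Z', ((i.succ : ℕ) + 1) = ∑ i ∈ Z', ((i : ℕ) + 1) + Z'.card := by
      rw [Finset.card_eq_sum_ones, ← Finset.sum_add_distrib]
      simp
    rw [h4]
    simp only [Fin.val_zero, zero_add]
    omega

end Walsh
end QMC
end

noncomputable section
namespace QMC

/-! ### Comparison with the constant of the construction -/

theorem oscBound_le_natCast {b : ℕ} (hb : 1 < b) (ν : ℕ) : oscBound b ν ≤ ν := by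
  induction ν with
  | zero => simp [oscBound]
  | succ ν ih =>
    have h1 := Real.sin_le_one (Real.pi / b)
    have h2 := sin_pi_div_pos hb
    have h3 := oscBound_nonneg hb ν
    rw [oscBound]
    push_cast
    nlinarith

/-- For `b ≥ 5` one has `sin (π / b) ≤ 3 / 4`, and `4` is the fixed point of `t ↦ 1 + 3 t / 4`. -/
theorem oscBound_le_four {b : ℕ} (hb : 5 ≤ b) (ν : ℕ) : oscBound b ν ≤ 4 := by
  have hb' : (5 : ℝ) ≤ b := by exact_mod_cast hb
  have hs : Real.sin (Real.pi / b) ≤ 3 / 4 := by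
    refine (Real.sin_le (by have := Real.pi_pos; positivity)).trans ?_
    rw [div_le_iff₀ (by linarith)]
    have := Real.pi_lt_d2
    linarith
  induction ν with
  | zero => simp [oscBound]
  | succ ν ih =>
    have h3 := oscBound_nonneg (b := b) (by omega) ν
    have h2 := sin_pi_div_pos (b := b) (by omega)
    rw [oscBound]
    nlinarith

/-- The last factor is at least `5`, and Bernoulli's inequality bounds the power below by `1 + (α -
2) / b`. For `b ≥ 5` the left side is at most `5`; for smaller bases it is at most `α + 1`, and `5
(α - 2) / b ≥ α - 2`. -/
theorem oscBound_add_one_le {b α ν : ℕ} (hb : 1 < b) (hα : 2 ≤ α) (hν : ν ≤ α) :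
    oscBound b ν + 1 ≤ (1 + 1 / (b : ℝ) + 1 / ((b : ℝ) * (b + 1))) ^ (α - 2) *
      (3 + 2 / (b : ℝ) + (2 * b + 1) / ((b : ℝ) - 1)) := by
  have hb' : (2 : ℝ) ≤ b := by exact_mod_cast hb
  have hY : (5 : ℝ) ≤ 3 + 2 / (b : ℝ) + (2 * b + 1) / ((b : ℝ) - 1) := by
    have h1 : (2 : ℝ) ≤ (2 * b + 1) / ((b : ℝ) - 1) := by
      rw [le_div_iff₀ (by linarith)]; linarith
    have h2 : 0 ≤ 2 / (b : ℝ) := by positivity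
    linarith
  have hX : 1 + ((α - 2 : ℕ) : ℝ) * (1 / b) ≤
      (1 + 1 / (b : ℝ) + 1 / ((b : ℝ) * (b + 1))) ^ (α - 2) := by
    have h0 : 0 < 1 / (b : ℝ) := by positivity
    have h1 : 0 < 1 / ((b : ℝ) * (b + 1)) := by positivity
    exact (one_add_mul_le_pow (by linarith) (α - 2)).trans
      (pow_le_pow_left₀ (by linarith) (by linarith) _)
  have hX0 : (0 : ℝ) ≤ ((α - 2 : ℕ) : ℝ) * (1 / b) := by positivity
  have hXY : (1 + ((α - 2 : ℕ) : ℝ) * (1 / b)) * 5 ≤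
      (1 + 1 / (b : ℝ) + 1 / ((b : ℝ) * (b + 1))) ^ (α - 2) *
      (3 + 2 / (b : ℝ) + (2 * b + 1) / ((b : ℝ) - 1)) := by gcongr
  refine le_trans ?_ hXY
  rcases le_or_gt 5 b with h5 | h5
  · have := oscBound_le_four h5 ν
    linarith
  · have h1 := oscBound_le_natCast hb ν
    have h2 : (ν : ℝ) ≤ α := by exact_mod_cast hν
    have h3 : (α : ℝ) = ((α - 2 : ℕ) : ℝ) + 2 := by rw [Nat.cast_sub hα]; push_cast; ring
    have h4 : (1 : ℝ) / 5 ≤ 1 / b := by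
      gcongr
      exact_mod_cast h5.le
    have h5 : (0 : ℝ) ≤ ((α - 2 : ℕ) : ℝ) := by positivity
    nlinarith

theorem inv_pow_le_fold {b α ν : ℕ} (hb : 1 < b) (hν1 : 1 ≤ ν) (hν : ν ≤ α) :
    ((2 * Real.sin (Real.pi / b)) ^ ν)⁻¹ ≤
      (Finset.Icc 1 (α - 1)).fold max (2 / (2 * Real.sin (Real.pi / b)) ^ α)
        (fun z => 1 / (2 * Real.sin (Real.pi / b)) ^ z) := by
  have hs := sin_pi_div_pos hb
  rw [Finset.le_fold_max]
  rcases hν.lt_or_eq with h | rfl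
  · exact Or.inr ⟨ν, Finset.mem_Icc.2 ⟨hν1, by omega⟩, by rw [one_div]⟩
  · left
    rw [inv_eq_one_div]
    gcongr
    norm_num

theorem factorial_mul_pow_le_coordWeight {α ν : ℕ} (hν1 : 1 ≤ ν) (hν : ν ≤ α) {x : ℝ}
    (hx : 0 ≤ x) : (ν.factorial : ℝ) * x ^ ν ≤ coordWeight α x := by
  unfold coordWeight
  refine le_trans ?_ (Finset.single_le_sum (f := fun ν : ℕ => (ν.factorial : ℝ) *
    (if ν = α then 2 else 1) * x ^ ν) (fun i _ => ?_) (Finset.mem_Icc.2 ⟨hν1, hν⟩))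
  · have : (0 : ℝ) ≤ (ν.factorial : ℝ) * x ^ ν := by positivity
    split_ifs <;> linarith
  · split_ifs <;> positivity

/-- The bounds for `oscBound` and for the power of the sine multiply to `walshConst`, and one term
of the sum `coordWeight` covers `ν! x ^ ν`. -/
theorem walsh_factor_le {b α ν : ℕ} (hb : 1 < b) (hα : 2 ≤ α) (hν1 : 1 ≤ ν) (hν : ν ≤ α) {x : ℝ}
    (hx : 0 ≤ x) :
    (oscBound b ν + 1) * ((2 * Real.sin (Real.pi / b)) ^ ν)⁻¹ * ((ν.factorial : ℝ) * x ^ ν) ≤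
      walshConst α b * coordWeight α x := by
  have h1 := oscBound_add_one_le hb hα hν
  have h2 := inv_pow_le_fold hb hν1 hν
  have h3 := factorial_mul_pow_le_coordWeight hν1 hν hx
  have h4 := oscBound_nonneg hb ν
  have hs := sin_pi_div_pos hb
  have hw := walshConst_pos (α := α) hb
  gcongr
  unfold walshConst
  rw [mul_assoc, mul_comm]
  have : 0 ≤ ((2 * Real.sin (Real.pi / b)) ^ ν)⁻¹ := by positivity
  exact mul_le_mul h2 h1 (by linarith) (this.trans h2)

/-! ### Decay of discrete Walsh coefficients in several variables -/

section Multi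

variable {b : ℕ} [Fact b.Prime]

/-- The `b`-adic number with digits `d`. -/
def gridPoint (M : ℕ) (d : Fin M → ZMod b) : ℝ := ∑ i, ((d i).val : ℝ) / (b : ℝ) ^ ((i : ℕ) + 1)

theorem gridPoint_cons (M : ℕ) (a : ZMod b) (d : Fin M → ZMod b) :
    gridPoint (M + 1) (Fin.cons a d) = ((a.val : ℝ) + gridPoint M d) / b := by
  have hb0 : (b : ℝ) ≠ 0 := by exact_mod_cast (Fact.out : b.Prime).ne_zero
  unfold gridPoint
  rw [Fin.sum_univ_succ, add_div, Finset.sum_div]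
  simp only [Fin.cons_zero, Fin.val_zero, zero_add, pow_one, Fin.cons_succ, Fin.val_succ]
  congr 1
  refine Finset.sum_congr rfl fun i _ => ?_
  rw [div_div, ← pow_succ]

theorem gridPoint_mem (M : ℕ) (d : Fin M → ZMod b) : gridPoint M d ∈ Set.Icc (0 : ℝ) 1 := by
  induction M with
  | zero => simp [gridPoint]
  | succ M ih =>
    rw [← Fin.cons_self_tail d, gridPoint_cons]
    exact mem_cell (ZMod.val_lt _) (ih _)

theorem sum_range_eq_sum_zmod (f : ℕ → ℂ) :
    ∑ n ∈ Finset.range b, f n = ∑ a : ZMod b, f a.val := by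
  refine Finset.sum_bij' (fun n _ => (n : ZMod b)) (fun a _ => a.val) (fun _ _ => Finset.mem_univ _)
    (fun a _ => Finset.mem_range.2 (ZMod.val_lt a)) (fun n hn => ?_) (fun a _ => ?_) (fun n hn => ?_)
  · exact ZMod.val_cast_of_lt (Finset.mem_range.1 hn)
  · exact ZMod.natCast_zmod_val a
  · rw [ZMod.val_cast_of_lt (Finset.mem_range.1 hn)]

/-- Unfolding the recursion digit by digit identifies `walshCoeff` with an ordinary finite Fourier
coefficient on the grid. -/
theorem walshCoeff_eq_sum (M : ℕ) (κ : Fin M → ZMod b) (h : ℝ → ℂ) :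
    walshCoeff M κ h = ((b : ℂ) ^ M)⁻¹ * ∑ d : Fin M → ZMod b,
      ZMod.stdAddChar (∑ i, κ i * d i) * h (gridPoint M d) := by
  induction M generalizing h with
  | zero => simp [walshCoeff, gridPoint]
  | succ M ih =>
    rw [walshCoeff, ih, ← (Fin.consEquiv fun _ => ZMod b).sum_comp, Fintype.sum_prod_type_right,
      pow_succ, mul_inv, mul_assoc, Finset.mul_sum (a := (b : ℂ)⁻¹)]
    congr 1
    refine Finset.sum_congr rfl fun d _ => ?_
    rw [digitAverage, sum_range_eq_sum_zmod
      (fun n => ZMod.stdAddChar (κ 0 * (n : ZMod b)) * h ((n + gridPoint M d) / b)), one_div,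
      mul_left_comm, Finset.mul_sum]
    congr 1
    refine Finset.sum_congr rfl fun a _ => ?_
    have h : (Fin.consEquiv fun _ => ZMod b) (a, d) = Fin.cons a d := rfl
    rw [h, gridPoint_cons, Fin.sum_univ_succ, AddChar.map_add_eq_mul, ZMod.natCast_zmod_val]
    simp only [Fin.cons_zero, Fin.cons_succ, Fin.tail]
    ring

/-- Complex version of `IsMixedPartials`. -/
def IsPartialFamily {s : ℕ} (α : ℕ) (D : (Fin s → ℕ) → (Fin s → ℝ) → ℂ) : Prop :=
  ∀ (ν : Fin s → ℕ) (j : Fin s), (∀ i, ν i ≤ α) → ν j < α →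
    ∀ y ∈ Set.Icc (0 : Fin s → ℝ) 1,
      HasDerivWithinAt (fun t => D ν (Function.update y j t)) (D (ν + Pi.single j 1) y)
        (Set.Icc 0 1) (y j)

/-- The discrete Walsh coefficient in several variables. -/
def walshCoeffMulti {s : ℕ} (M : ℕ) (κ : Fin s → Fin M → ZMod b) (F : (Fin s → ℝ) → ℂ) : ℂ :=
  ((b : ℂ) ^ (M * s))⁻¹ * ∑ d : Fin s → Fin M → ZMod b,
    ZMod.stdAddChar (∑ j, ∑ i, κ j i * d j i) * F fun j => gridPoint M (d j)

theorem walshCoeffMulti_succ {s : ℕ} (M : ℕ) (κ : Fin (s + 1) → Fin M → ZMod b)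
    (F : (Fin (s + 1) → ℝ) → ℂ) :
    walshCoeffMulti M κ F = walshCoeffMulti M (Fin.tail κ)
      fun y => walshCoeff M (κ 0) fun t => F (Fin.cons t y) := by
  unfold walshCoeffMulti
  rw [← (Fin.consEquiv fun _ => Fin M → ZMod b).sum_comp, Fintype.sum_prod_type_right,
    mul_add, mul_one, pow_add, mul_inv, mul_assoc]
  congr 1
  rw [Finset.mul_sum]
  refine Finset.sum_congr rfl fun d _ => ?_
  beta_reduce
  rw [walshCoeff_eq_sum, mul_left_comm]
  congr 1
  rw [Finset.mul_sum (a := (ZMod.stdAddChar (∑ j, ∑ i, Fin.tail κ j i * d j i) : ℂ))]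
  refine Finset.sum_congr rfl fun a _ => ?_
  have h : (Fin.consEquiv fun _ => Fin M → ZMod b) (a, d) = Fin.cons a d := rfl
  have h' : (fun j => gridPoint M ((Fin.cons a d : Fin (s + 1) → Fin M → ZMod b) j)) =
      Fin.cons (gridPoint M a) fun j => gridPoint M (d j) := by
    ext j
    refine Fin.cases ?_ (fun j => ?_) j <;> simp
  rw [h, h', Fin.sum_univ_succ, AddChar.map_add_eq_mul]
  simp only [Fin.cons_zero, Fin.cons_succ, Fin.tail]
  ring

theorem cons_mem_Icc {s : ℕ} {t : ℝ} {y : Fin s → ℝ} (ht : t ∈ Set.Icc (0 : ℝ) 1)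
    (hy : y ∈ Set.Icc (0 : Fin s → ℝ) 1) :
    (Fin.cons t y : Fin (s + 1) → ℝ) ∈ Set.Icc (0 : Fin (s + 1) → ℝ) 1 := by
  constructor
  · intro j
    refine Fin.cases ?_ (fun j => ?_) j
    · simpa using ht.1
    · simpa using hy.1 j
  · intro j
    refine Fin.cases ?_ (fun j => ?_) j
    · simpa using ht.2
    · simpa using hy.2 j

/-- The bound for one coordinate. -/
def walshBound (α M : ℕ) (κ : Fin M → ZMod b) : ℝ :=
  (oscBound b (walshOrder α M κ) + 1) *
    ((2 * Real.sin (Real.pi / b)) ^ walshOrder α M κ * (b : ℝ) ^ walshExp α M κ)⁻¹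

theorem walshBound_nonneg (α M : ℕ) (κ : Fin M → ZMod b) : 0 ≤ walshBound α M κ := by
  have hb : 1 < b := (Fact.out : b.Prime).one_lt
  have := oscBound_nonneg hb (walshOrder α M κ)
  have := sin_pi_div_pos hb
  unfold walshBound
  positivity

/-- Induction on the dimension. A coefficient in the first coordinate is a finite linear combination
of values, so it commutes with the partial derivatives in the other coordinates and leaves a family
of partials in one variable fewer. -/
theorem norm_walshCoeffMulti_le {s α : ℕ} (hα : 1 ≤ α) (M : ℕ) (κ : Fin s → Fin M → ZMod b)
    (D : (Fin s → ℕ) → (Fin s → ℝ) → ℂ) {R : ℝ} (hD : IsPartialFamily α D)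
    (hR : ∀ y ∈ Set.Icc (0 : Fin s → ℝ) 1, ‖D (fun j => walshOrder α M (κ j)) y‖ ≤ R) :
    ‖walshCoeffMulti M κ (D 0)‖ ≤ (∏ j, walshBound α M (κ j)) * R := by
  induction s generalizing R with
  | zero =>
    have := hR 0 (by simp)
    simp only [walshCoeffMulti, Finset.univ_eq_empty, Finset.sum_empty, Finset.prod_empty, mul_zero,
      pow_zero, inv_one, one_mul, AddChar.map_zero_eq_one, Fintype.sum_unique]
    convert this using 2
    congr 1 <;> exact Subsingleton.elim _ _
  | succ s ih =>
    let D' : (Fin s → ℕ) → (Fin s → ℝ) → ℂ := fun ν y =>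
      walshCoeff M (κ 0) fun t => D (Fin.cons 0 ν) (Fin.cons t y)
    have hD' : IsPartialFamily α D' := by
      intro ν j hν hj y hy
      simp only [D', walshCoeff_eq_sum]
      refine HasDerivWithinAt.const_mul _ (HasDerivWithinAt.fun_sum fun d _ => ?_)
      refine HasDerivWithinAt.const_mul _ ?_
      have := hD (Fin.cons 0 ν) j.succ (fun i => by refine Fin.cases ?_ (fun i => ?_) i <;> simp [hν])
        (by simpa using hj) _ (cons_mem_Icc (gridPoint_mem M d) hy)
      have h1 : (Fin.cons 0 ν : Fin (s + 1) → ℕ) + Pi.single j.succ 1 =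
          Fin.cons 0 (ν + Pi.single j 1) := by
        ext i
        refine Fin.cases ?_ (fun i => ?_) i
        · simp [(Fin.succ_ne_zero j).symm]
        · simp [Pi.single_apply]
      rw [h1, Fin.cons_succ] at this
      simpa only [← Fin.cons_update] using this
    have h1 := ih (Fin.tail κ) D' (R := walshBound α M (κ 0) * R) hD' (fun y hy => by
      have h2 : IsDerivFamily α fun i t =>
          D (Fin.cons i fun j => walshOrder α M (Fin.tail κ j)) (Fin.cons t y) := by
        intro i hi t ht
        have := hD (Fin.cons i fun j => walshOrder α M (Fin.tail κ j)) 0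
          (fun j => by
            refine Fin.cases ?_ (fun j => ?_) j
            · simpa using hi.le
            · simpa using walshOrder_le _ _ _) (by simpa using hi) _ (cons_mem_Icc ht hy)
        have h1 : (Fin.cons i (fun j => walshOrder α M (Fin.tail κ j)) : Fin (s + 1) → ℕ) +
            Pi.single 0 1 = Fin.cons (i + 1) fun j => walshOrder α M (Fin.tail κ j) := by
          ext j
          refine Fin.cases ?_ (fun j => ?_) j
          · simp
          · simp
        rw [h1, Fin.cons_zero] at this
        simpa only [Fin.update_cons_zero] using this
      have h3 : (Fin.cons (walshOrder α M (κ 0)) fun j => walshOrder α M (Fin.tail κ j)) =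
          fun j => walshOrder α M (κ j) := by
        ext j
        refine Fin.cases ?_ (fun j => ?_) j <;> simp [Fin.tail]
      exact norm_walshCoeff_le hα M (κ 0) h2 (fun t ht => by
        rw [h3]
        exact hR _ (cons_mem_Icc ht hy)))
    have h4 : (fun y => walshCoeff M (κ 0) fun t => D 0 (Fin.cons t y)) = D' 0 := by
      have h5 : (Fin.cons 0 0 : Fin (s + 1) → ℕ) = 0 := by
        ext j
        refine Fin.cases ?_ (fun j => ?_) j <;> simp
      ext y
      simp only [D', h5]
    rw [walshCoeffMulti_succ, h4, Fin.prod_univ_succ]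
    refine h1.trans (le_of_eq ?_)
    simp only [Fin.tail]
    ring

end Multi
end QMC
end

/-! ### Interlacing of digits and Fourier analysis on the grid -/

noncomputable section
namespace QMC
open Polynomial

theorem sum_range_mul_eq {A : Type*} [AddCommMonoid A] (M α : ℕ) (f : ℕ → A) :
    ∑ k ∈ Finset.range (M * α), f k = ∑ a ∈ Finset.range M, ∑ j ∈ Finset.range α, f (α * a + j) := by
  induction M with
  | zero => simp
  | succ M ih => rw [Nat.succ_mul, Finset.sum_range_add, ih, Finset.sum_range_succ, mul_comm α M]

theorem prod_range_mul_eq {A : Type*} [CommMonoid A] (M α : ℕ) (f : ℕ → A) :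
    ∏ k ∈ Finset.range (M * α), f k =
      ∏ a ∈ Finset.range M, ∏ j ∈ Finset.range α, f (α * a + j) := by
  induction M with
  | zero => simp
  | succ M ih => rw [Nat.succ_mul, Finset.prod_range_add, ih, Finset.prod_range_succ, mul_comm α M]

section Digits

variable {b : ℕ} [Fact b.Prime]

/-! ### Digits of the nodes -/

theorem vMap_eq_div (m : ℕ) (L : LaurentSeries (ZMod b)) :
    vMap b m L = ((∑ r ∈ Finset.range m, (L.coeff ((m - r : ℕ) : ℤ)).val * b ^ r : ℕ) : ℝ) /
      (b : ℝ) ^ m := by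
  have hb0 : (b : ℝ) ≠ 0 := by exact_mod_cast (Fact.out : b.Prime).ne_zero
  unfold vMap
  push_cast
  rw [Finset.sum_div]
  refine Finset.sum_nbij' (fun l => m - l) (fun r => m - r) ?_ ?_ ?_ ?_ ?_
  · intro l hl
    have := Finset.mem_Icc.1 hl
    exact Finset.mem_range.2 (by omega)
  · intro r hr
    have := Finset.mem_range.1 hr
    exact Finset.mem_Icc.2 (by omega)
  · intro l hl
    have := Finset.mem_Icc.1 hl
    omega
  · intro r hr
    have := Finset.mem_range.1 hr
    omega
  · intro l hl
    have h := Finset.mem_Icc.1 hl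
    rw [show m - (m - l) = l by omega, div_eq_div_iff (by positivity) (by positivity), mul_assoc,
      ← pow_add, show m - l + l = m by omega]

/-- The value is an integer divided by `b ^ m`, so the digits of the real number are those of the
finite expansion, followed by zeros. -/
theorem digits_vMap (m : ℕ) (L : LaurentSeries (ZMod b)) (a : ℕ) :
    (Real.digits (vMap b m L) b a : ℕ) = if a < m then (L.coeff ((a : ℤ) + 1)).val else 0 := by
  have hb0 : (b : ℝ) ≠ 0 := by exact_mod_cast (Fact.out : b.Prime).ne_zero
  have hb : 0 < b := (Fact.out : b.Prime).pos
  rw [Real.digits, Fin.val_ofNat, vMap_eq_div]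
  set A := ∑ r ∈ Finset.range m, (L.coeff ((m - r : ℕ) : ℤ)).val * b ^ r
  split_ifs with h
  · have h1 : (A : ℝ) / (b : ℝ) ^ m * (b : ℝ) ^ (a + 1) = (A : ℝ) / ((b ^ (m - 1 - a) : ℕ) : ℝ) := by
      push_cast
      rw [div_mul_eq_mul_div, div_eq_div_iff (by positivity) (by positivity), mul_assoc, ← pow_add,
        show a + 1 + (m - 1 - a) = m by omega]
    rw [h1, Nat.floor_div_eq_div, digit_of_digit_sum hb (fun r => (L.coeff ((m - r : ℕ) : ℤ)).val)
      (fun r => ZMod.val_lt _) m (m - 1 - a) (by omega)]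
    rw [show m - (m - 1 - a) = a + 1 by omega]
    push_cast
    rfl
  · have h1 : (A : ℝ) / (b : ℝ) ^ m * (b : ℝ) ^ (a + 1) = ((b * (A * b ^ (a - m)) : ℕ) : ℝ) := by
      push_cast
      rw [div_mul_eq_mul_div, div_eq_iff (by positivity)]
      rw [show a + 1 = 1 + (a - m) + m by omega, pow_add, pow_add, pow_one]
      ring
    rw [h1, Nat.floor_natCast, Nat.mul_mod_right]

/-- The digits of the coordinates of the interlaced points. -/
def nodeDigit (m α : ℕ) (P : (ZMod b)[X]) (q : ℕ → (ZMod b)[X]) (n i k : ℕ) : ZMod b :=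
  if k / α < m then residue P (X ^ (k / α) * (truncPoly b m n * q (α * i + k % α))) else 0

/-- Position `k` carries the digit `k / α` of component `k % α`, which is a residue. Any `M ≥ m` is
admitted, since further digits vanish; this leaves room for refining the grid. -/
theorem interlacedPoint_eq_gridPoint {m α s M : ℕ} (hM : m ≤ M) (hα : 0 < α) (P : (ZMod b)[X])
    (q : ℕ → (ZMod b)[X]) (n : ℕ) (i : Fin s) :
    interlacedPoint b m α s P q n i =
      gridPoint (M * α) fun k => nodeDigit m α P q n i k := by
  have h1 : ∀ k : ℕ, ((Real.digits (latticeCoord b m P (q (α * i + k % α)) n) b (k / α) : Fin b) : ℕ)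
      = (nodeDigit m α P q n i k).val := by
    intro k
    rw [latticeCoord, digits_vMap, nodeDigit]
    split_ifs with h
    · rw [residue_X_pow_mul, laurentAtInfty_mul]
    · simp
  unfold interlacedPoint interlace gridPoint
  rw [Real.ofDigits, tsum_eq_sum (s := Finset.range (M * α)), Finset.sum_range]
  · refine Finset.sum_congr rfl fun k _ => ?_
    rw [Real.ofDigitsTerm, h1, div_eq_mul_inv]
  · intro k hk
    rw [Real.ofDigitsTerm, h1, nodeDigit, if_neg]
    · simp
    · rw [Finset.mem_range, not_lt] at hk
      have := (Nat.le_div_iff_mul_le hα).2 hk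
      omega

/-! ### Words of a block of digits -/

/-- The digit in position `k`, which is zero beyond the last one. -/
def digitAt {M : ℕ} (κ : Fin M → ZMod b) (k : ℕ) : ZMod b := if h : k < M then κ ⟨k, h⟩ else 0

/-- The word with the digits of `κ` in the positions `j, j + α, …`. -/
def blockWord (α M : ℕ) (κ : Fin (M * α) → ZMod b) (j : ℕ) : ℕ :=
  ∑ a ∈ Finset.range M, (digitAt κ (α * a + j)).val * b ^ a

theorem blockWord_lt (α M : ℕ) (κ : Fin (M * α) → ZMod b) (j : ℕ) : blockWord α M κ j < b ^ M :=
  digit_sum_lt (Fact.out : b.Prime).pos _ (fun _ => ZMod.val_lt _) M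

theorem blockWord_digit {α M : ℕ} (κ : Fin (M * α) → ZMod b) (j : ℕ) {a : ℕ} (ha : a < M) :
    ((blockWord α M κ j / b ^ a : ℕ) : ZMod b) = digitAt κ (α * a + j) := by
  rw [← ZMod.natCast_mod, blockWord, digit_of_digit_sum (Fact.out : b.Prime).pos
    (fun a => (digitAt κ (α * a + j)).val) (fun _ => ZMod.val_lt _) M a ha, ZMod.natCast_zmod_val]

theorem eq_of_blockWord_eq {α M : ℕ} {κ κ' : Fin (M * α) → ZMod b}
    (h : ∀ j < α, blockWord α M κ j = blockWord α M κ' j) : κ = κ' := by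
  ext k
  have hα : 0 < α := Nat.pos_of_ne_zero (by rintro rfl; exact absurd k.2 (by simp))
  have h1 : (k : ℕ) / α < M := (Nat.div_lt_iff_lt_mul hα).2 k.2
  have h2 := blockWord_digit κ (k % α) h1
  rw [h _ (Nat.mod_lt _ hα), blockWord_digit κ' _ h1, Nat.div_add_mod] at h2
  simpa [digitAt] using h2.symm

theorem blockWord_zero (α M j : ℕ) : blockWord α M (0 : Fin (M * α) → ZMod b) j = 0 := by
  unfold blockWord digitAt
  simp

/-- The leading digits of the words of a block sit at distinct positions of `κ`, at most `α` in
number and all nonzero, so `sum_le_walshExp` bounds the sum of these positions. Word `j` leads at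
position `α (μ₁ - 1) + j + 1`, which is `α - 1 - j` short of `α μ₁`; the shortfalls add up to at
most `α (α - 1) / 2`. -/
theorem sum_mu1_le_walshExp {α M : ℕ} (κ : Fin (M * α) → ZMod b) :
    α * ∑ j ∈ Finset.range α, mu1 b (blockWord α M κ j) ≤
      walshExp α (M * α) κ + α * (α - 1) / 2 := by
  have hb : 1 < b := (Fact.out : b.Prime).one_lt
  classical
  set J := (Finset.range α).filter fun j => blockWord α M κ j ≠ 0 with hJ
  have hpos : ∀ j ∈ J, α * (mu1 b (blockWord α M κ j) - 1) + j < M * α ∧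
      digitAt κ (α * (mu1 b (blockWord α M κ j) - 1) + j) ≠ 0 ∧
      1 ≤ mu1 b (blockWord α M κ j) := by
    intro j hj
    obtain ⟨h1, h2⟩ := Finset.mem_filter.1 hj
    have h3 := mu1_pos hb h2
    have h4 := (mu1_le_iff hb).2 (blockWord_lt α M κ j)
    have h5 := Finset.mem_range.1 h1
    refine ⟨?_, ?_, h3⟩
    · calc α * (mu1 b (blockWord α M κ j) - 1) + j < α * (mu1 b (blockWord α M κ j) - 1) + α := by omega
        _ = α * (mu1 b (blockWord α M κ j) - 1 + 1) := by ring
        _ ≤ α * M := Nat.mul_le_mul_left _ (by omega)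
        _ = _ := mul_comm _ _
    · rw [← blockWord_digit κ j (by omega)]
      intro h0
      rw [ZMod.natCast_eq_zero_iff] at h0
      have h6 : blockWord α M κ j / b ^ (mu1 b (blockWord α M κ j) - 1) < b := by
        rw [Nat.div_lt_iff_lt_mul (by positivity), ← pow_succ', Nat.sub_add_cancel h3]
        exact (mu1_le_iff hb).1 le_rfl
      have h7 : ¬ mu1 b (blockWord α M κ j) ≤ mu1 b (blockWord α M κ j) - 1 := by omega
      rw [mu1_le_iff hb, not_lt] at h7
      have h8 : 0 < blockWord α M κ j / b ^ (mu1 b (blockWord α M κ j) - 1) :=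
        Nat.div_pos h7 (by positivity)
      exact absurd (Nat.le_of_dvd h8 h0) (by omega)
  let pos : ℕ → Fin (M * α) → Prop := fun j k => (k : ℕ) = α * (mu1 b (blockWord α M κ j) - 1) + j
  set Z : Finset (Fin (M * α)) := J.attach.image fun j => ⟨_, (hpos j.1 j.2).1⟩ with hZ
  have hinj : Function.Injective fun j : J => (⟨_, (hpos j.1 j.2).1⟩ : Fin (M * α)) := by
    intro i j hij
    have h1 := congrArg (fun x : Fin (M * α) => (x : ℕ) % α) hij
    simp only [Nat.mul_add_mod] at h1
    have h2 := Finset.mem_range.1 (Finset.mem_filter.1 i.2).1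
    have h3 := Finset.mem_range.1 (Finset.mem_filter.1 j.2).1
    rw [Nat.mod_eq_of_lt h2, Nat.mod_eq_of_lt h3] at h1
    exact Subtype.ext h1
  have h1 := sum_le_walshExp α (M * α) κ Z (by
    intro k hk
    obtain ⟨j, _, rfl⟩ := Finset.mem_image.1 hk
    have := (hpos j.1 j.2).2.1
    rwa [digitAt, dif_pos (hpos j.1 j.2).1] at this) (by
    rw [hZ, Finset.card_image_of_injective _ hinj, Finset.card_attach]
    exact (Finset.card_filter_le _ _).trans (by simp))
  rw [hZ, Finset.sum_image (fun _ _ _ _ h => hinj h), Finset.sum_attach J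
    (fun j => α * (mu1 b (blockWord α M κ j) - 1) + j + 1)] at h1
  have h2 : α * ∑ j ∈ Finset.range α, mu1 b (blockWord α M κ j) =
      ∑ j ∈ J, α * mu1 b (blockWord α M κ j) := by
    rw [hJ, Finset.sum_filter, Finset.mul_sum]
    refine Finset.sum_congr rfl fun j _ => ?_
    split_ifs with h
    · rfl
    · rw [not_not.1 h, mu1_zero, mul_zero]
  have h3 : ∑ j ∈ J, (α - 1 - j) ≤ α * (α - 1) / 2 := by
    rw [← Finset.sum_range_id, ← Finset.sum_range_reflect (fun j => j)]
    exact Finset.sum_le_sum_of_subset (Finset.filter_subset _ _)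
  have h4 : ∑ j ∈ J, α * mu1 b (blockWord α M κ j) =
      ∑ j ∈ J, (α * (mu1 b (blockWord α M κ j) - 1) + j + 1) + ∑ j ∈ J, (α - 1 - j) := by
    rw [← Finset.sum_add_distrib]
    refine Finset.sum_congr rfl fun j hj => ?_
    have h5 := Finset.mem_range.1 (Finset.mem_filter.1 hj).1
    obtain ⟨c, hc⟩ := Nat.exists_eq_add_of_le (hpos j hj).2.2
    rw [hc, Nat.add_sub_cancel_left, mul_add]
    omega
  omega

/-- The words of all the blocks. -/
def dualWord {s : ℕ} (α M : ℕ) (κ : Fin s → Fin (M * α) → ZMod b) (t : ℕ) : ℕ :=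
  if h : t / α < s then blockWord α M (κ ⟨t / α, h⟩) (t % α) else 0

theorem dualWord_mul_add {s α M : ℕ} (κ : Fin s → Fin (M * α) → ZMod b) (i : Fin s) {j : ℕ}
    (hj : j < α) : dualWord α M κ (α * i + j) = blockWord α M (κ i) j := by
  have h1 : (α * (i : ℕ) + j) / α = i := by
    rw [Nat.mul_add_div (by omega), Nat.div_eq_of_lt hj, add_zero]
  unfold dualWord
  rw [dif_pos (by rw [h1]; exact i.2), Nat.mul_add_mod, Nat.mod_eq_of_lt hj]
  congr 2
  exact Fin.ext h1

theorem dualWord_injective {s α M : ℕ} :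
    Function.Injective (dualWord α M : (Fin s → Fin (M * α) → ZMod b) → ℕ → ℕ) := by
  intro κ κ' h
  funext i
  refine eq_of_blockWord_eq fun j hj => ?_
  rw [← dualWord_mul_add κ i hj, h, dualWord_mul_add κ' i hj]

/-! ### Fourier analysis on the digits -/

theorem residue_C_mul (P f : (ZMod b)[X]) (c : ZMod b) : residue P (C c * f) = c * residue P f := by
  have : laurentAtInfty b (C c) = HahnSeries.C c := by
    ext z
    rw [laurentAtInfty_coeff, HahnSeries.C_apply, HahnSeries.coeff_single, coeff_C]
    split_ifs <;> first | rfl | omega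
  unfold residue
  rw [laurentAtInfty_mul, this, mul_div_assoc, HahnSeries.C_mul_eq_smul]
  rfl

theorem residue_sum {ι : Type*} (P : (ZMod b)[X]) (S : Finset ι) (f : ι → (ZMod b)[X]) :
    residue P (∑ i ∈ S, f i) = ∑ i ∈ S, residue P (f i) :=
  map_sum (AddMonoidHom.mk' (residue P) (residue_add P)) f S

/-- Digits of nodes are residues, and the residue is linear, so the pairing with a frequency
collects into the residue of one product. Digits of the frequency that enter its words from position
`m` on meet zero digits of the node. -/
theorem sum_mul_nodeDigit {s m α M : ℕ} (hM : m ≤ M) (hα : 0 < α) (P : (ZMod b)[X])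
    (q : ℕ → (ZMod b)[X]) (n : ℕ) (κ : Fin s → Fin (M * α) → ZMod b) :
    ∑ i : Fin s, ∑ k : Fin (M * α), κ i k * nodeDigit m α P q n i k =
      residue P (truncPoly b m n *
        ∑ t ∈ Finset.range (α * s), truncPoly b m (dualWord α M κ t) * q t) := by
  rw [mul_comm α s, sum_range_mul_eq, Finset.sum_range, Finset.mul_sum, residue_sum]
  refine Finset.sum_congr rfl fun i _ => ?_
  rw [Finset.mul_sum, residue_sum]
  have h1 : ∑ k : Fin (M * α), κ i k * nodeDigit m α P q n i k =
      ∑ k ∈ Finset.range (M * α), digitAt (κ i) k * nodeDigit m α P q n i k := by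
    rw [Finset.sum_range]
    refine Finset.sum_congr rfl fun k _ => ?_
    rw [digitAt, dif_pos k.2]
  rw [h1, sum_range_mul_eq, Finset.sum_comm]
  refine Finset.sum_congr rfl fun j hj => ?_
  have hj := Finset.mem_range.1 hj
  rw [dualWord_mul_add κ i hj]
  have h2 : truncPoly b m n * (truncPoly b m (blockWord α M (κ i) j) * q (α * i + j)) =
      ∑ a ∈ Finset.range m, C (digitAt (κ i) (α * a + j)) *
        (X ^ a * (truncPoly b m n * q (α * i + j))) := by
    conv_lhs => rw [truncPoly.eq_1 b m (blockWord _ _ _ _), Finset.sum_mul, Finset.mul_sum]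
    refine Finset.sum_congr rfl fun a ha => ?_
    rw [blockWord_digit _ _ ((Finset.mem_range.1 ha).trans_le hM)]
    ring
  rw [h2, residue_sum]
  symm
  refine Finset.sum_subset_zero_on_sdiff (Finset.range_subset_range.2 hM) ?_ ?_
  · intro a ha
    rw [Finset.mem_sdiff, Finset.mem_range, Finset.mem_range] at ha
    rw [nodeDigit, Nat.mul_add_div hα, Nat.div_eq_of_lt hj, if_neg (by omega), mul_zero]
  · intro a ha
    rw [nodeDigit, Nat.mul_add_div hα, Nat.div_eq_of_lt hj, Nat.mul_add_mod, Nat.mod_eq_of_lt hj,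
      if_pos (by simpa using ha), residue_C_mul, add_zero]

theorem sum_stdAddChar_dot {s M : ℕ} (e : Fin s → Fin M → ZMod b) :
    ∑ κ : Fin s → Fin M → ZMod b, (ZMod.stdAddChar (∑ j, ∑ i, κ j i * e j i) : ℂ) =
      if e = 0 then (b : ℂ) ^ (M * s) else 0 := by
  classical
  let ψ : AddChar (Fin s → Fin M → ZMod b) ℂ :=
    { toFun := fun κ => ZMod.stdAddChar (∑ j, ∑ i, κ j i * e j i)
      map_zero_eq_one' := by simp
      map_add_eq_mul' := fun κ κ' => by
        simp only [Pi.add_apply, add_mul, Finset.sum_add_distrib, AddChar.map_add_eq_mul] }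
  have h := AddChar.sum_eq_ite ψ
  have hc : (Fintype.card (Fin s → Fin M → ZMod b) : ℂ) = (b : ℂ) ^ (M * s) := by
    simp [ZMod.card, pow_mul]
  rw [hc] at h
  have h1 : ψ = 0 ↔ e = 0 := by
    constructor
    · intro h0
      by_contra he
      obtain ⟨j, hj⟩ := Function.ne_iff.1 he
      obtain ⟨i, hi⟩ := Function.ne_iff.1 hj
      refine stdAddChar_ne_one hi ?_
      have := DFunLike.congr_fun h0 (Pi.single j (Pi.single i 1))
      rw [AddChar.zero_apply] at this
      rw [← this]
      change _ = ZMod.stdAddChar _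
      congr 1
      rw [Finset.sum_eq_single j, Finset.sum_eq_single i]
      · simp
      · intro i' _ hi'
        simp [hi']
      · simp
      · intro j' _ hj'
        simp [hj']
      · simp
    · rintro rfl
      ext κ
      change ZMod.stdAddChar _ = _
      simp
  simp only [h1] at h
  exact h

/-- After interchanging the sums, orthogonality in `κ` singles out the grid point `e`. -/
theorem walsh_inversion {s M : ℕ} (F : (Fin s → ℝ) → ℂ) (e : Fin s → Fin M → ZMod b) :
    ∑ κ : Fin s → Fin M → ZMod b,
      ZMod.stdAddChar (-∑ j, ∑ i, κ j i * e j i) * walshCoeffMulti M κ F =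
      F fun j => gridPoint M (e j) := by
  classical
  have hb0 : (b : ℂ) ≠ 0 := by exact_mod_cast (Fact.out : b.Prime).ne_zero
  unfold walshCoeffMulti
  calc _ = ∑ d : Fin s → Fin M → ZMod b, ((b : ℂ) ^ (M * s))⁻¹ * (F fun j => gridPoint M (d j)) *
        ∑ κ : Fin s → Fin M → ZMod b, ZMod.stdAddChar (∑ j, ∑ i, κ j i * (d - e) j i) := by
        simp only [Finset.mul_sum]
        rw [Finset.sum_comm]
        refine Finset.sum_congr rfl fun d _ => Finset.sum_congr rfl fun κ _ => ?_
        simp only [Pi.sub_apply, mul_sub, Finset.sum_sub_distrib]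
        rw [sub_eq_add_neg, AddChar.map_add_eq_mul]
        ring
    _ = _ := by
        simp only [sum_stdAddChar_dot, sub_eq_zero, mul_ite, mul_zero]
        rw [Finset.sum_ite_eq' Finset.univ e, if_pos (Finset.mem_univ _)]
        field_simp

end Digits

end QMC
end

/-! ### Aliasing: the quadrature rule and the dual net -/

noncomputable section
namespace QMC
open Polynomial

section Error

variable {b : ℕ} [Fact b.Prime]

theorem digitCount_zero (M : ℕ) : digitCount M (0 : Fin M → ZMod b) = 0 := by
  induction M with
  | zero => rfl
  | succ M ih =>
    have h : Fin.tail (0 : Fin (M + 1) → ZMod b) = 0 := rfl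
    rw [digitCount, h, ih]
    simp

theorem one_le_walshOrder {α M : ℕ} (hα : 1 ≤ α) {κ : Fin M → ZMod b} (hκ : κ ≠ 0) :
    1 ≤ walshOrder α M κ := by
  obtain ⟨i, hi⟩ := Function.ne_iff.1 hκ
  have := card_le_digitCount M κ {i} (by simpa using hi)
  rw [walshOrder_eq_min]
  simp at this
  omega

/-- For nonzero `κ` the constants are covered by `walsh_factor_le` and the powers of `b` by
`sum_mu1_le_walshExp`. For `κ = 0` everything equals one, so a coordinate that is not involved costs
no weight. -/
theorem coord_walsh_le {α M : ℕ} (hα : 2 ≤ α) (κ : Fin (M * α) → ZMod b) {x : ℝ} (hx : 0 ≤ x) :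
    walshBound α (M * α) κ *
        (((walshOrder α (M * α) κ).factorial : ℝ) * x ^ walshOrder α (M * α) κ) ≤
      (if κ = 0 then 1 else walshConst α b * (b : ℝ) ^ (α * (α - 1) / 2) * coordWeight α x) *
        ∏ j ∈ Finset.range α, ((b : ℝ) ^ (α * mu1 b (blockWord α M κ j)))⁻¹ := by
  have hb : 1 < b := (Fact.out : b.Prime).one_lt
  have hb1 : (1 : ℝ) ≤ b := by exact_mod_cast hb.le
  split_ifs with h
  · subst h
    have h0 : walshOrder α (M * α) (0 : Fin (M * α) → ZMod b) = 0 := by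
      rw [walshOrder_eq_min, digitCount_zero, Nat.min_zero]
    rw [walshBound, walshExp_of_walshOrder_eq_zero (by omega) _ _ h0, h0]
    simp [oscBound, blockWord_zero, mu1_zero]
  · have h1 := one_le_walshOrder (α := α) (by omega) h
    have h2 := walsh_factor_le hb hα h1 (walshOrder_le α _ κ) hx
    have h3 : ((b : ℝ) ^ walshExp α (M * α) κ)⁻¹ ≤ (b : ℝ) ^ (α * (α - 1) / 2) *
        ∏ j ∈ Finset.range α, ((b : ℝ) ^ (α * mu1 b (blockWord α M κ j)))⁻¹ := by
      rw [Finset.prod_inv_distrib, Finset.prod_pow_eq_pow_sum, ← Finset.mul_sum, ← div_eq_mul_inv,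
        inv_eq_one_div, div_le_div_iff₀ (by positivity) (by positivity), one_mul, ← pow_add]
      refine pow_le_pow_right₀ hb1 ?_
      have := sum_mu1_le_walshExp κ
      omega
    have h4 : 0 ≤ walshConst α b * coordWeight α x :=
      mul_nonneg (walshConst_pos hb).le (coordWeight_nonneg α hx)
    calc _ = (oscBound b (walshOrder α (M * α) κ) + 1) *
          ((2 * Real.sin (Real.pi / b)) ^ walshOrder α (M * α) κ)⁻¹ *
          (((walshOrder α (M * α) κ).factorial : ℝ) * x ^ walshOrder α (M * α) κ) *
          ((b : ℝ) ^ walshExp α (M * α) κ)⁻¹ := by rw [walshBound, mul_inv]; ring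
      _ ≤ walshConst α b * coordWeight α x * ((b : ℝ) ^ (α * (α - 1) / 2) *
          ∏ j ∈ Finset.range α, ((b : ℝ) ^ (α * mu1 b (blockWord α M κ j)))⁻¹) := by gcongr
      _ = _ := by ring

/-- The components in which a frequency vector is supported. -/
def wordSupport {s : ℕ} (α M : ℕ) (κ : Fin s → Fin (M * α) → ZMod b) : Finset ℕ :=
  (Finset.range (α * s)).filter fun t => dualWord α M κ t ≠ 0

theorem mem_image_wordSupport {s α M : ℕ} (κ : Fin s → Fin (M * α) → ZMod b) (i : Fin s) :
    (i : ℕ) ∈ (wordSupport α M κ).image (· / α) ↔ κ i ≠ 0 := by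
  simp only [wordSupport, Finset.mem_image, Finset.mem_filter, Finset.mem_range]
  constructor
  · rintro ⟨t, ⟨ht, h0⟩, hti⟩ h
    have hα : 0 < α := Nat.pos_of_ne_zero (by rintro rfl; simp at ht)
    rw [← Nat.div_add_mod t α, hti, dualWord_mul_add κ i (Nat.mod_lt _ hα), h, blockWord_zero] at h0
    exact h0 rfl
  · intro h
    have : ∃ j < α, blockWord α M (κ i) j ≠ 0 := by
      by_contra! h'
      exact h (eq_of_blockWord_eq fun j hj => (h' j hj).trans (blockWord_zero α M j).symm)
    obtain ⟨j, hj, h1⟩ := this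
    refine ⟨α * i + j, ⟨?_, by rwa [dualWord_mul_add κ i hj]⟩, ?_⟩
    · calc α * (i : ℕ) + j < α * i + α := by omega
        _ = α * (i + 1) := by ring
        _ ≤ α * s := Nat.mul_le_mul_left _ i.2
    · rw [Nat.mul_add_div (by omega), Nat.div_eq_of_lt hj, add_zero]

/-- The coordinates with nonzero `κ i` are exactly the blocks met by the support, so the product of
the coordinate bounds is the set weight times the decay. -/
theorem prod_walsh_le {s α M : ℕ} (hα : 2 ≤ α) (κ : Fin s → Fin (M * α) → ZMod b) {β : ℕ → ℝ}
    (hβ : ∀ j, 0 < β j) :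
    (∏ i, walshBound α (M * α) (κ i)) * ((∏ i, ((walshOrder α (M * α) (κ i)).factorial : ℝ)) *
        ∏ i : Fin s, β i ^ walshOrder α (M * α) (κ i)) ≤
      setWeight b α β (wordSupport α M κ) *
        ((b : ℝ) ^ (α * ∑ t ∈ wordSupport α M κ, mu1 b (dualWord α M κ t)))⁻¹ := by
  rw [← Finset.prod_mul_distrib, ← Finset.prod_mul_distrib]
  refine (Finset.prod_le_prod (fun i _ => ?_) fun i _ =>
    coord_walsh_le hα (κ i) (hβ i).le).trans (le_of_eq ?_)
  · have := walshBound_nonneg α (M * α) (κ i)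
    have := (hβ i).le
    positivity
  rw [Finset.prod_mul_distrib]
  congr 1
  · rw [setWeight_eq, blockWeight]
    have h1 : (wordSupport α M κ).image (· / α) ⊆ Finset.range s := by
      intro i hi
      obtain ⟨t, ht, rfl⟩ := Finset.mem_image.1 hi
      have := Finset.mem_range.1 (Finset.mem_filter.1 ht).1
      exact Finset.mem_range.2 (Nat.div_lt_of_lt_mul this)
    rw [← Finset.inter_eq_right.2 h1, ← Finset.prod_ite_mem, Finset.prod_range]
    refine Finset.prod_congr rfl fun i _ => ?_
    simp only [mem_image_wordSupport, ite_not]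
    rfl
  · have h2 : ∏ t ∈ Finset.range (α * s), ((b : ℝ) ^ (α * mu1 b (dualWord α M κ t)))⁻¹ =
        ∏ i : Fin s, ∏ j ∈ Finset.range α, ((b : ℝ) ^ (α * mu1 b (blockWord α M (κ i) j)))⁻¹ := by
      rw [mul_comm α s, prod_range_mul_eq, Finset.prod_range]
      refine Finset.prod_congr rfl fun i _ => Finset.prod_congr rfl fun j hj => ?_
      rw [dualWord_mul_add κ i (Finset.mem_range.1 hj)]
    rw [← h2, Finset.mul_sum, ← Finset.prod_pow_eq_pow_sum, ← Finset.prod_inv_distrib, wordSupport,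
      Finset.prod_filter]
    refine Finset.prod_congr rfl fun t _ => ?_
    split_ifs with h
    · rfl
    · rw [not_not.1 h, mu1_zero]
      simp

theorem summable_dualNet {m α : ℕ} (hα : 2 ≤ α) (P : (ZMod b)[X]) (q : ℕ → (ZMod b)[X])
    (v : Finset ℕ) :
    Summable fun l : dualNet b m P q v => ((b : ℝ) ^ (α * ∑ j : v, mu1 b (l.1 j)))⁻¹ := by
  have hb : 1 < b := (Fact.out : b.Prime).one_lt
  have h := (hasSum_pi_prod (fun _ : v => decay b α) (fun _ => ∑' l, decay b α l)
    (fun _ => decay_nonneg b α) fun _ => (summable_decay hb hα).hasSum).summable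
  refine (h.subtype (dualNet b m P q v)).congr fun l => ?_
  rw [Finset.mul_sum, ← Finset.prod_pow_eq_pow_sum, ← Finset.prod_inv_distrib]
  refine Finset.prod_congr rfl fun j _ => ?_
  rw [decay, if_neg (l.2.1 j).ne']

/-- Frequencies are sorted by their support `v`. On each class, passing to the words on `v` is
injective into the dual net, so a finite part of a convergent nonnegative series is compared with
the whole. -/
theorem sum_dual_le_criterion {s α M m : ℕ} (hα : 2 ≤ α) {β : ℕ → ℝ} (hβ : ∀ j, 0 < β j)
    (P : (ZMod b)[X]) (q : ℕ → (ZMod b)[X]) (S : Finset (Fin s → Fin (M * α) → ZMod b))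
    (hS : ∀ κ ∈ S, κ ≠ 0 ∧
      P ∣ ∑ t ∈ Finset.range (α * s), truncPoly b m (dualWord α M κ t) * q t) :
    ∑ κ ∈ S, setWeight b α β (wordSupport α M κ) *
        ((b : ℝ) ^ (α * ∑ t ∈ wordSupport α M κ, mu1 b (dualWord α M κ t)))⁻¹ ≤
      criterion b m α β P (α * s) q := by
  classical
  have hb : 1 < b := (Fact.out : b.Prime).one_lt
  have hmaps : ∀ κ ∈ S, wordSupport α M κ ∈
      (Finset.range (α * s)).powerset.filter Finset.Nonempty := by
    intro κ hκ
    rw [Finset.mem_filter, Finset.mem_powerset]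
    refine ⟨Finset.filter_subset _ _, ?_⟩
    obtain ⟨i, hi⟩ := Function.ne_iff.1 (hS κ hκ).1
    have := (mem_image_wordSupport κ i).2 hi
    exact Finset.image_nonempty.1 ⟨_, this⟩
  rw [criterion, ← Finset.sum_fiberwise_of_maps_to hmaps]
  refine Finset.sum_le_sum fun v _ => ?_
  have hw : 0 ≤ setWeight b α β v := by
    rw [setWeight_eq]
    exact Finset.prod_nonneg fun j _ => cbcWeight_nonneg hb α hβ j
  set Sv := S.filter fun κ => wordSupport α M κ = v with hSv
  have h1 : ∑ κ ∈ Sv, setWeight b α β (wordSupport α M κ) *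
        ((b : ℝ) ^ (α * ∑ t ∈ wordSupport α M κ, mu1 b (dualWord α M κ t)))⁻¹ =
      setWeight b α β v * ∑ κ ∈ Sv, ((b : ℝ) ^ (α * ∑ t : v, mu1 b (dualWord α M κ t)))⁻¹ := by
    rw [Finset.mul_sum]
    refine Finset.sum_congr rfl fun κ hκ => ?_
    rw [(Finset.mem_filter.1 hκ).2, Finset.sum_coe_sort v fun t => mu1 b (dualWord α M κ t)]
  rw [h1]
  refine mul_le_mul_of_nonneg_left ?_ hw
  have hmem : ∀ κ : Sv, (fun t : v => dualWord α M κ.1 t) ∈ dualNet b m P q v := by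
    rintro ⟨κ, hκ⟩
    obtain ⟨hκS, hκv⟩ := Finset.mem_filter.1 hκ
    refine ⟨fun j => Nat.pos_of_ne_zero ?_, ?_⟩
    · have h : (j : ℕ) ∈ wordSupport α M κ := hκv ▸ j.2
      exact (Finset.mem_filter.1 h).2
    · rw [Finset.sum_coe_sort v fun t => truncPoly b m (dualWord α M κ t) * q t, ← hκv, wordSupport,
        Finset.sum_filter]
      convert (hS κ hκS).2 using 1
      refine Finset.sum_congr rfl fun t _ => ?_
      split_ifs with h
      · rfl
      · rw [not_not.1 h, truncPoly_zero, zero_mul]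
  let e : Sv → dualNet b m P q v := fun κ => ⟨_, hmem κ⟩
  have he : Function.Injective e := by
    rintro ⟨κ, hκ⟩ ⟨κ', hκ'⟩ h
    refine Subtype.ext (dualWord_injective (funext fun t => ?_))
    have h2 := congrArg Subtype.val h
    by_cases ht : t ∈ v
    · exact congrFun h2 ⟨t, ht⟩
    · have h3 : ∀ κ ∈ Sv, dualWord α M κ t = 0 := by
        intro κ hκ
        by_contra h0
        rcases lt_or_ge t (α * s) with h4 | h4
        · exact ht ((Finset.mem_filter.1 hκ).2 ▸ Finset.mem_filter.2 ⟨Finset.mem_range.2 h4, h0⟩)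
        · rw [dualWord, dif_neg] at h0
          · exact h0 rfl
          · rw [not_lt, Nat.le_div_iff_mul_le (by omega), mul_comm]
            exact h4
      rw [h3 κ hκ, h3 κ' hκ']
  calc ∑ κ ∈ Sv, ((b : ℝ) ^ (α * ∑ t : v, mu1 b (dualWord α M κ t)))⁻¹
      = ∑ κ : Sv, ((b : ℝ) ^ (α * ∑ t : v, mu1 b ((e κ).1 t)))⁻¹ :=
        (Finset.sum_coe_sort Sv fun κ => ((b : ℝ) ^ (α * ∑ t : v, mu1 b (dualWord α M κ t)))⁻¹).symm
    _ = ∑ l ∈ Finset.univ.image e, ((b : ℝ) ^ (α * ∑ t : v, mu1 b (l.1 t)))⁻¹ :=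
        (Finset.sum_image (f := fun l : dualNet b m P q v =>
          ((b : ℝ) ^ (α * ∑ t : v, mu1 b (l.1 t)))⁻¹) fun _ _ _ _ h => he h).symm
    _ ≤ _ := (summable_dualNet hα P q v).sum_le_tsum _ fun _ _ => by positivity

/-! ### The quadrature error for the digital nodes -/

/-- Every node value is expanded by `walsh_inversion`; the character sums over the nodes then keep
only the frequencies in the dual net. -/
theorem sum_nodes_eq {s α M m : ℕ} {P : (ZMod b)[X]} [Fact (Irreducible P)] (hα : 2 ≤ α)
    (hm : 1 ≤ m) (hP : P ≠ 0) (hd : P.natDegree = m) (hM : m ≤ M) (q : ℕ → (ZMod b)[X])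
    (F : (Fin s → ℝ) → ℂ) :
    ∑ n : Fin (b ^ m), F (interlacedPoint b m α s P q n) =
      (b : ℂ) ^ m * ∑ κ : Fin s → Fin (M * α) → ZMod b,
        open Classical in
        if P ∣ ∑ t ∈ Finset.range (α * s), truncPoly b m (dualWord α M κ t) * q t then
          walshCoeffMulti (M * α) κ F else 0 := by
  classical
  have h1 : ∀ n : ℕ, F (interlacedPoint b m α s P q n) =
      ∑ κ : Fin s → Fin (M * α) → ZMod b, fieldChar hP (wordClass m P n *
        AdjoinRoot.mk P (-∑ t ∈ Finset.range (α * s), truncPoly b m (dualWord α M κ t) * q t)) *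
        walshCoeffMulti (M * α) κ F := by
    intro n
    rw [_root_.funext (interlacedPoint_eq_gridPoint hM (by omega) P q n : ∀ i : Fin s, _)]
    refine (walsh_inversion F fun (i : Fin s) (k : Fin (M * α)) =>
      nodeDigit m α P q n i k).symm.trans ?_
    refine Finset.sum_congr rfl fun κ _ => ?_
    rw [sum_mul_nodeDigit hM (by omega), wordClass, ← map_mul, fieldChar_mk, mul_neg]
    congr 2
    rw [eq_comm, eq_neg_iff_add_eq_zero, ← residue_add, neg_add_cancel]
    simp [residue, laurentAtInfty_zero]
  simp only [h1]
  rw [Finset.sum_comm, Finset.mul_sum]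
  refine Finset.sum_congr rfl fun κ _ => ?_
  rw [← Finset.sum_mul, wordClass_char_sum hm hP hd]
  have h2 : AdjoinRoot.mk P (-∑ t ∈ Finset.range (α * s),
      truncPoly b m (dualWord α M κ t) * q t) = 0 ↔
      P ∣ ∑ t ∈ Finset.range (α * s), truncPoly b m (dualWord α M κ t) * q t := by
    rw [AdjoinRoot.mk_eq_zero, dvd_neg]
  simp only [h2]
  split_ifs <;> simp

/-- Apart from zero, each surviving frequency is bounded by its weight in the criterion. The bound
does not involve `M`, so the grid can be refined afterwards. -/
theorem norm_quadrature_sub_le {s α M m : ℕ} {P : (ZMod b)[X]} [Fact (Irreducible P)]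
    (hα : 2 ≤ α) (hm : 1 ≤ m) (hP : P ≠ 0) (hd : P.natDegree = m) (hM : m ≤ M)
    (q : ℕ → (ZMod b)[X]) {β : ℕ → ℝ} (hβ : ∀ j, 0 < β j) {c : ℝ} (hc : 0 < c)
    (D : (Fin s → ℕ) → (Fin s → ℝ) → ℝ) (hD : IsMixedPartials α (D 0) D)
    (hB : ProductBound α β c D) :
    ‖((quadrature (b ^ m) (interlacedPoint b m α s P q) (D 0) : ℝ) : ℂ) -
        walshCoeffMulti (M * α) (0 : Fin s → Fin (M * α) → ZMod b) fun y => (D 0 y : ℂ)‖ ≤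
      c * criterion b m α β P (α * s) q := by
  classical
  have hb0 : (b : ℂ) ≠ 0 := by exact_mod_cast (Fact.out : b.Prime).ne_zero
  have h1 : ((quadrature (b ^ m) (interlacedPoint b m α s P q) (D 0) : ℝ) : ℂ) =
      ∑ κ : Fin s → Fin (M * α) → ZMod b,
        if P ∣ ∑ t ∈ Finset.range (α * s), truncPoly b m (dualWord α M κ t) * q t then
          walshCoeffMulti (M * α) κ (fun y => (D 0 y : ℂ)) else 0 := by
    have := sum_nodes_eq (s := s) hα hm hP hd hM q (fun y => (D 0 y : ℂ))
    unfold quadrature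
    push_cast
    rw [Finset.sum_range, this, ← mul_assoc, one_div_mul_cancel (by positivity), one_mul]
  have h0 : (0 : Fin s → Fin (M * α) → ZMod b) ∈ Finset.univ.filter
      fun κ : Fin s → Fin (M * α) → ZMod b =>
        P ∣ ∑ t ∈ Finset.range (α * s), truncPoly b m (dualWord α M κ t) * q t := by
    rw [Finset.mem_filter]
    refine ⟨Finset.mem_univ _, ?_⟩
    rw [Finset.sum_eq_zero]
    · exact dvd_zero _
    · intro t _
      have : dualWord α M (0 : Fin s → Fin (M * α) → ZMod b) t = 0 := by
        unfold dualWord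
        split_ifs
        · exact blockWord_zero _ _ _
        · rfl
      rw [this, truncPoly_zero, zero_mul]
  rw [h1, ← Finset.sum_filter, ← Finset.add_sum_erase _ _ h0, add_sub_cancel_left]
  refine (norm_sum_le _ _).trans ?_
  have hfam : IsPartialFamily α fun ν (y : Fin s → ℝ) => (D ν y : ℂ) := fun ν j hν hj y hy =>
    (hD.succ ν j hν hj y hy).ofReal_comp
  calc _ ≤ ∑ κ ∈ (Finset.univ.filter fun κ : Fin s → Fin (M * α) → ZMod b =>
          P ∣ ∑ t ∈ Finset.range (α * s), truncPoly b m (dualWord α M κ t) * q t).erase 0,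
        c * (setWeight b α β (wordSupport α M κ) *
          ((b : ℝ) ^ (α * ∑ t ∈ wordSupport α M κ, mu1 b (dualWord α M κ t)))⁻¹) := by
        refine Finset.sum_le_sum fun κ _ => ?_
        refine (norm_walshCoeffMulti_le (α := α) (by omega) (M * α) κ _ hfam (fun y hy => by
          rw [Complex.norm_real]
          exact hB _ (fun j => walshOrder_le _ _ _) y hy)).trans ?_
        refine le_trans (le_of_eq ?_) (mul_le_mul_of_nonneg_left (prod_walsh_le hα κ hβ) hc.le)
        ring
    _ ≤ _ := by
        rw [← Finset.mul_sum]
        refine mul_le_mul_of_nonneg_left (sum_dual_le_criterion hα hβ P q _ fun κ hκ => ?_) hc.le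
        rw [Finset.mem_erase, Finset.mem_filter] at hκ
        exact ⟨hκ.1, hκ.2.2⟩

end Error
end QMC
end

noncomputable section
namespace QMC

section Riemann

open scoped Pointwise

/-! ### Convergence of the Riemann sums -/

theorem abs_sub_update_le {s : ℕ} {F : (Fin s → ℝ) → ℝ} {G : (Fin s → ℝ) → ℝ} {B : ℝ} (j : Fin s)
    (hF : ∀ y ∈ Set.Icc (0 : Fin s → ℝ) 1,
      HasDerivWithinAt (fun t => F (Function.update y j t)) (G y) (Set.Icc 0 1) (y j))
    (hG : ∀ y ∈ Set.Icc (0 : Fin s → ℝ) 1, |G y| ≤ B) {y : Fin s → ℝ}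
    (hy : y ∈ Set.Icc (0 : Fin s → ℝ) 1) {t : ℝ} (ht : t ∈ Set.Icc (0 : ℝ) 1) :
    |F (Function.update y j t) - F y| ≤ B * |t - y j| := by
  have hmem : ∀ u ∈ Set.Icc (0 : ℝ) 1, Function.update y j u ∈ Set.Icc (0 : Fin s → ℝ) 1 := by
    intro u hu
    refine ⟨fun i => ?_, fun i => ?_⟩ <;> rcases eq_or_ne i j with rfl | h
    · simpa using hu.1
    · simpa [h] using hy.1 i
    · simpa using hu.2
    · simpa [h] using hy.2 i
  have h1 : ∀ u ∈ Set.Icc (0 : ℝ) 1, HasDerivWithinAt (fun t => F (Function.update y j t))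
      (G (Function.update y j u)) (Set.Icc 0 1) u := by
    intro u hu
    simpa using hF _ (hmem u hu)
  have h2 := (convex_Icc (0 : ℝ) 1).norm_image_sub_le_of_norm_hasDerivWithin_le h1
    (fun u hu => hG _ (hmem u hu)) ⟨hy.1 j, hy.2 j⟩ ht
  simpa using h2

/-- Coordinates are exchanged one at a time, each at the cost of a bounded derivative times a
length. Only partial derivatives are assumed of the integrand, so its continuity has to be obtained
in this way. -/
theorem continuousOn_of_partials {s : ℕ} {F : (Fin s → ℝ) → ℝ} {G : Fin s → (Fin s → ℝ) → ℝ}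
    {B : Fin s → ℝ} (hF : ∀ j, ∀ y ∈ Set.Icc (0 : Fin s → ℝ) 1,
      HasDerivWithinAt (fun t => F (Function.update y j t)) (G j y) (Set.Icc 0 1) (y j))
    (hG : ∀ j, ∀ y ∈ Set.Icc (0 : Fin s → ℝ) 1, |G j y| ≤ B j) :
    ContinuousOn F (Set.Icc 0 1) := by
  classical
  have key : ∀ x ∈ Set.Icc (0 : Fin s → ℝ) 1, ∀ y ∈ Set.Icc (0 : Fin s → ℝ) 1, ∀ S : Finset (Fin s),
      |F (S.piecewise y x) - F x| ≤ ∑ j ∈ S, B j * |y j - x j| := by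
    intro x hx y hy S
    induction S using Finset.induction_on with
    | empty => simp
    | insert j S hj ih =>
      rw [Finset.piecewise_insert, Finset.sum_insert hj]
      have hm : S.piecewise y x ∈ Set.Icc (0 : Fin s → ℝ) 1 :=
        ⟨Finset.le_piecewise_of_le_of_le _ hy.1 hx.1, Finset.piecewise_le_of_le_of_le _ hy.2 hx.2⟩
      have := abs_sub_update_le j (hF j) (hG j) hm ⟨hy.1 j, hy.2 j⟩
      rw [Finset.piecewise_eq_of_notMem _ _ _ hj] at this
      exact (abs_sub_le _ (F (S.piecewise y x)) _).trans (add_le_add this ih)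
  intro x hx
  rw [ContinuousWithinAt, tendsto_iff_norm_sub_tendsto_zero]
  refine squeeze_zero' (g := fun y => ∑ j, B j * |y j - x j|)
    (Filter.Eventually.of_forall fun _ => norm_nonneg _) ?_ ?_
  · filter_upwards [self_mem_nhdsWithin] with y hy
    simpa using key x hx y hy Finset.univ
  · have : Continuous fun y : Fin s → ℝ => ∑ j, B j * |y j - x j| := by fun_prop
    have h := (this.tendsto x).mono_left (nhdsWithin_le_nhds (s := Set.Icc 0 1))
    simpa using h

variable {b : ℕ} [Fact b.Prime]

theorem gridPoint_eq_div (M : ℕ) (d : Fin M → ZMod b) :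
    gridPoint M d = ((∑ r ∈ Finset.range M, (digitAt d (M - 1 - r)).val * b ^ r : ℕ) : ℝ) /
      (b : ℝ) ^ M := by
  have hb0 : (b : ℝ) ≠ 0 := by exact_mod_cast (Fact.out : b.Prime).ne_zero
  unfold gridPoint
  push_cast
  rw [Finset.sum_div, ← Finset.sum_range_reflect, Finset.sum_range]
  refine Finset.sum_congr rfl fun i _ => ?_
  have h := i.2
  rw [show M - 1 - (M - 1 - (i : ℕ)) = i by omega, digitAt, dif_pos h,
    div_eq_div_iff (by positivity) (by positivity), mul_assoc, ← pow_add,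
    show M - 1 - (i : ℕ) + (i + 1) = M by omega]

/-- Digit vectors are the integers of the interval `[0, b^M)`. -/
def gridIndex (M : ℕ) (d : Fin M → ZMod b) : ℕ :=
  ∑ r ∈ Finset.range M, (digitAt d (M - 1 - r)).val * b ^ r

theorem gridIndex_lt (M : ℕ) (d : Fin M → ZMod b) : gridIndex M d < b ^ M :=
  digit_sum_lt (Fact.out : b.Prime).pos (fun r => (digitAt d (M - 1 - r)).val)
    (fun _ => ZMod.val_lt _) M

theorem exists_gridIndex (M : ℕ) {z : ℕ} (hz : z < b ^ M) :
    ∃ d : Fin M → ZMod b, gridIndex M d = z := by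
  refine ⟨fun i => ((z / b ^ (M - 1 - (i : ℕ)) : ℕ) : ZMod b), ?_⟩
  rw [gridIndex]
  conv_rhs => rw [← Nat.mod_eq_of_lt hz, ← digit_sum]
  refine Finset.sum_congr rfl fun r hr => ?_
  have := Finset.mem_range.1 hr
  rw [digitAt, dif_pos (by omega), ZMod.val_natCast,
    show M - 1 - (M - 1 - r) = r by omega]

theorem gridIndex_injective (M : ℕ) : Function.Injective (gridIndex M : (Fin M → ZMod b) → ℕ) := by
  intro d d' h
  ext i
  have hi := i.2
  have h1 : ∀ d : Fin M → ZMod b, gridIndex M d / b ^ (M - 1 - (i : ℕ)) % b = (d i).val := by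
    intro d
    rw [gridIndex, digit_of_digit_sum (Fact.out : b.Prime).pos
      (fun r => (digitAt d (M - 1 - r)).val) (fun _ => ZMod.val_lt _) M _ (by omega),
      show M - 1 - (M - 1 - (i : ℕ)) = i by omega, digitAt, dif_pos hi]
  have := h1 d
  rw [h, h1 d'] at this
  exact (ZMod.val_injective b this).symm

/-- The grid consists of the points of the scaled integer lattice in the half-open cube, the form in
which convergence of Riemann sums is available. -/
theorem tsum_lattice_eq {s : ℕ} (M : ℕ) (F : (Fin s → ℝ) → ℝ) :
    ∑' x : ↑((Set.univ.pi fun _ : Fin s => Set.Ico (0 : ℝ) 1) ∩ (((b ^ M : ℕ) : ℝ)⁻¹ •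
      (Submodule.span ℤ (Set.range (Pi.basisFun ℝ (Fin s))) : Set (Fin s → ℝ)))), F x =
    ∑ d : Fin s → Fin M → ZMod b, F fun j => gridPoint M (d j) := by
  have hb : 0 < b := (Fact.out : b.Prime).pos
  have : NeZero (b ^ M) := ⟨by positivity⟩
  have hbM : (0 : ℝ) < ((b ^ M : ℕ) : ℝ) := by positivity
  have hgrid : ∀ d : Fin M → ZMod b, gridPoint M d = (gridIndex M d : ℝ) / ((b ^ M : ℕ) : ℝ) := by
    intro d
    rw [gridPoint_eq_div, Nat.cast_pow]
    rfl
  let e : (Fin s → Fin M → ZMod b) → ↑((Set.univ.pi fun _ : Fin s => Set.Ico (0 : ℝ) 1) ∩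
      (((b ^ M : ℕ) : ℝ)⁻¹ • (Submodule.span ℤ (Set.range (Pi.basisFun ℝ (Fin s))) :
        Set (Fin s → ℝ)))) := fun d => ⟨fun j => gridPoint M (d j), by
    refine ⟨fun j _ => ?_, BoxIntegral.unitPartition.mem_smul_span_iff.2 fun j => ?_⟩
    · change gridPoint M (d j) ∈ Set.Ico (0 : ℝ) 1
      rw [hgrid]
      have := gridIndex_lt M (d j)
      refine ⟨by positivity, ?_⟩
      rw [div_lt_one hbM]
      exact_mod_cast this
    · refine ⟨(gridIndex M (d j) : ℤ), ?_⟩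
      rw [hgrid, mul_div_cancel₀ _ hbM.ne']
      simp⟩
  have he : Function.Bijective e := by
    constructor
    · intro d d' h
      funext j
      have h1 := congrFun (congrArg Subtype.val h) j
      change gridPoint M (d j) = gridPoint M (d' j) at h1
      rw [hgrid, hgrid, div_left_inj' hbM.ne'] at h1
      exact gridIndex_injective M (by exact_mod_cast h1)
    · rintro ⟨x, hx, hx'⟩
      replace hx' := BoxIntegral.unitPartition.mem_smul_span_iff.1 hx'
      have h1 : ∀ j, ∃ d : Fin M → ZMod b, gridPoint M d = x j := by
        intro j
        obtain ⟨z, hz⟩ := hx' j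
        have h2 := hx j (Set.mem_univ j)
        have hz' : (z : ℝ) = ((b ^ M : ℕ) : ℝ) * x j := by simpa using hz
        have h3 : (0 : ℝ) ≤ z := by rw [hz']; exact mul_nonneg hbM.le h2.1
        obtain ⟨n, rfl⟩ := Int.eq_ofNat_of_zero_le (by exact_mod_cast h3 : 0 ≤ z)
        have h4 : ((n : ℕ) : ℝ) < ((b ^ M : ℕ) : ℝ) := by
          have : ((n : ℤ) : ℝ) = (n : ℝ) := by simp
          rw [← this, hz']
          nlinarith [h2.2]
        obtain ⟨d, hd⟩ := exists_gridIndex (b := b) M (by exact_mod_cast h4 : n < b ^ M)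
        refine ⟨d, ?_⟩
        rw [hgrid, hd, div_eq_iff hbM.ne', mul_comm, ← hz']
        simp
      choose d hd using h1
      exact ⟨d, Subtype.ext (funext hd)⟩
  rw [← (Equiv.ofBijective e he).tsum_eq, tsum_fintype]
  rfl

/-- The coefficient at zero is a Riemann sum. Composition with the projection onto the cube makes
the integrand continuous everywhere, and the half-open and closed cubes differ by a null set. -/
theorem tendsto_walshCoeffMulti_zero {s α : ℕ} (hα : 1 ≤ α) {F : (Fin s → ℝ) → ℝ}
    (hF : ContinuousOn F (Set.Icc 0 1)) :
    Filter.Tendsto (fun M : ℕ => walshCoeffMulti (M * α) (0 : Fin s → Fin (M * α) → ZMod b)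
      fun y => (F y : ℂ)) Filter.atTop (nhds ((cubeIntegral F : ℝ) : ℂ)) := by
  have hb : 1 < b := (Fact.out : b.Prime).one_lt
  let proj : (Fin s → ℝ) → Fin s → ℝ := fun y j => max 0 (min (y j) 1)
  have hproj : ∀ y, proj y ∈ Set.Icc (0 : Fin s → ℝ) 1 := fun y =>
    ⟨fun j => le_max_left _ _, fun j => max_le (by simp) (min_le_right _ _)⟩
  have hproj' : ∀ y ∈ Set.Icc (0 : Fin s → ℝ) 1, proj y = y := by
    intro y hy
    funext j
    have h1 : 0 ≤ y j := hy.1 j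
    have h2 : y j ≤ 1 := hy.2 j
    change max 0 (min (y j) 1) = y j
    rw [min_eq_left h2, max_eq_right h1]
  have hc : Continuous (F ∘ proj) :=
    hF.comp_continuous (by fun_prop) hproj
  set Q : Set (Fin s → ℝ) := Set.univ.pi fun _ => Set.Ico (0 : ℝ) 1 with hQ
  have hQb : Bornology.IsBounded Q := by
    refine (Metric.isBounded_Icc (0 : Fin s → ℝ) 1).subset fun y hy => ?_
    exact ⟨fun j => (hy j trivial).1, fun j => (hy j trivial).2.le⟩
  have hQm : MeasurableSet Q := MeasurableSet.univ_pi fun _ => measurableSet_Ico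
  have hQc : Convex ℝ Q := convex_pi fun _ _ => convex_Ico 0 1
  have h1 := tendsto_tsum_div_pow_atTop_integral Q (F ∘ proj) hc hQb hQm
    (hQc.addHaar_frontier MeasureTheory.volume)
  have h2 : Filter.Tendsto (fun M : ℕ => b ^ (M * α)) Filter.atTop Filter.atTop := by
    refine (tendsto_pow_atTop_atTop_of_one_lt hb).comp ?_
    exact Filter.tendsto_id.atTop_mul_const' (by omega)
  have h3 := h1.comp h2
  have h4 : ∫ x in Q, (F ∘ proj) x = cubeIntegral F := by
    have h5 : (Q : Set (Fin s → ℝ)) =ᵐ[MeasureTheory.volume] Set.Icc (0 : Fin s → ℝ) 1 := by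
      have := MeasureTheory.Measure.univ_pi_Ico_ae_eq_Icc
        (μ := fun _ : Fin s => (MeasureTheory.volume : MeasureTheory.Measure ℝ))
        (f := (0 : Fin s → ℝ)) (g := 1)
      exact this
    rw [MeasureTheory.setIntegral_congr_set h5, cubeIntegral]
    refine MeasureTheory.setIntegral_congr_fun measurableSet_Icc fun y hy => ?_
    rw [Function.comp_apply, hproj' y hy]
  rw [h4] at h3
  refine ((Complex.continuous_ofReal.tendsto _).comp h3).congr fun M => ?_
  simp only [Function.comp_apply]
  have h6 := tsum_lattice_eq (b := b) (s := s) (M * α) (F ∘ proj)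
  rw [← hQ] at h6
  simp only [Function.comp_apply] at h6
  rw [h6, Fintype.card_fin]
  unfold walshCoeffMulti
  push_cast
  rw [div_eq_inv_mul, ← pow_mul]
  congr 1
  refine Finset.sum_congr rfl fun d _ => ?_
  rw [hproj' _ ⟨fun j => (gridPoint_mem _ (d j)).1, fun j => (gridPoint_mem _ (d j)).2⟩]
  simp

end Riemann

/-! ### The quadrature error -/

/-- `norm_quadrature_sub_le` is uniform in the grid; in the limit the zero coefficient becomes the
integral. -/
theorem abs_cubeIntegral_sub_quadrature_le {b : ℕ} [Fact b.Prime] {s α m : ℕ}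
    {P : Polynomial (ZMod b)} (hirr : Irreducible P) (hα : 2 ≤ α) (hm : 1 ≤ m)
    (hd : P.natDegree = m) (q : ℕ → Polynomial (ZMod b)) {β : ℕ → ℝ} (hβ : ∀ j, 0 < β j) {c : ℝ}
    (hc : 0 < c) (F : (Fin s → ℝ) → ℝ) (D : (Fin s → ℕ) → (Fin s → ℝ) → ℝ)
    (hD : IsMixedPartials α F D) (hB : ProductBound α β c D) :
    |cubeIntegral F - quadrature (b ^ m) (interlacedPoint b m α s P q) F| ≤
      c * criterion b m α β P (α * s) q := by
  have : Fact (Irreducible P) := ⟨hirr⟩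
  have hD0 : IsMixedPartials α (D 0) D := ⟨fun _ _ => rfl, hD.succ⟩
  have h1 : cubeIntegral F = cubeIntegral (D 0) :=
    MeasureTheory.setIntegral_congr_fun measurableSet_Icc fun y hy => (hD.zero y hy).symm
  have h2 : quadrature (b ^ m) (interlacedPoint b m α s P q) F =
      quadrature (b ^ m) (interlacedPoint b m α s P q) (D 0) := by
    unfold quadrature
    congr 1
    refine Finset.sum_congr rfl fun n _ => (hD.zero _ ?_).symm
    rw [_root_.funext (interlacedPoint_eq_gridPoint le_rfl (by omega) P q n : ∀ i : Fin s, _)]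
    exact ⟨fun j => (gridPoint_mem _ _).1, fun j => (gridPoint_mem _ _).2⟩
  rw [h1, h2]
  have hcont : ContinuousOn (D 0) (Set.Icc 0 1) := by
    refine continuousOn_of_partials (G := fun j => D (0 + Pi.single j 1))
      (fun j y hy => hD.succ 0 j (by simp) (by simp; omega) y hy) fun j y hy => hB _ (fun i => ?_) y hy
    rcases eq_or_ne i j with rfl | h
    · simp; omega
    · simp [h]
  have hlim := tendsto_walshCoeffMulti_zero (b := b) (α := α) (by omega) hcont
  have h3 := (hlim.const_sub
    ((quadrature (b ^ m) (interlacedPoint b m α s P q) (D 0) : ℝ) : ℂ)).norm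
  have h4 := le_of_tendsto h3 (Filter.eventually_atTop.2 ⟨m, fun M hM =>
    norm_quadrature_sub_le hα hm hirr.ne_zero hd hM q hβ hc D hD0 hB⟩)
  rwa [← Complex.ofReal_sub, Complex.norm_real, Real.norm_eq_abs, abs_sub_comm] at h4

end QMC
end

noncomputable section
namespace QMC
open Polynomial

section FieldWords

variable {b : ℕ} [Fact b.Prime] {m : ℕ} {P : (ZMod b)[X]}

/-! ### Arithmetic of the residue field on words -/

theorem truncPoly_digit_sum (m : ℕ) (f : ℕ → ℕ) (hf : ∀ r, f r < b) :
    truncPoly b m (∑ r ∈ Finset.range m, f r * b ^ r) =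
      ∑ r ∈ Finset.range m, C ((f r : ℕ) : ZMod b) * X ^ r := by
  unfold truncPoly
  refine Finset.sum_congr rfl fun r hr => ?_
  rw [← ZMod.natCast_mod, digit_of_digit_sum (Fact.out : b.Prime).pos f hf m r
    (Finset.mem_range.1 hr)]

/-- Multiplication by `X` shifts the digits; the digit pushed out of the word reappears at `X ^ m`.
-/
theorem truncPoly_mul_base (hm : 1 ≤ m) (k : ℕ) :
    truncPoly b m (k * b) + C ((k / b ^ (m - 1) : ℕ) : ZMod b) * X ^ m = X * truncPoly b m k := by
  have hb : 0 < b := (Fact.out : b.Prime).pos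
  obtain ⟨m, rfl⟩ := Nat.exists_eq_add_of_le' hm
  unfold truncPoly
  rw [Finset.sum_range_succ', Nat.add_sub_cancel, Finset.sum_range_succ _ m, mul_add,
    Finset.mul_sum]
  simp only [pow_zero, Nat.div_one, Nat.cast_mul, CharP.cast_eq_zero, mul_zero, map_zero, zero_mul,
    add_zero]
  congr 1
  · refine Finset.sum_congr rfl fun r _ => ?_
    rw [pow_succ b, Nat.mul_div_mul_right _ _ hb, pow_succ X]
    ring
  · ring

/-- One step of Horner's scheme on words: `x · acc + d · z` modulo the polynomial with the reduced
leading term `x^m = ∑ R r x^r`. -/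
def fieldStep (b m : ℕ) (R : ℕ → ℕ) (acc d z : ℕ) : ℕ :=
  ∑ r ∈ Finset.range m, ((acc * b / b ^ r + acc / b ^ (m - 1) * R r + d * (z / b ^ r)) % b) * b ^ r

theorem fieldStep_lt (R : ℕ → ℕ) (acc d z : ℕ) : fieldStep b m R acc d z < b ^ m :=
  digit_sum_lt (Fact.out : b.Prime).pos _ (fun _ => Nat.mod_lt _ (Fact.out : b.Prime).pos) m

/-- `P` is its leading coefficient times `X ^ m - ∑ R r X ^ r`, so modulo `P` the overflow of the
shift can be replaced by the digits `R r`. -/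
theorem wordClass_fieldStep (hm : 1 ≤ m) (hd : P.natDegree = m) {R : ℕ → ℕ}
    (hR : ∀ r < m, P.leadingCoeff * (R r : ZMod b) = -P.coeff r) (acc d z : ℕ) :
    wordClass m P (fieldStep b m R acc d z) =
      AdjoinRoot.root P * wordClass m P acc + AdjoinRoot.of P (d : ZMod b) * wordClass m P z := by
  have hb : 0 < b := (Fact.out : b.Prime).pos
  have hP0 : P ≠ 0 := by rintro rfl; simp at hd; omega
  have hlc : P.leadingCoeff ≠ 0 := leadingCoeff_ne_zero.2 hP0
  have h1 : truncPoly b m (fieldStep b m R acc d z) =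
      truncPoly b m (acc * b) + C ((acc / b ^ (m - 1) : ℕ) : ZMod b) *
        (∑ r ∈ Finset.range m, C (R r : ZMod b) * X ^ r) + C (d : ZMod b) * truncPoly b m z := by
    rw [fieldStep, truncPoly_digit_sum m
      (fun r => (acc * b / b ^ r + acc / b ^ (m - 1) * R r + d * (z / b ^ r)) % b)
      (fun r => Nat.mod_lt _ hb)]
    unfold truncPoly
    rw [Finset.mul_sum, Finset.mul_sum, ← Finset.sum_add_distrib, ← Finset.sum_add_distrib]
    refine Finset.sum_congr rfl fun r _ => ?_
    rw [ZMod.natCast_mod]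
    push_cast
    simp only [map_add, map_mul]
    ring
  have h2 : P = C P.leadingCoeff * (X ^ m - ∑ r ∈ Finset.range m, C (R r : ZMod b) * X ^ r) := by
    conv_lhs => rw [P.as_sum_range_C_mul_X_pow, Finset.sum_range_succ, hd]
    rw [mul_sub, Finset.mul_sum, leadingCoeff, hd, sub_eq_add_neg, ← Finset.sum_neg_distrib, add_comm]
    congr 1
    refine Finset.sum_congr rfl fun r hr => ?_
    have := hR r (Finset.mem_range.1 hr)
    rw [leadingCoeff, hd] at this
    rw [← mul_assoc, ← C_mul, this]
    simp
  have h3 : AdjoinRoot.mk P (X ^ m) =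
      AdjoinRoot.mk P (∑ r ∈ Finset.range m, C (R r : ZMod b) * X ^ r) := by
    rw [AdjoinRoot.mk_eq_mk]
    refine ⟨C P.leadingCoeff⁻¹, ?_⟩
    conv_rhs => rw [h2]
    rw [mul_comm, ← mul_assoc, ← C_mul, leadingCoeff_mul, leadingCoeff_C]
    have h4 : (X ^ m - ∑ r ∈ Finset.range m, C (R r : ZMod b) * X ^ r).leadingCoeff = 1 := by
      have := congrArg leadingCoeff h2
      rw [leadingCoeff_mul, leadingCoeff_C] at this
      exact (mul_right_eq_self₀.1 this.symm).resolve_right hlc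
    rw [h4, mul_one, inv_mul_cancel₀ hlc, C_1, one_mul]
  have h4 := truncPoly_mul_base (b := b) hm acc
  unfold wordClass
  rw [h1, map_add, map_add, map_mul, map_mul, ← h3, ← map_mul, ← map_add, h4, map_mul,
    AdjoinRoot.mk_X, AdjoinRoot.mk_C]

theorem wordClass_eq_horner {y : ℕ} (hy : y < b ^ m) :
    wordClass m P y =
      AdjoinRoot.root P * wordClass m P (y / b) + AdjoinRoot.of P ((y % b : ℕ) : ZMod b) := by
  have hb : 0 < b := (Fact.out : b.Prime).pos
  unfold wordClass
  rw [← AdjoinRoot.mk_X, ← AdjoinRoot.mk_C, ← map_mul, ← map_add]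
  congr 1
  ext i
  rw [coeff_add, coeff_C, truncPoly_coeff]
  cases i with
  | zero =>
    rw [coeff_X_mul_zero, zero_add, if_pos rfl]
    split_ifs with h
    · simp
    · have : m = 0 := by omega
      subst this
      have : y = 0 := by simpa using hy
      simp [this]
  | succ i =>
    rw [coeff_X_mul, truncPoly_coeff, if_neg (by omega : ¬ i + 1 = 0), add_zero, Nat.div_div_eq_div_mul,
      ← pow_succ']
    split_ifs with h1 h2 h2
    · rfl
    · omega
    · rw [Nat.div_eq_of_lt (hy.trans_le (Nat.pow_le_pow_right hb (by omega)))]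
      simp
    · rfl

theorem wordClass_one (hm : 1 ≤ m) : wordClass m P 1 = 1 := by
  have hb : 1 < b := (Fact.out : b.Prime).one_lt
  rw [wordClass_eq_horner (Nat.one_lt_pow (by omega) hb), Nat.div_eq_of_lt hb, wordClass_zero,
    Nat.mod_eq_of_lt hb]
  simp

theorem wordClass_base_sub_one (hm : 1 ≤ m) : wordClass m P (b - 1) = -1 := by
  have hb : 1 < b := (Fact.out : b.Prime).one_lt
  have h1 : b ≤ b ^ m := Nat.le_self_pow (by omega) b
  rw [wordClass_eq_horner (by omega), Nat.div_eq_of_lt (by omega), wordClass_zero,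
    Nat.mod_eq_of_lt (by omega), Nat.cast_sub hb.le]
  simp

/-! ### Small words generate the multiplicative group -/

/-- Subtraction acts digitwise modulo `b`. Digits above `d` stay zero, and if the larger leading
digit comes first, digit `d` of the difference is a true difference and so remains below `t`. -/
theorem exists_word_sub {t d : ℕ} (ht : t ≤ b) (hdm : d < m) {u u' : ℕ} (hu : u < t * b ^ d)
    (hu' : u' < t * b ^ d) (h : u' / b ^ d ≤ u / b ^ d) :
    ∃ k < t * b ^ d, wordClass m P k = wordClass m P u - wordClass m P u' := by
  have hb : 0 < b := (Fact.out : b.Prime).pos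
  have hbd : 0 < b ^ d := by positivity
  have hle : t * b ^ d ≤ b ^ (d + 1) := by rw [pow_succ']; gcongr
  have hz : ∀ {u i : ℕ}, u < b ^ (d + 1) → d + 1 ≤ i → u / b ^ i = 0 := fun hu hi =>
    Nat.div_eq_of_lt (hu.trans_le (Nat.pow_le_pow_right hb hi))
  obtain ⟨k, hk, hf⟩ := exists_truncPoly (b := b) hb (m := d + 1)
    (f := truncPoly b m u - truncPoly b m u') (fun i hi => by
      rw [coeff_sub, truncPoly_coeff, truncPoly_coeff, hz (hu.trans_le hle) hi,
        hz (hu'.trans_le hle) hi]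
      simp)
  have hk' : truncPoly b m k = truncPoly b (d + 1) k := by
    ext i
    rw [truncPoly_coeff, truncPoly_coeff]
    rcases lt_or_ge i (d + 1) with hi | hi
    · rw [if_pos hi, if_pos (by omega)]
    · rw [hz hk hi]; simp
  refine ⟨k, ?_, ?_⟩
  · have h1 := congrArg (fun f => coeff f d) hf
    simp only [coeff_sub, truncPoly_coeff, if_pos hdm, if_pos (Nat.lt_succ_self d)] at h1
    rw [← Nat.cast_sub h] at h1
    have h2 : k / b ^ d < b := by
      rw [Nat.div_lt_iff_lt_mul hbd, ← pow_succ']; exact hk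
    have h3 : u / b ^ d < t := by rwa [Nat.div_lt_iff_lt_mul hbd]
    have h4 := (ZMod.natCast_eq_natCast_iff' _ _ _).1 h1
    have h5 : u / b ^ d - u' / b ^ d < t := (Nat.sub_le _ _).trans_lt h3
    rw [Nat.mod_eq_of_lt h2, Nat.mod_eq_of_lt (h5.trans_le ht)] at h4
    rwa [← Nat.div_lt_iff_lt_mul hbd, h4]
  · unfold wordClass
    rw [hk', hf, map_sub]

theorem exists_word_sub_or {t d : ℕ} (ht : t ≤ b) (hdm : d < m) {u u' : ℕ} (hu : u < t * b ^ d)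
    (hu' : u' < t * b ^ d) :
    ∃ k < t * b ^ d, wordClass m P u - wordClass m P u' = wordClass m P k ∨
      wordClass m P u - wordClass m P u' = -wordClass m P k := by
  rcases le_total (u' / b ^ d) (u / b ^ d) with h | h
  · obtain ⟨k, hk, h1⟩ := exists_word_sub (P := P) ht hdm hu hu' h
    exact ⟨k, hk, Or.inl h1.symm⟩
  · obtain ⟨k, hk, h1⟩ := exists_word_sub (P := P) ht hdm hu' hu h
    exact ⟨k, hk, Or.inr (by rw [h1, neg_sub])⟩

/-- The box needs more than `√N` words for the pigeonhole argument but only `O(√N)` for the cost.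
Powers of `b` alone are too coarse, so the leading digit is restricted as well. -/
theorem exists_leading_box (hm : 1 ≤ m) (hb : 1 < b) :
    ∃ t d : ℕ, t ≤ b ∧ d < m ∧ b ^ m < (t * b ^ d) ^ 2 ∧ (t * b ^ d) ^ 2 ≤ 4 * b ^ m := by
  obtain ⟨k, rfl | rfl⟩ : ∃ k, m = 2 * k ∨ m = 2 * k + 1 := ⟨m / 2, by omega⟩
  · refine ⟨2, k, hb, by omega, ?_, ?_⟩ <;> rw [mul_pow, ← pow_mul, mul_comm k 2]
    · have : 0 < b ^ (2 * k) := by positivity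
      omega
    · omega
  · refine ⟨Nat.sqrt b + 1, k, ?_, by omega, ?_, ?_⟩
    · exact Nat.sqrt_lt_self hb
    · rw [mul_pow, ← pow_mul, mul_comm k 2, pow_succ', pow_two (Nat.sqrt b + 1)]
      exact Nat.mul_lt_mul_of_pos_right (Nat.lt_succ_sqrt b) (by positivity)
    · rw [mul_pow, ← pow_mul, mul_comm k 2, pow_succ' b, ← mul_assoc]
      refine Nat.mul_le_mul_right _ ?_
      have h1 := Nat.sqrt_le' b
      have h2 : 1 ≤ Nat.sqrt b := Nat.sqrt_pos.2 (by omega)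
      nlinarith

variable [Fact (Irreducible P)]

theorem pow_card_sub_one_eq_one' (hm : 1 ≤ m) (hd : P.natDegree = m) {z : AdjoinRoot P}
    (hz : z ≠ 0) : z ^ (b ^ m - 1) = 1 := by
  have : Fintype (AdjoinRoot P) := Fintype.ofEquiv _ (wordEquiv hm hd)
  have hc : Fintype.card (AdjoinRoot P) = b ^ m := by
    rw [← Fintype.card_congr (wordEquiv hm hd), Fintype.card_fin]
  rw [← hc]
  exact FiniteField.pow_card_sub_one_eq_one z hz

theorem exists_orderOf_eq (hm : 1 ≤ m) (hd : P.natDegree = m) :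
    ∃ z : AdjoinRoot P, orderOf z = b ^ m - 1 := by
  have : Fintype (AdjoinRoot P) := Fintype.ofEquiv _ (wordEquiv hm hd)
  have hc : Fintype.card (AdjoinRoot P) = b ^ m := by
    rw [← Fintype.card_congr (wordEquiv hm hd), Fintype.card_fin]
  obtain ⟨g, hg⟩ := IsCyclic.exists_generator (α := (AdjoinRoot P)ˣ)
  refine ⟨g, ?_⟩
  rw [orderOf_units, orderOf_eq_card_of_forall_mem_zpowers hg, Nat.card_units, Nat.card_eq_fintype_card, hc]

/-- The small words and `-1` do not all satisfy `z ^ k = 1` unless all nonzero classes do. -/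
theorem exists_small_word_pow_ne_one (hm : 1 ≤ m) (hd : P.natDegree = m) {k B : ℕ} (hk0 : 0 < k)
    (hk : k < b ^ m - 1) (hB : 4 * b ^ m ≤ B ^ 2) :
    ∃ y, ((0 < y ∧ y < B ∧ y < b ^ m) ∨ y = b - 1) ∧ wordClass m P y ^ k ≠ 1 := by
  have hb : 1 < b := (Fact.out : b.Prime).one_lt
  -- Otherwise the `k`-th power is one on nonzero differences of words in the box, hence on
  -- quotients of such differences, hence on a primitive element, whose order exceeds `k`.
  by_contra! H
  have hneg : (-1 : AdjoinRoot P) ^ k = 1 := by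
    rw [← wordClass_base_sub_one (m := m) hm]
    exact H _ (Or.inr rfl)
  obtain ⟨t, d, ht, hdm, h1, h2⟩ := exists_leading_box (b := b) hm hb
  have htB : t * b ^ d ≤ B := by
    by_contra! h
    have := Nat.pow_lt_pow_left h (two_ne_zero)
    omega
  have htN : t * b ^ d ≤ b ^ m := by
    calc t * b ^ d ≤ b * b ^ d := by gcongr
      _ = b ^ (d + 1) := by rw [pow_succ']
      _ ≤ _ := Nat.pow_le_pow_right hb.le hdm
  have hsmall : ∀ y < t * b ^ d, y ≠ 0 → wordClass m P y ^ k = 1 := fun y hy h0 =>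
    H y (Or.inl ⟨Nat.pos_of_ne_zero h0, hy.trans_le htB, hy.trans_le htN⟩)
  have hdiff : ∀ u < t * b ^ d, ∀ u' < t * b ^ d, u ≠ u' →
      (wordClass m P u - wordClass m P u') ^ k = 1 := by
    intro u hu u' hu' hne
    obtain ⟨y, hy, h⟩ := exists_word_sub_or (P := P) ht hdm hu hu'
    have hy0 : y ≠ 0 := by
      rintro rfl
      rw [wordClass_zero, neg_zero, or_self, sub_eq_zero] at h
      exact hne (wordClass_injOn hm hd (hu.trans_le htN) (hu'.trans_le htN) h)
    rcases h with h | h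
    · rw [h, hsmall y hy hy0]
    · rw [h, neg_pow, hneg, hsmall y hy hy0, one_mul]
  obtain ⟨z, hz⟩ := exists_orderOf_eq (P := P) hm hd
  have hz0 : z ≠ 0 := by
    rintro rfl
    have h3 : b ≤ b ^ m := Nat.le_self_pow (by omega) b
    have := orderOf_pos_iff.1 (show 0 < orderOf (0 : AdjoinRoot P) by rw [hz]; omega)
    obtain ⟨n, hn, h4⟩ := isOfFinOrder_iff_pow_eq_one.1 this
    rw [zero_pow hn.ne'] at h4
    exact zero_ne_one h4
  have hzk : z ^ k = 1 := by
    have : Fintype (AdjoinRoot P) := Fintype.ofEquiv _ (wordEquiv hm hd)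
    have hc : Fintype.card (AdjoinRoot P) = b ^ m := by
      rw [← Fintype.card_congr (wordEquiv hm hd), Fintype.card_fin]
    -- Pigeonhole in the manner of Thue: there are more pairs `(u, u')` than field elements, so two
    -- values `u z - u'` coincide and `z` is a quotient of differences from the box.
    obtain ⟨p, p', hne, hpp⟩ := Fintype.exists_ne_map_eq_of_card_lt
      (fun p : Fin (t * b ^ d) × Fin (t * b ^ d) => wordClass m P p.1 * z - wordClass m P p.2) (by
        rw [hc, Fintype.card_prod, Fintype.card_fin, ← pow_two]
        exact h1)
    have h5 : (wordClass m P p.1 - wordClass m P p'.1) * z =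
        wordClass m P p.2 - wordClass m P p'.2 := by
      linear_combination hpp
    have h6 : (p.1 : ℕ) ≠ p'.1 := by
      intro h
      rw [h, sub_self, zero_mul, eq_comm, sub_eq_zero] at h5
      have := wordClass_injOn hm hd (p.2.2.trans_le htN) (p'.2.2.trans_le htN) h5
      exact hne (Prod.ext (Fin.ext h) (Fin.ext this))
    have h7 : (p.2 : ℕ) ≠ p'.2 := by
      intro h
      rw [h, sub_self, mul_eq_zero, sub_eq_zero] at h5
      exact h6 (wordClass_injOn hm hd (p.1.2.trans_le htN) (p'.1.2.trans_le htN)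
        (h5.resolve_right hz0))
    have := congrArg (· ^ k) h5
    simp only [mul_pow] at this
    rwa [hdiff _ p.1.2 _ p'.1.2 h6, hdiff _ p.2.2 _ p'.2.2 h7, one_mul] at this
  have := Nat.le_of_dvd hk0 (orderOf_dvd_of_pow_eq_one hzk)
  omega

/-- The element `c ^ e'` is killed by the exponent `e`, a power of `p`, but not by `e / p`, since
that would say `c ^ (n / p) = 1`. -/
theorem orderOf_pow_of_pow_ne_one {F : Type*} [Monoid F] {c : F} {n p e e' : ℕ} [Fact p.Prime]
    (hn : n = e * e') (hc : c ^ n = 1) (hcp : c ^ (n / p) ≠ 1) {j : ℕ} (he : e = p ^ (j + 1)) :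
    orderOf (c ^ e') = e := by
  have hp : 0 < p := (Fact.out : p.Prime).pos
  rw [he]
  apply orderOf_eq_prime_pow
  · rw [← pow_mul]
    rwa [hn, he, pow_succ, mul_assoc, mul_comm p, ← mul_assoc, Nat.mul_div_cancel _ hp,
      mul_comm] at hcp
  · rw [← pow_mul, mul_comm, ← he, ← hn, hc]

/-- A primitive element runs through all nonzero classes. This reindexing turns products of node and
candidate into sums of exponents, and the search into a cyclic correlation. -/
theorem sum_ne_zero_eq_sum_pow (hm : 1 ≤ m) (hd : P.natDegree = m) {g : AdjoinRoot P}
    (hg : orderOf g = b ^ m - 1) (f : AdjoinRoot P → ℝ) :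
    ∑ n ∈ Finset.univ.filter (fun n : Fin (b ^ m) => (n : ℕ) ≠ 0), f (wordClass m P n) =
      ∑ a ∈ Finset.range (b ^ m - 1), f (g ^ a) := by
  classical
  have : Fintype (AdjoinRoot P) := Fintype.ofEquiv _ (wordEquiv hm hd)
  have hb : 1 < b := (Fact.out : b.Prime).one_lt
  have hc : Fintype.card (AdjoinRoot P) = b ^ m := by
    rw [← Fintype.card_congr (wordEquiv hm hd), Fintype.card_fin]
  have hN : 1 < b ^ m := Nat.one_lt_pow (by omega) hb
  have hg0 : g ≠ 0 := by
    rintro rfl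
    have := orderOf_pos_iff.1 (show 0 < orderOf (0 : AdjoinRoot P) by rw [hg]; omega)
    obtain ⟨n, hn, h4⟩ := isOfFinOrder_iff_pow_eq_one.1 this
    rw [zero_pow hn.ne'] at h4
    exact zero_ne_one h4
  have h1 : (Finset.range (b ^ m - 1)).image (fun a => g ^ a) = Finset.univ.erase 0 := by
    refine Finset.eq_of_subset_of_card_le (fun z hz => ?_) ?_
    · obtain ⟨a, _, rfl⟩ := Finset.mem_image.1 hz
      exact Finset.mem_erase.2 ⟨pow_ne_zero _ hg0, Finset.mem_univ _⟩
    · rw [Finset.card_erase_of_mem (Finset.mem_univ _), Finset.card_univ, hc,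
        Finset.card_image_of_injOn, Finset.card_range]
      intro a ha a' ha' h
      exact pow_injOn_Iio_orderOf (by simpa [hg] using ha) (by simpa [hg] using ha') h
  rw [← Finset.sum_image (f := f) (g := fun a => g ^ a) (s := Finset.range (b ^ m - 1)), h1]
  · refine Finset.sum_bij' (fun n _ => wordEquiv hm hd n) (fun z _ => (wordEquiv hm hd).symm z)
      ?_ ?_ ?_ ?_ ?_
    · intro n hn
      rw [Finset.mem_filter] at hn
      refine Finset.mem_erase.2 ⟨?_, Finset.mem_univ _⟩
      rw [wordEquiv_apply, Ne, wordClass_eq_zero_iff hm hd n.2]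
      exact hn.2
    · intro z hz
      rw [Finset.mem_filter]
      refine ⟨Finset.mem_univ _, fun h => (Finset.mem_erase.1 hz).1 ?_⟩
      rw [← (wordEquiv hm hd).apply_symm_apply z, wordEquiv_apply, h, wordClass_zero]
    · intro n _; simp
    · intro z _; simp
    · intro n _
      rw [wordEquiv_apply]
  · intro a ha a' ha' h
    exact pow_injOn_Iio_orderOf (by simpa [hg] using ha) (by simpa [hg] using ha') h

end FieldWords

end QMC
end

noncomputable section
namespace QMC

section Fourier

/-! ### The fast Fourier transform -/

/-- The root of unity `exp (2πik/n)`. -/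
def turn (k n : ℕ) : ℂ := Complex.exp (((2 * Real.pi * k / n : ℝ) : ℂ) * Complex.I)

theorem turn_re (k n : ℕ) : (turn k n).re = Real.cos (2 * Real.pi * k / n) :=
  Complex.exp_ofReal_mul_I_re _

theorem turn_im (k n : ℕ) : (turn k n).im = Real.sin (2 * Real.pi * k / n) :=
  Complex.exp_ofReal_mul_I_im _

theorem turn_add (j k n : ℕ) : turn (j + k) n = turn j n * turn k n := by
  unfold turn
  rw [← Complex.exp_add]
  congr 1
  push_cast
  ring

theorem turn_mul (k : ℕ) {c n : ℕ} (hc : c ≠ 0) : turn (c * k) (c * n) = turn k n := by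
  unfold turn
  congr 3
  push_cast
  rw [mul_left_comm, mul_div_mul_left _ _ (by exact_mod_cast hc)]

theorem turn_zero (n : ℕ) : turn 0 n = 1 := by simp [turn]

theorem turn_pow (j k n : ℕ) : turn (k * j) n = turn j n ^ k := by
  induction k with
  | zero => simp [turn_zero]
  | succ k ih => rw [Nat.succ_mul, turn_add, ih, pow_succ]

theorem turn_self {n : ℕ} (hn : n ≠ 0) : turn n n = 1 := by
  unfold turn
  rw [mul_div_assoc, div_self (by exact_mod_cast hn), mul_one]
  push_cast
  exact Complex.exp_two_pi_mul_I

theorem turn_mul_self (k n : ℕ) (hn : n ≠ 0) : turn (k * n) n = 1 := by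
  rw [turn_pow, turn_self hn, one_pow]

theorem turn_mod (k : ℕ) {n : ℕ} (hn : n ≠ 0) : turn (k % n) n = turn k n := by
  conv_rhs => rw [← Nat.mod_add_div k n, turn_add, mul_comm n, turn_mul_self _ _ hn, mul_one]

theorem turn_mul_mod (j k : ℕ) {n : ℕ} (hn : n ≠ 0) : turn (j * (k % n)) n = turn (j * k) n := by
  rw [turn_pow, turn_mod _ hn, ← turn_pow]

theorem turn_eq_one_iff {k n : ℕ} (hn : n ≠ 0) : turn k n = 1 ↔ n ∣ k := by
  constructor
  · intro h
    unfold turn at h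
    rw [Complex.exp_eq_one_iff] at h
    obtain ⟨z, hz⟩ := h
    have hpi := Real.pi_ne_zero
    have h1 : ((2 * Real.pi * k / n : ℝ) : ℂ) = ((z * (2 * Real.pi) : ℝ) : ℂ) := by
      apply mul_right_cancel₀ Complex.I_ne_zero
      rw [hz]
      push_cast
      ring
    have h2 := Complex.ofReal_injective h1
    have hn' : (n : ℝ) ≠ 0 := by exact_mod_cast hn
    rw [div_eq_iff hn'] at h2
    have h3 : (k : ℝ) = z * n := by
      have : (2 * Real.pi) * (k : ℝ) = (2 * Real.pi) * (z * n) := by rw [h2]; ring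
      exact mul_left_cancel₀ (by positivity) this
    have h4 : (k : ℤ) = z * n := by exact_mod_cast h3
    exact Int.natCast_dvd_natCast.1 ⟨z, by rw [h4, mul_comm]⟩
  · rintro ⟨c, rfl⟩
    rw [mul_comm, turn_mul_self _ _ hn]

theorem sum_turn {n : ℕ} (hn : n ≠ 0) (j : ℕ) :
    ∑ k ∈ Finset.range n, turn (k * j) n = if n ∣ j then (n : ℂ) else 0 := by
  simp only [turn_pow]
  split_ifs with h
  · rw [(turn_eq_one_iff hn).2 h]
    simp
  · have h1 : turn j n ≠ 1 := fun h1 => h ((turn_eq_one_iff hn).1 h1)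
    rw [geom_sum_eq h1, ← turn_pow, mul_comm, turn_mul_self _ _ hn, sub_self, zero_div]

/-- The natural number `n * j - j` represents `-j` modulo `n`. -/
theorem conj_turn (k j : ℕ) {n : ℕ} (hn : n ≠ 0) :
    (starRingEnd ℂ) (turn (k * j) n) = turn (k * (n * j - j)) n := by
  have h1 : turn (k * j) n * turn (k * (n * j - j)) n = 1 := by
    have : j ≤ n * j := Nat.le_mul_of_pos_left _ (Nat.pos_of_ne_zero hn)
    rw [← turn_add, ← Nat.mul_add, Nat.add_sub_cancel' this, Nat.mul_left_comm, mul_comm n,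
      turn_mul_self _ _ hn]
  have h2 : turn (k * j) n * (starRingEnd ℂ) (turn (k * j) n) = 1 := by
    rw [Complex.mul_conj, Complex.normSq_eq_norm_sq, turn, Complex.norm_exp_ofReal_mul_I]
    simp
  have h3 : turn (k * j) n ≠ 0 := left_ne_zero_of_mul_eq_one h2
  exact mul_left_cancel₀ h3 (h2.trans h1.symm)

/-- The discrete Fourier transform. -/
def dft (L : ℕ) (x : ℕ → ℂ) (i : ℕ) : ℂ := ∑ j ∈ Finset.range L, x j * turn (j * i) L

/-- The sum over `k` vanishes unless `j` is congruent to `a + c`. With one spectrum conjugated, a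
second forward transform already gives the correlation at shift `c`, up to the factor `L`, so no
inverse transform is needed. -/
theorem dft_correlation {L : ℕ} (hL : L ≠ 0) (x w : ℕ → ℝ) (c : ℕ) :
    dft L (fun k => dft L (fun j => (x j : ℂ)) k *
        (starRingEnd ℂ) (dft L (fun j => (w j : ℂ)) k)) c =
      ((L * ∑ a ∈ Finset.range L, x a * w ((a + c) % L) : ℝ) : ℂ) := by
  have h1 : ∀ k, dft L (fun j => (x j : ℂ)) k * (starRingEnd ℂ) (dft L (fun j => (w j : ℂ)) k) *
      turn (k * c) L = ∑ a ∈ Finset.range L, ∑ j ∈ Finset.range L,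
        ((x a : ℂ) * w j) * turn (k * (a + c + (L * j - j))) L := by
    intro k
    rw [dft, dft, map_sum, Finset.sum_mul_sum, Finset.sum_mul]
    refine Finset.sum_congr rfl fun a _ => ?_
    rw [Finset.sum_mul]
    refine Finset.sum_congr rfl fun j _ => ?_
    rw [map_mul, Complex.conj_ofReal, mul_comm j k, conj_turn _ _ hL, Nat.mul_add, Nat.mul_add,
      turn_add, turn_add, mul_comm a k]
    ring
  rw [dft]
  simp only [h1]
  rw [Finset.sum_comm]
  push_cast
  rw [Finset.mul_sum]
  refine Finset.sum_congr rfl fun a _ => ?_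
  rw [Finset.sum_comm]
  simp only [← Finset.mul_sum, sum_turn hL]
  have hmod : (a + c) % L ∈ Finset.range L := Finset.mem_range.2 (Nat.mod_lt _ (Nat.pos_of_ne_zero hL))
  rw [Finset.sum_eq_single_of_mem _ hmod]
  · rw [if_pos]
    · ring
    · have h2 : (a + c) % L ≤ L * ((a + c) % L) := Nat.le_mul_of_pos_left _ (Nat.pos_of_ne_zero hL)
      have h3 := Nat.mod_add_div (a + c) L
      refine ⟨(a + c) / L + (a + c) % L, ?_⟩
      rw [mul_add]
      omega
  · intro j hj hne
    rw [if_neg, mul_zero]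
    intro h
    have hj' := Finset.mem_range.1 hj
    have h2 : j ≤ L * j := Nat.le_mul_of_pos_left _ (Nat.pos_of_ne_zero hL)
    apply hne
    have h4 : (a + c + (L * j - j) + j) % L = j % L := by
      rw [Nat.add_mod, Nat.mod_eq_zero_of_dvd h, zero_add, Nat.mod_mod]
    rw [add_assoc, Nat.sub_add_cancel h2, Nat.add_mul_mod_self_left, Nat.mod_eq_of_lt hj'] at h4
    exact h4.symm

/-- The intermediate results of the radix-two transform of length `2^T`. -/
def fftStage (T : ℕ) (x : ℕ → ℂ) (t i : ℕ) : ℂ :=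
  ∑ j ∈ Finset.range (2 ^ t),
    x (i % 2 ^ (T - t) + 2 ^ (T - t) * j) * turn (j * (i / 2 ^ (T - t))) (2 ^ t)

theorem fftStage_zero (T : ℕ) (x : ℕ → ℂ) {i : ℕ} (hi : i < 2 ^ T) : fftStage T x 0 i = x i := by
  simp [fftStage, Nat.mod_eq_of_lt hi, turn_zero]

theorem fftStage_last (T : ℕ) (x : ℕ → ℂ) (i : ℕ) : fftStage T x T i = dft (2 ^ T) x i := by
  simp [fftStage, dft, Nat.mod_one]

/-- With `i = h k + r` one has `2 i - r = 2 h k + r`, and reduction modulo `2 h n` reduces `k`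
modulo `n`. -/
theorem two_mul_sub_mod_mod {h n : ℕ} (hh : 0 < h) (hn : 0 < n) (i : ℕ) :
    (2 * i - i % h) % (2 * h * n) = 2 * h * (i / h % n) + i % h := by
  have hr : i % h < h := Nat.mod_lt _ hh
  have hi := (Nat.div_add_mod i h).symm
  set r := i % h
  set k := i / h
  rw [show 2 * i - r = r + 2 * h * k by rw [hi]; ring_nf; omega, Nat.add_mod,
    Nat.mul_mod_mul_left, Nat.mod_eq_of_lt (a := r), add_comm, Nat.mod_eq_of_lt]
  · have : k % n + 1 ≤ n := Nat.mod_lt _ hn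
    calc _ < 2 * h * (k % n) + 2 * h := by omega
      _ = 2 * h * (k % n + 1) := by ring
      _ ≤ _ := Nat.mul_le_mul_left _ this
  · calc r < 2 * h * 1 := by omega
      _ ≤ _ := Nat.mul_le_mul_left _ hn

theorem two_mul_sub_mod_mod_add_lt {h n : ℕ} (hh : 0 < h) (hn : 0 < n) (i : ℕ) :
    (2 * i - i % h) % (2 * h * n) + h < 2 * h * n := by
  rw [two_mul_sub_mod_mod hh hn]
  have h1 : i % h < h := Nat.mod_lt _ hh
  have h2 : i / h % n + 1 ≤ n := Nat.mod_lt _ hn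
  calc _ < 2 * h * (i / h % n) + 2 * h := by omega
    _ = 2 * h * (i / h % n + 1) := by ring
    _ ≤ _ := Nat.mul_le_mul_left _ h2

/-- The even and the odd values of `j` each give a sum of the previous stage, over the residue
classes of `r` and `r + h`; the odd ones share one root of unity as a factor. -/
theorem fftStage_succ {T : ℕ} (x : ℕ → ℂ) {t i : ℕ} (ht : t < T) :
    fftStage T x (t + 1) i =
      fftStage T x t ((2 * i - i % 2 ^ (T - (t + 1))) % 2 ^ T) +
      turn (i / 2 ^ (T - (t + 1))) (2 ^ (t + 1)) *
        fftStage T x t ((2 * i - i % 2 ^ (T - (t + 1))) % 2 ^ T + 2 ^ (T - (t + 1))) := by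
  set h := 2 ^ (T - (t + 1)) with hh
  have hh0 : 0 < h := by positivity
  have hH : 2 ^ (T - t) = 2 * h := by
    rw [hh, ← pow_succ']; congr 1; omega
  have hL : 2 ^ T = 2 * h * 2 ^ t := by
    rw [← hH, ← pow_add]; congr 1; omega
  have hr : i % h < h := Nat.mod_lt _ hh0
  set r := i % h
  set k := i / h
  have h1 : (2 * i - r) % 2 ^ T = 2 * h * (k % 2 ^ t) + r := by
    rw [hL]
    exact two_mul_sub_mod_mod hh0 (by positivity) i
  have h2 : (2 * h * (k % 2 ^ t) + r) % (2 * h) = r := by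
    rw [Nat.mul_add_mod, Nat.mod_eq_of_lt (by omega)]
  have h3 : (2 * h * (k % 2 ^ t) + r) / (2 * h) = k % 2 ^ t := by
    rw [Nat.mul_add_div (by omega), Nat.div_eq_of_lt (by omega), add_zero]
  have h4 : (2 * h * (k % 2 ^ t) + r + h) % (2 * h) = r + h := by
    rw [add_assoc, Nat.mul_add_mod, Nat.mod_eq_of_lt (by omega)]
  have h5 : (2 * h * (k % 2 ^ t) + r + h) / (2 * h) = k % 2 ^ t := by
    rw [add_assoc, Nat.mul_add_div (by omega), Nat.div_eq_of_lt (by omega), add_zero]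
  rw [h1]
  unfold fftStage
  rw [hH, h2, h3, h4, h5, ← hh, pow_succ 2 t, sum_range_mul_eq, Finset.mul_sum,
    ← Finset.sum_add_distrib]
  refine Finset.sum_congr rfl fun j _ => ?_
  have h2t : 2 ^ t ≠ 0 := by positivity
  rw [Finset.sum_range_succ, Finset.sum_range_one, add_zero, turn_mul_mod _ _ h2t, Nat.add_mul,
    turn_add, one_mul, mul_comm (2 ^ t) 2, mul_assoc 2 j, turn_mul _ (two_ne_zero)]
  change x (r + h * (2 * j)) * turn (j * k) (2 ^ t) + x (r + h * (2 * j + 1)) *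
    (turn (j * k) (2 ^ t) * turn k (2 * 2 ^ t)) = _
  rw [show r + h * (2 * j) = r + 2 * h * j by ring,
    show r + h * (2 * j + 1) = r + h + 2 * h * j by ring]
  ring

end Fourier

end QMC
end

noncomputable section
namespace QMC

/-! ### Reasoning about programs -/

infixr:35 " ;; " => Prog.seq

instance : Add WExp := ⟨WExp.add⟩
instance : Sub WExp := ⟨WExp.sub⟩
instance : Mul WExp := ⟨WExp.mul⟩
instance : Div WExp := ⟨WExp.div⟩
instance : Mod WExp := ⟨WExp.mod⟩
instance (n : ℕ) : OfNat WExp n := ⟨WExp.const n⟩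
instance : Add RExp := ⟨RExp.add⟩
instance : Sub RExp := ⟨RExp.sub⟩
instance : Mul RExp := ⟨RExp.mul⟩
instance : Div RExp := ⟨RExp.div⟩

/-- The word in cell `0` of an array. -/
abbrev var (a : ℕ) : WExp := .load a 0

/-- The real number in cell `0` of an array. -/
abbrev rvar (a : ℕ) : RExp := .load a 0

section Eval

variable (σ : Mem)

@[simp] theorem WExp.eval_ofNat (n : ℕ) :
    WExp.eval σ (no_index (OfNat.ofNat n)) = (OfNat.ofNat n : ℕ) := rfl
@[simp] theorem WExp.eval_add (e f : WExp) : (e + f).eval σ = e.eval σ + f.eval σ := rfl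
@[simp] theorem WExp.eval_sub (e f : WExp) : (e - f).eval σ = e.eval σ - f.eval σ := rfl
@[simp] theorem WExp.eval_mul (e f : WExp) : (e * f).eval σ = e.eval σ * f.eval σ := rfl
@[simp] theorem WExp.eval_div (e f : WExp) : (e / f).eval σ = e.eval σ / f.eval σ := rfl
@[simp] theorem WExp.eval_mod (e f : WExp) : (e % f).eval σ = e.eval σ % f.eval σ := rfl
@[simp] theorem WExp.eval_load (a : ℕ) (i : WExp) : (WExp.load a i).eval σ = σ.word a (i.eval σ) := rfl
@[simp] theorem RExp.eval_add (e f : RExp) : (e + f).eval σ = e.eval σ + f.eval σ := rfl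
@[simp] theorem RExp.eval_sub (e f : RExp) : (e - f).eval σ = e.eval σ - f.eval σ := rfl
@[simp] theorem RExp.eval_mul (e f : RExp) : (e * f).eval σ = e.eval σ * f.eval σ := rfl
@[simp] theorem RExp.eval_div (e f : RExp) : (e / f).eval σ = e.eval σ / f.eval σ := rfl
@[simp] theorem RExp.eval_load (a : ℕ) (i : WExp) : (RExp.load a i).eval σ = σ.real a (i.eval σ) := rfl
@[simp] theorem RExp.eval_ofWord (e : WExp) : (RExp.ofWord e).eval σ = (e.eval σ : ℝ) := rfl
@[simp] theorem RExp.eval_cosTurn (k n : WExp) :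
    (RExp.cosTurn k n).eval σ = Real.cos (2 * Real.pi * (k.eval σ : ℝ) / (n.eval σ : ℝ)) := rfl
@[simp] theorem RExp.eval_sinTurn (k n : WExp) :
    (RExp.sinTurn k n).eval σ = Real.sin (2 * Real.pi * (k.eval σ : ℝ) / (n.eval σ : ℝ)) := rfl

@[simp] theorem Mem.setWord_word_self (a i x : ℕ) :
    (σ.setWord a i x).word a = Function.update (σ.word a) i x := by simp [Mem.setWord]

@[simp] theorem Mem.setWord_word_of_ne {a a' : ℕ} (i x : ℕ) (h : a' ≠ a) :
    (σ.setWord a i x).word a' = σ.word a' := by simp [Mem.setWord, h]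

@[simp] theorem Mem.setWord_real (a i x : ℕ) : (σ.setWord a i x).real = σ.real := rfl

@[simp] theorem Mem.setReal_real_self (a i : ℕ) (x : ℝ) :
    (σ.setReal a i x).real a = Function.update (σ.real a) i x := by simp [Mem.setReal]

@[simp] theorem Mem.setReal_real_of_ne {a a' : ℕ} (i : ℕ) (x : ℝ) (h : a' ≠ a) :
    (σ.setReal a i x).real a' = σ.real a' := by simp [Mem.setReal, h]

@[simp] theorem Mem.setReal_word (a i : ℕ) (x : ℝ) : (σ.setReal a i x).word = σ.word := rfl

end Eval

/-- A bound for the exponent of the words in an expression. -/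
def WExp.weight : WExp → ℕ
  | .const n => n + 1
  | .load _ i => i.weight + 1
  | .add e f => e.weight + f.weight + 1
  | .sub e f => e.weight + f.weight + 1
  | .mul e f => e.weight + f.weight + 1
  | .div e f => e.weight + f.weight + 1
  | .mod e f => e.weight + f.weight + 1

theorem pow_add_pow_le {W : ℕ} (hW : 2 ≤ W) (a b : ℕ) : W ^ a + W ^ b ≤ W ^ (a + b + 1) := by
  have h1 : 1 ≤ W ^ a := Nat.one_le_pow _ _ (by omega)
  have h2 : 1 ≤ W ^ b := Nat.one_le_pow _ _ (by omega)
  calc W ^ a + W ^ b ≤ W ^ a * W ^ b * 2 := by nlinarith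
    _ ≤ W ^ a * W ^ b * W := Nat.mul_le_mul_left _ hW
    _ = _ := by ring

/-- Each operation yields at most the product of the bounds of its operands times one more factor
`W`, so the exponent is additive over the expression. -/
theorem WExp.peak_le {W : ℕ} (hW : 2 ≤ W) {σ : Mem} (hσ : ∀ a i, σ.word a i ≤ W) (e : WExp) :
    e.eval σ ≤ W ^ e.weight ∧ e.peak σ ≤ W ^ e.weight := by
  have hmono : ∀ {i j : ℕ}, i ≤ j → W ^ i ≤ W ^ j := fun h => Nat.pow_le_pow_right (by omega) h
  induction e with
  | const n =>
    have : n ≤ W ^ (n + 1) := (Nat.lt_two_pow_self.le.trans (Nat.pow_le_pow_left hW n)).trans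
      (hmono (by omega))
    exact ⟨this, this⟩
  | load a i ih =>
    have h1 : σ.word a (i.eval σ) ≤ W ^ (i.weight + 1) :=
      (hσ _ _).trans (Nat.le_self_pow (by omega) W)
    exact ⟨h1, max_le (ih.2.trans (hmono (Nat.le_succ _))) h1⟩
  | add e f ihe ihf =>
    have h1 : e.eval σ + f.eval σ ≤ W ^ (e.weight + f.weight + 1) :=
      (Nat.add_le_add ihe.1 ihf.1).trans (pow_add_pow_le hW _ _)
    exact ⟨h1, max_le (max_le (ihe.2.trans (hmono (by simp only [weight]; omega)))
      (ihf.2.trans (hmono (by simp only [weight]; omega)))) h1⟩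
  | sub e f ihe ihf =>
    exact ⟨(Nat.sub_le _ _).trans (ihe.1.trans (hmono (by simp only [weight]; omega))),
      max_le (ihe.2.trans (hmono (by simp only [weight]; omega)))
        (ihf.2.trans (hmono (by simp only [weight]; omega)))⟩
  | mul e f ihe ihf =>
    have h1 : e.eval σ * f.eval σ ≤ W ^ (e.weight + f.weight + 1) :=
      (Nat.mul_le_mul ihe.1 ihf.1).trans (by rw [← pow_add]; exact hmono (by omega))
    exact ⟨h1, max_le (max_le (ihe.2.trans (hmono (by simp only [weight]; omega)))
      (ihf.2.trans (hmono (by simp only [weight]; omega)))) h1⟩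
  | div e f ihe ihf =>
    exact ⟨(Nat.div_le_self _ _).trans (ihe.1.trans (hmono (by simp only [weight]; omega))),
      max_le (ihe.2.trans (hmono (by simp only [weight]; omega)))
        (ihf.2.trans (hmono (by simp only [weight]; omega)))⟩
  | mod e f ihe ihf =>
    exact ⟨(Nat.mod_le _ _).trans (ihe.1.trans (hmono (by simp only [weight]; omega))),
      max_le (ihe.2.trans (hmono (by simp only [weight]; omega)))
        (ihf.2.trans (hmono (by simp only [weight]; omega)))⟩

/-- A bound for the exponent of the words in an expression. -/
def RExp.weight : RExp → ℕ
  | .ofWord e => e.weight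
  | .load _ i => i.weight
  | .add e f => e.weight + f.weight
  | .sub e f => e.weight + f.weight
  | .mul e f => e.weight + f.weight
  | .div e f => e.weight + f.weight
  | .cosTurn k n => k.weight + n.weight
  | .sinTurn k n => k.weight + n.weight

theorem RExp.peak_le {W : ℕ} (hW : 2 ≤ W) {σ : Mem} (hσ : ∀ a i, σ.word a i ≤ W) (e : RExp) :
    e.peak σ ≤ W ^ e.weight := by
  have hmono : ∀ {i j : ℕ}, i ≤ j → W ^ i ≤ W ^ j := fun h => Nat.pow_le_pow_right (by omega) h
  have hp := fun e => (WExp.peak_le hW hσ e).2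
  induction e with
  | ofWord e => exact hp e
  | load a i => exact hp i
  | add e f ihe ihf | sub e f ihe ihf | mul e f ihe ihf | div e f ihe ihf =>
    exact max_le (ihe.trans (hmono (by simp only [weight]; omega)))
      (ihf.trans (hmono (by simp only [weight]; omega)))
  | cosTurn k n | sinTurn k n =>
    exact max_le ((hp k).trans (hmono (by simp only [weight]; omega)))
      ((hp n).trans (hmono (by simp only [weight]; omega)))

namespace Prog

/-- The length of a program. -/
def size : Prog → ℕ
  | .skip => 1
  | .setWord _ i e => i.cost + i.weight + e.cost + e.weight + 1
  | .setReal _ i e => i.cost + i.weight + e.cost + e.weight + 1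
  | .seq c d => c.size + d.size
  | .ifWordLt e f c d => e.cost + e.weight + f.cost + f.weight + 1 + c.size + d.size
  | .ifRealLt e f c d => e.cost + e.weight + f.cost + f.weight + 1 + c.size + d.size
  | .loop _ e c => e.cost + e.weight + 2 + c.size

/-- All the words that are stored in the run are at most `W`. -/
def Safe (W : ℕ) : Prog → Mem → Prop
  | .skip, _ => True
  | .setWord _ _ e, σ => e.eval σ ≤ W
  | .setReal _ _ _, _ => True
  | .seq c d, σ => c.Safe W σ ∧ d.Safe W (c.run σ)
  | .ifWordLt e f c d, σ => (e.eval σ < f.eval σ → c.Safe W σ) ∧ (¬e.eval σ < f.eval σ → d.Safe W σ)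
  | .ifRealLt e f c d, σ => (e.eval σ < f.eval σ → c.Safe W σ) ∧ (¬e.eval σ < f.eval σ → d.Safe W σ)
  | .loop a e c, σ => e.eval σ ≤ W ∧ ∀ i < e.eval σ,
      c.Safe W ((iter (fun i τ => c.run (τ.setWord a 0 i)) i σ).setWord a 0 i)

theorem setWord_le {W : ℕ} {σ : Mem} (hσ : ∀ a i, σ.word a i ≤ W) (a i : ℕ) {x : ℕ} (hx : x ≤ W)
    (a' i' : ℕ) : (σ.setWord a i x).word a' i' ≤ W := by
  rcases eq_or_ne a' a with rfl | h
  · rw [Mem.setWord_word_self, Function.update_apply]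
    split_ifs
    · exact hx
    · exact hσ _ _
  · rw [Mem.setWord_word_of_ne _ _ _ h]
    exact hσ _ _

/-- Only stored words have to be controlled individually; intermediate results are then bounded by a
power of `W` whose exponent depends on the program text alone. -/
theorem Safe.peak_le {W : ℕ} (hW : 2 ≤ W) (c : Prog) : ∀ {σ : Mem}, c.Safe W σ →
    (∀ a i, σ.word a i ≤ W) → (∀ a i, (c.run σ).word a i ≤ W) ∧ c.peak σ ≤ W ^ c.size := by
  have hmono : ∀ {i j : ℕ}, i ≤ j → W ^ i ≤ W ^ j := fun h => Nat.pow_le_pow_right (by omega) h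
  have hp := fun {σ : Mem} (hσ : ∀ a i, σ.word a i ≤ W) e => (WExp.peak_le hW hσ e).2
  have hq := fun {σ : Mem} (hσ : ∀ a i, σ.word a i ≤ W) e => RExp.peak_le hW hσ e
  induction c with
  | skip => exact fun _ hσ => ⟨hσ, Nat.zero_le _⟩
  | setWord a i e =>
    exact fun h hσ => ⟨setWord_le hσ _ _ h, max_le
      ((hp hσ i).trans (hmono (by simp only [size]; omega)))
      ((hp hσ e).trans (hmono (by simp only [size]; omega)))⟩
  | setReal a i e =>
    exact fun h hσ => ⟨hσ, max_le
      ((hp hσ i).trans (hmono (by simp only [size]; omega)))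
      ((hq hσ e).trans (hmono (by simp only [size]; omega)))⟩
  | seq c d ihc ihd =>
    intro σ h hσ
    have h1 := ihc h.1 hσ
    have h2 := ihd h.2 h1.1
    exact ⟨h2.1, max_le (h1.2.trans (hmono (by simp only [size]; omega)))
      (h2.2.trans (hmono (by simp only [size]; omega)))⟩
  | ifWordLt e f c d ihc ihd =>
    intro σ h hσ
    simp only [run, peak]
    refine ⟨?_, max_le (max_le ((hp hσ e).trans (hmono (by simp only [size]; omega)))
      ((hp hσ f).trans (hmono (by simp only [size]; omega)))) ?_⟩ <;> split_ifs with hc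
    · exact (ihc (h.1 hc) hσ).1
    · exact (ihd (h.2 hc) hσ).1
    · exact (ihc (h.1 hc) hσ).2.trans (hmono (by simp only [size]; omega))
    · exact (ihd (h.2 hc) hσ).2.trans (hmono (by simp only [size]; omega))
  | ifRealLt e f c d ihc ihd =>
    intro σ h hσ
    simp only [run, peak]
    refine ⟨?_, max_le (max_le ((hq hσ e).trans (hmono (by simp only [size]; omega)))
      ((hq hσ f).trans (hmono (by simp only [size]; omega)))) ?_⟩ <;> split_ifs with hc
    · exact (ihc (h.1 hc) hσ).1
    · exact (ihd (h.2 hc) hσ).1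
    · exact (ihc (h.1 hc) hσ).2.trans (hmono (by simp only [size]; omega))
    · exact (ihd (h.2 hc) hσ).2.trans (hmono (by simp only [size]; omega))
  | loop a e c ih =>
    intro σ h hσ
    have hiter : ∀ n ≤ e.eval σ, ∀ a' i',
        (iter (fun i τ => c.run (τ.setWord a 0 i)) n σ).word a' i' ≤ W := by
      intro n
      induction n with
      | zero => exact fun _ => hσ
      | succ n ihn =>
        intro hn
        exact (ih (h.2 n hn) (setWord_le (ihn (by omega)) _ _ (by have := h.1; omega))).1
    refine ⟨hiter _ le_rfl, max_le ((hp hσ e).trans (hmono (by simp only [size]; omega))) ?_⟩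
    refine Finset.sup_le fun i hi => ?_
    have hi := Finset.mem_range.1 hi
    exact (ih (h.2 i hi) (setWord_le (hiter i hi.le) _ _ (by have := h.1; omega))).2.trans
      (hmono (by simp only [size]; omega))

/-- The program writes only to the word arrays from `A` on, the array `2`, and the real arrays from
`B` on. -/
def above (A B : ℕ) : Prog → Bool
  | .skip => true
  | .setWord a _ _ => decide (A ≤ a) || decide (a = 2)
  | .setReal a _ _ => decide (B ≤ a)
  | .seq c d => c.above A B && d.above A B
  | .ifWordLt _ _ c d => c.above A B && d.above A B
  | .ifRealLt _ _ c d => c.above A B && d.above A B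
  | .loop a _ c => decide (A ≤ a) && c.above A B

end Prog

/-- Two states agree on the word arrays before `A`, apart from the array `2`, and on the real arrays
before `B`. -/
structure Agree (A B : ℕ) (σ τ : Mem) : Prop where
  word : ∀ a < A, a ≠ 2 → τ.word a = σ.word a
  real : ∀ a < B, τ.real a = σ.real a

theorem Agree.refl (A B : ℕ) (σ : Mem) : Agree A B σ σ := ⟨fun _ _ _ => rfl, fun _ _ => rfl⟩

theorem Agree.trans {A B : ℕ} {σ τ υ : Mem} (h : Agree A B σ τ) (h' : Agree A B τ υ) :
    Agree A B σ υ :=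
  ⟨fun a ha h2 => (h'.word a ha h2).trans (h.word a ha h2),
    fun a ha => (h'.real a ha).trans (h.real a ha)⟩

theorem Agree.setWord {A B : ℕ} (σ : Mem) {a : ℕ} (h : A ≤ a ∨ a = 2) (i x : ℕ) :
    Agree A B σ (σ.setWord a i x) :=
  ⟨fun a' ha' h2 => Mem.setWord_word_of_ne _ _ _ (by omega), fun _ _ => rfl⟩

theorem Agree.setReal {A B : ℕ} (σ : Mem) {a : ℕ} (h : B ≤ a) (i : ℕ) (x : ℝ) :
    Agree A B σ (σ.setReal a i x) :=
  ⟨fun _ _ _ => rfl, fun a' ha' => Mem.setReal_real_of_ne _ _ _ (by omega)⟩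

/-- The hypothesis is a Boolean computed from the program text, so frame conditions for concrete
programs hold by evaluation. -/
theorem Prog.agree_run {A B : ℕ} (c : Prog) : ∀ (_ : c.above A B = true) (σ : Mem),
    Agree A B σ (c.run σ) := by
  induction c with
  | skip => exact fun _ σ => Agree.refl A B σ
  | setWord a i e => exact fun h σ => Agree.setWord σ (by simpa [above] using h) _ _
  | setReal a i e => exact fun h σ => Agree.setReal σ (by simpa [above] using h) _ _
  | seq c d ihc ihd =>
    intro h σ
    simp only [above, Bool.and_eq_true] at h
    exact (ihc h.1 σ).trans (ihd h.2 _)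
  | ifWordLt e f c d ihc ihd | ifRealLt e f c d ihc ihd =>
    intro h σ
    simp only [above, Bool.and_eq_true] at h
    simp only [run]
    split_ifs
    · exact ihc h.1 σ
    · exact ihd h.2 σ
  | loop a e c ih =>
    intro h σ
    simp only [above, Bool.and_eq_true, decide_eq_true_eq] at h
    have : ∀ n, Agree A B σ (iter (fun i τ => c.run (τ.setWord a 0 i)) n σ) := by
      intro n
      induction n with
      | zero => exact Agree.refl A B σ
      | succ n ihn => exact (ihn.trans (Agree.setWord _ (Or.inl h.1) _ _)).trans (ih h.2 _)
    exact this _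

/-- The program, started in `σ`, ends in a state that satisfies `Q`, takes at most `X` steps for
each of its symbols, and stores no word above `W`. -/
structure Ok (W X : ℕ) (c : Prog) (σ : Mem) (Q : Mem → Prop) : Prop where
  post : Q (c.run σ)
  steps : c.steps σ ≤ c.size * X
  safe : c.Safe W σ

namespace Ok

variable {W X : ℕ} {c d : Prog} {σ : Mem} {Q Q' : Mem → Prop}

theorem conseq (h : Ok W X c σ Q) (hQ : ∀ τ, Q τ → Q' τ) : Ok W X c σ Q' := ⟨hQ _ h.1, h.2, h.3⟩

theorem mono {X' : ℕ} (h : Ok W X c σ Q) (hX : X ≤ X') : Ok W X' c σ Q :=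
  ⟨h.1, h.2.trans (Nat.mul_le_mul_left _ hX), h.3⟩

theorem frame (A B : ℕ) (h : Ok W X c σ Q) (hc : c.above A B = true) :
    Ok W X c σ fun τ => Agree A B σ τ ∧ Q τ := ⟨⟨c.agree_run hc σ, h.1⟩, h.2, h.3⟩

theorem seq (h : Ok W X c σ Q) (h' : ∀ τ, Q τ → Ok W X d τ Q') : Ok W X (c ;; d) σ Q' := by
  have h1 := h' _ h.1
  exact ⟨h1.1, by
    simp only [Prog.steps, Prog.size, add_mul]
    exact Nat.add_le_add h.2 h1.2, h.3, h1.3⟩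

theorem skip (hX : 1 ≤ X) (hQ : Q σ) : Ok W X .skip σ Q := ⟨hQ, by simpa [Prog.steps, Prog.size], trivial⟩

theorem setWord {a : ℕ} {i e : WExp} (hX : 1 ≤ X) (hW : e.eval σ ≤ W)
    (hQ : Q (σ.setWord a (i.eval σ) (e.eval σ))) : Ok W X (.setWord a i e) σ Q :=
  ⟨hQ, by
    simp only [Prog.steps, Prog.size]
    exact le_trans (by omega) (Nat.le_mul_of_pos_right _ hX), hW⟩

theorem setReal {a : ℕ} {i : WExp} {e : RExp} (hX : 1 ≤ X)
    (hQ : Q (σ.setReal a (i.eval σ) (e.eval σ))) : Ok W X (.setReal a i e) σ Q :=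
  ⟨hQ, by
    simp only [Prog.steps, Prog.size]
    exact le_trans (by omega) (Nat.le_mul_of_pos_right _ hX), trivial⟩

theorem setWord_seq {a : ℕ} {i e : WExp} (hX : 1 ≤ X) (hW : e.eval σ ≤ W)
    (h : Ok W X c (σ.setWord a (i.eval σ) (e.eval σ)) Q) : Ok W X (.setWord a i e ;; c) σ Q :=
  seq (setWord (Q := fun τ => τ = σ.setWord a (i.eval σ) (e.eval σ)) hX hW rfl)
    fun _ hτ => hτ ▸ h

theorem setReal_seq {a : ℕ} {i : WExp} {e : RExp} (hX : 1 ≤ X)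
    (h : Ok W X c (σ.setReal a (i.eval σ) (e.eval σ)) Q) : Ok W X (.setReal a i e ;; c) σ Q :=
  seq (setReal (Q := fun τ => τ = σ.setReal a (i.eval σ) (e.eval σ)) hX rfl)
    fun _ hτ => hτ ▸ h

theorem setWord_eq {a j x : ℕ} {i e : WExp} (hX : 1 ≤ X) (hi : i.eval σ = j) (he : e.eval σ = x)
    (hW : x ≤ W) (hQ : Q (σ.setWord a j x)) : Ok W X (.setWord a i e) σ Q :=
  setWord hX (he ▸ hW) (by rw [hi, he]; exact hQ)

theorem setWord_eq_seq {a j x : ℕ} {i e : WExp} (hX : 1 ≤ X) (hi : i.eval σ = j)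
    (he : e.eval σ = x) (hW : x ≤ W) (h : Ok W X c (σ.setWord a j x) Q) :
    Ok W X (.setWord a i e ;; c) σ Q :=
  setWord_seq hX (he ▸ hW) (by rw [hi, he]; exact h)

theorem setReal_eq {a j : ℕ} {x : ℝ} {i : WExp} {e : RExp} (hX : 1 ≤ X) (hi : i.eval σ = j)
    (he : e.eval σ = x) (hQ : Q (σ.setReal a j x)) : Ok W X (.setReal a i e) σ Q :=
  setReal hX (by rw [hi, he]; exact hQ)

theorem setReal_eq_seq {a j : ℕ} {x : ℝ} {i : WExp} {e : RExp} (hX : 1 ≤ X) (hi : i.eval σ = j)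
    (he : e.eval σ = x) (h : Ok W X c (σ.setReal a j x) Q) : Ok W X (.setReal a i e ;; c) σ Q :=
  setReal_seq hX (by rw [hi, he]; exact h)

theorem ifWordLt {e f : WExp} (hX : 1 ≤ X) (h : e.eval σ < f.eval σ → Ok W X c σ Q)
    (h' : ¬e.eval σ < f.eval σ → Ok W X d σ Q) : Ok W X (.ifWordLt e f c d) σ Q := by
  by_cases hc : e.eval σ < f.eval σ
  · have h1 := h hc
    refine ⟨by simpa only [Prog.run, if_pos hc] using h1.1, ?_, fun _ => h1.3, fun h => absurd hc h⟩
    simp only [Prog.steps, Prog.size, if_pos hc]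
    have := h1.2
    nlinarith
  · have h1 := h' hc
    refine ⟨by simpa only [Prog.run, if_neg hc] using h1.1, ?_, fun h => absurd h hc, fun _ => h1.3⟩
    simp only [Prog.steps, Prog.size, if_neg hc]
    have := h1.2
    nlinarith

theorem ifRealLt {e f : RExp} (hX : 1 ≤ X) (h : e.eval σ < f.eval σ → Ok W X c σ Q)
    (h' : ¬e.eval σ < f.eval σ → Ok W X d σ Q) : Ok W X (.ifRealLt e f c d) σ Q := by
  by_cases hc : e.eval σ < f.eval σ
  · have h1 := h hc
    refine ⟨by simpa only [Prog.run, if_pos hc] using h1.1, ?_, fun _ => h1.3, fun h => absurd hc h⟩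
    simp only [Prog.steps, Prog.size, if_pos hc]
    have := h1.2
    nlinarith
  · have h1 := h' hc
    refine ⟨by simpa only [Prog.run, if_neg hc] using h1.1, ?_, fun h => absurd h hc, fun _ => h1.3⟩
    simp only [Prog.steps, Prog.size, if_neg hc]
    have := h1.2
    nlinarith

/-- A body that costs `Y` per symbol and runs `n` times costs `n Y` per symbol. The two extra units
in the size of a loop pay for starting it and for its rounds. The invariant must survive a write to
the counter, which precedes every round. -/
theorem loop {Y n a : ℕ} {e : WExp} (A B : ℕ) (I : ℕ → Mem → Prop)
    (hab : (Prog.loop a e c).above A B = true) (hn : e.eval σ = n) (hnW : n ≤ W) (hX : n * Y ≤ X)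
    (hY : 1 ≤ Y) (hX1 : 1 ≤ X) (h0 : I 0 σ) (hI : ∀ i τ x, I i τ → I i (τ.setWord a 0 x))
    (hbody : ∀ i < n, ∀ τ, Agree A B σ τ → I i τ → τ.word a 0 = i → Ok W Y c τ (I (i + 1))) :
    Ok W X (.loop a e c) σ fun τ => Agree A B σ τ ∧ I n τ := by
  have hab' := hab
  simp only [Prog.above, Bool.and_eq_true, decide_eq_true_eq] at hab'
  set f : ℕ → Mem := fun i => iter (fun i τ => c.run (τ.setWord a 0 i)) i σ with hf
  have hagree : ∀ i, Agree A B σ (f i) := by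
    intro i
    induction i with
    | zero => exact Agree.refl A B σ
    | succ i ih =>
      exact (ih.trans (Agree.setWord _ (Or.inl hab'.1) _ _)).trans (c.agree_run hab'.2 _)
  have hok : ∀ i < n, I i (f i) → Ok W Y c ((f i).setWord a 0 i) (I (i + 1)) := fun i hi h =>
    hbody i hi _ ((hagree i).trans (Agree.setWord _ (Or.inl hab'.1) _ _)) (hI _ _ _ h) (by simp)
  have hinv : ∀ i ≤ n, I i (f i) := by
    intro i
    induction i with
    | zero => exact fun _ => h0
    | succ i ih => exact fun hi => (hok i hi (ih (by omega))).1
  refine ⟨⟨Prog.agree_run _ hab σ, ?_⟩, ?_, ?_, ?_⟩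
  · simp only [Prog.run, hn]
    exact hinv n le_rfl
  · simp only [Prog.steps, Prog.size, hn]
    have h1 : ∑ i ∈ Finset.range n, (c.steps ((f i).setWord a 0 i) + 1) ≤ n * (c.size * Y + 1) := by
      rw [← smul_eq_mul, ← Finset.card_range n, ← Finset.sum_const, Finset.card_range]
      refine Finset.sum_le_sum fun i hi => ?_
      have hi := Finset.mem_range.1 hi
      have := (hok i hi (hinv i hi.le)).2
      omega
    have h2 : n ≤ X := (Nat.le_mul_of_pos_right n hY).trans hX
    have h3 : n * (c.size * Y + 1) ≤ (c.size + 1) * X := by nlinarith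
    have h4 : e.cost + 1 ≤ (e.cost + 1) * X := Nat.le_mul_of_pos_right _ hX1
    nlinarith
  · rw [hn]; exact hnW
  · rw [hn]
    exact fun i hi => (hok i hi (hinv i hi.le)).3

end Ok

end QMC
end

/-! ### Programs for the arithmetic of the residue field -/

noncomputable section
namespace QMC

/-- The words that the algorithm stores are bounded by `W`. -/
structure Sizes (W b m s α T : ℕ) : Prop where
  deg : 1 ≤ m
  le_len : 2 * b ^ m ≤ 2 ^ T
  len : 2 ^ T ≤ W
  ord : 2 ≤ α
  ord_le : α ≤ W
  dim : 1 ≤ s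
  dim_le : s ≤ W

/-- The parameters and the tables of the field arithmetic. -/
structure Base (b m s α T : ℕ) (P : Polynomial (ZMod b)) (σ : Mem) : Prop where
  base : σ.word 0 0 = b
  deg : σ.word 0 1 = m
  dim : σ.word 0 2 = s
  ord : σ.word 0 3 = α
  pw : ∀ r ≤ m, σ.word 3 r = b ^ r
  card : σ.word 4 0 = b ^ m
  len : σ.word 5 0 = 2 ^ T
  log : σ.word 6 0 = T
  red : ∀ r < m, P.leadingCoeff * (σ.word 8 r : ZMod b) = -P.coeff r

theorem Base.agree {b m s α T : ℕ} {P : Polynomial (ZMod b)} {σ τ : Mem} {A B : ℕ}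
    (h : Base b m s α T P σ) (hστ : Agree A B σ τ) (hA : 9 ≤ A) : Base b m s α T P τ := by
  have h0 := hστ.word 0 (by omega) (by omega)
  have h3 := hστ.word 3 (by omega) (by omega)
  have h4 := hστ.word 4 (by omega) (by omega)
  have h5 := hστ.word 5 (by omega) (by omega)
  have h6 := hστ.word 6 (by omega) (by omega)
  have h8 := hστ.word 8 (by omega) (by omega)
  constructor <;> simp only [h0, h3, h4, h5, h6, h8]
  exacts [h.base, h.deg, h.dim, h.ord, h.pw, h.card, h.len, h.log, h.red]

theorem Base.setWord {b m s α T : ℕ} {P : Polynomial (ZMod b)} {σ : Mem}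
    (h : Base b m s α T P σ) {a : ℕ} (ha : 9 ≤ a) (i x : ℕ) :
    Base b m s α T P (σ.setWord a i x) :=
  h.agree (A := 9) (B := 0) (Agree.setWord σ (Or.inl ha) i x) le_rfl

theorem Base.setReal {b m s α T : ℕ} {P : Polynomial (ZMod b)} {σ : Mem}
    (h : Base b m s α T P σ) (a i : ℕ) (x : ℝ) : Base b m s α T P (σ.setReal a i x) :=
  h.agree (A := 9) (B := 0) (Agree.setReal σ (Nat.zero_le _) i x) le_rfl

theorem Sizes.card_le {W b m s α T : ℕ} (h : Sizes W b m s α T) : 2 * b ^ m ≤ W :=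
  h.le_len.trans h.len

section Words

variable {W b m s α T : ℕ} [Fact b.Prime] {P : Polynomial (ZMod b)}

theorem deg_lt_card (b m : ℕ) [Fact b.Prime] : m < b ^ m :=
  Nat.lt_pow_self (Fact.out : b.Prime).one_lt

theorem Sizes.base_lt (h : Sizes W b m s α T) : 1 < b ^ m := by
  have := h.deg
  exact (Fact.out : b.Prime).one_lt.trans_le (Nat.le_self_pow (by omega) b)

/-- One step of Horner's scheme: accumulator `60`, digit `58`, factor `56`. -/
def stepProg : Prog :=
  .setWord 61 0 (var 60 / .load 3 (.load 0 1 - 1)) ;;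
  .setWord 62 0 0 ;;
  .loop 63 (.load 0 1) (.setWord 62 0 (var 62 + ((var 60 * .load 0 0 / .load 3 (var 63) +
    var 61 * .load 8 (var 63) + var 58 * (var 56 / .load 3 (var 63))) % .load 0 0) *
    .load 3 (var 63))) ;;
  .setWord 60 0 (var 62)

/-- The digits of `fieldStep` are accumulated from the bottom; every partial sum is a word with at
most `m` digits and so respects the word bound. -/
theorem stepProg_ok (hs : Sizes W b m s α T) {σ : Mem} (hσ : Base b m s α T P σ)
    (hacc : σ.word 60 0 < b ^ m) :
    Ok W m stepProg σ fun τ => Agree 60 1000 σ τ ∧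
      τ.word 60 0 = fieldStep b m (σ.word 8) (σ.word 60 0) (σ.word 58 0) (σ.word 56 0) := by
  refine Ok.frame 60 1000 ?_ rfl
  have hm := hs.deg
  have hb := (Fact.out : b.Prime).pos
  have hcard := hs.card_le
  have hmN := deg_lt_card b m
  set acc := σ.word 60 0
  set f : ℕ → ℕ := fun r => (acc * b / b ^ r + acc / b ^ (m - 1) * σ.word 8 r +
    σ.word 58 0 * (σ.word 56 0 / b ^ r)) % b with hf
  have hlt : ∀ i ≤ m, ∑ r ∈ Finset.range i, f r * b ^ r ≤ W := by
    intro i hi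
    have h1 := digit_sum_lt hb f (fun _ => Nat.mod_lt _ hb) i
    have h2 : b ^ i ≤ b ^ m := Nat.pow_le_pow_right hb hi
    omega
  refine Ok.setWord_eq_seq (j := 0) (x := acc / b ^ (m - 1)) hm rfl
    (by simp [hσ.deg, hσ.pw (m - 1) (by omega), acc])
    ((Nat.div_le_self _ _).trans (by omega)) ?_
  refine Ok.setWord_eq_seq (j := 0) (x := 0) hm rfl rfl (Nat.zero_le _) ?_
  refine Ok.seq (Ok.loop (n := m) (Y := 1) 62 1000
    (fun i τ => τ.word 62 0 = ∑ r ∈ Finset.range i, f r * b ^ r) rfl (by simp [hσ.deg])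
    (by omega) (by omega) le_rfl hm (by simp) (fun i τ x h => by simpa using h) ?_) ?_
  · intro i hi τ hτ hI hc
    refine Ok.setWord_eq (j := 0) (x := ∑ r ∈ Finset.range (i + 1), f r * b ^ r) le_rfl rfl ?_
      (hlt _ hi) (by simp)
    have h0 := hτ.word 0 (by omega) (by omega)
    have h3 := hτ.word 3 (by omega) (by omega)
    have h8 := hτ.word 8 (by omega) (by omega)
    have h56 := hτ.word 56 (by omega) (by omega)
    have h58 := hτ.word 58 (by omega) (by omega)
    have h60 := hτ.word 60 (by omega) (by omega)
    have h61 := hτ.word 61 (by omega) (by omega)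
    simp at h0 h3 h8 h56 h58 h60 h61
    rw [Finset.sum_range_succ]
    simp [h0, h3, h8, h56, h58, h60, h61, hI, hc, hσ.base, hσ.pw i hi.le, hf, acc]
  · rintro τ ⟨hτ, hI⟩
    refine Ok.setWord_eq (j := 0) (x := fieldStep b m (σ.word 8) acc (σ.word 58 0) (σ.word 56 0))
      hm rfl (by simp [hI, fieldStep, hf]) ?_ (by simp)
    have := fieldStep_lt (b := b) (m := m) (σ.word 8) acc (σ.word 58 0) (σ.word 56 0)
    omega

/-- The product of the words `55` and `56`, computed in `60`. -/
def mulProg : Prog :=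
  .setWord 60 0 0 ;;
  .loop 57 (.load 0 1) (
    .setWord 58 0 (var 55 / .load 3 (.load 0 1 - 1 - var 57) % .load 0 0) ;;
    stepProg)

/-- Horner's scheme from the top digit: after `i` rounds the accumulator is the product with the
quotient of the first factor by `b ^ (m - i)`. -/
theorem mulProg_ok (hs : Sizes W b m s α T) (hd : P.natDegree = m) {σ : Mem}
    (hσ : Base b m s α T P σ) (h55 : σ.word 55 0 < b ^ m) :
    Ok W (m * m) mulProg σ fun τ => Agree 57 1000 σ τ ∧ τ.word 60 0 < b ^ m ∧
      wordClass m P (τ.word 60 0) = wordClass m P (σ.word 55 0) * wordClass m P (σ.word 56 0) := by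
  refine Ok.frame 57 1000 ?_ rfl
  have hm := hs.deg
  have hb := (Fact.out : b.Prime).pos
  have hcard := hs.card_le
  have hmN := deg_lt_card b m
  have hbm : b ≤ b ^ m := Nat.le_self_pow (by omega) b
  have hmm : 1 ≤ m * m := Nat.mul_pos hm hm
  refine Ok.setWord_eq_seq (j := 0) (x := 0) hmm rfl rfl (Nat.zero_le _) ?_
  refine (Ok.loop (n := m) (Y := m) 57 1000
    (fun i τ => τ.word 60 0 < b ^ m ∧ wordClass m P (τ.word 60 0) =
      wordClass m P (σ.word 55 0 / b ^ (m - i)) * wordClass m P (σ.word 56 0)) rfl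
    (by simp [hσ.deg]) (by omega) le_rfl hm hmm ?_ (fun i τ x h => by simpa using h) ?_).conseq ?_
  · simp only [Mem.setWord_word_self, Function.update_self, Nat.sub_zero]
    rw [Nat.div_eq_of_lt h55, wordClass_zero, zero_mul]
    exact ⟨by positivity, rfl⟩
  · intro i hi τ hτ hI hc
    have hτB := (hσ.setWord (a := 60) (by omega) 0 0).agree hτ (by omega)
    have h55' := hτ.word 55 (by omega) (by omega)
    have h56' := hτ.word 56 (by omega) (by omega)
    simp at h55' h56'
    set y := σ.word 55 0 / b ^ (m - (i + 1)) with hy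
    have hmi : m - 1 - i = m - (i + 1) := by omega
    refine Ok.setWord_eq_seq (j := 0) (x := y % b) hm rfl
      (by simp [hτB.deg, hτB.base, hτB.pw (m - (i + 1)) (by omega), hc, h55', hy, hmi]) ?_ ?_
    · have := Nat.mod_lt y hb
      omega
    refine (stepProg_ok hs (hτB.setWord (by omega) _ _) (by simpa using hI.1)).conseq ?_
    rintro υ ⟨_, hυ⟩
    rw [hυ]
    refine ⟨fieldStep_lt _ _ _ _, ?_⟩
    rw [wordClass_fieldStep hm hd (by simpa using hτB.red)]
    simp only [Mem.setWord_word_self, Function.update_self, ne_eq, Nat.reduceEqDiff,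
      not_false_eq_true, Mem.setWord_word_of_ne, h56', hI.2]
    have h1 : σ.word 55 0 / b ^ (m - i) = y / b := by
      rw [hy, Nat.div_div_eq_div_mul, ← pow_succ]
      congr 2
      omega
    have h2 : y < b ^ m := (Nat.div_le_self _ _).trans_lt h55
    rw [h1, wordClass_eq_horner h2]
    ring
  · rintro τ ⟨_, h1, h2⟩
    rw [Nat.sub_self, pow_zero, Nat.div_one] at h2
    exact ⟨h1, h2⟩

/-- The power of the word `48` with exponent `49`, computed in `50`. -/
def powProg : Prog :=
  .setWord 50 0 1 ;;
  .setWord 51 0 (var 48) ;;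
  .setWord 52 0 (var 49) ;;
  .loop 53 (var 6) (
    .ifWordLt 0 (var 52 % 2) (
      .setWord 55 0 (var 50) ;;
      .setWord 56 0 (var 51) ;;
      mulProg ;;
      .setWord 50 0 (var 60)) .skip ;;
    .setWord 55 0 (var 51) ;;
    .setWord 56 0 (var 51) ;;
    mulProg ;;
    .setWord 51 0 (var 60) ;;
    .setWord 52 0 (var 52 / 2))

/-- Repeated squaring: the accumulator times the current base to the remaining exponent is
invariant, and `T` rounds exhaust an exponent below `2 ^ T`. -/
theorem powProg_ok (hs : Sizes W b m s α T) (hd : P.natDegree = m) {σ : Mem}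
    (hσ : Base b m s α T P σ) (h48 : σ.word 48 0 < b ^ m) (h49 : σ.word 49 0 < b ^ m) :
    Ok W (T * (m * m)) powProg σ fun τ => Agree 50 1000 σ τ ∧ τ.word 50 0 < b ^ m ∧
      wordClass m P (τ.word 50 0) = wordClass m P (σ.word 48 0) ^ σ.word 49 0 := by
  refine Ok.frame 50 1000 ?_ rfl
  have hm := hs.deg
  have hcard := hs.card_le
  have hlen := hs.le_len
  have hlenW := hs.len
  have hT : T < 2 ^ T := Nat.lt_two_pow_self
  have hmm : 1 ≤ m * m := Nat.mul_pos hm hm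
  have h1N := hs.base_lt
  have hT0 : 1 ≤ T := Nat.pos_of_ne_zero (by rintro rfl; simp at hlen; omega)
  have hX : 1 ≤ T * (m * m) := Nat.mul_pos hT0 hmm
  refine Ok.setWord_eq_seq (j := 0) (x := 1) hX rfl rfl (by omega) ?_
  refine Ok.setWord_eq_seq (j := 0) (x := σ.word 48 0) hX rfl (by simp) (by omega) ?_
  refine Ok.setWord_eq_seq (j := 0) (x := σ.word 49 0) hX rfl (by simp) (by omega) ?_
  have mul_sq : ∀ τ : Mem, Base b m s α T P τ → τ.word 51 0 < b ^ m → τ.word 52 0 ≤ W →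
      Ok W (m * m) (.setWord 55 0 (var 51) ;; .setWord 56 0 (var 51) ;; mulProg ;;
        .setWord 51 0 (var 60) ;; .setWord 52 0 (var 52 / 2)) τ fun υ =>
        υ.word 50 0 = τ.word 50 0 ∧ υ.word 51 0 < b ^ m ∧ υ.word 52 0 = τ.word 52 0 / 2 ∧
        wordClass m P (υ.word 51 0) = wordClass m P (τ.word 51 0) ^ 2 := by
    intro τ hτ h51 h52W
    refine Ok.setWord_eq_seq (j := 0) (x := τ.word 51 0) hmm rfl (by simp) (by omega) ?_
    refine Ok.setWord_eq_seq (j := 0) (x := τ.word 51 0) hmm rfl (by simp) (by omega) ?_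
    refine Ok.seq (mulProg_ok hs hd ((hτ.setWord (by omega) _ _).setWord (by omega) _ _)
      (by simpa using h51)) ?_
    rintro υ ⟨hυ, h60, hmul⟩
    have h50' := hυ.word 50 (by omega) (by omega)
    have h52' := hυ.word 52 (by omega) (by omega)
    simp at h50' h52' hmul
    have h51' := hυ.word 51 (by omega) (by omega)
    simp at h51'
    refine Ok.setWord_eq_seq (j := 0) (x := υ.word 60 0) hmm rfl (by simp) (by omega) ?_
    refine Ok.setWord_eq (j := 0) (x := τ.word 52 0 / 2) hmm rfl (by simp [h52'])
      ((Nat.div_le_self _ _).trans h52W) ?_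
    simpa [h50', hmul, pow_two] using h60
  refine (Ok.loop (n := T) (Y := m * m) 50 1000
    (fun i τ => τ.word 50 0 < b ^ m ∧ τ.word 51 0 < b ^ m ∧ τ.word 52 0 = σ.word 49 0 / 2 ^ i ∧
      wordClass m P (τ.word 50 0) * wordClass m P (τ.word 51 0) ^ τ.word 52 0 =
      wordClass m P (σ.word 48 0) ^ σ.word 49 0) rfl
    (by simp [hσ.log]) (by omega) le_rfl hmm hX ?_ (fun i τ x h => by simpa using h) ?_).conseq ?_
  · simp [wordClass_one hm, h1N, h48]
  · rintro i hi τ hτ ⟨hI1, hI2, hI3, hI4⟩ hc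
    have hτB := (((hσ.setWord (a := 50) (by omega) 0 1).setWord (a := 51) (by omega) 0
      (σ.word 48 0)).setWord (a := 52) (by omega) 0 (σ.word 49 0)).agree hτ (by omega)
    have h52W : τ.word 52 0 ≤ W := by
      rw [hI3]
      exact (Nat.div_le_self _ _).trans (by omega)
    have hdiv : σ.word 49 0 / 2 ^ i / 2 = σ.word 49 0 / 2 ^ (i + 1) := by
      rw [Nat.div_div_eq_div_mul, pow_succ]
    refine Ok.seq (Q := fun υ => Base b m s α T P υ ∧ υ.word 50 0 < b ^ m ∧
      υ.word 51 0 = τ.word 51 0 ∧ υ.word 52 0 = τ.word 52 0 ∧ wordClass m P (υ.word 50 0) =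
        wordClass m P (τ.word 50 0) * wordClass m P (τ.word 51 0) ^ (τ.word 52 0 % 2))
      (Ok.ifWordLt hmm (fun h => ?_) fun h => Ok.skip hmm ?_) ?_
    · have h1 : τ.word 52 0 % 2 = 1 := by
        simp at h
        omega
      refine Ok.setWord_eq_seq (j := 0) (x := τ.word 50 0) hmm rfl (by simp) (by omega) ?_
      refine Ok.setWord_eq_seq (j := 0) (x := τ.word 51 0) hmm rfl (by simp) (by omega) ?_
      refine Ok.seq (mulProg_ok hs hd ((hτB.setWord (by omega) _ _).setWord (by omega) _ _)
        (by simpa using hI1)) ?_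
      rintro υ ⟨hυ, h60, hmul⟩
      have h51' := hυ.word 51 (by omega) (by omega)
      have h52' := hυ.word 52 (by omega) (by omega)
      simp at h51' h52' hmul
      refine Ok.setWord_eq (j := 0) (x := υ.word 60 0) hmm rfl (by simp) (by omega) ?_
      refine ⟨(((hτB.setWord (by omega) _ _).setWord (by omega) _ _).agree hυ
        (by omega)).setWord (by omega) _ _, ?_⟩
      simp [h51', h52', hmul, h60, h1]
    · have h1 : τ.word 52 0 % 2 = 0 := by
        simp at h
        omega
      exact ⟨hτB, hI1, rfl, rfl, by rw [h1, pow_zero, mul_one]⟩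
    · rintro υ ⟨hυ, h50', h51', h52', hcl⟩
      refine (mul_sq υ hυ (by omega) (by omega)).conseq ?_
      rintro ω ⟨e50, e51, e52, e⟩
      refine ⟨by omega, e51, by rw [e52, h52', hI3, hdiv], ?_⟩
      rw [e50, hcl, e, e52, h51', h52', ← pow_mul, mul_assoc, ← pow_add, Nat.mod_add_div, hI4]
  · rintro τ ⟨_, h1, h2, h3, h4⟩
    have h5 : σ.word 49 0 / 2 ^ T = 0 := Nat.div_eq_of_lt (by omega)
    rw [h3, h5, pow_zero, mul_one] at h4
    exact ⟨h1, h4⟩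

end Words
end QMC
end

/-! ### Programs for the parameters and the reduced modulus -/

noncomputable section
namespace QMC

section Setup

variable {W b m s α : ℕ} [Fact b.Prime] {P : Polynomial (ZMod b)}

/-- The powers of the base in array `3`, and the number of nodes in array `4`. -/
def powersProg : Prog :=
  .setWord 3 0 1 ;;
  .loop 20 (.load 0 1) (.setWord 3 (var 20 + 1) (.load 3 (var 20) * .load 0 0)) ;;
  .setWord 4 0 (.load 3 (.load 0 1))

theorem powersProg_ok {σ : Mem} (hm : 1 ≤ m) (hW : b ^ m ≤ W) (h0 : σ.word 0 0 = b)
    (h1 : σ.word 0 1 = m) :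
    Ok W (b ^ m) powersProg σ fun τ => Agree 3 1000 σ τ ∧ (∀ r ≤ m, τ.word 3 r = b ^ r) ∧
      τ.word 4 0 = b ^ m := by
  refine Ok.frame 3 1000 ?_ rfl
  have hb := (Fact.out : b.Prime).pos
  have hmN := deg_lt_card b m
  have hX : 1 ≤ b ^ m := by omega
  refine Ok.setWord_eq_seq (j := 0) (x := 1) hX rfl rfl (by omega) ?_
  refine Ok.seq (Ok.loop (n := m) (Y := 1) 3 1000
    (fun i τ => ∀ r ≤ i, τ.word 3 r = b ^ r) rfl (by simp [h1]) (by omega) (by omega) le_rfl hX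
    (by simp) (fun i τ x h => by simpa using h) ?_) ?_
  · intro i hi τ hτ hI hc
    have h0' := hτ.word 0 (by omega) (by omega)
    simp at h0'
    have hle : b ^ (i + 1) ≤ b ^ m := Nat.pow_le_pow_right hb hi
    refine Ok.setWord_eq (j := i + 1) (x := b ^ (i + 1)) le_rfl (by simp [hc])
      (by simp [hc, hI i le_rfl, h0', h0, pow_succ]) (hle.trans hW) ?_
    intro r hr
    rcases eq_or_ne r (i + 1) with rfl | h
    · simp
    · simp [h, hI r (by omega)]
  · rintro τ ⟨hτ, hI⟩
    have h0' := hτ.word 0 (by omega) (by omega)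
    simp at h0'
    refine Ok.setWord_eq (j := 0) (x := b ^ m) hX rfl (by simp [h0', h1, hI m le_rfl]) hW ?_
    simpa using hI

/-- The length of the Fourier transform in array `5` and its logarithm in array `6`. -/
def lengthProg : Prog :=
  .setWord 5 0 1 ;;
  .setWord 6 0 0 ;;
  .loop 20 (var 4) (.ifWordLt (var 5) (2 * var 4)
    (.setWord 5 0 (2 * var 5) ;; .setWord 6 0 (var 6 + 1)) .skip)

theorem clog_le_card (N : ℕ) (hN : 1 ≤ N) : Nat.clog 2 (2 * N) ≤ N := by
  rw [Nat.clog_le_iff_le_pow one_lt_two]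
  have := (Nat.lt_two_pow_self (n := N - 1))
  have h2 : 2 ^ N = 2 * 2 ^ (N - 1) := by rw [← pow_succ']; congr 1; omega
  omega

/-- Doubling continues while the length is below `2 N`, so the exponent after `i` rounds is `min i
T`; `N` rounds suffice because `T ≤ N`. -/
theorem lengthProg_ok {σ : Mem} {N T : ℕ} (hN : 1 ≤ N) (hT : T = Nat.clog 2 (2 * N))
    (hW : 2 ^ T ≤ W) (h4 : σ.word 4 0 = N) :
    Ok W N lengthProg σ fun τ => Agree 5 1000 σ τ ∧ τ.word 5 0 = 2 ^ T ∧ τ.word 6 0 = T := by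
  refine Ok.frame 5 1000 ?_ rfl
  have hTN : T ≤ N := hT ▸ clog_le_card N hN
  have hNT : 2 * N ≤ 2 ^ T := hT ▸ Nat.le_pow_clog one_lt_two _
  have hTT : T < 2 ^ T := Nat.lt_two_pow_self
  refine Ok.setWord_eq_seq (j := 0) (x := 1) hN rfl rfl (by omega) ?_
  refine Ok.setWord_eq_seq (j := 0) (x := 0) hN rfl rfl (by omega) ?_
  refine (Ok.loop (n := N) (Y := 1) 5 1000
    (fun i τ => τ.word 5 0 = 2 ^ min i T ∧ τ.word 6 0 = min i T) rfl (by simp [h4]) (by omega)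
    (by omega) le_rfl hN (by simp) (fun i τ x h => by simpa using h) ?_).conseq ?_
  · rintro i hi τ hτ ⟨hI1, hI2⟩ hc
    have h4' := hτ.word 4 (by omega) (by omega)
    simp at h4'
    refine Ok.ifWordLt le_rfl (fun h => ?_) fun h => Ok.skip le_rfl ?_
    · simp [hI1, h4', h4] at h
      have h2 : min i T < T := by
        rw [hT]
        exact (Nat.lt_clog_iff_pow_lt one_lt_two).2 (hT ▸ h)
      have h3 : min (i + 1) T = min i T + 1 := by omega
      have h5 : 2 ^ min (i + 1) T ≤ 2 ^ T := Nat.pow_le_pow_right (by omega) (by omega)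
      refine Ok.setWord_eq_seq (j := 0) (x := 2 ^ min (i + 1) T) le_rfl rfl
        (by simp [hI1, h3, pow_succ']) (h5.trans hW) ?_
      exact Ok.setWord_eq (j := 0) (x := min (i + 1) T) le_rfl rfl (by simp [hI2, h3]) (by omega)
        (by simp)
    · simp [hI1, h4', h4] at h
      have h2 : T ≤ min i T := by
        conv_lhs => rw [hT]
        exact (Nat.clog_le_iff_le_pow one_lt_two).2 h
      have h3 : min (i + 1) T = min i T := by omega
      rw [h3]
      exact ⟨hI1, hI2⟩
  · rintro τ ⟨_, h1, h2⟩
    rw [min_eq_right hTN] at h1 h2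
    exact ⟨h1, h2⟩

/-- The reduced coefficients of the modulus in array `8`. -/
def reduceProg : Prog :=
  .setWord 7 0 1 ;;
  .loop 20 (.load 0 0 - 2) (.setWord 7 0 (var 7 * .load 1 (.load 0 1) % .load 0 0)) ;;
  .loop 20 (.load 0 1) (.setWord 8 (var 20) ((.load 0 0 - .load 1 (var 20)) * var 7 % .load 0 0))

/-- By Fermat's theorem the power `b - 2` of the leading coefficient is its inverse. Plain repeated
multiplication is affordable, as `b ≤ b ^ m`. -/
theorem reduceProg_ok {σ : Mem} (hm : 1 ≤ m) (hd : P.natDegree = m) (hW : b ^ m ≤ W)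
    (h0 : σ.word 0 0 = b) (h1 : σ.word 0 1 = m) (hP : ∀ r, σ.word 1 r = (P.coeff r).val) :
    Ok W (b ^ m) reduceProg σ fun τ => Agree 7 1000 σ τ ∧
      ∀ r < m, P.leadingCoeff * (τ.word 8 r : ZMod b) = -P.coeff r := by
  refine Ok.frame 7 1000 ?_ rfl
  have hb := (Fact.out : b.Prime).one_lt
  have hmN := deg_lt_card b m
  have hbm : b ≤ b ^ m := Nat.le_self_pow (by omega) b
  have hX : 1 ≤ b ^ m := by omega
  have hlc : P.leadingCoeff ≠ 0 := by
    rw [Polynomial.leadingCoeff_ne_zero]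
    rintro rfl
    simp at hd
    omega
  refine Ok.setWord_eq_seq (j := 0) (x := 1) hX rfl rfl (by omega) ?_
  refine Ok.seq (Ok.loop (n := b - 2) (Y := 1) 7 1000
    (fun i τ => (τ.word 7 0 : ZMod b) = P.leadingCoeff ^ i) rfl (by simp [h0]) (by omega)
    (by omega) le_rfl hX (by simp) (fun i τ x h => by simpa using h) ?_) ?_
  · intro i hi τ hτ hI hc
    have h0' := hτ.word 0 (by omega) (by omega)
    have h1' := hτ.word 1 (by omega) (by omega)
    simp at h0' h1'
    refine Ok.setWord_eq (j := 0) (x := τ.word 7 0 * (P.coeff m).val % b) le_rfl rfl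
      (by simp [h0', h1', h0, h1, hP]) ?_ ?_
    · have := Nat.mod_lt (τ.word 7 0 * (P.coeff m).val) (show 0 < b by omega)
      omega
    · simp [hI, ← hd, pow_succ]
  · rintro τ ⟨hτ, hI⟩
    have h0' := hτ.word 0 (by omega) (by omega)
    have h1' := hτ.word 1 (by omega) (by omega)
    simp at h0' h1'
    refine (Ok.loop (n := m) (Y := 1) 8 1000
      (fun i υ => ∀ r < i, P.leadingCoeff * (υ.word 8 r : ZMod b) = -P.coeff r) rfl
      (by simp [h0', h1]) (by omega) (by omega) le_rfl hX (by simp)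
      (fun i τ x h => by simpa using h) ?_).conseq fun _ h => h.2
    intro i hi υ hυ hI' hc
    have h0'' := hυ.word 0 (by omega) (by omega)
    have h1'' := hυ.word 1 (by omega) (by omega)
    have h7 := hυ.word 7 (by omega) (by omega)
    refine Ok.setWord_eq (j := i) (x := (b - (P.coeff i).val) * τ.word 7 0 % b) le_rfl (by simp [hc])
      (by simp [h0'', h1'', h0', h1', h0, hP, hc, h7]) ?_ ?_
    · have := Nat.mod_lt ((b - (P.coeff i).val) * τ.word 7 0) (show 0 < b by omega)
      omega
    · intro r hr
      rcases eq_or_ne r i with rfl | h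
      · have h2 := ZMod.val_lt (P.coeff r)
        simp only [Mem.setWord_word_self, Function.update_self, ZMod.natCast_mod, Nat.cast_mul]
        rw [hI, Nat.cast_sub h2.le, ZMod.natCast_zmod_val, CharP.cast_eq_zero, zero_sub,
          mul_left_comm, ← pow_succ', show b - 2 + 1 = b - 1 by omega,
          ZMod.pow_card_sub_one_eq_one hlc, mul_one]
      · simpa [h] using hI' r (by omega)

/-- The parameters and the tables of the field arithmetic. -/
def setupProg : Prog := powersProg ;; lengthProg ;; reduceProg

theorem setupProg_ok {σ : Mem} {T : ℕ} (hs : Sizes W b m s α T) (hT : T = Nat.clog 2 (2 * b ^ m))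
    (hd : P.natDegree = m) (h0 : σ.word 0 0 = b) (h1 : σ.word 0 1 = m) (h2 : σ.word 0 2 = s)
    (h3 : σ.word 0 3 = α) (hP : ∀ r, σ.word 1 r = (P.coeff r).val) :
    Ok W (b ^ m) setupProg σ fun τ => Agree 3 1000 σ τ ∧ Base b m s α T P τ := by
  refine Ok.frame 3 1000 ?_ rfl
  have hcard := hs.card_le
  have hN := hs.base_lt
  refine Ok.seq (powersProg_ok hs.deg (by omega) h0 h1) ?_
  rintro τ ⟨hτ, hpw, hN4⟩
  refine Ok.seq (lengthProg_ok (by omega) hT hs.len hN4) ?_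
  rintro υ ⟨hυ, hL, hlog⟩
  have a0 := (hυ.word 0 (by omega) (by omega)).trans (hτ.word 0 (by omega) (by omega))
  have a1 := (hυ.word 1 (by omega) (by omega)).trans (hτ.word 1 (by omega) (by omega))
  refine (reduceProg_ok hs.deg hd (by omega) (by rw [a0, h0]) (by rw [a0, h1])
    (by simpa [a1] using hP)).conseq ?_
  rintro ω ⟨hω, hR⟩
  have b0 := (hω.word 0 (by omega) (by omega)).trans a0
  have b3 := (hω.word 3 (by omega) (by omega)).trans (hυ.word 3 (by omega) (by omega))
  have b4 := (hω.word 4 (by omega) (by omega)).trans (hυ.word 4 (by omega) (by omega))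
  have b5 := hω.word 5 (by omega) (by omega)
  have b6 := hω.word 6 (by omega) (by omega)
  constructor <;> try simp only [b0, b3, b4, b5, b6]
  exacts [h0, h1, h2, h3, hpw, hN4, hL, hlog, hR]

end Setup
end QMC
end

/-! ### Search for a primitive element -/

noncomputable section
namespace QMC

section Generator

variable {W b m s α T : ℕ} [Fact b.Prime] {P : Polynomial (ZMod b)}

/-- The least number whose square is at least four times the number of nodes, in array `21`. -/
def sqrtProg : Prog :=
  .setWord 21 0 1 ;;
  .loop 22 (var 4) (.ifWordLt (var 21 * var 21) (4 * var 4) (.setWord 21 0 (var 21 + 1)) .skip)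

theorem sqrtProg_ok {σ : Mem} {N : ℕ} (hN : 1 ≤ N) (hW : N + 1 ≤ W) (h4 : σ.word 4 0 = N) :
    Ok W N sqrtProg σ fun τ => Agree 21 1000 σ τ ∧ 4 * N ≤ τ.word 21 0 ^ 2 ∧
      τ.word 21 0 ≤ Nat.sqrt (4 * N) + 1 ∧ τ.word 21 0 ≤ W := by
  refine Ok.frame 21 1000 ?_ rfl
  refine Ok.setWord_eq_seq (j := 0) (x := 1) hN rfl rfl (by omega) ?_
  refine (Ok.loop (n := N) (Y := 1) 21 1000 (fun i τ => (4 * N ≤ τ.word 21 0 ^ 2 ∨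
    τ.word 21 0 = i + 1) ∧ τ.word 21 0 ≤ i + 1 ∧ τ.word 21 0 ≤ Nat.sqrt (4 * N) + 1) rfl
    (by simp [h4]) (by omega) (by omega) le_rfl hN (by simp) (fun i τ x h => by simpa using h)
    ?_).conseq ?_
  · rintro i hi τ hτ ⟨h1, h2, h3⟩ hc
    have h4' := hτ.word 4 (by omega) (by omega)
    simp at h4'
    refine Ok.ifWordLt le_rfl (fun h => ?_) fun h => Ok.skip le_rfl ?_
    · simp [h4', h4] at h
      refine Ok.setWord_eq (j := 0) (x := τ.word 21 0 + 1) le_rfl rfl (by simp) (by omega) ?_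
      have h5 : τ.word 21 0 ≤ Nat.sqrt (4 * N) := Nat.le_sqrt.2 h.le
      have h6 : τ.word 21 0 = i + 1 := h1.resolve_left (by rw [pow_two]; omega)
      simp only [Mem.setWord_word_self, Function.update_self]
      exact ⟨Or.inr (by omega), by omega, by omega⟩
    · simp [h4', h4] at h
      exact ⟨Or.inl (by rw [pow_two]; omega), by omega, h3⟩
  · rintro τ ⟨_, h1, h2, h3⟩
    refine ⟨h1.elim id fun h => ?_, h3, by omega⟩
    rw [h]
    -- If the value was raised in every round it is `N + 1`, and `(N + 1) ^ 2 ≥ 4 N`.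
    nlinarith [sq_nonneg ((N : ℤ) - 1), Nat.mul_self_le_mul_self (show 1 ≤ N from hN)]

/-- The least prime factor of the word `24`, in array `30`. -/
def factorProg : Prog :=
  .setWord 30 0 0 ;;
  .loop 31 (var 4) (.ifWordLt 1 (var 31) (.ifWordLt (var 24 % var 31) 1
    (.ifWordLt (var 30) 1 (.setWord 30 0 (var 31)) .skip) .skip) .skip)

/-- Trial division in increasing order; the cell is written only while it is zero, so it keeps the
first divisor found. -/
theorem factorProg_ok {σ : Mem} {N R : ℕ} (hR : 2 ≤ R) (hRN : R < N) (hW : N ≤ W)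
    (h4 : σ.word 4 0 = N) (h24 : σ.word 24 0 = R) :
    Ok W N factorProg σ fun τ => Agree 30 1000 σ τ ∧ τ.word 30 0 = R.minFac := by
  refine Ok.frame 30 1000 ?_ rfl
  have hN : 1 ≤ N := by omega
  have hp := (Nat.minFac_prime (show R ≠ 1 by omega)).two_le
  refine Ok.setWord_eq_seq (j := 0) (x := 0) hN rfl rfl (by omega) ?_
  refine (Ok.loop (n := N) (Y := 1) 30 1000
    (fun i τ => τ.word 30 0 = if R.minFac < i then R.minFac else 0) rfl
    (by simp [h4]) (by omega) (by omega) le_rfl hN (by simp) (fun i τ x h => by simpa using h)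
    ?_).conseq ?_
  · intro i hi τ hτ hI hc
    have h24' := hτ.word 24 (by omega) (by omega)
    simp at h24'
    have key : i ≠ R.minFac → (if R.minFac < i then R.minFac else 0) =
        if R.minFac < i + 1 then R.minFac else 0 := by
      intro h
      split_ifs <;> omega
    refine Ok.ifWordLt le_rfl (fun h => Ok.ifWordLt le_rfl (fun h' => Ok.ifWordLt le_rfl
      (fun h'' => ?_) fun h'' => Ok.skip le_rfl ?_) fun h' => Ok.skip le_rfl ?_)
      fun h => Ok.skip le_rfl ?_
    · simp [hc] at h
      simp [hc, h24', h24] at h'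
      simp [hI] at h''
      have h1 : R.minFac ≤ i := Nat.minFac_le_of_dvd h (Nat.dvd_of_mod_eq_zero h')
      have h2 : i = R.minFac := by
        by_contra h3
        have := h'' (by omega)
        omega
      refine Ok.setWord_eq (j := 0) (x := i) le_rfl rfl (by simp [hc]) (by omega) ?_
      simp [← h2]
    · rw [hI]
      refine key ?_
      rintro rfl
      simp [hI] at h''
    · rw [hI]
      refine key ?_
      rintro rfl
      simp [hc, h24', h24] at h'
      exact h' (Nat.mod_eq_zero_of_dvd R.minFac_dvd)
    · rw [hI]
      refine key ?_
      simp [hc] at h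
      omega
  · rintro τ ⟨_, h⟩
    rw [h, if_pos]
    exact (Nat.minFac_le (by omega)).trans_lt hRN

/-- The largest power of the word `30` that divides the word `24`, in array `32`; the cofactor is
in array `33`. -/
def extractProg : Prog :=
  .setWord 32 0 1 ;;
  .setWord 33 0 (var 24) ;;
  .loop 34 (var 6) (.ifWordLt (var 33 % var 30) 1
    (.setWord 33 0 (var 33 / var 30) ;; .setWord 32 0 (var 32 * var 30)) .skip)

/-- While divisions succeed, the exponent equals the number of rounds. They cannot succeed in all
`T` rounds, since `p ^ T > R`. -/
theorem extractProg_ok {σ : Mem} {R p : ℕ} (hR : 1 ≤ R) (hRT : R < 2 ^ T) (hW : 2 ^ T ≤ W)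
    (hp : 2 ≤ p) (hpR : p ∣ R) (h6 : σ.word 6 0 = T) (h24 : σ.word 24 0 = R)
    (h30 : σ.word 30 0 = p) :
    Ok W T extractProg σ fun τ => Agree 32 1000 σ τ ∧ (∃ j, τ.word 32 0 = p ^ (j + 1)) ∧
      τ.word 32 0 * τ.word 33 0 = R ∧ ¬p ∣ τ.word 33 0 := by
  refine Ok.frame 32 1000 ?_ rfl
  have hT : 1 ≤ T := Nat.pos_of_ne_zero (by
    rintro rfl
    have := Nat.le_of_dvd hR hpR
    simp at hRT
    omega)
  have hT2 : T < 2 ^ T := Nat.lt_two_pow_self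
  refine Ok.setWord_eq_seq (j := 0) (x := 1) hT rfl rfl (by omega) ?_
  refine Ok.setWord_eq_seq (j := 0) (x := R) hT rfl (by simp [h24]) (by omega) ?_
  refine (Ok.loop (n := T) (Y := 1) 32 1000
    (fun i τ => τ.word 32 0 * τ.word 33 0 = R ∧ ∃ j, τ.word 32 0 = p ^ j ∧
      (¬p ∣ τ.word 33 0 ∨ j = i)) rfl
    (by simp [h6]) (by omega) (by omega) le_rfl hT ?_ (fun i τ x h => by simpa using h) ?_).conseq ?_
  · exact ⟨by simp, 0, by simp⟩
  · rintro i hi τ hτ ⟨h1, j, h2, h3⟩ hc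
    have h30' := hτ.word 30 (by omega) (by omega)
    simp at h30'
    refine Ok.ifWordLt le_rfl (fun h => ?_) fun h => Ok.skip le_rfl ?_
    · simp [h30', h30] at h
      obtain ⟨k, hk⟩ := Nat.dvd_of_mod_eq_zero h
      have h4 : τ.word 33 0 / p = k := by rw [hk, Nat.mul_div_cancel_left _ (by omega)]
      have h5 : τ.word 32 0 * p * k = R := by rw [← h1, hk, mul_assoc]
      have hk0 : 1 ≤ k := Nat.pos_of_ne_zero (by rintro rfl; simp at h5; omega)
      have h6 : τ.word 32 0 * p ≤ R := by nlinarith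
      have h7 : k ≤ R := by
        have : 1 ≤ τ.word 32 0 * p := Nat.pos_of_ne_zero (by intro h; rw [h] at h5; simp at h5; omega)
        nlinarith
      have h8 : j = i := h3.resolve_left fun h => h ⟨k, hk⟩
      refine Ok.setWord_eq_seq (j := 0) (x := k) le_rfl rfl (by simp [h30', h30, h4]) (by omega) ?_
      refine Ok.setWord_eq (j := 0) (x := τ.word 32 0 * p) le_rfl rfl (by simp [h30', h30])
        (by omega) ?_
      exact ⟨by simpa using h5, i + 1, by simp [h2, h8, pow_succ], Or.inr rfl⟩
    · simp [h30', h30] at h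
      exact ⟨h1, j, h2, Or.inl fun h' => h (Nat.mod_eq_zero_of_dvd h')⟩
  · rintro τ ⟨_, h1, j, h2, h3⟩
    have h0 : τ.word 33 0 ≠ 0 := by intro h; rw [h] at h1; omega
    have h4 : ¬p ∣ τ.word 33 0 := by
      refine h3.resolve_right ?_
      rintro rfl
      have h5 : 2 ^ j ≤ p ^ j := Nat.pow_le_pow_left hp j
      have h6 : τ.word 32 0 ≤ R := h1 ▸ Nat.le_mul_of_pos_right _ (Nat.pos_of_ne_zero h0)
      omega
    refine ⟨?_, h1, h4⟩
    rcases j with _ | j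
    · rw [pow_zero] at h2
      rw [h2, one_mul] at h1
      exact absurd (h1 ▸ hpR) h4
    · exact ⟨j, h2⟩

variable [Fact (Irreducible P)]

/-- A word whose power with exponent `20 / 30` differs from one, in array `36`. -/
def candidateProg : Prog :=
  .setWord 36 0 (.load 0 0 - 1) ;;
  .loop 37 (var 21) (.ifWordLt 0 (var 37) (.ifWordLt (var 37) (var 4) (
    .setWord 48 0 (var 37) ;;
    .setWord 49 0 (var 20 / var 30) ;;
    powProg ;;
    .ifWordLt 1 (var 50) (.setWord 36 0 (var 37)) .skip) .skip) .skip)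

/-- The default `b - 1` encodes `-1`, the exceptional alternative in `exists_small_word_pow_ne_one`;
the small nonzero words are all tried. A power other than one shows up as a word above `1`, since a
power of a nonzero class is not zero. -/
theorem candidateProg_ok (hs : Sizes W b m s α T) (hd : P.natDegree = m) {σ : Mem}
    (hσ : Base b m s α T P σ) {p S : ℕ} (hp : 2 ≤ p) (hpn : p ∣ b ^ m - 1)
    (h20 : σ.word 20 0 = b ^ m - 1) (h30 : σ.word 30 0 = p)
    (h21 : 4 * b ^ m ≤ σ.word 21 0 ^ 2) (hS : σ.word 21 0 ≤ S) (hSW : σ.word 21 0 ≤ W) :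
    Ok W (S * (T * (m * m))) candidateProg σ fun τ => Agree 36 1000 σ τ ∧ τ.word 36 0 ≠ 0 ∧
      τ.word 36 0 < b ^ m ∧ wordClass m P (τ.word 36 0) ^ ((b ^ m - 1) / p) ≠ 1 := by
  refine Ok.frame 36 1000 ?_ rfl
  have hm := hs.deg
  have hcard := hs.card_le
  have hlen := hs.le_len
  have h1N := hs.base_lt
  have hb := (Fact.out : b.Prime).one_lt
  have hbm : b ≤ b ^ m := Nat.le_self_pow (by omega) b
  have hT0 : 1 ≤ T := Nat.pos_of_ne_zero (by rintro rfl; simp at hlen; omega)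
  have hY : 1 ≤ T * (m * m) := Nat.mul_pos hT0 (Nat.mul_pos hm hm)
  have hS1 : 1 ≤ S := le_trans (Nat.pos_of_ne_zero (by intro h; rw [h] at h21; omega)) hS
  have hX : 1 ≤ S * (T * (m * m)) := Nat.mul_pos hS1 hY
  set k := (b ^ m - 1) / p with hk
  have hk0 : 0 < k := Nat.div_pos (Nat.le_of_dvd (by omega) hpn) (by omega)
  have hkn : k < b ^ m - 1 := Nat.div_lt_self (by omega) (by omega)
  refine Ok.setWord_eq_seq (j := 0) (x := b - 1) hX rfl (by simp [hσ.base]) (by omega) ?_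
  refine (Ok.loop (n := σ.word 21 0) (Y := T * (m * m)) 36 1000
    (fun i τ => τ.word 36 0 ≠ 0 ∧ τ.word 36 0 < b ^ m ∧
      ((∃ y, 0 < y ∧ y < i ∧ y < b ^ m ∧ wordClass m P y ^ k ≠ 1) →
        wordClass m P (τ.word 36 0) ^ k ≠ 1) ∧
      (τ.word 36 0 = b - 1 ∨ wordClass m P (τ.word 36 0) ^ k ≠ 1)) rfl
    (by simp) hSW (Nat.mul_le_mul_right _ hS) hY hX ?_ (fun i τ x h => by simpa using h)
    ?_).conseq ?_
  · simp only [Mem.setWord_word_self, Function.update_self]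
    exact ⟨by omega, by omega, by rintro ⟨y, _, h, _⟩; omega, Or.inl trivial⟩
  · rintro i hi τ hτ ⟨h1, h2, h3, h4⟩ hc
    have hτB := (hσ.setWord (a := 36) (by omega) 0 (b - 1)).agree hτ (by omega)
    have h20' := hτ.word 20 (by omega) (by omega)
    have h30' := hτ.word 30 (by omega) (by omega)
    simp at h20' h30'
    refine Ok.ifWordLt hY (fun h => Ok.ifWordLt hY (fun h' => ?_) fun h' => Ok.skip hY ?_)
      fun h => Ok.skip hY ?_
    · simp [hc] at h
      simp [hc, hτB.card] at h'
      refine Ok.setWord_eq_seq (j := 0) (x := i) hY rfl (by simp [hc]) (by omega) ?_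
      refine Ok.setWord_eq_seq (j := 0) (x := k) hY rfl (by simp [h20', h30', h20, h30, hk])
        (by omega) ?_
      refine Ok.seq (powProg_ok hs hd ((hτB.setWord (by omega) _ _).setWord (by omega) _ _)
        (by simpa using h') (by simp; omega)) ?_
      rintro υ ⟨hυ, h50, hpow⟩
      have h36 := hυ.word 36 (by omega) (by omega)
      have h37 := hυ.word 37 (by omega) (by omega)
      simp at h36 h37 hpow
      have hne : wordClass m P i ≠ 0 := fun h0 => by
        have := (wordClass_eq_zero_iff hm hd h').1 h0
        omega
      refine Ok.ifWordLt hY (fun hlt => ?_) fun hlt => Ok.skip hY ?_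
      · simp at hlt
        have hpne : wordClass m P i ^ k ≠ 1 := by
          rw [← hpow, ← wordClass_one (P := P) hm]
          intro h0
          have := wordClass_injOn hm hd h50 h1N h0
          omega
        refine Ok.setWord_eq (j := 0) (x := i) hY rfl (by simp [h37, hc]) (by omega) ?_
        simp only [Mem.setWord_word_self, Function.update_self]
        exact ⟨by omega, h', fun _ => hpne, Or.inr hpne⟩
      · simp at hlt
        have h51 : wordClass m P i ^ k = 1 := by
          rw [← hpow]
          have h0 : υ.word 50 0 ≠ 0 := by
            intro h0
            rw [h0, wordClass_zero] at hpow
            exact pow_ne_zero k hne hpow.symm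
          rw [show υ.word 50 0 = 1 by omega, wordClass_one hm]
        rw [h36]
        refine ⟨h1, h2, ?_, h4⟩
        rintro ⟨y, hy0, hyi, hyN, hy⟩
        refine h3 ⟨y, hy0, ?_, hyN, hy⟩
        rcases Nat.lt_succ_iff_lt_or_eq.1 hyi with h5 | rfl
        · exact h5
        · exact absurd h51 hy
    · simp [hc, hτB.card] at h'
      refine ⟨h1, h2, ?_, h4⟩
      rintro ⟨y, hy0, hyi, hyN, hy⟩
      exact h3 ⟨y, hy0, by omega, hyN, hy⟩
    · simp [hc] at h
      refine ⟨h1, h2, ?_, h4⟩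
      rintro ⟨y, hy0, hyi, hyN, hy⟩
      omega
  · rintro τ ⟨_, h1, h2, h3, h4⟩
    refine ⟨h1, h2, ?_⟩
    obtain ⟨y, ⟨hy0, hyB, hyN⟩ | rfl, hy⟩ := exists_small_word_pow_ne_one hm hd hk0 hkn h21
    · exact h3 ⟨y, hy0, hyB, hyN, hy⟩
    · exact h4.elim (fun h => h ▸ hy) id

/-- Passage to an element of larger order. -/
def primeProg : Prog :=
  factorProg ;; extractProg ;; candidateProg ;;
  .setWord 48 0 (var 36) ;;
  .setWord 49 0 (var 20 / var 32) ;;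
  powProg ;;
  .setWord 55 0 (var 25) ;;
  .setWord 56 0 (var 50) ;;
  mulProg ;;
  .setWord 25 0 (var 60) ;;
  .setWord 24 0 (var 33)

/-- The invariant says that the order of the current element and the missing cofactor are coprime
with product `b ^ m - 1`. An element whose order is the full power of `p` in the cofactor has order
coprime to the current one, so the orders multiply and the cofactor is at least halved. -/
theorem primeProg_ok (hs : Sizes W b m s α T) (hd : P.natDegree = m) {σ : Mem}
    (hσ : Base b m s α T P σ) {S : ℕ} (h20 : σ.word 20 0 = b ^ m - 1)
    (h21 : 4 * b ^ m ≤ σ.word 21 0 ^ 2) (hS : σ.word 21 0 ≤ S) (hSW : σ.word 21 0 ≤ W)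
    (h24 : 2 ≤ σ.word 24 0) (h25 : σ.word 25 0 < b ^ m)
    (hord : orderOf (wordClass m P (σ.word 25 0)) * σ.word 24 0 = b ^ m - 1)
    (hcop : (orderOf (wordClass m P (σ.word 25 0))).Coprime (σ.word 24 0)) :
    Ok W (b ^ m + S * (T * (m * m))) primeProg σ fun τ => Agree 24 1000 σ τ ∧
      1 ≤ τ.word 24 0 ∧ 2 * τ.word 24 0 ≤ σ.word 24 0 ∧ τ.word 25 0 < b ^ m ∧
      orderOf (wordClass m P (τ.word 25 0)) * τ.word 24 0 = b ^ m - 1 ∧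
      (orderOf (wordClass m P (τ.word 25 0))).Coprime (τ.word 24 0) := by
  refine Ok.frame 24 1000 ?_ rfl
  have hm := hs.deg
  have hcard := hs.card_le
  have hlen := hs.le_len
  have hlenW := hs.len
  have h1N := hs.base_lt
  have hT2 : T < 2 ^ T := Nat.lt_two_pow_self
  have hT0 : 1 ≤ T := Nat.pos_of_ne_zero (by rintro rfl; simp at hlen; omega)
  have hmm : 1 ≤ m * m := Nat.mul_pos hm hm
  have hS1 : 1 ≤ S := le_trans (Nat.pos_of_ne_zero (by intro h; rw [h] at h21; omega)) hS
  have hTS : T * (m * m) ≤ S * (T * (m * m)) := Nat.le_mul_of_pos_left _ hS1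
  have hTm : T ≤ T * (m * m) := Nat.le_mul_of_pos_right _ hmm
  have hmT : m * m ≤ T * (m * m) := Nat.le_mul_of_pos_left _ hT0
  set R := σ.word 24 0 with hR
  set o := orderOf (wordClass m P (σ.word 25 0)) with ho
  have hRn : R ∣ b ^ m - 1 := ⟨o, by rw [← hord, mul_comm]⟩
  have hRN : R < b ^ m := by
    have := Nat.le_of_dvd (by omega) hRn
    omega
  have hX : 1 ≤ b ^ m + S * (T * (m * m)) := by omega
  have hprime := Nat.minFac_prime (show R ≠ 1 by omega)
  have hpR := R.minFac_dvd
  set p := R.minFac with hp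
  refine Ok.seq ((factorProg_ok h24 hRN (by omega) hσ.card rfl).mono (by omega)) ?_
  rintro τ ⟨hτ, hτp⟩
  have hτB := hσ.agree hτ (by omega)
  have hτ24 := hτ.word 24 (by omega) (by omega)
  refine Ok.seq ((extractProg_ok (R := R) (p := p) (by omega) (by omega) hs.len hprime.two_le hpR hτB.log
    (by rw [hτ24, hR]) hτp).mono (by omega)) ?_
  rintro υ ⟨hυ, ⟨j, hj⟩, hmul, hndvd⟩
  have hυB := hτB.agree hυ (by omega)
  have hυ20 := (hυ.word 20 (by omega) (by omega)).trans (hτ.word 20 (by omega) (by omega))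
  have hυ21 := (hυ.word 21 (by omega) (by omega)).trans (hτ.word 21 (by omega) (by omega))
  have hυ25 := (hυ.word 25 (by omega) (by omega)).trans (hτ.word 25 (by omega) (by omega))
  have hυ30 := hυ.word 30 (by omega) (by omega)
  refine Ok.seq ((candidateProg_ok (S := S) (p := p) hs hd hυB hprime.two_le (hpR.trans hRn)
    (by rw [hυ20, h20]) (by rw [hυ30, hτp]) (by rw [hυ21]; exact h21) (by rw [hυ21]; exact hS)
    (by rw [hυ21]; exact hSW)).mono (by omega)) ?_
  rintro ω ⟨hω, hc0, hcN, hcp⟩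
  have hωB := hυB.agree hω (by omega)
  have hω20 := (hω.word 20 (by omega) (by omega)).trans hυ20
  have hω25 := (hω.word 25 (by omega) (by omega)).trans hυ25
  have hω32 := hω.word 32 (by omega) (by omega)
  have hω33 := hω.word 33 (by omega) (by omega)
  set e := υ.word 32 0 with he
  set R' := υ.word 33 0 with hR'
  have heR : e ∣ R := ⟨R', hmul.symm⟩
  have hR'0 : 1 ≤ R' := Nat.pos_of_ne_zero (by intro h; rw [h] at hmul; omega)
  refine Ok.setWord_eq_seq (j := 0) (x := ω.word 36 0) hX rfl (by simp) (by omega) ?_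
  refine Ok.setWord_eq_seq (j := 0) (x := (b ^ m - 1) / e) hX rfl (by simp [hω20, h20, hω32, he])
    ((Nat.div_le_self _ _).trans (by omega)) ?_
  refine Ok.seq ((powProg_ok hs hd ((hωB.setWord (by omega) _ _).setWord (by omega) _ _)
    (by simpa using hcN) ?_).mono (by omega)) ?_
  · have := Nat.div_le_self (b ^ m - 1) e
    simp
    omega
  rintro μ ⟨hμ, hμN, hpow⟩
  have hμB := ((hωB.setWord (a := 48) (by omega) _ _).setWord (a := 49) (by omega) _ _).agree hμ
    (by omega)
  have hμ25 := hμ.word 25 (by omega) (by omega)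
  have hμ33 := hμ.word 33 (by omega) (by omega)
  simp at hμ25 hμ33 hpow
  have hv25 : μ.word 25 0 = σ.word 25 0 := by rw [hμ25, hω25]
  refine Ok.setWord_eq_seq (j := 0) (x := σ.word 25 0) hX rfl (by simp [hv25]) (by omega) ?_
  refine Ok.setWord_eq_seq (j := 0) (x := μ.word 50 0) hX rfl (by simp) (by omega) ?_
  refine Ok.seq ((mulProg_ok hs hd ((hμB.setWord (by omega) _ _).setWord (by omega) _ _)
    (by simpa using h25)).mono (by omega)) ?_
  rintro ν ⟨hν, hνN, hprod⟩
  have hν33 := hν.word 33 (by omega) (by omega)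
  simp [hμ33, hω33] at hν33 hprod
  have hR'R : R' ≤ R := hmul ▸ Nat.le_mul_of_pos_left _ (Nat.pos_of_ne_zero (by
    intro h; rw [h] at hmul; omega))
  refine Ok.setWord_eq_seq (j := 0) (x := ν.word 60 0) hX rfl (by simp) (by omega) ?_
  refine Ok.setWord_eq (j := 0) (x := R') hX rfl (by simp [hν33, hR']) (by omega) ?_
  simp only [Mem.setWord_word_self, Function.update_self, ne_eq, Nat.reduceEqDiff,
    not_false_eq_true, Mem.setWord_word_of_ne]
  have hcne : wordClass m P (ω.word 36 0) ≠ 0 := fun h => hc0 ((wordClass_eq_zero_iff hm hd hcN).1 h)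
  have : Fact p.Prime := ⟨hprime⟩
  have hoe : orderOf (wordClass m P (μ.word 50 0)) = e := by
    rw [hpow]
    exact orderOf_pow_of_pow_ne_one (p := p) (j := j)
      (Nat.mul_div_cancel' (heR.trans hRn)).symm (pow_card_sub_one_eq_one' hm hd hcne) hcp hj
  have hcop1 : o.Coprime e := hcop.coprime_dvd_right heR
  have hord' : orderOf (wordClass m P (ν.word 60 0)) = o * e := by
    rw [hprod, (Commute.all _ _).orderOf_mul_eq_mul_orderOf_of_coprime (by rw [hoe]; exact hcop1),
      hoe]
  rw [hord']
  refine ⟨hR'0, ?_, hνN, by rw [mul_assoc, hmul, hord], ?_⟩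
  · have h2e : 2 ≤ e := by
      rw [hj]
      exact hprime.two_le.trans (Nat.le_self_pow (by omega) p)
    nlinarith
  · refine Nat.Coprime.mul_left (hcop.coprime_dvd_right ⟨e, by rw [← hmul, mul_comm]⟩) ?_
    rw [hj]
    exact Nat.Coprime.pow_left _ ((Nat.Prime.coprime_iff_not_dvd hprime).2 hndvd)

/-- A generator of the multiplicative group, in array `25`. -/
def generatorProg : Prog :=
  .setWord 20 0 (var 4 - 1) ;;
  sqrtProg ;;
  .setWord 24 0 (var 20) ;;
  .setWord 25 0 1 ;;
  .loop 26 (var 6) (.ifWordLt 1 (var 24) primeProg .skip)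

/-- As each round at least halves the cofactor, `T` rounds bring it down to one. -/
theorem generatorProg_ok (hs : Sizes W b m s α T) (hd : P.natDegree = m) {σ : Mem}
    (hσ : Base b m s α T P σ) :
    Ok W (T * (b ^ m + (Nat.sqrt (4 * b ^ m) + 1) * (T * (m * m)))) generatorProg σ fun τ =>
      Agree 20 1000 σ τ ∧ τ.word 25 0 < b ^ m ∧
        orderOf (wordClass m P (τ.word 25 0)) = b ^ m - 1 := by
  refine Ok.frame 20 1000 ?_ rfl
  have hm := hs.deg
  have hcard := hs.card_le
  have hlen := hs.le_len
  have hlenW := hs.len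
  have h1N := hs.base_lt
  have hT2 : T < 2 ^ T := Nat.lt_two_pow_self
  have hT0 : 1 ≤ T := Nat.pos_of_ne_zero (by rintro rfl; simp at hlen; omega)
  set Y := b ^ m + (Nat.sqrt (4 * b ^ m) + 1) * (T * (m * m)) with hYdef
  have hY : 1 ≤ Y := by omega
  have hYX : Y ≤ T * Y := Nat.le_mul_of_pos_left _ hT0
  have hX : 1 ≤ T * Y := by omega
  refine Ok.setWord_eq_seq (j := 0) (x := b ^ m - 1) hX rfl (by simp [hσ.card]) (by omega) ?_
  refine Ok.seq ((sqrtProg_ok (N := b ^ m) (by omega) (by omega) (by simp [hσ.card])).mono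
    (by omega)) ?_
  rintro τ ⟨hτ, hsq, hsqS, hsqW⟩
  have hτB := (hσ.setWord (a := 20) (by omega) _ _).agree hτ (by omega)
  have hτ20 := hτ.word 20 (by omega) (by omega)
  simp at hτ20
  refine Ok.setWord_eq_seq (j := 0) (x := b ^ m - 1) hX rfl (by simp [hτ20]) (by omega) ?_
  refine Ok.setWord_eq_seq (j := 0) (x := 1) hX rfl rfl (by omega) ?_
  refine (Ok.loop (n := T) (Y := Y) 24 1000
    (fun i τ => 1 ≤ τ.word 24 0 ∧ (τ.word 24 0 = 1 ∨ τ.word 24 0 < 2 ^ (T - i)) ∧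
      τ.word 25 0 < b ^ m ∧ orderOf (wordClass m P (τ.word 25 0)) * τ.word 24 0 = b ^ m - 1 ∧
      (orderOf (wordClass m P (τ.word 25 0))).Coprime (τ.word 24 0)) rfl
    (by simp [hτB.log]) (by omega) le_rfl hY hX ?_ (fun i τ x h => by simpa using h)
    ?_).conseq ?_
  · simp [wordClass_one hm, h1N]
    omega
  · rintro i hi υ hυ ⟨h1, h2, h3, h4, h5⟩ hc
    have hυB := ((hτB.setWord (a := 24) (by omega) _ _).setWord (a := 25) (by omega) _ _).agree hυ
      (by omega)
    have h20' := hυ.word 20 (by omega) (by omega)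
    have h21' := hυ.word 21 (by omega) (by omega)
    simp at h20' h21'
    refine Ok.ifWordLt hY (fun h => ?_) fun h => Ok.skip hY ?_
    · simp at h
      refine (primeProg_ok hs hd hυB (by rw [h20', hτ20]; simp) (by rw [h21']; exact hsq)
        (by rw [h21']; exact hsqS) (by rw [h21']; exact hsqW) h h3 h4 h5).conseq ?_
      rintro ω ⟨_, g1, g2, g3, g4, g5⟩
      refine ⟨g1, Or.inr ?_, g3, g4, g5⟩
      have h6 : υ.word 24 0 < 2 ^ (T - i) := h2.resolve_left (by omega)
      rw [show T - i = T - (i + 1) + 1 by omega, pow_succ] at h6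
      omega
    · simp at h
      exact ⟨h1, Or.inl (by omega), h3, h4, h5⟩
  · rintro υ ⟨_, h1, h2, h3, h4, h5⟩
    have h6 : υ.word 24 0 = 1 := h2.elim id fun h => by
      rw [Nat.sub_self, pow_zero] at h
      omega
    rw [h6, mul_one] at h4
    exact ⟨h3, h4⟩

end Generator
end QMC
end

/-! ### Tables: powers of the generator, kernel values and constants -/

noncomputable section
namespace QMC

section Tables

variable {W b m s α T : ℕ} [Fact b.Prime] {P : Polynomial (ZMod b)}

theorem mu1_div_add_one {b : ℕ} (hb : 1 < b) {v : ℕ} (hv : 0 < v) :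
    mu1 b v = mu1 b (v / b) + 1 := by
  rw [mu1, Nat.digits_def' hb hv, List.length_cons, mu1]

theorem Sizes.log_pos (hs : Sizes W b m s α T) : 1 ≤ T := by
  have hlen := hs.le_len
  have := hs.base_lt
  exact Nat.pos_of_ne_zero (by rintro rfl; simp at hlen; omega)

theorem Sizes.deg_le_log (hs : Sizes W b m s α T) : m ≤ T := by
  have h1 : 2 ^ m ≤ b ^ m := Nat.pow_le_pow_left (Fact.out : b.Prime).two_le m
  exact (Nat.pow_le_pow_iff_right one_lt_two).1
    (show 2 ^ m ≤ 2 ^ T by have := hs.le_len; omega)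

/-- The products of all words with the word `25`, in array `11`. -/
def multipleProg : Prog :=
  .setWord 56 0 (var 25) ;;
  .setWord 11 0 0 ;;
  .loop 12 (var 4) (
    .setWord 60 0 (.load 11 (var 12 / .load 0 0)) ;;
    .setWord 58 0 (var 12 % .load 0 0) ;;
    stepProg ;;
    .setWord 11 (var 12) (var 60))

/-- The multiple of a word follows by a single Horner step from the multiple of its quotient by `b`,
which is already in the table. This costs `m ≤ T` per word, less than a full multiplication. -/
theorem multipleProg_ok (hs : Sizes W b m s α T) (hd : P.natDegree = m) {σ : Mem}
    (hσ : Base b m s α T P σ) (h25 : σ.word 25 0 < b ^ m) :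
    Ok W (b ^ m * T) multipleProg σ fun τ => Agree 11 1000 σ τ ∧ ∀ y < b ^ m,
      τ.word 11 y < b ^ m ∧
      wordClass m P (τ.word 11 y) = wordClass m P y * wordClass m P (σ.word 25 0) := by
  refine Ok.frame 11 1000 ?_ rfl
  have hm := hs.deg
  have hcard := hs.card_le
  have h1N := hs.base_lt
  have hT0 := hs.log_pos
  have hb := (Fact.out : b.Prime).one_lt
  have hbm : b ≤ b ^ m := Nat.le_self_pow (by omega) b
  have hX : 1 ≤ b ^ m * T := Nat.mul_pos (by omega) hT0
  refine Ok.setWord_eq_seq (j := 0) (x := σ.word 25 0) hX rfl (by simp) (by omega) ?_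
  refine Ok.setWord_eq_seq (j := 0) (x := 0) hX rfl rfl (by omega) ?_
  refine (Ok.loop (n := b ^ m) (Y := T) 11 1000
    (fun i τ => τ.word 56 0 = σ.word 25 0 ∧ (i = 0 → τ.word 11 0 = 0) ∧
      ∀ y < i, τ.word 11 y < b ^ m ∧
      wordClass m P (τ.word 11 y) = wordClass m P y * wordClass m P (σ.word 25 0)) rfl
    (by simp [hσ.card]) (by omega) le_rfl hT0 hX (by simp) (fun i τ x h => by simpa using h)
    ?_).conseq ?_
  · rintro i hi τ hτ ⟨h56, h0, hI⟩ hc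
    have hτB := ((hσ.setWord (a := 56) (by omega) _ _).setWord (a := 11) (by omega) _ _).agree hτ
      (by omega)
    have hmod := Nat.mod_lt i (show 0 < b by omega)
    have key : τ.word 11 (i / b) < b ^ m ∧ wordClass m P (τ.word 11 (i / b)) =
        wordClass m P (i / b) * wordClass m P (σ.word 25 0) := by
      -- The word zero refers to its own cell, which is why that cell is initialized.
      rcases Nat.eq_zero_or_pos i with rfl | h
      · rw [Nat.zero_div, h0 rfl]
        simp [wordClass_zero]
        omega
      · exact hI _ (Nat.div_lt_self h hb)
    refine Ok.setWord_eq_seq (j := 0) (x := τ.word 11 (i / b)) hT0 rfl (by simp [hc, hτB.base])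
      (by omega) ?_
    refine Ok.setWord_eq_seq (j := 0) (x := i % b) hT0 rfl (by simp [hc, hτB.base])
      (by omega) ?_
    refine Ok.seq ((stepProg_ok hs ((hτB.setWord (by omega) _ _).setWord (by omega) _ _)
      (by simpa using key.1)).mono hs.deg_le_log) ?_
    rintro υ ⟨hυ, h60⟩
    have hυ11 := hυ.word 11 (by omega) (by omega)
    have hυ12 := hυ.word 12 (by omega) (by omega)
    have hυ56 := hυ.word 56 (by omega) (by omega)
    simp at hυ11 hυ12 hυ56 h60
    have hlt : υ.word 60 0 < b ^ m := by
      rw [h60]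
      exact fieldStep_lt _ _ _ _
    refine Ok.setWord_eq (j := i) (x := υ.word 60 0) hT0 (by simp [hυ12, hc]) (by simp)
      (by omega) ?_
    refine ⟨by simp [hυ56, h56], by omega, fun y hy => ?_⟩
    rcases eq_or_ne y i with rfl | hyi
    · simp only [Mem.setWord_word_self, Function.update_self]
      refine ⟨hlt, ?_⟩
      rw [h60, wordClass_fieldStep hm hd hτB.red, key.2, h56, wordClass_eq_horner hi]
      ring
    · simpa [hyi, hυ11] using hI y (by omega)
  · rintro τ ⟨_, _, _, h⟩
    exact h

/-- The powers of the generator, in array `13`. -/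
def exponentialProg : Prog :=
  .setWord 13 0 1 ;;
  .loop 14 (var 4 - 1) (.setWord 13 (var 14 + 1) (.load 11 (.load 13 (var 14))))

theorem exponentialProg_ok (hs : Sizes W b m s α T) {σ : Mem}
    (hσ : Base b m s α T P σ) {g : AdjoinRoot P} (h11 : ∀ y < b ^ m, σ.word 11 y < b ^ m ∧
      wordClass m P (σ.word 11 y) = wordClass m P y * g) :
    Ok W (b ^ m) exponentialProg σ fun τ => Agree 13 1000 σ τ ∧ ∀ k < b ^ m,
      τ.word 13 k < b ^ m ∧ wordClass m P (τ.word 13 k) = g ^ k := by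
  refine Ok.frame 13 1000 ?_ rfl
  have hm := hs.deg
  have hcard := hs.card_le
  have h1N := hs.base_lt
  have hX : 1 ≤ b ^ m := by omega
  refine Ok.setWord_eq_seq (j := 0) (x := 1) hX rfl rfl (by omega) ?_
  refine (Ok.loop (n := b ^ m - 1) (Y := 1) 13 1000
    (fun i τ => ∀ k ≤ i, τ.word 13 k < b ^ m ∧ wordClass m P (τ.word 13 k) = g ^ k) rfl
    (by simp [hσ.card]) (by omega) (by omega) le_rfl hX (by simp [h1N, wordClass_one hm])
    (fun i τ x h => by simpa using h) ?_).conseq ?_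
  · rintro i hi τ hτ hI hc
    have hτ11 := hτ.word 11 (by omega) (by omega)
    simp at hτ11
    have h1 := h11 _ (hI i le_rfl).1
    refine Ok.setWord_eq (j := i + 1) (x := σ.word 11 (τ.word 13 i)) le_rfl (by simp [hc])
      (by simp [hτ11, hc]) (by omega) fun k hk => ?_
    rcases eq_or_ne k (i + 1) with rfl | hki
    · simp only [Mem.setWord_word_self, Function.update_self]
      exact ⟨h1.1, by rw [h1.2, (hI i le_rfl).2, pow_succ]⟩
    · simpa [hki] using hI k (by omega)
  · rintro τ ⟨_, h⟩ k hk
    exact h k (by omega)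

/-- The numbers of digits, in array `15`. -/
def digitCountProg : Prog :=
  .setWord 15 0 0 ;;
  .loop 16 (var 4) (.ifWordLt 0 (var 16)
    (.setWord 15 (var 16) (.load 15 (var 16 / .load 0 0) + 1)) .skip)

theorem digitCountProg_ok (hs : Sizes W b m s α T) {σ : Mem} (hσ : Base b m s α T P σ) :
    Ok W (b ^ m) digitCountProg σ fun τ => Agree 15 1000 σ τ ∧ ∀ v < b ^ m,
      τ.word 15 v = mu1 b v := by
  refine Ok.frame 15 1000 ?_ rfl
  have hcard := hs.card_le
  have h1N := hs.base_lt
  have hmN := deg_lt_card b m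
  have hb := (Fact.out : b.Prime).one_lt
  have hX : 1 ≤ b ^ m := by omega
  refine Ok.setWord_eq_seq (j := 0) (x := 0) hX rfl rfl (by omega) ?_
  refine (Ok.loop (n := b ^ m) (Y := 1) 15 1000
    (fun i τ => τ.word 15 0 = 0 ∧ ∀ v < i, τ.word 15 v = mu1 b v) rfl
    (by simp [hσ.card]) (by omega) (by omega) le_rfl hX (by simp)
    (fun i τ x h => by simpa using h) ?_).conseq ?_
  · rintro i hi τ hτ ⟨h0, hI⟩ hc
    have hτB := (hσ.setWord (a := 15) (by omega) 0 0).agree hτ (by omega)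
    refine Ok.ifWordLt le_rfl (fun h => ?_) fun h => Ok.skip le_rfl ?_
    · simp [hc] at h
      have h1 : mu1 b i ≤ m := (mu1_le_iff hb).2 hi
      refine Ok.setWord_eq (j := i) (x := mu1 b i) le_rfl (by simp [hc])
        (by simp [hc, hτB.base, hI _ (Nat.div_lt_self h hb), mu1_div_add_one hb h]) (by omega) ?_
      refine ⟨by simpa [h.ne] using h0, fun v hv => ?_⟩
      rcases eq_or_ne v i with rfl | hvi
      · simp
      · simpa [hvi] using hI v (by omega)
    · simp [hc] at h
      refine ⟨h0, fun v hv => ?_⟩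
      rw [show v = 0 by omega, h0, mu1_zero]
  · rintro τ ⟨_, _, h⟩
    exact h

/-- The values of the worst-case kernel, indexed by the number of leading zeros, in the real array
`4`. -/
def weightProg : Prog :=
  .setReal 1 0 (.ofWord 1) ;;
  .loop 17 (.load 0 3) (.setReal 1 0 (rvar 1 / .ofWord (.load 0 0))) ;;
  .setReal 2 0 (.ofWord 0) ;;
  .setReal 3 0 (rvar 1) ;;
  .loop 17 (.load 0 1 + 1) (
    .setReal 4 (var 17) (rvar 2 - rvar 3 * .ofWord (.load 3 (var 17))) ;;
    .setReal 2 0 (rvar 2 + rvar 3 * (.ofWord (.load 3 (var 17) * .load 0 0) -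
      .ofWord (.load 3 (var 17)))) ;;
    .setReal 3 0 (rvar 3 * rvar 1))

/-- `nodeWeight` depends on `e` only through `m - e`, the length of its sum, so one running sum
provides all values in the order of that length. -/
theorem weightProg_ok (hs : Sizes W b m s α T) {σ : Mem} (hσ : Base b m s α T P σ) :
    Ok W (α + b ^ m) weightProg σ fun τ => Agree 17 1 σ τ ∧ ∀ e ≤ m,
      τ.real 4 (m - e) = nodeWeight b m α e := by
  refine Ok.frame 17 1 ?_ rfl
  have hcard := hs.card_le
  have hαW := hs.ord_le
  have h1N := hs.base_lt
  have hmN := deg_lt_card b m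
  have hX : 1 ≤ α + b ^ m := by omega
  refine Ok.setReal_eq_seq (j := 0) (x := 1) hX rfl (by simp) ?_
  refine Ok.seq (Ok.loop (n := α) (Y := 1) 17 1
    (fun i τ => τ.real 1 0 = ((b : ℝ) ^ i)⁻¹) rfl (by simp [hσ.ord]) hαW (by omega) le_rfl hX
    (by simp) (fun i τ x h => by simpa using h) ?_) ?_
  · rintro i hi τ hτ hI hc
    have hτB := (hσ.setReal 1 0 1).agree hτ (by omega)
    refine Ok.setReal_eq (j := 0) (x := ((b : ℝ) ^ (i + 1))⁻¹) le_rfl rfl ?_ (by simp)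
    simp [hI, hτB.base, pow_succ, div_eq_mul_inv, mul_comm]
  rintro τ ⟨hτ, hA⟩
  have hτB := (hσ.setReal 1 0 1).agree hτ (by omega)
  refine Ok.setReal_eq_seq (j := 0) (x := 0) hX rfl (by simp) ?_
  refine Ok.setReal_eq_seq (j := 0) (x := ((b : ℝ) ^ α)⁻¹) hX rfl (by simp [hA]) ?_
  set U : ℕ → ℝ := fun f => ∑ k ∈ Finset.range f,
    ((b : ℝ) ^ (α * (k + 1)))⁻¹ * ((b : ℝ) ^ (k + 1) - (b : ℝ) ^ k) with hU
  refine (Ok.loop (n := m + 1) (Y := 1) 17 2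
    (fun i τ => τ.real 2 0 = U i ∧ τ.real 3 0 = ((b : ℝ) ^ (α * (i + 1)))⁻¹ ∧
      ∀ f < i, τ.real 4 f = U f - ((b : ℝ) ^ (α * (f + 1)))⁻¹ * (b : ℝ) ^ f) rfl
    (by simp [hτB.deg]) (by omega) (by omega) le_rfl hX (by simp [hU])
    (fun i τ x h => by simpa using h) ?_).conseq ?_
  · rintro i hi υ hυ ⟨h2, h3, hI⟩ hc
    have hυB := ((hτB.setReal 2 0 _).setReal 3 0 _).agree hυ (by omega)
    have h1 := hυ.real 1 (by omega)
    simp at h1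
    have hpw := hυB.pw i (by omega)
    refine Ok.setReal_eq_seq (j := i) (x := U i - ((b : ℝ) ^ (α * (i + 1)))⁻¹ * (b : ℝ) ^ i) le_rfl
      (by simp [hc]) (by simp [hc, h2, h3, hpw]) ?_
    refine Ok.setReal_eq_seq (j := 0) (x := U (i + 1)) le_rfl rfl
      (by simp [hc, h2, h3, hpw, hυB.base, hU, Finset.sum_range_succ, pow_succ]) ?_
    refine Ok.setReal_eq (j := 0) (x := ((b : ℝ) ^ (α * (i + 1 + 1)))⁻¹) le_rfl rfl
      (by simp [h3, h1, hA, mul_add, pow_add, mul_comm]) ?_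
    refine ⟨by simp, by simp, fun f hf => ?_⟩
    rcases eq_or_ne f i with rfl | hfi
    · simp
    · simpa [hfi] using hI f (by omega)
  · rintro υ ⟨_, _, _, h⟩ e he
    rw [h _ (by omega), nodeWeight]

/-- The values of the worst-case kernel at the powers of the generator, in the real array `5`. -/
def kernelProg : Prog :=
  .loop 17 (var 4 - 1)
    (.setReal 5 (var 17) (.load 4 (.load 0 1 - .load 15 (.load 13 (var 17)))))

/-- The state after the computation of the tables. -/
structure Tables (b m s α T : ℕ) [Fact b.Prime] (P : Polynomial (ZMod b)) (hP : P ≠ 0)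
    (g : AdjoinRoot P) (σ : Mem) : Prop where
  base : Base b m s α T P σ
  exp : ∀ k < b ^ m - 1, σ.word 13 k < b ^ m ∧ wordClass m P (σ.word 13 k) = g ^ k
  kernel : ∀ k < b ^ m - 1, σ.real 5 k = nodeReal m α hP (g ^ k)

theorem Tables.agree {hP : P ≠ 0} {g : AdjoinRoot P} {σ τ : Mem} {A B : ℕ}
    (h : Tables b m s α T P hP g σ) (hστ : Agree A B σ τ) (hA : 14 ≤ A) (hB : 6 ≤ B) :
    Tables b m s α T P hP g τ := by
  have h13 := hστ.word 13 (by omega) (by omega)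
  have h5 := hστ.real 5 (by omega)
  exact ⟨h.base.agree hστ (by omega), by rw [h13]; exact h.exp, by rw [h5]; exact h.kernel⟩

/-- The computation of the tables. -/
def tablesProg : Prog :=
  multipleProg ;; exponentialProg ;; digitCountProg ;; weightProg ;; kernelProg

/-- The kernel at `g ^ k` is looked up from the number of digits of the word of `g ^ k`, by
`nodeReal_wordClass`. -/
theorem tablesProg_ok [Fact (Irreducible P)] (hs : Sizes W b m s α T) (hd : P.natDegree = m)
    (hP : P ≠ 0) {σ : Mem} (hσ : Base b m s α T P σ) (h25 : σ.word 25 0 < b ^ m)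
    (hg : orderOf (wordClass m P (σ.word 25 0)) = b ^ m - 1) :
    Ok W (α + b ^ m * T) tablesProg σ fun τ => Agree 11 1 σ τ ∧
      Tables b m s α T P hP (wordClass m P (σ.word 25 0)) τ := by
  refine Ok.frame 11 1 ?_ rfl
  have hm := hs.deg
  have hcard := hs.card_le
  have h1N := hs.base_lt
  have hT0 := hs.log_pos
  have hb := (Fact.out : b.Prime).one_lt
  have hNT : b ^ m ≤ b ^ m * T := Nat.le_mul_of_pos_right _ hT0
  set g := wordClass m P (σ.word 25 0) with hgdef
  have hg0 : g ≠ 0 := by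
    intro h
    rw [h, orderOf_zero] at hg
    omega
  refine Ok.seq ((multipleProg_ok hs hd hσ h25).mono (by omega)) ?_
  rintro τ₁ ⟨h₁, hmul⟩
  have B₁ := hσ.agree h₁ (by omega)
  refine Ok.seq ((exponentialProg_ok hs B₁ hmul).mono (by omega)) ?_
  rintro τ₂ ⟨h₂, hexp⟩
  have B₂ := B₁.agree h₂ (by omega)
  refine Ok.seq ((digitCountProg_ok hs B₂).mono (by omega)) ?_
  rintro τ₃ ⟨h₃, hdc⟩
  have B₃ := B₂.agree h₃ (by omega)
  refine Ok.seq ((weightProg_ok hs B₃).mono (by omega)) ?_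
  rintro τ₄ ⟨h₄, hwt⟩
  have B₄ := B₃.agree h₄ (by omega)
  have e13 := (h₄.word 13 (by omega) (by omega)).trans (h₃.word 13 (by omega) (by omega))
  have e15 := h₄.word 15 (by omega) (by omega)
  refine (Ok.loop (n := b ^ m - 1) (Y := 1) 17 5
    (fun i τ => ∀ k < i, τ.real 5 k = nodeReal m α hP (g ^ k)) rfl
    (by simp [B₄.card]) (by omega) (by omega) le_rfl (by omega) (by simp)
    (fun i τ x h => by simpa using h) ?_).conseq ?_
  · rintro i hi τ hτ hI hc
    have Bτ := B₄.agree hτ (by omega)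
    have f4 := hτ.real 4 (by omega)
    have f13 := (hτ.word 13 (by omega) (by omega)).trans e13
    have f15 := (hτ.word 15 (by omega) (by omega)).trans e15
    obtain ⟨hEN, hE⟩ := hexp i (by omega)
    have hE0 : τ₂.word 13 i ≠ 0 := by
      intro h
      rw [h, wordClass_zero] at hE
      exact pow_ne_zero i hg0 hE.symm
    have h1 : mu1 b (τ₂.word 13 i) ≤ m := (mu1_le_iff hb).2 hEN
    refine Ok.setReal_eq (j := i) (x := nodeReal m α hP (g ^ i)) le_rfl (by simp [hc]) ?_
      fun k hk => ?_
    · rw [← hE, nodeReal_wordClass hP hd hE0 hEN, ← hwt _ h1]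
      simp [hc, f4, f13, f15, Bτ.deg, hdc _ hEN]
    · rcases eq_or_ne k i with rfl | hki
      · simp
      · simpa [hki] using hI k (by omega)
  · rintro τ ⟨hτ, hI⟩
    have f13 := (hτ.word 13 (by omega) (by omega)).trans e13
    refine ⟨B₄.agree hτ (by omega), fun k hk => ?_, hI⟩
    rw [f13]
    exact hexp k (by omega)

/-- The constant factor of the weights, in the real array `8`. -/
def constantProg : Prog :=
  .setReal 6 0 (.ofWord 2 * .sinTurn 1 (2 * .load 0 0)) ;;
  .setReal 7 0 (.ofWord 1) ;;
  .loop 17 (.load 0 3) (.setReal 7 0 (rvar 7 * rvar 6)) ;;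
  .setReal 8 0 (.ofWord 2 / rvar 7) ;;
  .setReal 7 0 (.ofWord 1) ;;
  .loop 17 (.load 0 3 - 1) (
    .setReal 7 0 (rvar 7 * rvar 6) ;;
    .ifRealLt (rvar 8) (.ofWord 1 / rvar 7) (.setReal 8 0 (.ofWord 1 / rvar 7)) .skip) ;;
  .setReal 6 0 (.ofWord 1 + .ofWord 1 / .ofWord (.load 0 0) +
    .ofWord 1 / (.ofWord (.load 0 0) * (.ofWord (.load 0 0) + .ofWord 1))) ;;
  .loop 17 (.load 0 3 - 2) (.setReal 8 0 (rvar 8 * rvar 6)) ;;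
  .setReal 8 0 (rvar 8 * (.ofWord 3 + .ofWord 2 / .ofWord (.load 0 0) +
    (.ofWord 2 * .ofWord (.load 0 0) + .ofWord 1) / (.ofWord (.load 0 0) - .ofWord 1))) ;;
  .setReal 7 0 (.ofWord 1) ;;
  .loop 17 (.load 0 3) (
    .setReal 8 0 (rvar 8 * rvar 7) ;;
    .setReal 7 0 (rvar 7 * .ofWord (.load 0 0)))

-- The sine of `π / b` is that of the turn `1 / (2 b)`, and `b ^ (α (α - 1) / 2)` arises as the
-- product of the powers `b ^ k` with `k < α`.
set_option linter.unusedSectionVars false in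
theorem constantProg_ok (hs : Sizes W b m s α T) {σ : Mem} (hσ : Base b m s α T P σ) :
    Ok W α constantProg σ fun τ => Agree 17 6 σ τ ∧
      τ.real 8 0 = walshConst α b * (b : ℝ) ^ (α * (α - 1) / 2) := by
  refine Ok.frame 17 6 ?_ rfl
  have hαW := hs.ord_le
  have hα := hs.ord
  have hX : 1 ≤ α := by omega
  set x : ℝ := 2 * Real.sin (Real.pi / b) with hx
  have hsin : 2 * Real.sin (2 * Real.pi * ((1 : ℕ) : ℝ) / ((2 * b : ℕ) : ℝ)) = x := by
    rw [hx]
    congr 2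
    push_cast
    rw [mul_one, mul_div_mul_left _ _ two_ne_zero]
  refine Ok.setReal_eq_seq (j := 0) (x := x) hX rfl ?_ ?_
  · rw [← hsin]
    simp [hσ.base]
  have B₁ := hσ.setReal 6 0 x
  refine Ok.setReal_eq_seq (j := 0) (x := 1) hX rfl (by simp) ?_
  have B₂ := B₁.setReal 7 0 1
  refine Ok.seq (Ok.loop (n := α) (Y := 1) 17 7 (fun i τ => τ.real 7 0 = x ^ i) rfl
    (by simp [B₂.ord]) hαW (by omega) le_rfl hX (by simp) (fun i τ x h => by simpa using h) ?_) ?_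
  · rintro i hi τ hτ hI hc
    have h6 := hτ.real 6 (by omega)
    simp at h6
    exact Ok.setReal_eq (j := 0) (x := x ^ (i + 1)) le_rfl rfl (by simp [hI, h6, pow_succ]) (by simp)
  rintro τ₁ ⟨h₁, h17⟩
  have h16 := h₁.real 6 (by omega)
  simp at h16
  have C₁ := B₂.agree h₁ (by omega)
  refine Ok.setReal_eq_seq (j := 0) (x := 2 / x ^ α) hX rfl (by simp [h17]) ?_
  have C₂ := C₁.setReal 8 0 (2 / x ^ α)
  refine Ok.setReal_eq_seq (j := 0) (x := 1) hX rfl (by simp) ?_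
  have C₃ := C₂.setReal 7 0 1
  refine Ok.seq (Ok.loop (n := α - 1) (Y := 1) 17 7 (fun i τ => τ.real 7 0 = x ^ i ∧
    τ.real 8 0 = (Finset.Icc 1 i).fold max (2 / x ^ α) (fun z => 1 / x ^ z)) rfl
    (by simp [C₃.ord]) (by omega) (by omega) le_rfl hX (by simp)
    (fun i τ x h => by simpa using h) ?_) ?_
  · rintro i hi τ hτ ⟨h7, h8⟩ hc
    have h6 := hτ.real 6 (by omega)
    simp [h16] at h6
    have hIcc : Finset.Icc 1 (i + 1) = insert (i + 1) (Finset.Icc 1 i) :=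
      (Finset.insert_Icc_right_eq_Icc_add_one (by omega)).symm
    have hfold : (Finset.Icc 1 (i + 1)).fold max (2 / x ^ α) (fun z => 1 / x ^ z) =
        max (1 / x ^ (i + 1)) ((Finset.Icc 1 i).fold max (2 / x ^ α) (fun z => 1 / x ^ z)) := by
      rw [hIcc, Finset.fold_insert (by simp)]
    refine Ok.setReal_eq_seq (j := 0) (x := x ^ (i + 1)) le_rfl rfl (by simp [h7, h6, pow_succ]) ?_
    refine Ok.ifRealLt le_rfl (fun h => ?_) fun h => Ok.skip le_rfl ?_
    · simp [h8] at h
      refine Ok.setReal_eq (j := 0) (x := 1 / x ^ (i + 1)) le_rfl rfl (by simp) ⟨by simp, ?_⟩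
      rw [hfold, max_eq_left]
      · simp
      · simpa using h.le
    · simp [h8] at h
      refine ⟨by simp, ?_⟩
      rw [hfold, max_eq_right]
      · simpa using h8
      · simpa using h
  rintro τ₂ ⟨h₂, _, h28⟩
  have D₁ := C₃.agree h₂ (by omega)
  set M := (Finset.Icc 1 (α - 1)).fold max (2 / x ^ α) (fun z => 1 / x ^ z) with hM
  set y : ℝ := 1 + 1 / (b : ℝ) + 1 / ((b : ℝ) * (b + 1)) with hy
  refine Ok.setReal_eq_seq (j := 0) (x := y) hX rfl (by simp [D₁.base, hy]) ?_
  have D₂ := D₁.setReal 6 0 y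
  refine Ok.seq (Ok.loop (n := α - 2) (Y := 1) 17 8 (fun i τ => τ.real 8 0 = M * y ^ i) rfl
    (by simp [D₂.ord]) (by omega) (by omega) le_rfl hX (by simp [h28])
    (fun i τ x h => by simpa using h) ?_) ?_
  · rintro i hi τ hτ hI hc
    have h6 := hτ.real 6 (by omega)
    simp at h6
    exact Ok.setReal_eq (j := 0) (x := M * y ^ (i + 1)) le_rfl rfl
      (by simp [hI, h6, pow_succ, mul_assoc]) (by simp)
  rintro τ₃ ⟨h₃, h38⟩
  have F₁ := D₂.agree h₃ (by omega)
  refine Ok.setReal_eq_seq (j := 0) (x := walshConst α b) hX rfl ?_ ?_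
  · simp only [RExp.eval_mul, RExp.eval_load, WExp.eval_ofNat, h38, RExp.eval_add, RExp.eval_div,
      RExp.eval_ofWord, WExp.eval_load, F₁.base, RExp.eval_sub, walshConst]
    rw [← hx, ← hy, ← hM]
    push_cast
    rfl
  have F₂ := F₁.setReal 8 0 (walshConst α b)
  refine Ok.setReal_eq_seq (j := 0) (x := 1) hX rfl (by simp) ?_
  have F₃ := F₂.setReal 7 0 1
  refine (Ok.loop (n := α) (Y := 1) 17 7 (fun i τ => τ.real 7 0 = (b : ℝ) ^ i ∧
    τ.real 8 0 = walshConst α b * ∏ k ∈ Finset.range i, (b : ℝ) ^ k) rfl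
    (by simp [F₃.ord]) (by omega) (by omega) le_rfl hX (by simp)
    (fun i τ x h => by simpa using h) ?_).conseq ?_
  · rintro i hi τ hτ ⟨h7, h8⟩ hc
    have Fτ := F₃.agree hτ (by omega)
    refine Ok.setReal_eq_seq (j := 0)
      (x := walshConst α b * ∏ k ∈ Finset.range (i + 1), (b : ℝ) ^ k) le_rfl rfl
      (by simp [h7, h8, Finset.prod_range_succ, mul_assoc]) ?_
    exact Ok.setReal_eq (j := 0) (x := (b : ℝ) ^ (i + 1)) le_rfl rfl
      (by simp [h7, Fτ.base, pow_succ]) (by simp)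
  · rintro τ ⟨_, _, h8⟩
    rw [h8, Finset.prod_pow_eq_pow_sum, Finset.sum_range_id]

end Tables
end QMC
end

/-! ### The fast Fourier transform as a program -/

noncomputable section
namespace QMC

section Fourier

variable {W b m s α T : ℕ} [Fact b.Prime] {P : Polynomial (ZMod b)}

/-- The complex number in the cells `i` of the real arrays `20` and `21`. -/
def Mem.cplx (σ : Mem) (i : ℕ) : ℂ := ⟨σ.real 20 i, σ.real 21 i⟩

@[simp] theorem Mem.cplx_setWord (σ : Mem) (a i x k : ℕ) : (σ.setWord a i x).cplx k = σ.cplx k := rfl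

/-- One stage of the fast Fourier transform, written to the real arrays `22` and `23`. -/
def butterflyProg : Prog :=
  .loop 43 (var 5) (
    .setWord 44 0 ((2 * var 43 - var 43 % var 40) % var 5) ;;
    .setReal 24 0 (.cosTurn (var 43 / var 40) (var 41)) ;;
    .setReal 25 0 (.sinTurn (var 43 / var 40) (var 41)) ;;
    .setReal 22 (var 43) (.load 20 (var 44) + (rvar 24 * .load 20 (var 44 + var 40) -
      rvar 25 * .load 21 (var 44 + var 40))) ;;
    .setReal 23 (var 43) (.load 21 (var 44) + (rvar 24 * .load 21 (var 44 + var 40) +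
      rvar 25 * .load 20 (var 44 + var 40)))) ;;
  .loop 43 (var 5) (
    .setReal 20 (var 43) (.load 22 (var 43)) ;;
    .setReal 21 (var 43) (.load 23 (var 43)))

-- A stage reads entries that direct writing could already have replaced, so the results go to a
-- second pair of arrays and are copied back.
set_option linter.unusedSectionVars false in
theorem butterflyProg_ok (hs : Sizes W b m s α T) {σ : Mem} (hσ : Base b m s α T P σ)
    {h n : ℕ} (h40 : σ.word 40 0 = h) (h41 : σ.word 41 0 = n) :
    Ok W (2 ^ T) butterflyProg σ fun τ => Agree 42 20 σ τ ∧ ∀ i < 2 ^ T,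
      τ.cplx i = σ.cplx ((2 * i - i % h) % 2 ^ T) +
        turn (i / h) n * σ.cplx ((2 * i - i % h) % 2 ^ T + h) := by
  refine Ok.frame 42 20 ?_ rfl
  have hlenW := hs.len
  have hL : 0 < 2 ^ T := by positivity
  set v : ℕ → ℂ := fun i => σ.cplx ((2 * i - i % h) % 2 ^ T) +
        turn (i / h) n * σ.cplx ((2 * i - i % h) % 2 ^ T + h) with hv
  refine Ok.seq (Ok.loop (n := 2 ^ T) (Y := 1) 43 22
    (fun i τ => ∀ k < i, τ.real 22 k = (v k).re ∧ τ.real 23 k = (v k).im) rfl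
    (by simp [hσ.len]) hlenW (by omega) le_rfl hL (by simp)
    (fun i τ x h => by simpa using h) ?_) ?_
  · rintro i hi τ hτ hI hc
    have Bτ := hσ.agree hτ (by omega)
    have f40 := (hτ.word 40 (by omega) (by omega))
    have f41 := (hτ.word 41 (by omega) (by omega))
    have f20 := hτ.real 20 (by omega)
    have f21 := hτ.real 21 (by omega)
    set j := (2 * i - i % h) % 2 ^ T with hj
    have hjL : j < 2 ^ T := Nat.mod_lt _ hL
    refine Ok.setWord_eq_seq (j := 0) (x := j) le_rfl rfl
      (by simp [hc, f40, h40, Bτ.len, hj]) (by omega) ?_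
    refine Ok.setReal_eq_seq (j := 0) (x := (turn (i / h) n).re) le_rfl rfl
      (by simp [hc, f40, h40, f41, h41, turn_re]) ?_
    refine Ok.setReal_eq_seq (j := 0) (x := (turn (i / h) n).im) le_rfl rfl
      (by simp [hc, f40, h40, f41, h41, turn_im]) ?_
    refine Ok.setReal_eq_seq (j := i) (x := (v i).re) le_rfl
      (by simp [hc]) (by simp [hv, ← hj, f40, h40, f20, f21, Mem.cplx]) ?_
    refine Ok.setReal_eq (j := i) (x := (v i).im) le_rfl
      (by simp [hc]) (by simp [hv, ← hj, f40, h40, f20, f21, Mem.cplx]) fun k hk => ?_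
    rcases eq_or_ne k i with rfl | hki
    · simp
    · simpa [hki] using hI k (by omega)
  · rintro τ ⟨hτ, hI⟩
    have Bτ := hσ.agree hτ (by omega)
    refine (Ok.loop (n := 2 ^ T) (Y := 1) 43 20
      (fun i υ => υ.real 22 = τ.real 22 ∧ υ.real 23 = τ.real 23 ∧ ∀ k < i, υ.cplx k = v k) rfl
      (by simp [Bτ.len]) hlenW (by omega) le_rfl hL (by simp)
      (fun i τ x h => by simpa using h) ?_).conseq fun _ h => h.2.2.2
    rintro i hi υ hυ ⟨e22, e23, hI'⟩ hc
    refine Ok.setReal_eq_seq (j := i) (x := (v i).re) le_rfl (by simp [hc])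
      (by simp [hc, e22, (hI i hi).1]) ?_
    refine Ok.setReal_eq (j := i) (x := (v i).im) le_rfl (by simp [hc])
      (by simp [hc, e23, (hI i hi).2]) ⟨by simp [e22], by simp [e23], fun k hk => ?_⟩
    rcases eq_or_ne k i with rfl | hki
    · simp [Mem.cplx]
    · simpa [hki, Mem.cplx] using hI' k (by omega)

/-- The fast Fourier transform of the real arrays `20` and `21`, in place. -/
def fourierProg : Prog :=
  .setWord 40 0 (var 5) ;;
  .setWord 41 0 1 ;;
  .loop 42 (var 6) (
    .setWord 40 0 (var 40 / 2) ;;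
    .setWord 41 0 (2 * var 41) ;;
    butterflyProg)

/-- After `t` rounds the arrays hold `fftStage T x t`, with stride `2 ^ (T - t)` in cell `40` and
order `2 ^ t` in cell `41`. -/
theorem fourierProg_ok (hs : Sizes W b m s α T) {σ : Mem} (hσ : Base b m s α T P σ) {x : ℕ → ℂ}
    (hx : ∀ i < 2 ^ T, σ.cplx i = x i) :
    Ok W (T * 2 ^ T) fourierProg σ fun τ => Agree 40 20 σ τ ∧ ∀ i < 2 ^ T,
      τ.cplx i = dft (2 ^ T) x i := by
  refine Ok.frame 40 20 ?_ rfl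
  have hlenW := hs.len
  have hL : 0 < 2 ^ T := by positivity
  have hT := hs.log_pos
  have hTL : T < 2 ^ T := Nat.lt_two_pow_self
  have hX : 1 ≤ T * 2 ^ T := Nat.mul_pos hT hL
  refine Ok.setWord_eq_seq (j := 0) (x := 2 ^ T) hX rfl (by simp [hσ.len]) hlenW ?_
  refine Ok.setWord_eq_seq (j := 0) (x := 1) hX rfl rfl (by omega) ?_
  refine (Ok.loop (n := T) (Y := 2 ^ T) 40 20
    (fun t τ => τ.word 40 0 = 2 ^ (T - t) ∧ τ.word 41 0 = 2 ^ t ∧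
      ∀ i < 2 ^ T, τ.cplx i = fftStage T x t i) rfl
    (by simp [hσ.log]) (by omega) le_rfl hL hX ?_
    (fun i τ x h => by simpa using h) ?_).conseq ?_
  · refine ⟨by simp, by simp, fun i hi => ?_⟩
    rw [fftStage_zero T x hi, ← hx i hi]
    rfl
  · rintro t ht τ hτ ⟨h40, h41, hI⟩ hc
    have Bτ := ((hσ.setWord (a := 40) (by omega) _ _).setWord (a := 41) (by omega) _ _).agree hτ
      (by omega)
    have hp : 2 ^ (T - t) = 2 * 2 ^ (T - (t + 1)) := by
      rw [← pow_succ']; congr 1; omega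
    set h := 2 ^ (T - (t + 1)) with hh
    have hh0 : 0 < h := by positivity
    have hhL : h ≤ 2 ^ T := Nat.pow_le_pow_right (by omega) (by omega)
    have htL : 2 ^ (t + 1) ≤ 2 ^ T := Nat.pow_le_pow_right (by omega) (by omega)
    have hT2 : 2 ^ T = 2 * h * 2 ^ t := by
      rw [hh, ← pow_succ', ← pow_add]; congr 1; omega
    refine Ok.setWord_eq_seq (j := 0) (x := h) hL rfl (by simp [h40, hp]) (by omega) ?_
    refine Ok.setWord_eq_seq (j := 0) (x := 2 ^ (t + 1)) hL rfl (by simp [h41, pow_succ'])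
      (by omega) ?_
    refine (butterflyProg_ok (h := h) (n := 2 ^ (t + 1)) hs
      ((Bτ.setWord (by omega) _ _).setWord (by omega) _ _) (by simp) (by simp)).conseq ?_
    rintro υ ⟨hυ, hv⟩
    have e40 := hυ.word 40 (by omega) (by omega)
    have e41 := hυ.word 41 (by omega) (by omega)
    refine ⟨by simp [e40], by simp [e41], fun i hi => ?_⟩
    have hlt : (2 * i - i % h) % 2 ^ T < 2 ^ T := Nat.mod_lt _ hL
    have hlt' : (2 * i - i % h) % 2 ^ T + h < 2 ^ T := by
      rw [hT2]
      exact two_mul_sub_mod_mod_add_lt hh0 (by positivity) i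
    rw [hv i hi, Mem.cplx_setWord, Mem.cplx_setWord, Mem.cplx_setWord, Mem.cplx_setWord, hI _ hlt, hI _ hlt', fftStage_succ x ht]
  · rintro τ ⟨_, _, _, h⟩ i hi
    rw [h i hi, fftStage_last]

end Fourier
end QMC
end

/-! ### Cyclic correlation and the minimization step -/

noncomputable section
namespace QMC

section Convolution

/-- The cyclic correlation of two sequences of length `n`. -/
def cyclicSum (n : ℕ) (x w : ℕ → ℝ) (c : ℕ) : ℝ := ∑ a ∈ Finset.range n, x a * w ((a + c) % n)

/-- A shift only permutes the residues. For the first component this makes all candidates equally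
good, so the prescribed value `1` is a minimizer. -/
theorem cyclicSum_const (n : ℕ) (w : ℕ → ℝ) (c : ℕ) :
    cyclicSum n (fun _ => 1) w c = cyclicSum n (fun _ => 1) w 0 := by
  induction c with
  | zero => rfl
  | succ c ih =>
    rw [← ih]
    simp only [cyclicSum, one_mul]
    rcases n with _ | n
    · simp
    · have h : w ((n + (c + 1)) % (n + 1)) = w ((0 + c) % (n + 1)) := by
        rw [show n + (c + 1) = 0 + c + (n + 1) by omega, Nat.add_mod_right]
      rw [Finset.sum_range_succ, Finset.sum_range_succ', h]
      congr 1
      exact Finset.sum_congr rfl fun a _ => by rw [show a + (c + 1) = a + 1 + c by omega]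

/-- The length `n` need not be a power of two. One sequence is padded with zeros, the other is
continued periodically, and `a + c < 2 n ≤ L` excludes wrap-around. -/
theorem dft_eq_cyclicSum {L n : ℕ} (hL : 2 * n ≤ L) (x w : ℕ → ℝ) {c : ℕ}
    (hc : c < n) :
    dft L (fun k => dft L (fun j => ((if j < n then x j else 0 : ℝ) : ℂ)) k *
        (starRingEnd ℂ) (dft L (fun j => (w (j % n) : ℂ)) k)) c =
      ((L * cyclicSum n x w c : ℝ) : ℂ) := by
  rw [dft_correlation (by omega) (fun j => if j < n then x j else 0) (fun j => w (j % n))]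
  congr 2
  rw [cyclicSum, ← Finset.sum_subset (Finset.range_mono (show n ≤ L by omega))]
  · refine Finset.sum_congr rfl fun a ha => ?_
    have ha := Finset.mem_range.1 ha
    rw [if_pos ha, Nat.mod_eq_of_lt (a := a + c) (by omega)]
  · intro a _ ha
    rw [if_neg (by simpa using ha), zero_mul]

end Convolution

section Convolve

variable {W b m s α T : ℕ} [Fact b.Prime] {P : Polynomial (ZMod b)}

/-- The Fourier transform of the kernel, in the real arrays `9` and `10`. -/
def spectrumProg : Prog :=
  .loop 30 (var 5) (
    .setReal 20 (var 30) (.load 5 (var 30 % (var 4 - 1))) ;;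
    .setReal 21 (var 30) (.ofWord 0)) ;;
  fourierProg ;;
  .loop 30 (var 5) (
    .setReal 9 (var 30) (.load 20 (var 30)) ;;
    .setReal 10 (var 30) (.load 21 (var 30)))

/-- The Fourier transform of the periodic continuation of a sequence of length `n`. -/
def spectrum (L n : ℕ) (w : ℕ → ℝ) (k : ℕ) : ℂ := dft L (fun j => (w (j % n) : ℂ)) k

theorem spectrumProg_ok (hs : Sizes W b m s α T) {σ : Mem} (hσ : Base b m s α T P σ) :
    Ok W (T * 2 ^ T) spectrumProg σ fun τ => Agree 30 9 σ τ ∧ ∀ k < 2 ^ T,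
      τ.real 9 k = (spectrum (2 ^ T) (b ^ m - 1) (σ.real 5) k).re ∧
      τ.real 10 k = (spectrum (2 ^ T) (b ^ m - 1) (σ.real 5) k).im := by
  refine Ok.frame 30 9 ?_ rfl
  have hlenW := hs.len
  have hL : 0 < 2 ^ T := by positivity
  have hT := hs.log_pos
  have hLT : 2 ^ T ≤ T * 2 ^ T := Nat.le_mul_of_pos_left _ hT
  refine Ok.seq (Ok.loop (n := 2 ^ T) (Y := 1) 30 20
    (fun i τ => ∀ k < i, τ.cplx k = (σ.real 5 (k % (b ^ m - 1)) : ℂ)) rfl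
    (by simp [hσ.len]) hlenW (by omega) le_rfl (by omega) (by simp)
    (fun i τ x h => by simpa using h) ?_) ?_
  · intro i hi τ hτ hI hc
    have Bτ := hσ.agree hτ (by omega)
    have f5 := hτ.real 5 (by omega)
    refine Ok.setReal_eq_seq (j := i) (x := σ.real 5 (i % (b ^ m - 1))) le_rfl (by simp [hc])
      (by simp [hc, f5, Bτ.card]) ?_
    refine Ok.setReal_eq (j := i) (x := 0) le_rfl (by simp [hc]) (by simp) fun k hk => ?_
    rcases eq_or_ne k i with rfl | hki
    · simp [Mem.cplx, Complex.ext_iff]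
    · simpa [hki, Mem.cplx] using hI k (by omega)
  rintro τ ⟨hτ, hI⟩
  have Bτ := hσ.agree hτ (by omega)
  refine Ok.seq (fourierProg_ok hs Bτ hI) ?_
  rintro υ ⟨hυ, hdft⟩
  have Bυ := Bτ.agree hυ (by omega)
  refine (Ok.loop (n := 2 ^ T) (Y := 1) 30 9
    (fun i τ => (∀ k, τ.cplx k = υ.cplx k) ∧ ∀ k < i,
      τ.real 9 k = (spectrum (2 ^ T) (b ^ m - 1) (σ.real 5) k).re ∧
      τ.real 10 k = (spectrum (2 ^ T) (b ^ m - 1) (σ.real 5) k).im) rfl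
    (by simp [Bυ.len]) hlenW (by omega) le_rfl (by omega) (by simp)
    (fun i τ x h => by simpa using h) ?_).conseq fun _ h => h.2.2
  rintro i hi ω hω ⟨h1, h2⟩ hc
  have h3 : ω.cplx i = spectrum (2 ^ T) (b ^ m - 1) (σ.real 5) i := by
    rw [h1, hdft i hi, spectrum]
  have h4 := congrArg Complex.re h3
  have h5 := congrArg Complex.im h3
  simp only [Mem.cplx] at h4 h5
  refine Ok.setReal_eq_seq (j := i) (x := (spectrum (2 ^ T) (b ^ m - 1) (σ.real 5) i).re) le_rfl
    (by simp [hc]) (by simp [hc, h4]) ?_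
  refine Ok.setReal_eq (j := i) (x := (spectrum (2 ^ T) (b ^ m - 1) (σ.real 5) i).im) le_rfl
    (by simp [hc]) (by simp [hc, h5]) ⟨fun k => by simpa [Mem.cplx] using h1 k, fun k hk => ?_⟩
  rcases eq_or_ne k i with rfl | hki
  · simp
  · simpa [hki] using h2 k (by omega)

/-- The correlation of the product of the real arrays `11` and `14` with the kernel, in the real
array `20`. -/
def convolveProg : Prog :=
  .loop 33 (var 5) (
    .ifWordLt (var 33) (var 4 - 1)
      (.setReal 20 (var 33) (.load 11 (var 33) * .load 14 (var 33)))
      (.setReal 20 (var 33) (.ofWord 0)) ;;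
    .setReal 21 (var 33) (.ofWord 0)) ;;
  fourierProg ;;
  .loop 33 (var 5) (
    .setReal 15 0 (.load 20 (var 33) * .load 9 (var 33) + .load 21 (var 33) * .load 10 (var 33)) ;;
    .setReal 21 (var 33)
      (.load 21 (var 33) * .load 9 (var 33) - .load 20 (var 33) * .load 10 (var 33)) ;;
    .setReal 20 (var 33) (rvar 15)) ;;
  fourierProg

/-- Two transforms with a multiplication by the conjugate spectrum in between. The factor `2 ^ T`
stays, since only comparisons of the entries follow. -/
theorem convolveProg_ok (hs : Sizes W b m s α T) {σ : Mem} (hσ : Base b m s α T P σ) {w : ℕ → ℝ}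
    (hspec : ∀ k < 2 ^ T, σ.real 9 k = (spectrum (2 ^ T) (b ^ m - 1) w k).re ∧
      σ.real 10 k = (spectrum (2 ^ T) (b ^ m - 1) w k).im) :
    Ok W (T * 2 ^ T) convolveProg σ fun τ => Agree 33 15 σ τ ∧ ∀ c < b ^ m - 1,
      τ.real 20 c = 2 ^ T * cyclicSum (b ^ m - 1) (fun a => σ.real 11 a * σ.real 14 a) w c := by
  refine Ok.frame 33 15 ?_ rfl
  have hlenW := hs.len
  have hlen := hs.le_len
  have h1N := hs.base_lt
  have hL : 0 < 2 ^ T := by positivity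
  have hT := hs.log_pos
  have hLT : 2 ^ T ≤ T * 2 ^ T := Nat.le_mul_of_pos_left _ hT
  set n := b ^ m - 1 with hn
  set x : ℕ → ℂ := fun k => ((if k < n then σ.real 11 k * σ.real 14 k else 0 : ℝ) : ℂ) with hx
  refine Ok.seq (Ok.loop (n := 2 ^ T) (Y := 1) 33 20 (fun i τ => ∀ k < i, τ.cplx k = x k) rfl
    (by simp [hσ.len]) hlenW (by omega) le_rfl (by omega) (by simp)
    (fun i τ x h => by simpa using h) ?_) ?_
  · intro i hi τ hτ hI hc
    have Bτ := hσ.agree hτ (by omega)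
    have f11 := hτ.real 11 (by omega)
    have f14 := hτ.real 14 (by omega)
    refine Ok.seq (Q := fun υ => υ.word 33 0 = i ∧ υ.real 20 i = (x i).re ∧
      ∀ k < i, υ.cplx k = x k) (Ok.ifWordLt le_rfl (fun h => ?_) fun h => ?_) ?_
    · simp [hc, Bτ.card, ← hn] at h
      refine Ok.setReal_eq (j := i) (x := σ.real 11 i * σ.real 14 i) le_rfl (by simp [hc])
        (by simp [hc, f11, f14]) ⟨by simp [hc], by simp [hx, h], fun k hk => ?_⟩
      simpa [hk.ne, Mem.cplx] using hI k hk
    · simp [hc, Bτ.card, ← hn] at h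
      refine Ok.setReal_eq (j := i) (x := 0) le_rfl (by simp [hc])
        (by simp) ⟨by simp [hc], by simp [hx, not_lt.2 h], fun k hk => ?_⟩
      simpa [hk.ne, Mem.cplx] using hI k hk
    · rintro υ ⟨hc', h1, h2⟩
      refine Ok.setReal_eq (j := i) (x := 0) le_rfl (by simp [hc']) (by simp) fun k hk => ?_
      rcases eq_or_ne k i with rfl | hki
      · simp [Mem.cplx, Complex.ext_iff, h1, hx]
      · simpa [hki, Mem.cplx] using h2 k (by omega)
  rintro τ ⟨hτ, hI⟩
  have Bτ := hσ.agree hτ (by omega)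
  refine Ok.seq (fourierProg_ok hs Bτ hI) ?_
  rintro υ ⟨hυ, hdft⟩
  have Bυ := Bτ.agree hυ (by omega)
  set y : ℕ → ℂ := fun k => dft (2 ^ T) x k * (starRingEnd ℂ) (spectrum (2 ^ T) n w k) with hy
  refine Ok.seq (Ok.loop (n := 2 ^ T) (Y := 1) 33 15 (fun i ω => ∀ k < 2 ^ T,
    ω.cplx k = if k < i then y k else dft (2 ^ T) x k) rfl
    (by simp [Bυ.len]) hlenW (by omega) le_rfl (by omega) (by simpa using hdft)
    (fun i τ x h => by simpa using h) ?_) ?_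
  · intro i hi ω hω hI' hc
    have f9 := (hω.real 9 (by omega)).trans ((hυ.real 9 (by omega)).trans (hτ.real 9 (by omega)))
    have f10 := (hω.real 10 (by omega)).trans
      ((hυ.real 10 (by omega)).trans (hτ.real 10 (by omega)))
    have h3 := hI' i hi
    rw [if_neg (lt_irrefl i)] at h3
    have h4 := congrArg Complex.re h3
    have h5 := congrArg Complex.im h3
    simp only [Mem.cplx] at h4 h5
    obtain ⟨g9, g10⟩ := hspec i hi
    refine Ok.setReal_eq_seq (j := 0) (x := (y i).re) le_rfl rfl
      (by simp [hc, f9, f10, h4, h5, g9, g10, hy]) ?_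
    refine Ok.setReal_eq_seq (j := i) (x := (y i).im) le_rfl (by simp [hc])
      (by simp [hc, f9, f10, h4, h5, g9, g10, hy]; ring) ?_
    refine Ok.setReal_eq (j := i) (x := (y i).re) le_rfl (by simp [hc]) (by simp) fun k hk => ?_
    rcases eq_or_ne k i with rfl | hki
    · simp [Mem.cplx]
    · have h6 : k < i + 1 ↔ k < i := by omega
      simp only [h6]
      rw [← hI' k hk]
      simp [hki, Mem.cplx]
  rintro ω ⟨hω, hI'⟩
  have Bω := Bυ.agree hω (by omega)
  refine (fourierProg_ok (x := y) hs Bω fun i hi => by rw [hI' i hi, if_pos hi]).conseq ?_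
  rintro μ ⟨_, hμ⟩ c hc
  have h1 := hμ c (by omega)
  rw [hy, hx] at h1
  simp only [spectrum] at h1
  rw [dft_eq_cyclicSum (n := n) (by omega) (fun a => σ.real 11 a * σ.real 14 a) w hc] at h1
  have h2 := congrArg Complex.re h1
  rw [Complex.ofReal_re] at h2
  rw [← show (((2 ^ T : ℕ) : ℝ)) = 2 ^ T by push_cast; rfl]
  exact h2

/-- The first index of a minimal entry of the real array `20`, in array `34`. -/
def argminProg : Prog :=
  .setWord 34 0 0 ;;
  .loop 35 (var 4 - 1)
    (.ifRealLt (.load 20 (var 35)) (.load 20 (var 34)) (.setWord 34 0 (var 35)) .skip)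

/-- The comparison is strict, so ties go to the smallest index; the last clause records this for
index zero. -/
theorem argminProg_ok (hs : Sizes W b m s α T) {σ : Mem} (hσ : Base b m s α T P σ) :
    Ok W (b ^ m) argminProg σ fun τ => Agree 34 1000 σ τ ∧ τ.word 34 0 < b ^ m - 1 ∧
      (∀ c < b ^ m - 1, σ.real 20 (τ.word 34 0) ≤ σ.real 20 c) ∧
      (τ.word 34 0 = 0 ∨ σ.real 20 (τ.word 34 0) < σ.real 20 0) := by
  refine Ok.frame 34 1000 ?_ rfl
  have hcard := hs.card_le
  have h1N := hs.base_lt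
  have hX : 1 ≤ b ^ m := by omega
  refine Ok.setWord_eq_seq (j := 0) (x := 0) hX rfl rfl (by omega) ?_
  refine (Ok.loop (n := b ^ m - 1) (Y := 1) 34 1000
    (fun i τ => τ.word 34 0 < b ^ m - 1 ∧
      (∀ c < i, σ.real 20 (τ.word 34 0) ≤ σ.real 20 c) ∧
      (τ.word 34 0 = 0 ∨ σ.real 20 (τ.word 34 0) < σ.real 20 0)) rfl
    (by simp [hσ.card]) (by omega) (by omega) le_rfl hX (by simp [h1N])
    (fun i τ x h => by simpa using h) ?_).conseq fun _ h => h.2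
  rintro i hi τ hτ ⟨h1, h2, h3⟩ hc
  have f20 := hτ.real 20 (by omega)
  simp at f20
  refine Ok.ifRealLt le_rfl (fun h => ?_) fun h => Ok.skip le_rfl ?_
  · simp [hc, f20] at h
    refine Ok.setWord_eq (j := 0) (x := i) le_rfl rfl (by simp [hc]) (by omega) ?_
    simp only [Mem.setWord_word_self, Function.update_self]
    refine ⟨hi, fun c hc' => ?_, Or.inr (h3.elim (fun h4 => h4 ▸ h) h.trans)⟩
    rcases Nat.lt_succ_iff_lt_or_eq.1 hc' with h4 | rfl
    · exact h.le.trans (h2 c h4)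
    · exact le_rfl
  · simp [hc, f20] at h
    refine ⟨h1, fun c hc' => ?_, h3⟩
    rcases Nat.lt_succ_iff_lt_or_eq.1 hc' with h4 | rfl
    · exact h2 c h4
    · exact h

end Convolve
end QMC
end

/-! ### The choice of one component -/

noncomputable section
namespace QMC

/-- The program does not write to the word array `a`. -/
def Prog.keeps (a : ℕ) : Prog → Bool
  | .skip => true
  | .setWord a' _ _ => decide (a' ≠ a)
  | .setReal _ _ _ => true
  | .seq c d => c.keeps a && d.keeps a
  | .ifWordLt _ _ c d => c.keeps a && d.keeps a
  | .ifRealLt _ _ c d => c.keeps a && d.keeps a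
  | .loop a' _ c => decide (a' ≠ a) && c.keeps a

theorem Prog.keeps_run {a : ℕ} (c : Prog) : ∀ (_ : c.keeps a = true) (σ : Mem),
    (c.run σ).word a = σ.word a := by
  induction c with
  | skip => exact fun _ σ => rfl
  | setWord a' i e =>
    exact fun h σ => Mem.setWord_word_of_ne _ _ _ (Ne.symm (by simpa [keeps] using h))
  | setReal a' i e => exact fun _ σ => rfl
  | seq c d ihc ihd =>
    intro h σ
    simp only [keeps, Bool.and_eq_true] at h
    exact (ihd h.2 _).trans (ihc h.1 σ)
  | ifWordLt e f c d ihc ihd | ifRealLt e f c d ihc ihd =>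
    intro h σ
    simp only [keeps, Bool.and_eq_true] at h
    simp only [run]
    split_ifs
    · exact ihc h.1 σ
    · exact ihd h.2 σ
  | loop a' e c ih =>
    intro h σ
    simp only [keeps, Bool.and_eq_true, decide_eq_true_eq] at h
    have : ∀ n, (iter (fun i τ => c.run (τ.setWord a' 0 i)) n σ).word a = σ.word a := by
      intro n
      induction n with
      | zero => rfl
      | succ n ihn =>
        rw [iter, ih h.2, Mem.setWord_word_of_ne _ _ _ h.1.symm, ihn]
    exact this _

theorem Ok.keep {W X : ℕ} {c : Prog} {σ : Mem} {Q : Mem → Prop} (a : ℕ) (h : Ok W X c σ Q)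
    (hc : c.keeps a = true) : Ok W X c σ fun τ => τ.word a = σ.word a ∧ Q τ :=
  ⟨⟨c.keeps_run hc σ, h.1⟩, h.2, h.3⟩

section Search

variable {W b m s α T : ℕ} [Fact b.Prime] {P : Polynomial (ZMod b)}

theorem fullProd_congr {w x y : ℕ → ℝ} {I : ℕ} (h : ∀ k < α * I, x k = y k) :
    fullProd α w x I = fullProd α w y I := by
  refine Finset.prod_congr rfl fun i hi => ?_
  have hi := Finset.mem_range.1 hi
  congr 3
  refine Finset.prod_congr rfl fun j hj => ?_
  have hj := Finset.mem_range.1 hj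
  rw [h]
  calc α * i + j < α * (i + 1) := by rw [mul_add]; omega
    _ ≤ _ := Nat.mul_le_mul_left _ hi

theorem partProd_congr {x y : ℕ → ℝ} {I j : ℕ} (h : ∀ k < α * I + j, x k = y k) :
    partProd α x I j = partProd α y I j :=
  Finset.prod_congr rfl fun j' hj => by rw [h _ (by have := Finset.mem_range.1 hj; omega)]

/-- The kernel at the products of `z` with the components of the generating vector. -/
def kernelAt (m α : ℕ) (hP : P ≠ 0) (Q : ℕ → AdjoinRoot P) (z : AdjoinRoot P) (k : ℕ) : ℝ :=
  nodeReal m α hP (z * Q k)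

/-- The sum that is minimized by the choice of component `j` of block `I`, as a sum over the powers
of `g`. -/
def powerSum (m α : ℕ) (hP : P ≠ 0) (w : ℕ → ℝ) (g : AdjoinRoot P) (Q : ℕ → AdjoinRoot P)
    (I j : ℕ) (r : AdjoinRoot P) : ℝ :=
  ∑ a ∈ Finset.range (b ^ m - 1), fullProd α w (kernelAt m α hP Q (g ^ a)) I *
    partProd α (kernelAt m α hP Q (g ^ a)) I j * nodeReal m α hP (g ^ a * r)

theorem powerSum_congr (hP : P ≠ 0) (w : ℕ → ℝ) (g : AdjoinRoot P) {Q Q' : ℕ → AdjoinRoot P}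
    {I j : ℕ} (h : ∀ k < α * I + j, Q k = Q' k) (r : AdjoinRoot P) :
    powerSum m α hP w g Q I j r = powerSum m α hP w g Q' I j r := by
  refine Finset.sum_congr rfl fun a _ => ?_
  have h1 : ∀ k < α * I + j, kernelAt m α hP Q (g ^ a) k = kernelAt m α hP Q' (g ^ a) k :=
    fun k hk => by rw [kernelAt, kernelAt, h k hk]
  rw [fullProd_congr fun k hk => h1 k (by omega), partProd_congr h1]

/-- The state after the choice of the first `d` components. -/
structure Progress (m α : ℕ) (hP : P ≠ 0) (w : ℕ → ℝ) (g : AdjoinRoot P) (I d : ℕ) (σ : Mem) :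
    Prop where
  full : ∀ a < b ^ m - 1, σ.real 11 a =
    fullProd α w (kernelAt m α hP (fun k => wordClass m P (σ.word 2 k)) (g ^ a)) I
  lt : ∀ k < d, σ.word 2 k < b ^ m
  ne : ∀ k < d, wordClass m P (σ.word 2 k) ≠ 0
  first : 0 < d → wordClass m P (σ.word 2 0) = 1
  min : ∀ I' j', j' < α → α * I' + j' < d → ∀ c < b ^ m - 1,
    powerSum m α hP w g (fun k => wordClass m P (σ.word 2 k)) I' j'
        (wordClass m P (σ.word 2 (α * I' + j'))) ≤
      powerSum m α hP w g (fun k => wordClass m P (σ.word 2 k)) I' j' (g ^ c)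

theorem Progress.congr {hP : P ≠ 0} {w : ℕ → ℝ} {g : AdjoinRoot P} {I d : ℕ} {σ τ : Mem}
    (h : Progress m α hP w g I d σ) (h2 : τ.word 2 = σ.word 2) (h11 : τ.real 11 = σ.real 11) :
    Progress m α hP w g I d τ := by
  constructor <;> simp only [h2, h11]
  exacts [h.full, h.lt, h.ne, h.first, h.min]

/-- The tables that are used in the search. -/
structure Ready (b m s α T : ℕ) [Fact b.Prime] (P : Polynomial (ZMod b)) (hP : P ≠ 0) (β : ℕ → ℝ)
    (g : AdjoinRoot P) (σ : Mem) : Prop where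
  tables : Tables b m s α T P hP g σ
  const : σ.real 8 0 = walshConst α b * (b : ℝ) ^ (α * (α - 1) / 2)
  input : ∀ i < s, σ.real 0 i = β i
  spec : ∀ k < 2 ^ T, σ.real 9 k = (spectrum (2 ^ T) (b ^ m - 1) (σ.real 5) k).re ∧
    σ.real 10 k = (spectrum (2 ^ T) (b ^ m - 1) (σ.real 5) k).im

theorem Ready.agree {hP : P ≠ 0} {β : ℕ → ℝ} {g : AdjoinRoot P} {σ τ : Mem} {A B : ℕ}
    (h : Ready b m s α T P hP β g σ) (hστ : Agree A B σ τ) (hA : 14 ≤ A) (hB : 11 ≤ B) :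
    Ready b m s α T P hP β g τ := by
  have h0 := hστ.real 0 (by omega)
  have h5 := hστ.real 5 (by omega)
  have h8 := hστ.real 8 (by omega)
  have h9 := hστ.real 9 (by omega)
  have h10 := hστ.real 10 (by omega)
  refine ⟨h.tables.agree hστ hA (by omega), ?_, ?_, ?_⟩ <;> simp only [h0, h5, h8, h9, h10]
  exacts [h.const, h.input, h.spec]

/-- For the candidate `g ^ c` the kernel at node `g ^ a` has exponent `a + c`, which matters only
modulo the order of `g`. -/
theorem powerSum_pow {hP : P ≠ 0} {g : AdjoinRoot P} (hg : orderOf g = b ^ m - 1) (w : ℕ → ℝ)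
    (Q : ℕ → AdjoinRoot P) (I j c : ℕ) {om : ℕ → ℝ} (hN : 1 < b ^ m)
    (hom : ∀ k < b ^ m - 1, om k = nodeReal m α hP (g ^ k)) :
    powerSum m α hP w g Q I j (g ^ c) = cyclicSum (b ^ m - 1)
      (fun a => fullProd α w (kernelAt m α hP Q (g ^ a)) I *
        partProd α (kernelAt m α hP Q (g ^ a)) I j) om c := by
  refine Finset.sum_congr rfl fun a _ => ?_
  rw [hom _ (Nat.mod_lt _ (by omega)), ← hg, pow_mod_orderOf, pow_add]

/-- The choice of a component. -/
def componentProg : Prog :=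
  convolveProg ;; argminProg ;;
  .setWord 2 (.load 0 3 * var 30 + var 32) (.load 13 (var 34)) ;;
  .loop 33 (var 4 - 1) (.setReal 14 (var 33)
    (.load 14 (var 33) * (.ofWord 1 + .load 5 ((var 33 + var 34) % (var 4 - 1)))))

/-- One correlation lists the values of all candidates `g ^ c`. The minimizer is stored as a word,
and `partProd` is updated from the same kernel table, with index shifted by `c`. -/
theorem componentProg_ok [Fact (Irreducible P)] (hs : Sizes W b m s α T) {hP : P ≠ 0} {β : ℕ → ℝ}
    {g : AdjoinRoot P} (hg : orderOf g = b ^ m - 1) {w : ℕ → ℝ} {i j : ℕ} (hj : j < α) {σ : Mem}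
    (hσ : Ready b m s α T P hP β g σ) (h30 : σ.word 30 0 = i) (h32 : σ.word 32 0 = j)
    (hpro : Progress m α hP w g i (α * i + j) σ)
    (hcur : ∀ a < b ^ m - 1, σ.real 14 a =
      partProd α (kernelAt m α hP (fun k => wordClass m P (σ.word 2 k)) (g ^ a)) i j) :
    Ok W (T * 2 ^ T) componentProg σ fun τ => Agree 33 14 σ τ ∧
      Progress m α hP w g i (α * i + (j + 1)) τ ∧ ∀ a < b ^ m - 1, τ.real 14 a =
        partProd α (kernelAt m α hP (fun k => wordClass m P (τ.word 2 k)) (g ^ a)) i (j + 1) := by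
  refine Ok.frame 33 14 ?_ rfl
  have hlenW := hs.len
  have hlen := hs.le_len
  have h1N := hs.base_lt
  have hL : 0 < 2 ^ T := by positivity
  have hT := hs.log_pos
  have hLT : 2 ^ T ≤ T * 2 ^ T := Nat.le_mul_of_pos_left _ hT
  have hg0 : g ≠ 0 := by
    rintro rfl
    rw [orderOf_zero] at hg
    omega
  have Bσ := hσ.tables.base
  set n := b ^ m - 1 with hn
  set d := α * i + j with hd
  set Q : ℕ → AdjoinRoot P := fun k => wordClass m P (σ.word 2 k) with hQ
  refine Ok.seq ((convolveProg_ok (w := σ.real 5) hs Bσ hσ.spec).keep 2 rfl) ?_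
  rintro τ ⟨hτ2, hτ, hconv⟩
  have Bτ := Bσ.agree hτ (by omega)
  refine Ok.seq (((argminProg_ok hs Bτ).keep 2 rfl).mono (by omega)) ?_
  rintro υ ⟨hυ2, hυ, hbest, hmin, hfirst⟩
  have Rυ := (hσ.agree hτ (by omega) (by omega)).agree hυ (by omega) (by omega)
  have Bυ := Rυ.tables.base
  set c := υ.word 34 0 with hc34
  obtain ⟨hEN, hE⟩ := Rυ.tables.exp c hbest
  have v30 := (hυ.word 30 (by omega) (by omega)).trans (hτ.word 30 (by omega) (by omega))
  have v32 := (hυ.word 32 (by omega) (by omega)).trans (hτ.word 32 (by omega) (by omega))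
  have r5 := (hυ.real 5 (by omega)).trans (hτ.real 5 (by omega))
  have r11 := (hυ.real 11 (by omega)).trans (hτ.real 11 (by omega))
  have r14 := (hυ.real 14 (by omega)).trans (hτ.real 14 (by omega))
  have v2 := hυ2.trans hτ2
  have hsum : ∀ c' < n, τ.real 20 c' = 2 ^ T * powerSum m α hP w g Q i j (g ^ c') := by
    intro c' hc'
    rw [hconv c' hc', powerSum_pow hg w Q i j c' h1N hσ.tables.kernel]
    congr 1
    refine Finset.sum_congr rfl fun a ha => ?_
    have ha := Finset.mem_range.1 ha
    beta_reduce
    rw [hpro.full a ha, hcur a ha]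
  set e := υ.word 13 c with he
  set Q' : ℕ → AdjoinRoot P := fun k => wordClass m P (Function.update (σ.word 2) d e k) with hQ'
  have hQQ : ∀ k, k ≠ d → Q' k = Q k := fun k hk => by simp [hQ, hQ', hk]
  have hQd : Q' d = g ^ c := by simp [hQ', hE]
  have key : Progress m α hP w g i (d + 1) (υ.setWord 2 d e) := by
    have hword : (υ.setWord 2 d e).word 2 = Function.update (σ.word 2) d e := by simp [v2]
    constructor <;> simp only [hword, Mem.setWord_real, r11]
    · intro a ha
      rw [hpro.full a ha]
      refine fullProd_congr fun k hk => ?_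
      rw [kernelAt, kernelAt]
      exact congrArg (fun z => nodeReal m α hP (g ^ a * z)) (hQQ k (by omega)).symm
    · intro k hk
      rcases eq_or_ne k d with rfl | hkd
      · simpa using hEN
      · simpa [hkd] using hpro.lt k (by omega)
    · intro k hk
      rcases eq_or_ne k d with rfl | hkd
      · simpa [hE] using fun h => absurd h hg0
      · simpa [hkd] using hpro.ne k (by omega)
    · intro _
      -- For the first component both vectors are constantly one and all candidates tie; the tie
      -- rule of `argminProg` then selects `c = 0`, that is, the class of `1`.
      rcases Nat.eq_zero_or_pos d with h0 | h0
      · have hi0 : α * i = 0 := by omega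
        have hj0 : j = 0 := by omega
        have hconst : ∀ c' < n, τ.real 20 c' = τ.real 20 0 := by
          intro c' hc'
          rw [hconv c' hc', hconv 0 (by omega)]
          congr 1
          have h1 : ∀ c, cyclicSum n (fun a => σ.real 11 a * σ.real 14 a) (σ.real 5) c =
              cyclicSum n (fun _ => 1) (σ.real 5) c := by
            intro c
            refine Finset.sum_congr rfl fun a ha => ?_
            have ha := Finset.mem_range.1 ha
            have hi0' : i = 0 := by
              rcases Nat.mul_eq_zero.1 hi0 with h | h
              · omega
              · exact h
            beta_reduce
            rw [hpro.full a ha, hcur a ha, hi0', hj0]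
            simp [fullProd, partProd]
          rw [h1, h1, cyclicSum_const]
        have hc0 : c = 0 := hfirst.resolve_right (by rw [hconst c hbest]; exact lt_irrefl _)
        have h2 := hQd
        rw [h0, hc0, pow_zero] at h2
        exact h2
      · exact (hQQ 0 (by omega)).trans (hpro.first h0)
    · intro I' j' hj' hlt c' hc'
      change powerSum m α hP w g Q' I' j' (Q' (α * I' + j')) ≤ powerSum m α hP w g Q' I' j' (g ^ c')
      -- The sum minimized at a component involves only earlier components, so the new entry leaves
      -- previous minimality statements intact.
      have hcongr : ∀ r, powerSum m α hP w g Q' I' j' r = powerSum m α hP w g Q I' j' r :=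
        powerSum_congr hP w g fun k hk => hQQ k (by omega)
      rw [hcongr, hcongr]
      rcases eq_or_ne (α * I' + j') d with hd' | hd'
      · have hα0 : 0 < α := by omega
        have hI : I' = i := by
          have h1 := congrArg (· / α) hd'
          simp only [hd, Nat.mul_add_div hα0, Nat.div_eq_of_lt hj', Nat.div_eq_of_lt hj] at h1
          omega
        have hJ : j' = j := by rw [hI] at hd'; omega
        rw [hd', hQd, hI, hJ]
        have h1 := hmin c' hc'
        rw [hsum c hbest, hsum c' hc'] at h1
        exact le_of_mul_le_mul_left h1 (by positivity)
      · rw [hQQ _ hd']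
        exact hpro.min I' j' hj' (by omega) c' hc'
  refine Ok.setWord_eq_seq (j := d) (x := e) (by omega) (by simp [v30, v32, h30, h32, Bυ.ord, hd])
    (by simp [he, hc34]) (by omega) ?_
  refine (Ok.loop (n := n) (Y := 1) 33 14
    (fun k ω => ω.word 2 = (υ.setWord 2 d e).word 2 ∧ ω.word 34 0 = c ∧ ∀ a < n, ω.real 14 a =
      partProd α (kernelAt m α hP Q' (g ^ a)) i (if a < k then j + 1 else j)) rfl
    (by simp [Bυ.card, hn]) (by omega) (by omega) le_rfl (by omega) ?_
    (fun i τ x h => by simpa using h) ?_).conseq ?_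
  · refine ⟨rfl, by simp [hc34], fun a ha => ?_⟩
    rw [Mem.setWord_real, r14, hcur a ha, if_neg (Nat.not_lt_zero a)]
    refine partProd_congr fun k hk => ?_
    rw [kernelAt, kernelAt, hQQ k (by omega)]
  · rintro k hk ω hω ⟨h1, h2, h3⟩ hc
    have Bω := (Bυ.agree (Agree.setWord (A := 9) (B := 0) υ (Or.inr rfl) d e) le_rfl).agree hω
      (by omega)
    have w5 := hω.real 5 (by omega)
    have hom : σ.real 5 ((k + c) % n) = kernelAt m α hP Q' (g ^ k) d := by
      rw [hσ.tables.kernel _ (Nat.mod_lt _ (by omega)), kernelAt, hQd, ← pow_add, ← hn, ← hg,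
        pow_mod_orderOf]
    have h4 := h3 k hk
    rw [if_neg (lt_irrefl k)] at h4
    refine Ok.setReal_eq (j := k) (x := partProd α (kernelAt m α hP Q' (g ^ k)) i (j + 1)) le_rfl
      (by simp [hc]) ?_ ⟨by simp [h1], by simp [h2], fun a ha => ?_⟩
    · rw [partProd_succ, ← hd, ← hom]
      simp [hc, h2, h4, w5, r5, Bω.card, ← hn]
    · rcases eq_or_ne a k with rfl | hak
      · simp
      · have h6 : a < k + 1 ↔ a < k := by omega
        simp only [h6]
        rw [← h3 a ha]
        simp [hak]
  · rintro ω ⟨hω, h1, h2, h3⟩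
    have w11 := hω.real 11 (by omega)
    refine ⟨key.congr h1 (by rw [w11]), fun a ha => ?_⟩
    rw [h3 a ha, if_pos ha, h1]
    simp [hQ', v2]

end Search
end QMC
end

/-! ### Blocks of components and the whole search -/

noncomputable section
namespace QMC

section Blocks

variable {W b m s α T : ℕ} [Fact b.Prime] {P : Polynomial (ZMod b)}

/-- The doubled last term is split off, so that the loop needs no case distinction. -/
theorem coordWeight_eq {α : ℕ} (hα : 1 ≤ α) (x : ℝ) :
    coordWeight α x = ∑ k ∈ Finset.range α, ((k + 1).factorial : ℝ) * x ^ (k + 1) +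
      (α.factorial : ℝ) * x ^ α := by
  obtain ⟨a, rfl⟩ := Nat.exists_eq_add_of_le' hα
  have h1 : Finset.Icc 1 (a + 1) = Finset.Ico 1 (a + 1 + 1) := by ext; simp
  rw [coordWeight, h1, Finset.sum_Ico_eq_sum_range, Nat.add_sub_cancel, Finset.sum_range_succ,
    Finset.sum_range_succ, if_pos (add_comm 1 a), add_comm 1 a]
  have h2 : ∑ k ∈ Finset.range a, ((1 + k).factorial : ℝ) * (if 1 + k = a + 1 then 2 else 1) *
      x ^ (1 + k) = ∑ k ∈ Finset.range a, ((k + 1).factorial : ℝ) * x ^ (k + 1) := by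
    refine Finset.sum_congr rfl fun k hk => ?_
    have := Finset.mem_range.1 hk
    rw [if_neg (by omega), mul_one, add_comm 1 k]
  rw [h2]
  ring

/-- The weight of the block `30`, in the real array `13`. -/
def blockWeightProg : Prog :=
  .setReal 12 0 (.ofWord 1) ;;
  .setReal 13 0 (.ofWord 0) ;;
  .loop 31 (.load 0 3) (
    .setReal 12 0 (rvar 12 * (.ofWord (var 31 + 1) * .load 0 (var 30))) ;;
    .setReal 13 0 (rvar 13 + rvar 12)) ;;
  .setReal 13 0 (rvar 8 * (rvar 13 + rvar 12))

theorem blockWeightProg_ok (hs : Sizes W b m s α T) {hP : P ≠ 0} {β : ℕ → ℝ}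
    {g : AdjoinRoot P} {i : ℕ} (hi : i < s) {σ : Mem}
    (hσ : Ready b m s α T P hP β g σ) (h30 : σ.word 30 0 = i) :
    Ok W α blockWeightProg σ fun τ => Agree 31 12 σ τ ∧ τ.real 13 0 = cbcWeight b α β i := by
  refine Ok.frame 31 12 ?_ rfl
  have hα := hs.ord
  have hαW := hs.ord_le
  have Bσ := hσ.tables.base
  have hX : 1 ≤ α := by omega
  refine Ok.setReal_eq_seq (j := 0) (x := 1) hX rfl (by simp) ?_
  refine Ok.setReal_eq_seq (j := 0) (x := 0) hX rfl (by simp) ?_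
  refine Ok.seq (Ok.loop (n := α) (Y := 1) 31 12
    (fun k τ => τ.real 12 0 = (k.factorial : ℝ) * β i ^ k ∧
      τ.real 13 0 = ∑ l ∈ Finset.range k, ((l + 1).factorial : ℝ) * β i ^ (l + 1)) rfl
    (by simp [Bσ.ord]) hαW (by omega) le_rfl hX (by simp)
    (fun i τ x h => by simpa using h) ?_) ?_
  · rintro k hk τ hτ ⟨h1, h2⟩ hc
    have e0 := hτ.real 0 (by omega)
    have e30 := hτ.word 30 (by omega) (by omega)
    simp at e0 e30
    refine Ok.setReal_eq_seq (j := 0) (x := ((k + 1).factorial : ℝ) * β i ^ (k + 1)) le_rfl rfl ?_ ?_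
    · simp only [RExp.eval_mul, RExp.eval_load, RExp.eval_ofWord, WExp.eval_add, WExp.eval_load,
        WExp.eval_ofNat, hc, h1, e0, e30, h30, hσ.input i hi, Nat.factorial_succ, pow_succ]
      push_cast
      ring
    · exact Ok.setReal_eq (j := 0)
        (x := ∑ l ∈ Finset.range (k + 1), ((l + 1).factorial : ℝ) * β i ^ (l + 1)) le_rfl rfl
        (by simp [h2, Finset.sum_range_succ]) (by simp)
  · rintro τ ⟨hτ, h1, h2⟩
    have e8 := hτ.real 8 (by omega)
    simp at e8
    refine Ok.setReal_eq (j := 0) (x := cbcWeight b α β i) hX rfl ?_ (by simp)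
    rw [cbcWeight, coordWeight_eq hX]
    simp [e8, hσ.const, h1, h2]

/-- The choice of the components of a block. -/
def blockProg : Prog :=
  blockWeightProg ;;
  .loop 31 (var 4 - 1) (.setReal 14 (var 31) (.ofWord 1)) ;;
  .loop 32 (.load 0 3) componentProg ;;
  .loop 33 (var 4 - 1) (.setReal 11 (var 33)
    (.load 11 (var 33) * (.ofWord 1 + rvar 13 * (.load 14 (var 33) - .ofWord 1))))

/-- Inside a block only `partProd` changes; the completed block enters `fullProd` with its weight,
by `fullProd_succ`. -/
theorem blockProg_ok [Fact (Irreducible P)] (hs : Sizes W b m s α T) {hP : P ≠ 0} {β : ℕ → ℝ}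
    {g : AdjoinRoot P} (hg : orderOf g = b ^ m - 1) {i : ℕ} (hi : i < s) {σ : Mem}
    (hσ : Ready b m s α T P hP β g σ) (h30 : σ.word 30 0 = i)
    (hpro : Progress m α hP (cbcWeight b α β) g i (α * i) σ) :
    Ok W (α * (T * 2 ^ T)) blockProg σ
      (Progress m α hP (cbcWeight b α β) g (i + 1) (α * (i + 1))) := by
  have hlenW := hs.len
  have hlen := hs.le_len
  have h1N := hs.base_lt
  have hL : 0 < 2 ^ T := by positivity
  have hT := hs.log_pos
  have hα := hs.ord
  have hαW := hs.ord_le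
  have hLT : 2 ^ T ≤ T * 2 ^ T := Nat.le_mul_of_pos_left _ hT
  have hY : 1 ≤ T * 2 ^ T := by omega
  have hX1 : T * 2 ^ T ≤ α * (T * 2 ^ T) := Nat.le_mul_of_pos_left _ (by omega)
  have hX2 : α ≤ α * (T * 2 ^ T) := Nat.le_mul_of_pos_right _ (by omega)
  have hX : 1 ≤ α * (T * 2 ^ T) := by omega
  set n := b ^ m - 1 with hn
  refine Ok.seq (((blockWeightProg_ok hs hi hσ h30).keep 2 rfl).mono hX2) ?_
  rintro τ ⟨hτ2, hτ, hw⟩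
  have Rτ := hσ.agree hτ (by omega) (by omega)
  have Pτ := hpro.congr hτ2 (hτ.real 11 (by omega))
  have t30 := hτ.word 30 (by omega) (by omega)
  refine Ok.seq ((Ok.loop (n := n) (Y := 1) 31 14
    (fun k τ => ∀ a < k, τ.real 14 a = 1) rfl
    (by simp [Rτ.tables.base.card, hn]) (by omega) (by omega) le_rfl hX (by simp)
    (fun i τ x h => by simpa using h) ?_).keep 2 rfl) ?_
  · intro k hk υ hυ hI hc
    refine Ok.setReal_eq (j := k) (x := 1) le_rfl (by simp [hc]) (by simp) fun a ha => ?_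
    rcases eq_or_ne a k with rfl | hak
    · simp
    · simpa [hak] using hI a (by omega)
  rintro υ ⟨hυ2, hυ, hone⟩
  have Rυ := Rτ.agree hυ (by omega) (by omega)
  have Pυ := Pτ.congr hυ2 (hυ.real 11 (by omega))
  have u30 := (hυ.word 30 (by omega) (by omega)).trans t30
  have u13 := hυ.real 13 (by omega)
  refine Ok.seq (Ok.loop (n := α) (Y := T * 2 ^ T) 32 14
    (fun j ω => Progress m α hP (cbcWeight b α β) g i (α * i + j) ω ∧
      ∀ a < n, ω.real 14 a =
        partProd α (kernelAt m α hP (fun k => wordClass m P (ω.word 2 k)) (g ^ a)) i j) rfl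
    (by simp [Rυ.tables.base.ord]) hαW le_rfl hY hX ⟨Pυ, fun a ha => ?_⟩
    (fun i τ x h => ⟨h.1.congr (by simp) rfl, by simpa using h.2⟩) ?_) ?_
  · rw [hone a ha]
    simp [partProd]
  · rintro j hj ω hω ⟨h1, h2⟩ hc
    have Rω := Rυ.agree hω (by omega) (by omega)
    have w30 := (hω.word 30 (by omega) (by omega)).trans u30
    exact (componentProg_ok hs hg hj Rω (by rw [w30, h30]) hc h1 h2).conseq fun _ h => h.2
  rintro ω ⟨hω, h1, h2⟩
  have Rω := Rυ.agree hω (by omega) (by omega)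
  have w13 := (hω.real 13 (by omega)).trans u13
  refine (Ok.loop (n := n) (Y := 1) 33 11
    (fun k μ => μ.word 2 = ω.word 2 ∧ μ.real 13 = ω.real 13 ∧ μ.real 14 = ω.real 14 ∧
      ∀ a < n, μ.real 11 a =
        fullProd α (cbcWeight b α β)
          (kernelAt m α hP (fun k => wordClass m P (ω.word 2 k)) (g ^ a))
          (if a < k then i + 1 else i)) rfl
    (by simp [Rω.tables.base.card, hn]) (by omega) (by omega) le_rfl hX ?_
    (fun i τ x h => by simpa using h) ?_).conseq ?_
  · exact ⟨rfl, rfl, rfl, fun a ha => by rw [if_neg (Nat.not_lt_zero a)]; exact h1.full a ha⟩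
  · rintro k hk μ hμ ⟨e2, e13, e14, hI⟩ hc
    have h3 := hI k hk
    rw [if_neg (lt_irrefl k)] at h3
    refine Ok.setReal_eq (j := k) (x := fullProd α (cbcWeight b α β)
      (kernelAt m α hP (fun k => wordClass m P (ω.word 2 k)) (g ^ k)) (i + 1)) le_rfl
      (by simp [hc]) ?_ ⟨by simp [e2], by simp [e13], by simp [e14], fun a ha => ?_⟩
    · rw [fullProd_succ]
      simp [hc, h3, e13, e14, w13, hw, h2 k hk]
    · rcases eq_or_ne a k with rfl | hak
      · simp
      · have h6 : a < k + 1 ↔ a < k := by omega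
        simp only [h6]
        rw [← hI a ha]
        simp [hak]
  · rintro μ ⟨_, e2, _, _, hI⟩
    refine ⟨?_, ?_, ?_, ?_, ?_⟩ <;> simp only [e2]
    · intro a ha
      rw [hI a ha, if_pos ha]
    exacts [h1.lt, h1.ne, h1.first, h1.min]

/-- The choice of all components. -/
def searchProg : Prog :=
  .loop 31 (var 4 - 1) (.setReal 11 (var 31) (.ofWord 1)) ;;
  .loop 30 (.load 0 2) blockProg

theorem searchProg_ok [Fact (Irreducible P)] (hs : Sizes W b m s α T) {hP : P ≠ 0} {β : ℕ → ℝ}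
    {g : AdjoinRoot P} (hg : orderOf g = b ^ m - 1) {σ : Mem}
    (hσ : Ready b m s α T P hP β g σ) :
    Ok W (s * (α * (T * 2 ^ T))) searchProg σ
      (Progress m α hP (cbcWeight b α β) g s (α * s)) := by
  have hlenW := hs.len
  have hlen := hs.le_len
  have h1N := hs.base_lt
  have hL : 0 < 2 ^ T := by positivity
  have hT := hs.log_pos
  have hα := hs.ord
  have hdim := hs.dim
  have hLT : 2 ^ T ≤ T * 2 ^ T := Nat.le_mul_of_pos_left _ hT
  have hY1 : T * 2 ^ T ≤ α * (T * 2 ^ T) := Nat.le_mul_of_pos_left _ (by omega)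
  have hX1 : α * (T * 2 ^ T) ≤ s * (α * (T * 2 ^ T)) := Nat.le_mul_of_pos_left _ (by omega)
  set n := b ^ m - 1 with hn
  refine Ok.seq (Ok.loop (n := n) (Y := 1) 31 11
    (fun k τ => ∀ a < k, τ.real 11 a = 1) rfl
    (by simp [hσ.tables.base.card, hn]) (by omega) (by omega) le_rfl (by omega) (by simp)
    (fun i τ x h => by simpa using h) ?_) ?_
  · intro k hk υ hυ hI hc
    refine Ok.setReal_eq (j := k) (x := 1) le_rfl (by simp [hc]) (by simp) fun a ha => ?_
    rcases eq_or_ne a k with rfl | hak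
    · simp
    · simpa [hak] using hI a (by omega)
  rintro τ ⟨hτ, hone⟩
  have Rτ := hσ.agree hτ (by omega) (by omega)
  refine (Ok.loop (n := s) (Y := α * (T * 2 ^ T)) 30 11
    (fun i ω => Progress m α hP (cbcWeight b α β) g i (α * i) ω) rfl
    (by simp [Rτ.tables.base.dim]) hs.dim_le le_rfl (by omega) (by omega) ?_
    (fun i τ x h => h.congr (by simp) rfl) ?_).conseq fun _ h => h.2
  · refine ⟨fun a ha => ?_, ?_, ?_, ?_, ?_⟩
    · rw [hone a ha]
      simp [fullProd]
    all_goals simp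
  · intro i hi ω hω hI hc
    exact blockProg_ok hs hg hi (Rτ.agree hω (by omega) (by omega)) hc hI

end Blocks
end QMC
end

/-! ### Correctness, cost and word size of the construction -/

noncomputable section
namespace QMC

section Construction

open Polynomial

variable {W b m s α T : ℕ} [Fact b.Prime] {P : Polynomial (ZMod b)}

/-- The component-by-component construction. -/
def cbcProg : Prog :=
  setupProg ;; generatorProg ;; tablesProg ;; constantProg ;; spectrumProg ;; searchProg

/-- The running time of the construction, up to a constant factor. -/
def cbcCost (N m s α T : ℕ) : ℕ :=
  s * (α * (T * 2 ^ T)) + T * (N + (Nat.sqrt (4 * N) + 1) * (T * (m * m)))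

theorem cbcProg_ok [Fact (Irreducible P)] (hs : Sizes W b m s α T)
    (hT : T = Nat.clog 2 (2 * b ^ m)) (hd : P.natDegree = m) (hP : P ≠ 0) (β : ℕ → ℝ) :
    Ok W (cbcCost (b ^ m) m s α T) cbcProg (input b m s α P β) fun τ =>
      ∃ g : AdjoinRoot P, orderOf g = b ^ m - 1 ∧
        Progress m α hP (cbcWeight b α β) g s (α * s) τ := by
  have hlen := hs.le_len
  have hT0 := hs.log_pos
  have hα := hs.ord
  have hdim := hs.dim
  have h1 : b ^ m ≤ cbcCost (b ^ m) m s α T :=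
    ((Nat.le_add_right _ _).trans (Nat.le_mul_of_pos_left _ hT0)).trans (Nat.le_add_left _ _)
  have h2 : T * (b ^ m + (Nat.sqrt (4 * b ^ m) + 1) * (T * (m * m))) ≤ cbcCost (b ^ m) m s α T :=
    Nat.le_add_left _ _
  have h3 : s * (α * (T * 2 ^ T)) ≤ cbcCost (b ^ m) m s α T := Nat.le_add_right _ _
  have h4 : α * (T * 2 ^ T) ≤ s * (α * (T * 2 ^ T)) := Nat.le_mul_of_pos_left _ hdim
  have h5 : T * 2 ^ T ≤ α * (T * 2 ^ T) := Nat.le_mul_of_pos_left _ (by omega)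
  have h6 : α + b ^ m * T ≤ α * (T * 2 ^ T) := by
    have h7 : 1 ≤ T * b ^ m := Nat.mul_pos hT0 (by have := hs.base_lt; omega)
    calc α + b ^ m * T ≤ α * (T * (2 * b ^ m)) := by nlinarith
      _ ≤ _ := by gcongr
  have h7 : α ≤ α * (T * 2 ^ T) :=
    Nat.le_mul_of_pos_right _ (Nat.mul_pos hT0 (by positivity))
  refine Ok.seq ((setupProg_ok hs hT hd rfl rfl rfl rfl fun r => rfl).mono h1) ?_
  rintro τ₁ ⟨a₁, B₁⟩
  refine Ok.seq ((generatorProg_ok hs hd B₁).mono h2) ?_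
  rintro τ₂ ⟨a₂, hN, hg⟩
  have B₂ := B₁.agree a₂ (by omega)
  refine Ok.seq ((tablesProg_ok hs hd hP B₂ hN hg).mono (by omega)) ?_
  rintro τ₃ ⟨a₃, R₃⟩
  refine Ok.seq ((constantProg_ok hs R₃.base).mono (by omega)) ?_
  rintro τ₄ ⟨a₄, hc⟩
  have R₄ := R₃.agree a₄ (by omega) (by omega)
  refine Ok.seq ((spectrumProg_ok hs R₄.base).mono (by omega)) ?_
  rintro τ₅ ⟨a₅, hspec⟩
  have r0 := (a₅.real 0 (by omega)).trans ((a₄.real 0 (by omega)).trans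
    ((a₃.real 0 (by omega)).trans ((a₂.real 0 (by omega)).trans (a₁.real 0 (by omega)))))
  have r5 := a₅.real 5 (by omega)
  have r8 := a₅.real 8 (by omega)
  refine ((searchProg_ok hs hg (β := β) ⟨R₄.agree a₅ (by omega) (by omega), by rw [r8, hc],
    fun i hi => ?_, by rw [r5]; exact hspec⟩).mono h3).conseq fun τ h => ⟨_, hg, h⟩
  rw [r0]
  simp [input, hi]

/-- If `z` were not a power of `g`, the reindexed sum of its indicator function would vanish on one
side only. -/
theorem exists_pow_eq (hm : 1 ≤ m) (hd : P.natDegree = m) [Fact (Irreducible P)]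
    {g : AdjoinRoot P} (hg : orderOf g = b ^ m - 1) {z : AdjoinRoot P} (hz : z ≠ 0) :
    ∃ c < b ^ m - 1, g ^ c = z := by
  classical
  by_contra! H
  have h1 := sum_ne_zero_eq_sum_pow hm hd hg (fun y => if y = z then (1 : ℝ) else 0)
  rw [Finset.sum_eq_zero (s := Finset.range _) fun a ha => if_neg (H a (Finset.mem_range.1 ha))] at h1
  obtain ⟨n, hn, rfl⟩ := wordClass_surjOn hm hd z
  have hn0 : n ≠ 0 := by rintro rfl; exact hz wordClass_zero
  have h2 := (Finset.sum_eq_zero_iff_of_nonneg fun i _ => by positivity).1 h1 ⟨n, hn⟩ (by simpa using hn0)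
  simp at h2

theorem truncPoly_one (hm : 1 ≤ m) : truncPoly b m 1 = 1 := by
  have hb := (Fact.out : b.Prime).one_lt
  obtain ⟨m, rfl⟩ := Nat.exists_eq_add_of_le' hm
  rw [truncPoly, Finset.sum_range_succ', Finset.sum_eq_zero]
  · simp
  · intro r _
    rw [Nat.div_eq_of_lt (Nat.one_lt_pow (by omega) hb)]
    simp

/-- Every candidate is a nonzero class and hence a power of `g`, so minimality among the powers is
minimality over `genSet`. -/
theorem Progress.isCBC [Fact (Irreducible P)] (hα : 2 ≤ α) (hm : 1 ≤ m) (hs : 1 ≤ s)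
    (hd : P.natDegree = m) {hP : P ≠ 0} {β : ℕ → ℝ} (hβ : ∀ j, 0 < β j) {g : AdjoinRoot P}
    (hg : orderOf g = b ^ m - 1) {σ : Mem}
    (h : Progress m α hP (cbcWeight b α β) g s (α * s) σ) :
    IsCBC b m α β P (α * s) (output b m σ) := by
  have hpos : 0 < α * s := Nat.mul_pos (by omega) hs
  have hsum : ∀ I j r, searchSum m α hP (cbcWeight b α β) (output b m σ) I j r =
      powerSum m α hP (cbcWeight b α β) g (fun k => wordClass m P (σ.word 2 k)) I j r :=
    fun I j r => sum_ne_zero_eq_sum_pow hm hd hg fun y =>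
      fullProd α (cbcWeight b α β) (kernelAt m α hP (fun k => wordClass m P (σ.word 2 k)) y) I *
        partProd α (kernelAt m α hP (fun k => wordClass m P (σ.word 2 k)) y) I j *
        nodeReal m α hP (y * r)
  refine isCBC_of_minimal hα hm hP hd hβ _ ?_ (fun i hi => ?_) fun I hI j hj r hr => ?_
  · have h1 := h.first hpos
    rw [← wordClass_one (P := P) hm] at h1
    have h2 := wordClass_injOn hm hd (h.lt 0 hpos)
      (Nat.one_lt_pow (by omega) (Fact.out : b.Prime).one_lt) h1
    rw [output, h2, truncPoly_one hm]
  · refine truncPoly_mem_genSet hm (h.lt i hi) fun h0 => h.ne i hi ?_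
    rw [h0, wordClass_zero]
  · have hr0 : AdjoinRoot.mk P r ≠ 0 := fun h0 =>
      hr.1 (eq_zero_of_dvd_of_natDegree_lt (AdjoinRoot.mk_eq_zero.1 h0) (by rw [hd]; exact hr.2))
    obtain ⟨c, hc, hgc⟩ := exists_pow_eq hm hd hg hr0
    have hlt : α * I + j < α * s := by
      calc α * I + j < α * (I + 1) := by rw [mul_add]; omega
        _ ≤ _ := Nat.mul_le_mul_left _ hI
    rw [hsum, hsum, ← hgc]
    exact h.min I j hj hlt c hc

theorem pow_six_le (T : ℕ) : T ^ 6 ≤ 6 ^ 6 * 2 ^ T := by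
  have h1 : T / 6 + 1 ≤ 2 ^ (T / 6) := Nat.lt_two_pow_self
  have h2 : T ≤ 6 * 2 ^ (T / 6) := by omega
  calc T ^ 6 ≤ (6 * 2 ^ (T / 6)) ^ 6 := Nat.pow_le_pow_left h2 6
    _ = 6 ^ 6 * 2 ^ (T / 6 * 6) := by rw [mul_pow, ← pow_mul]
    _ ≤ _ := Nat.mul_le_mul_left _ (Nat.pow_le_pow_right (by omega) (Nat.div_mul_le_self T 6))

/-- The candidate search costs at most about `√N T³` per prime factor, and `T³` is bounded by a
multiple of `√N`. The constant comes from `1728 ^ 2 = 16 * 4 * 6 ^ 6`. -/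
theorem sqrt_mul_cube_le {N T : ℕ} (hN : 1 ≤ N) (hT : 2 ^ T ≤ 4 * N) :
    (Nat.sqrt (4 * N) + 1) * T ^ 3 ≤ 1728 * N := by
  have h1 := Nat.sqrt_le' (4 * N)
  have h2 : 1 ≤ Nat.sqrt (4 * N) := Nat.le_sqrt.2 (by omega)
  have h3 : (Nat.sqrt (4 * N) + 1) ^ 2 ≤ 16 * N := by nlinarith
  have h4 : T ^ 6 ≤ 6 ^ 6 * (4 * N) := (pow_six_le T).trans (Nat.mul_le_mul_left _ hT)
  refine (Nat.pow_le_pow_iff_left two_ne_zero).1 ?_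
  calc ((Nat.sqrt (4 * N) + 1) * T ^ 3) ^ 2 = (Nat.sqrt (4 * N) + 1) ^ 2 * T ^ 6 := by ring
    _ ≤ 16 * N * (6 ^ 6 * (4 * N)) := Nat.mul_le_mul h3 h4
    _ = (1728 * N) ^ 2 := by ring

/-- The constant is `4 + 1 + 1728`: the transform length is at most `4 N`, and the generator costs
at most `N + 1728 N` per prime factor. -/
theorem cbcCost_le {N : ℕ} (hN : 1 ≤ N) (hmT : m ≤ T) (hT : 2 ^ T ≤ 4 * N) (hα : 1 ≤ α)
    (hs : 1 ≤ s) : cbcCost N m s α T ≤ 1733 * (α * s * N * T) := by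
  have h1 : (Nat.sqrt (4 * N) + 1) * (T * (m * m)) ≤ 1728 * N :=
    (Nat.mul_le_mul_left _ (by
      calc T * (m * m) ≤ T * (T * T) := by gcongr
        _ = T ^ 3 := by ring)).trans (sqrt_mul_cube_le hN hT)
  have h2 : 1 ≤ α * s := Nat.mul_pos hα hs
  calc cbcCost N m s α T ≤ s * (α * (T * (4 * N))) + T * (N + 1728 * N) := by
        unfold cbcCost; gcongr
    _ = (4 * (α * s) + 1729) * (N * T) := by ring
    _ ≤ (1733 * (α * s)) * (N * T) := Nat.mul_le_mul_right _ (by omega)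
    _ = _ := by ring

theorem two_pow_clog_le {N : ℕ} (hN : 2 ≤ N) : 2 ^ Nat.clog 2 (2 * N) ≤ 4 * N := by
  have h1 := Nat.pow_pred_clog_lt_self one_lt_two (show 1 < 2 * N by omega)
  have h2 : 1 ≤ Nat.clog 2 (2 * N) := Nat.clog_pos one_lt_two (by omega)
  have h3 : 2 ^ Nat.clog 2 (2 * N) = 2 * 2 ^ (Nat.clog 2 (2 * N)).pred := by
    rw [← pow_succ', Nat.pred_eq_sub_one, Nat.sub_add_cancel h2]
  omega

/-- `T log 2 ≤ 2 log 2 + log N ≤ 3 log N`, and `3 / log 2 < 5`. -/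
theorem le_five_mul_log {N T : ℕ} (hN : 2 ≤ N) (hT : 2 ^ T ≤ 4 * N) :
    (T : ℝ) ≤ 5 * Real.log N := by
  have h1 : ((2 : ℝ) ^ T) ≤ (2 : ℝ) ^ 2 * N := by
    have : ((2 ^ T : ℕ) : ℝ) ≤ ((4 * N : ℕ) : ℝ) := by exact_mod_cast hT
    push_cast at this
    linarith
  have hN0 : (0 : ℝ) < N := by positivity
  have h2 := Real.log_le_log (by positivity) h1
  rw [Real.log_pow, Real.log_mul (by norm_num) hN0.ne', Real.log_pow] at h2
  have h3 : Real.log 2 ≤ Real.log N := Real.log_le_log two_pos (by exact_mod_cast hN)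
  have h4 := Real.log_two_gt_d9
  push_cast at h2
  have h5 : (T : ℝ) * Real.log 2 ≤ 3 * Real.log N := by linarith
  have h6 : (0 : ℝ) ≤ T := Nat.cast_nonneg T
  nlinarith

theorem cbcProg_spec (hα : 2 ≤ α) (hs : 1 ≤ s) (hm : 1 ≤ m) (hirr : Irreducible P)
    (hd : P.natDegree = m) {β : ℕ → ℝ} (hβ : ∀ j, 0 < β j) :
    IsCBC b m α β P (α * s) (output b m (cbcProg.run (input b m s α P β))) ∧
    (cbcProg.steps (input b m s α P β) : ℝ) ≤
      (8665 * cbcProg.size : ℕ) * (α * s * (b ^ m : ℕ) * Real.log (b ^ m : ℕ)) ∧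
    cbcProg.peak (input b m s α P β) ≤ (α * s * b ^ m) ^ (8665 * cbcProg.size) := by
  have : Fact (Irreducible P) := ⟨hirr⟩
  have hP := hirr.ne_zero
  have hb := (Fact.out : b.Prime).two_le
  have hbm : b ≤ b ^ m := Nat.le_self_pow (by omega) b
  have hmN := deg_lt_card b m
  have hN : 2 ≤ b ^ m := hb.trans hbm
  set N := b ^ m with hNdef
  set T := Nat.clog 2 (2 * N) with hT
  have hTN : 2 ^ T ≤ 4 * N := two_pow_clog_le hN
  have hαs : 1 ≤ α * s := Nat.mul_pos (by omega) hs
  have hM : N ≤ α * s * N := Nat.le_mul_of_pos_left _ hαs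
  have hM' : α * s ≤ α * s * N := Nat.le_mul_of_pos_right _ (by omega)
  have hα' : α ≤ α * s := Nat.le_mul_of_pos_right _ hs
  have hs' : 2 * s ≤ α * s := Nat.mul_le_mul_right _ hα
  have hM4 : 4 ≤ α * s * N := by nlinarith
  set M := α * s * N with hMdef
  -- The bound `4 M` leaves room for the transform length, at most `4 N`. As `M ≥ 4` it is at most
  -- `M ^ 2`, so the peak is a fixed power of `M`.
  have hsz : Sizes (4 * M) b m s α T :=
    ⟨hm, Nat.le_pow_clog one_lt_two _, by omega, hα, by omega, hs, by omega⟩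
  obtain ⟨⟨g, hg, hpro⟩, hsteps, hsafe⟩ := cbcProg_ok hsz hT hd hP β
  refine ⟨hpro.isCBC hα hm hs hd hβ hg, ?_, ?_⟩
  · have h1 : cbcProg.steps (input b m s α P β) ≤ cbcProg.size * (1733 * (α * s * N * T)) :=
      hsteps.trans (Nat.mul_le_mul_left _ (cbcCost_le (by omega) hsz.deg_le_log hTN (by omega) hs))
    have h2 : (cbcProg.steps (input b m s α P β) : ℝ) ≤
        ((cbcProg.size * (1733 * (α * s * N * T)) : ℕ) : ℝ) := by exact_mod_cast h1
    refine h2.trans ?_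
    push_cast
    -- Here `8665 = 5 * 1733` arises, from `le_five_mul_log` and `cbcCost_le`.
    calc (cbcProg.size : ℝ) * (1733 * (α * s * N * T)) =
        (cbcProg.size * 1733 * (α * s * N)) * T := by ring
      _ ≤ (cbcProg.size * 1733 * (α * s * N)) * (5 * Real.log N) :=
        mul_le_mul_of_nonneg_left (le_five_mul_log hN hTN) (by positivity)
      _ = _ := by ring
  · have hinput : ∀ a i, (input b m s α P β).word a i ≤ 4 * M := by
      intro a i
      have hval := ZMod.val_lt (P.coeff i)
      simp only [input]
      split_ifs <;> omega
    have h1 := (Prog.Safe.peak_le (by omega) cbcProg hsafe hinput).2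
    have h2 : 4 * M ≤ M ^ 2 := by nlinarith
    calc _ ≤ (4 * M) ^ cbcProg.size := h1
      _ ≤ (M ^ 2) ^ cbcProg.size := Nat.pow_le_pow_left h2 _
      _ = M ^ (2 * cbcProg.size) := by rw [← pow_mul]
      _ ≤ _ := Nat.pow_le_pow_right (by omega) (by omega)

end Construction
end QMC
end

theorem mainTheorem2 :
    ∃ (prog : QMC.Prog) (K : ℕ),
      ∀ (b : ℕ) [Fact b.Prime] (p : ℝ) (β : ℕ → ℝ),
        0 < p → p ≤ 1 → (∀ j, 0 < β j) → Summable (fun j => β j ^ p) →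
        ∃ C : ℝ, 0 < C ∧
          ∀ (α s m N : ℕ) (P : Polynomial (ZMod b)) (q : ℕ → Polynomial (ZMod b)),
            α = ⌊1 / p⌋₊ + 1 → 1 ≤ s → 1 ≤ m → N = b ^ m →
            Irreducible P → P.natDegree = m →
            q = QMC.output b m (prog.run (QMC.input b m s α P β)) →
            -- the program carries out the component-by-component construction,
            QMC.IsCBC b m α β P (α * s) q ∧
            -- with cost `O(α s N log N)`,
            (prog.steps (QMC.input b m s α P β) : ℝ) ≤ K * (α * s * N * Real.log N) ∧
            -- on words of `O(log (α s N))` bits,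
            prog.peak (QMC.input b m s α P β) ≤ (α * s * N) ^ K ∧
            -- and the resulting rule has error `O(N^{-1/p})`
            ∀ (F : (Fin s → ℝ) → ℝ) (D : (Fin s → ℕ) → (Fin s → ℝ) → ℝ) (c : ℝ),
              0 < c → QMC.IsMixedPartials α F D → QMC.ProductBound α β c D →
              |QMC.cubeIntegral F -
                  QMC.quadrature N (QMC.interlacedPoint b m α s P q) F| ≤
                c * C * (N : ℝ) ^ (-(1 / p)) := by
  refine ⟨QMC.cbcProg, 8665 * QMC.cbcProg.size, fun b _ p β hp hp1 hβ hsum => ?_⟩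
  have h1p : 1 ≤ 1 / p := by rw [le_div_iff₀ hp]; linarith
  have hα2 : 2 ≤ ⌊1 / p⌋₊ + 1 := Nat.succ_le_succ (Nat.le_floor (by simpa using h1p))
  -- The strict inequality `α > 1 / p` is what makes the `p`-th powers of the decay summable.
  have hαp : 1 < ((⌊1 / p⌋₊ + 1 : ℕ) : ℝ) * p := by
    rw [← div_lt_iff₀ hp]
    push_cast
    exact Nat.lt_floor_add_one (1 / p)
  obtain ⟨C, hC, hbound⟩ := QMC.exists_criterion_bound b p β hp hp1 hβ hsum hα2 hαp
  refine ⟨C, hC, ?_⟩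
  rintro α s m N P q rfl hs hm rfl hirr hd rfl
  obtain ⟨hcbc, hsteps, hpeak⟩ := QMC.cbcProg_spec hα2 hs hm hirr hd hβ
  refine ⟨hcbc, hsteps, hpeak, fun F D c hc hD hB => ?_⟩
  refine (QMC.abs_cubeIntegral_sub_quadrature_le hirr hα2 hm hd _ hβ hc F D hD hB).trans ?_
  have h1 := hbound s m P _ hm hirr hd hcbc
  rw [mul_assoc]
  push_cast
  exact mul_le_mul_of_nonneg_left h1 hc.le
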